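/- Let $m\ge 1$, let $e_0,e_1,\dots,e_m$ generate the (complexified) Clifford algebra, $e_\alpha e_\beta+e_\beta e_\alpha=-2\delta_{\alpha\beta}$, $\bar e_0=-e_0$, identify $\underline x\in\mathbb R^m$ with $\sum_{j\ge1} x_je_j$, and put $r=|\underline x|$, $\underline\omega=\underline x/r$, $\underline\partial=\sum_{j=1}^m e_j\partial_{x_j}$, $\sigma_n=2\pi^{n/2}/\Gamma(n/2)$, $|x|=\sqrt{x_0^2+r^2}$. **Potentials.** For $x_0>0$ let $A_{-1}=\frac{2}{\sigma_{m+1}}\frac{x_0}{|x|^{m+1}}$, $B_{-1}=-\frac{2}{\sigma_{m+1}}\frac{\underline x}{|x|^{m+1}}$, $A_{-k-1}=\partial_{x_0}^kA_{-1}$, $B_{-k-1}=\partial_{x_0}^kB_{-1}$ ($k\ge1$); $A_0=-\frac{2}{(m-1)\sigma_{m+1}}|x|^{1-m}$ ($m\ge2$), $B_0=\frac{2}{\sigma_{m+1}}\frac{\underline x}{r^m}\int_0^{r/x_0}\eta^{m-1}(1+\eta^2)^{-(m+1)/2}d\eta$; and, with $a_0(\underline y)=-\frac{2}{(m-1)\sigma_{m+1}}|\underline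 y|^{1-m}$, $A_k=a_0*A_{k-1}$ and $B_k=a_0*B_{k-1}$ ($k\ge1$), the convolutions being taken over $\mathbb R^m$ as limits of integrals over balls $|\underline y|<R$, $R\to\infty$. The potentials in question are the $A_j$ with $j<m-1$ and the $B_j$ with $j<m$. Let $a_j$, $b_j$ be the limits in $\mathcal S'(\mathbb R^m)$ of $A_j(x_0,\cdot)$, $B_j(x_0,\cdot)$ as $x_0\to0+$. **Kernels.** Let $T_\lambda=\mathrm{Fp}\,r^\lambda$, $U_\lambda=\mathrm{Fp}\,r^\lambda\underline\omega$, and for $l=0,1,2,\dots$ $$T^*_\lambda=\frac{\pi^{\frac{\lambda+m}{2}}T_\lambda}{\Gamma(\frac{\lambda+m}{2})}\ (\lambda\ne-m-2l),\qquad T^*_{-m-2l}=\frac{\pi^{\frac m2-l}}{2^{2l}\Gamma(\frac m2+l)}(-\Delta_m)^l\delta,$$ $$U^*_\lambda=\frac{\pi^{\frac{\lambda+m+1}{2}}U_\lambda}{\Gamma(\frac{\lambda+m+1}{2})}\ (\lambda\ne-m-2l-1),\qquad U^*_{-m-2l-1}=-\frac{\pi^{\frac m2-l}}{2^{2l+1}\Gamma(\frac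 m2+l+1)}\underline\partial^{2l+1}\delta.$$ The operators $\underline\partial^\mu$, ${}^\mu\mathcal H$, $(-\Delta_m)^\beta$, ${}^\beta\mathcal L$ are the convolution operators with kernels $$\underline\partial^\mu\delta=\tfrac{1+e^{i\pi\mu}}{2}\tfrac{2^\mu\Gamma(\frac{m+\mu}2)}{\pi^{(m-\mu)/2}}T^*_{-m-\mu}-\tfrac{1-e^{i\pi\mu}}{2}\tfrac{2^\mu\Gamma(\frac{m+\mu+1}2)}{\pi^{(m-\mu+1)/2}}U^*_{-m-\mu},$$ $$\underline\partial^\mu H=\tfrac{1-e^{i\pi\mu}}{2}\tfrac{2^\mu\Gamma(\frac{m+\mu}2)}{\pi^{(m-\mu)/2}}T^*_{-m-\mu}-\tfrac{1+e^{i\pi\mu}}{2}\tfrac{2^\mu\Gamma(\frac{m+\mu+1}2)}{\pi^{(m-\mu+1)/2}}U^*_{-m-\mu},$$ $$(-\Delta_m)^\beta\delta=\tfrac{2^{2\beta}\Gamma(\frac{m+2\beta}2)}{\pi^{(m-2\beta)/2}}T^*_{-m-2\beta},\qquad(-\Delta_m)^\beta H=-\tfrac{2^{2\beta}\Gamma(\frac{m+2\beta+1}2)}{\pi^{(m-2\beta+1)/2}}U^*_{-m-2\beta},$$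 where a term with coefficient $1\pm e^{i\pi\mu}=0$ is omitted. In the exceptional cases the kernel is instead a logarithmic distribution: for $n=0,1,2,\dots$ let $G_n=(p_n\ln r+q_n)T^*_n$ for $n$ even and $G_n=(p_n\ln r+q_n)U^*_n$ for $n$ odd, with $p_0=-\frac1{2^{m-1}\pi^m}$, $q_0=0$, $p_{2j+1}=-\frac1{2\pi}p_{2j}$, $q_{2j+1}=-\frac1{2\pi}(q_{2j}-\frac{p_{2j}}{m+2j})$, $p_{2j+2}=\frac{p_{2j+1}}{2j+2}$, $q_{2j+2}=\frac1{2j+2}(q_{2j+1}-\frac{p_{2j+1}}{2j+2})$; then $\underline\partial^{-m-n}\delta=G_n$ for $m$ even, $\underline\partial^{-m-n}H=G_n$ for $m$ odd, $(-\Delta_m)^{-\frac m2-n}\delta=G_{2n}$ and $(-\Delta_m)^{-\frac{m+1}2-n}H=G_{2n+1}$ for all $m$. Put $E_\mu=\underline\partial^{-\mu}\delta$, $F_\mu=\underline\partial^{-\mu}H$, $K_\beta=(-\Delta_m)^{-\beta}\delta$, $L_\beta=(-\Delta_m)^{-\beta}H$. **Statement.** With $C_k=\frac12A_k+\frac12\bar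 e_0B_k$ and $\overline D=\frac12(\partial_{x_0}-\bar e_0\underline\partial)$, $C_{-1}$ is the Cauchy kernel $\frac1{\sigma_{m+1}}\frac{x\bar e_0}{|x|^{m+1}}$ ($x=x_0e_0+\underline x$), $C_{-k-1}=\overline D\,C_{-k}$ for $k\ge1$, and the convolutions that define $A_j$ ($1\le j<m-1$) and $B_j$ ($1\le j<m$) converge. The distributional limits $a_j$ ($j<m-1$) and $b_j$ ($j<m$) exist, and for $k\in\mathbb Z$ $$a_{2k-1}=E_{2k}=K_k\quad(2k<m),\qquad b_{2k}=-E_{2k+1}=-L_{k+\frac12}\quad(2k<m),$$ $$a_{2k}=-F_{2k+1}=-K_{k+\frac12}\quad(2k+1<m),\qquad b_{2k-1}=F_{2k}=L_k\quad(2k-1<m).$$ In the same ranges each $E$, $F$, $K$, $L$ that occurs is a fundamental solution of its operator: the following convolutions of tempered distributions exist and $$\underline\partial^{\mu}\delta*E_\mu=\delta\ (\mu=2k,\,2k+1),\qquad \underline\partial^{\mu}H*F_\mu=\delta\ (\mu=2k+1,\,2k),$$ $$(-\Delta_m)^\beta\delta*K_\beta=\delta\ (\beta=k,\,k+\tfrac12),\qquad(-\Delta_m)^\beta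 H*L_\beta=\delta\ (\beta=k+\tfrac12,\,k).$$ -/

import Mathlib

open MeasureTheory Filter Topology
open scoped SchwartzMap ContDiff LineDeriv Laplacian

noncomputable section

namespace HarmonicPotentials

/-! ### Clifford algebra -/

/-- The quadratic form of signature `(0, n)`, with complexified scalars. -/
def cliffordForm (n : ℕ) : QuadraticForm ℂ (Fin n → ℂ) :=
  -QuadraticMap.weightedSumSquares ℂ (fun _ : Fin n => (1 : ℂ))

/-- The complexified Clifford algebra `ℂ ⊗ ℝ_{0,n}`: the generators satisfy
`e_i e_j + e_j e_i = -2 δ_{ij}`. -/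
abbrev Cl (n : ℕ) : Type := CliffordAlgebra (cliffordForm n)

/-- The generator `e_j`. -/
def e {n : ℕ} (j : Fin n) : Cl n := CliffordAlgebra.ι (cliffordForm n) (Pi.single j 1)

theorem e_mul_self {n : ℕ} (j : Fin n) : e j * e j = -1 := by
  rw [e, CliffordAlgebra.ι_sq_scalar]
  have h : cliffordForm n (Pi.single j 1) = -1 := by
    simp [cliffordForm, QuadraticMap.weightedSumSquares_apply, Pi.single_apply]
  rw [h, map_neg, map_one]

/-- Complex scalars inside the Clifford algebra. -/
def sc {n : ℕ} (c : ℂ) : Cl n := algebraMap ℂ (Cl n) c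

/-- Euclidean space `ℝ^m`. -/
abbrev Eu (m : ℕ) : Type := EuclideanSpace ℝ (Fin m)

/-- The identification of `x ∈ ℝ^m` with the Clifford vector `∑ x_j e_j`. -/
def vec {m : ℕ} (x : Eu m) : Cl m := ∑ j, (x j : ℂ) • e j

/-- `σ_n = 2 π^{n/2} / Γ(n/2)`, the area of the unit sphere of `ℝ^n`. -/
def sig (n : ℕ) : ℝ := 2 * Real.pi ^ ((n : ℝ) / 2) / Real.Gamma ((n : ℝ) / 2)

/-! ### Distributions -/

/-- Scalar functionals on Schwartz functions. -/
abbrev SFun (m : ℕ) : Type := 𝓢(Eu m, ℂ) → ℂ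

/-- Clifford-valued functionals on Schwartz functions. -/
abbrev CFun (m : ℕ) : Type := 𝓢(Eu m, ℂ) → Cl m

/-- The Dirac distribution `δ`. -/
def delta (m : ℕ) : CFun m := fun φ => sc (φ 0)

/-- The translate `y ↦ φ (x + y)`. -/
def shift {m : ℕ} (x : Eu m) (φ : 𝓢(Eu m, ℂ)) : 𝓢(Eu m, ℂ) :=
  SchwartzMap.compSubConstCLM ℂ (-x) φ

theorem shift_apply {m : ℕ} (x y : Eu m) (φ : 𝓢(Eu m, ℂ)) : shift x φ y = φ (x + y) := by
  simp [shift, add_comm]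

/-- Approximate units: smooth compactly supported functions, with every derivative bounded
uniformly in the index, that are eventually equal to `1` on each compact set. -/
structure IsApproxUnit {m : ℕ} (χ : ℕ → Eu m → ℂ) : Prop where
  smooth : ∀ i, ContDiff ℝ ∞ (χ i)
  compactSupport : ∀ i, HasCompactSupport (χ i)
  bounded : ∀ n : ℕ, ∃ C : ℝ, ∀ i x, ‖iteratedFDeriv ℝ n (χ i) x‖ ≤ C
  eventuallyOne : ∀ K : Set (Eu m), IsCompact K → ∀ᶠ i in atTop, ∀ x ∈ K, χ i x = 1

/-- The tempered distributions `s`, `t` are convolvable with `s * t = r`: for each Schwartz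
function `φ` and each approximate unit `χ_i`, the function `χ_i(x) ⟨t_y, φ(x + y)⟩` of `x` is
a test function, and `⟨s_x, χ_i(x) ⟨t_y, φ(x + y)⟩⟩ → ⟨r, φ⟩`. -/
def IsScalarConv {m : ℕ} (s t r : 𝓢'(Eu m, ℂ)) : Prop :=
  ∀ (φ : 𝓢(Eu m, ℂ)) (χ : ℕ → Eu m → ℂ), IsApproxUnit χ →
    ∃ ψ : ℕ → 𝓢(Eu m, ℂ), (∀ i x, ψ i x = χ i x * t (shift x φ)) ∧
      Tendsto (fun i => s (ψ i)) atTop (𝓝 (r φ))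

/-- The Clifford distributions `S`, `T` are convolvable with `S * T = R`: with
`S = ∑ s_i a_i` and `T = ∑ t_j b_j`, one has `R = ∑ (s_i * t_j) a_i b_j`, where `s_i`, `t_j`
are scalar tempered distributions and `a_i`, `b_j` are Clifford numbers. -/
def IsConv {m : ℕ} (S T R : CFun m) : Prop :=
  ∃ (p q : ℕ) (a : Fin p → Cl m) (b : Fin q → Cl m)
    (s : Fin p → 𝓢'(Eu m, ℂ)) (t : Fin q → 𝓢'(Eu m, ℂ)) (r : Fin p → Fin q → 𝓢'(Eu m, ℂ)),
    (∀ φ, S φ = ∑ i, s i φ • a i) ∧ (∀ φ, T φ = ∑ j, t j φ • b j) ∧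
    (∀ i j, IsScalarConv (s i) (t j) (r i j)) ∧
    (∀ φ, R φ = ∑ i, ∑ j, r i j φ • (a i * b j))

/-- `f` is a fundamental solution of the convolution operator with kernel `kernel`. -/
def IsFundamentalSolution {m : ℕ} (kernel f : CFun m) : Prop := IsConv kernel f (delta m)

/-- `f` is the distributional limit of `F(x₀, ·)` for `x₀ → 0+`. Convergence in the
finite-dimensional Clifford algebra is tested by its linear functionals. -/
def IsBoundaryValue {m : ℕ} (F : ℝ → Eu m → Cl m) (f : CFun m) : Prop :=
  ∀ (ℓ : Cl m →ₗ[ℂ] ℂ) (φ : 𝓢(Eu m, ℂ)),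
    (∀ x₀ : ℝ, 0 < x₀ → Integrable (fun x => ℓ (F x₀ x) * φ x)) ∧
    Tendsto (fun x₀ : ℝ => ∫ x, ℓ (F x₀ x) * φ x) (𝓝[>] 0) (𝓝 (ℓ (f φ)))

/-! ### The distributions `T_λ`, `U_λ` and their normalizations -/

/-- The generalized spherical mean `Σ^{(0)}[φ]`. -/
def sphereMean (m : ℕ) (φ : 𝓢(Eu m, ℂ)) (r : ℝ) : ℂ :=
  (1 / (sig m : ℂ)) *
    ∫ w : Metric.sphere (0 : Eu m) 1, φ (r • (w : Eu m)) ∂(volume : Measure (Eu m)).toSphere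

/-- The `e_j`-component of the generalized spherical mean `Σ^{(1)}[φ]`. -/
def sphereMeanVec (m : ℕ) (j : Fin m) (φ : 𝓢(Eu m, ℂ)) (r : ℝ) : ℂ :=
  (1 / (sig m : ℂ)) *
    ∫ w : Metric.sphere (0 : Eu m) 1, ((w : Eu m) j : ℂ) * φ (r • (w : Eu m))
      ∂(volume : Measure (Eu m)).toSphere

/-- Hadamard's finite part `⟨Fp r_+^μ, ψ⟩`. If `μ + i + 1 = 0` for some `i`, the corresponding
summand of the last sum is dropped (it is a division by zero in Lean), as in the finite part
of `∫_ε^1 r^{-1} dr = - ln ε`. -/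
def finitePart (μ : ℂ) (ψ : ℝ → ℂ) : ℂ :=
  let n : ℕ := ⌈-μ.re⌉₊
  let c : ℕ → ℂ := fun i => iteratedDeriv i ψ 0 / (i.factorial : ℂ)
  (∫ r in Set.Ioc (0 : ℝ) 1, (r : ℂ) ^ μ * (ψ r - ∑ i ∈ Finset.range n, c i * (r : ℂ) ^ i)) +
    (∫ r in Set.Ioi (1 : ℝ), (r : ℂ) ^ μ * ψ r) +
    ∑ i ∈ Finset.range n, c i / (μ + i + 1)

/-- `T_λ = Fp r^λ`. -/
def T (m : ℕ) (lam : ℂ) : SFun m := fun φ =>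
  (sig m : ℂ) * finitePart (lam + m - 1) (sphereMean m φ)

/-- The `e_j`-component of `U_λ = Fp r^λ ω`. -/
def U (m : ℕ) (lam : ℂ) (j : Fin m) : SFun m := fun φ =>
  (sig m : ℂ) * finitePart (lam + m - 1) (sphereMeanVec m j φ)

/-- `(-Δ_m)^l φ` for a Schwartz function `φ`. -/
def negLaplaceIter {m : ℕ} (l : ℕ) (φ : 𝓢(Eu m, ℂ)) : 𝓢(Eu m, ℂ) :=
  (fun f : 𝓢(Eu m, ℂ) => -Δ f)^[l] φ

open Classical in
/-- The normalized distribution `T*_λ`; note `⟨(-Δ)^l δ, φ⟩ = ((-Δ)^l φ)(0)`. -/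
def Tstar (m : ℕ) (lam : ℂ) : SFun m := fun φ =>
  if h : ∃ l : ℕ, lam = -m - 2 * l then
    (Real.pi : ℂ) ^ ((m : ℂ) / 2 - (h.choose : ℂ)) /
      (2 ^ (2 * h.choose) * Complex.Gamma ((m : ℂ) / 2 + h.choose)) *
      negLaplaceIter h.choose φ 0
  else (Real.pi : ℂ) ^ ((lam + m) / 2) * T m lam φ / Complex.Gamma ((lam + m) / 2)

open Classical in
/-- The `e_j`-component of the normalized distribution `U*_λ`; note that the `e_j`-component
of `∂^{2l+1} δ = ∂ (-Δ)^l δ` sends `φ` to `-∂_j (-Δ)^l φ (0)`. -/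
def Ustar (m : ℕ) (lam : ℂ) (j : Fin m) : SFun m := fun φ =>
  if h : ∃ l : ℕ, lam = -m - 2 * l - 1 then
    -((Real.pi : ℂ) ^ ((m : ℂ) / 2 - (h.choose : ℂ)) /
      (2 ^ (2 * h.choose + 1) * Complex.Gamma ((m : ℂ) / 2 + h.choose + 1))) *
      (-(lineDeriv ℝ (negLaplaceIter h.choose φ) 0 (EuclideanSpace.single j 1)))
  else (Real.pi : ℂ) ^ ((lam + m + 1) / 2) * U m lam j φ / Complex.Gamma ((lam + m + 1) / 2)

/-- The Clifford distribution with scalar component `s` and `e_j`-components `u j`. -/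
def scalarVector {m : ℕ} (s : SFun m) (u : Fin m → SFun m) : CFun m := fun φ =>
  sc (s φ) + ∑ j, u j φ • e j

/-! ### The logarithmic distributions -/

/-- The constants `(p_n, q_n)`, with `p_0 = -1/(2^{m-1} π^m)` and `q_0 = 0`. -/
def pq (m : ℕ) : ℕ → ℝ × ℝ
  | 0 => (-1 / (2 ^ (m - 1) * Real.pi ^ m), 0)
  | n + 1 =>
    let p := (pq m n).1
    let q := (pq m n).2
    if Even n then
      (-(1 / (2 * Real.pi)) * p, -(1 / (2 * Real.pi)) * (q - 1 / ((m : ℝ) + n) * p))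
    else
      (1 / ((n : ℝ) + 1) * p, 1 / ((n : ℝ) + 1) * (q - 1 / ((n : ℝ) + 1) * p))

/-- `(p_n ln r + q_n) T*_n` for even `n` and `(p_n ln r + q_n) U*_n` for odd `n`, where
`T*_n = π^{(n+m)/2} r^n / Γ((n+m)/2)` and `U*_n = π^{(n+m+1)/2} r^{n-1} x / Γ((n+m+1)/2)` are
regular distributions. -/
def logDist (m n : ℕ) : CFun m :=
  if Even n then
    scalarVector
      (fun φ => ∫ x : Eu m, ((((pq m n).1 * Real.log ‖x‖ + (pq m n).2) *
        (Real.pi ^ (((n : ℝ) + m) / 2) * ‖x‖ ^ n / Real.Gamma (((n : ℝ) + m) / 2)) : ℝ) : ℂ) * φ x)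
      0
  else
    scalarVector 0
      (fun j φ => ∫ x : Eu m, ((((pq m n).1 * Real.log ‖x‖ + (pq m n).2) *
        (Real.pi ^ (((n : ℝ) + m + 1) / 2) * (‖x‖ ^ (n - 1) * x j) /
          Real.Gamma (((n : ℝ) + m + 1) / 2)) : ℝ) : ℂ) * φ x)

/-! ### Convolution kernels of the four operators, and their fundamental solutions -/

/-- The factor `e^{iπμ}`. -/
def eip (μ : ℂ) : ℂ := Complex.exp (Complex.I * Real.pi * μ)

open Classical in
/-- The kernel `∂^μ δ` of the operator `∂^μ`. -/
def diracPow (m : ℕ) (μ : ℂ) : CFun m :=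
  if h : Even m ∧ ∃ n : ℕ, μ = -m - n then logDist m h.2.choose
  else scalarVector
    (fun φ => (1 + eip μ) / 2 *
      (2 ^ μ * Complex.Gamma ((m + μ) / 2) / (Real.pi : ℂ) ^ ((m - μ) / 2)) *
      Tstar m (-m - μ) φ)
    (fun j φ => -((1 - eip μ) / 2) *
      (2 ^ μ * Complex.Gamma ((m + μ + 1) / 2) / (Real.pi : ℂ) ^ ((m - μ + 1) / 2)) *
      Ustar m (-m - μ) j φ)

open Classical in
/-- The kernel `∂^μ H` of the operator `^μ𝓗`. -/
def hilbertPow (m : ℕ) (μ : ℂ) : CFun m :=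
  if h : Odd m ∧ ∃ n : ℕ, μ = -m - n then logDist m h.2.choose
  else scalarVector
    (fun φ => (1 - eip μ) / 2 *
      (2 ^ μ * Complex.Gamma ((m + μ) / 2) / (Real.pi : ℂ) ^ ((m - μ) / 2)) *
      Tstar m (-m - μ) φ)
    (fun j φ => -((1 + eip μ) / 2) *
      (2 ^ μ * Complex.Gamma ((m + μ + 1) / 2) / (Real.pi : ℂ) ^ ((m - μ + 1) / 2)) *
      Ustar m (-m - μ) j φ)

open Classical in
/-- The kernel `(-Δ_m)^β δ` of the operator `(-Δ_m)^β`. -/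
def laplacePow (m : ℕ) (β : ℂ) : CFun m :=
  if h : ∃ n : ℕ, β = -(m / 2) - n then logDist m (2 * h.choose)
  else scalarVector
    (fun φ => 2 ^ (2 * β) * Complex.Gamma ((m + 2 * β) / 2) /
      (Real.pi : ℂ) ^ ((m - 2 * β) / 2) * Tstar m (-m - 2 * β) φ)
    0

open Classical in
/-- The kernel `(-Δ_m)^β H` of the operator `^β𝓛`. -/
def laplaceHilbertPow (m : ℕ) (β : ℂ) : CFun m :=
  if h : ∃ n : ℕ, β = -((m + 1) / 2) - n then logDist m (2 * h.choose + 1)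
  else scalarVector 0
    (fun j φ => -(2 ^ (2 * β) * Complex.Gamma ((m + 2 * β + 1) / 2) /
      (Real.pi : ℂ) ^ ((m - 2 * β + 1) / 2)) * Ustar m (-m - 2 * β) j φ)

/-- `E_μ = ∂^{-μ} δ`. -/
def E (m : ℕ) (μ : ℂ) : CFun m := diracPow m (-μ)

/-- `F_μ = ∂^{-μ} H`. -/
def F (m : ℕ) (μ : ℂ) : CFun m := hilbertPow m (-μ)

/-- `K_β = (-Δ_m)^{-β} δ`. -/
def K (m : ℕ) (β : ℂ) : CFun m := laplacePow m (-β)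

/-- `L_β = (-Δ_m)^{-β} H`. -/
def L (m : ℕ) (β : ℂ) : CFun m := laplaceHilbertPow m (-β)

/-! ### The chain of conjugate harmonic potentials in the upper half-space -/

/-- `|x|` for `x = (x₀, x̲) ∈ ℝ^{m+1}`. -/
def nrm {m : ℕ} (x₀ : ℝ) (x : Eu m) : ℝ := Real.sqrt (x₀ ^ 2 + ‖x‖ ^ 2)

/-- The Poisson kernel `P = A_{-1}`. -/
def poisson (m : ℕ) (x₀ : ℝ) (x : Eu m) : ℝ := 2 / sig (m + 1) * (x₀ / nrm x₀ x ^ (m + 1))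

/-- The conjugate Poisson kernel `Q = B_{-1}`. -/
def conjPoisson (m : ℕ) (x₀ : ℝ) (x : Eu m) : Eu m :=
  (-(2 / sig (m + 1)) / nrm x₀ x ^ (m + 1)) • x

/-- `F_m(v) = ∫_0^v η^{m-1} (1 + η^2)^{-(m+1)/2} dη`. -/
def Fm (m : ℕ) (v : ℝ) : ℝ :=
  ∫ η in (0 : ℝ)..v, η ^ (m - 1) / (1 + η ^ 2) ^ (((m : ℝ) + 1) / 2)

/-- `A_0`, twice Green's function of `ℝ^{m+1}` (for `m ≥ 2`). -/
def A0 (m : ℕ) (x₀ : ℝ) (x : Eu m) : ℝ :=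
  -(2 / ((m : ℝ) - 1)) * (1 / sig (m + 1)) * (1 / nrm x₀ x ^ (m - 1))

/-- `B_0`. -/
def B0 (m : ℕ) (x₀ : ℝ) (x : Eu m) : Eu m :=
  (2 / sig (m + 1) / ‖x‖ ^ m * Fm m (‖x‖ / x₀)) • x

/-- The locally integrable function `a_0` (for `m ≥ 2`). -/
def a0 (m : ℕ) (y : Eu m) : ℝ :=
  -(2 / ((m : ℝ) - 1)) * (1 / sig (m + 1)) * (1 / ‖y‖ ^ (m - 1))

/-- The truncated convolution `∫_{|y| < R} a_0(y) G(x₀, x - y) dy`. -/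
def truncConv {m : ℕ} {V : Type} [NormedAddCommGroup V] [NormedSpace ℝ V]
    (G : ℝ → Eu m → V) (x₀ : ℝ) (x : Eu m) (R : ℝ) : V :=
  ∫ y in Metric.ball (0 : Eu m) R, a0 m y • G x₀ (x - y)

/-- The convolution `a_0 * G(x₀, ·)` in the variable of `ℝ^m`, as an integral that is
improper at infinity. -/
def a0Conv {m : ℕ} {V : Type} [NormedAddCommGroup V] [NormedSpace ℝ V]
    (G : ℝ → Eu m → V) (x₀ : ℝ) (x : Eu m) : V :=
  limUnder atTop (truncConv G x₀ x)

/-- The integrals over balls defining `a_0 * G(x₀, ·)` exist and converge. -/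
def A0Convolvable {m : ℕ} {V : Type} [NormedAddCommGroup V] [NormedSpace ℝ V]
    (G : ℝ → Eu m → V) : Prop :=
  ∀ x₀ : ℝ, 0 < x₀ → ∀ x : Eu m,
    (∀ R : ℝ, IntegrableOn (fun y => a0 m y • G x₀ (x - y)) (Metric.ball (0 : Eu m) R)) ∧
    Tendsto (truncConv G x₀ x) atTop (𝓝 (a0Conv G x₀ x))

/-- The upstream potentials `A_k = a_0 * A_{k-1}`. -/
def upA (m : ℕ) : ℕ → ℝ → Eu m → ℝ
  | 0 => A0 m
  | k + 1 => a0Conv (upA m k)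

/-- The upstream potentials `B_k = a_0 * B_{k-1}`. -/
def upB (m : ℕ) : ℕ → ℝ → Eu m → Eu m
  | 0 => B0 m
  | k + 1 => a0Conv (upB m k)

/-- The potentials `A_k`, `k ∈ ℤ`; downstream `A_{-k-1} = ∂_{x₀}^k A_{-1}`. -/
def potA (m : ℕ) : ℤ → ℝ → Eu m → ℝ
  | Int.ofNat k => upA m k
  | Int.negSucc k => fun x₀ x => iteratedDeriv k (fun t => poisson m t x) x₀

/-- The potentials `B_k`, `k ∈ ℤ`; downstream `B_{-k-1} = ∂_{x₀}^k B_{-1}`. -/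
def potB (m : ℕ) : ℤ → ℝ → Eu m → Eu m
  | Int.ofNat k => upB m k
  | Int.negSucc k => fun x₀ x => iteratedDeriv k (fun t => conjPoisson m t x) x₀

/-- `A_k` as a function with values in the Clifford algebra. -/
def clA (m : ℕ) (k : ℤ) (x₀ : ℝ) (x : Eu m) : Cl m := sc (potA m k x₀ x)

/-- `B_k` as a function with values in the Clifford algebra. -/
def clB (m : ℕ) (k : ℤ) (x₀ : ℝ) (x : Eu m) : Cl m := vec (potB m k x₀ x)

/-! In the Clifford algebra over `ℝ^{m+1}`, the generators are `e_0` and `e_{j+1}`, `j < m`. -/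

/-- The Clifford conjugate of `e_0`. -/
def e0bar (m : ℕ) : Cl (m + 1) := -e 0

/-- The vector `x̲ ∈ ℝ^m` in the Clifford algebra over `ℝ^{m+1}`. -/
def vecSucc {m : ℕ} (x : Eu m) : Cl (m + 1) := ∑ j : Fin m, (x j : ℂ) • e j.succ

/-- The Cauchy kernel `C_{-1} = (1/σ_{m+1}) x ē_0 / |x|^{m+1}`, with `x = x₀ e_0 + x̲`. -/
def cauchyKernel (m : ℕ) (x₀ : ℝ) (x : Eu m) : Cl (m + 1) :=
  ((1 / (sig (m + 1) * nrm x₀ x ^ (m + 1)) : ℝ) : ℂ) •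
    (((x₀ : ℂ) • e 0 + vecSucc x) * e0bar m)

/-- `C_k = ½ A_k + ½ ē_0 B_k`. -/
def potC (m : ℕ) (k : ℤ) (x₀ : ℝ) (x : Eu m) : Cl (m + 1) :=
  (1 / 2 : ℂ) • sc (potA m k x₀ x) + (1 / 2 : ℂ) • (e0bar m * vecSucc (potB m k x₀ x))

/-- `G = D̄ C` in the upper half-space, where `D̄ = ½ (∂_{x₀} - ē_0 ∂)` and
`∂ = ∑ e_j ∂_{x_j}`. Here `d₀` and `d j` are the partial derivatives of the Clifford-valued
function `C`, as seen by all linear functionals. -/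
def IsDbar {m : ℕ} (C G : ℝ → Eu m → Cl (m + 1)) : Prop :=
  ∀ x₀ : ℝ, 0 < x₀ → ∀ x : Eu m, ∃ (d₀ : Cl (m + 1)) (d : Fin m → Cl (m + 1)),
    (∀ ℓ : Cl (m + 1) →ₗ[ℂ] ℂ, HasDerivAt (fun t : ℝ => ℓ (C t x)) (ℓ d₀) x₀) ∧
    (∀ (j : Fin m) (ℓ : Cl (m + 1) →ₗ[ℂ] ℂ),
      HasDerivAt (fun t : ℝ => ℓ (C x₀ (x + t • EuclideanSpace.single j 1))) (ℓ (d j)) 0) ∧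
    G x₀ x = (1 / 2 : ℂ) • (d₀ - e0bar m * ∑ j : Fin m, e j.succ * d j)

end HarmonicPotentials

end

open MeasureTheory Filter Topology
open scoped SchwartzMap ContDiff LineDeriv Laplacian

noncomputable section

namespace HarmonicPotentials

open Real Set FourierTransform

variable {m : ℕ}

local notation "unitVec" j:max => EuclideanSpace.single j (1 : ℝ)

theorem integral_congr_of_eq {α V : Type*} [MeasurableSpace α] [NormedAddCommGroup V]
    [NormedSpace ℝ V] {μ : Measure α} {f g : α → V} (h : ∀ x, f x = g x) :
    ∫ x, f x ∂μ = ∫ x, g x ∂μ := congrArg _ (funext h)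

theorem ae_ne_zero (hm : 1 ≤ m) : ∀ᵐ x : Eu m, x ≠ 0 := by
  have : Nonempty (Fin m) := ⟨⟨0, hm⟩⟩
  simp [ae_iff]

/-! ### The subordination formula -/

theorem image_sub_div {b : ℝ} (hb : 0 < b) : (fun v : ℝ => v - b / v) '' Ioi 0 = univ := by
  refine eq_univ_of_forall fun y => ?_
  have hs : Real.sqrt (y ^ 2 + 4 * b) ^ 2 = y ^ 2 + 4 * b := Real.sq_sqrt (by positivity)
  have hlt : |y| < Real.sqrt (y ^ 2 + 4 * b) := by
    rw [← Real.sqrt_sq_eq_abs]; exact Real.sqrt_lt_sqrt (sq_nonneg _) (by linarith)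
  have hpos : 0 < (y + Real.sqrt (y ^ 2 + 4 * b)) / 2 := by
    have := neg_abs_le y; linarith
  refine ⟨(y + Real.sqrt (y ^ 2 + 4 * b)) / 2, hpos, ?_⟩
  have h2 : y + Real.sqrt (y ^ 2 + 4 * b) ≠ 0 := by linarith
  simp only
  field_simp
  nlinarith

theorem cauchy_schlomilch_gaussian {b : ℝ} (hb : 0 ≤ b) :
    IntegrableOn (fun v : ℝ => Real.exp (-(v - b / v) ^ 2)) (Ioi 0) ∧
    ∫ v in Ioi (0 : ℝ), Real.exp (-(v - b / v) ^ 2) = √π / 2 := by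
  rcases hb.eq_or_lt with rfl | hb
  · have h1 := integral_gaussian_Ioi 1
    have h2 := (integrable_exp_neg_mul_sq (b := 1) one_pos).integrableOn (s := Ioi 0)
    simp only [neg_mul, one_mul, div_one] at h1 h2
    simpa using ⟨h2, h1⟩
  have hder : ∀ v ∈ Ioi (0 : ℝ),
      HasDerivWithinAt (fun v : ℝ => v - b / v) (1 + b / v ^ 2) (Ioi 0) v := by
    intro v hv
    have hv' : v ≠ 0 := (mem_Ioi.1 hv).ne'
    refine (((hasDerivAt_id v).sub ((hasDerivAt_inv hv').const_mul b)).congr_deriv ?_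
      |>.hasDerivWithinAt).congr_of_mem (fun x _ => ?_) hv
    · field_simp; ring
    · simp [div_eq_mul_inv]
  have hinj : InjOn (fun v : ℝ => v - b / v) (Ioi 0) := by
    intro v hv w hw h
    have hv' : 0 < v := hv
    have hw' : 0 < w := hw
    have h' : v - b / v = w - b / w := h
    have : (v - w) * (1 + b / (v * w)) = 0 := by
      have : (v - w) * (1 + b / (v * w)) = (v - b / v) - (w - b / w) := by field_simp; ring
      rw [this, h', sub_self]
    rcases mul_eq_zero.1 this with h0 | h0
    · linarith
    · have : 0 < 1 + b / (v * w) := by positivity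
      linarith
  have hder2 : ∀ v ∈ Ioi (0 : ℝ),
      HasDerivWithinAt (fun v : ℝ => b / v) (-(b / v ^ 2)) (Ioi 0) v := by
    intro v hv
    have hv' : v ≠ 0 := (mem_Ioi.1 hv).ne'
    refine (((hasDerivAt_inv hv').const_mul b).congr_deriv ?_
      |>.hasDerivWithinAt).congr_of_mem (fun x _ => ?_) hv
    · field_simp
    · simp [div_eq_mul_inv]
  have hinj2 : InjOn (fun v : ℝ => b / v) (Ioi 0) := by
    intro v hv w hw h
    have hv' : 0 < v := hv
    have hw' : 0 < w := hw
    simp only at h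
    field_simp at h
    exact h.symm
  have him2 : (fun v : ℝ => b / v) '' Ioi 0 = Ioi 0 := by
    ext y
    constructor
    · rintro ⟨v, hv, rfl⟩
      exact div_pos hb hv
    · intro hy
      exact ⟨b / y, div_pos hb hy, by have : y ≠ 0 := (mem_Ioi.1 hy).ne'; field_simp⟩
  have hg : Integrable (fun y : ℝ => Real.exp (-y ^ 2)) := by
    simpa using integrable_exp_neg_mul_sq (b := 1) one_pos
  have hI1 : IntegrableOn (fun v : ℝ => |1 + b / v ^ 2| • Real.exp (-(v - b / v) ^ 2)) (Ioi 0) := by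
    rw [← integrableOn_image_iff_integrableOn_abs_deriv_smul measurableSet_Ioi hder hinj
      (fun y : ℝ => Real.exp (-y ^ 2)), image_sub_div hb]
    exact hg.integrableOn
  have hE1 : ∫ v in Ioi (0 : ℝ), |1 + b / v ^ 2| • Real.exp (-(v - b / v) ^ 2) = √π := by
    rw [← integral_image_eq_integral_abs_deriv_smul measurableSet_Ioi hder hinj
      (fun y : ℝ => Real.exp (-y ^ 2)), image_sub_div hb, setIntegral_univ]
    simpa using integral_gaussian 1
  have hE2 : ∫ v in Ioi (0 : ℝ), |-(b / v ^ 2)| • Real.exp (-(v - b / v) ^ 2) =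
      ∫ v in Ioi (0 : ℝ), Real.exp (-(v - b / v) ^ 2) := by
    conv_rhs => rw [← him2]
    rw [integral_image_eq_integral_abs_deriv_smul measurableSet_Ioi hder2 hinj2
      (fun v : ℝ => Real.exp (-(v - b / v) ^ 2))]
    refine setIntegral_congr_fun measurableSet_Ioi fun v hv => ?_
    have hv' : v ≠ 0 := (mem_Ioi.1 hv).ne'
    congr 3
    have : b / (b / v) = v := by field_simp
    rw [this]; ring
  have hmeas : AEStronglyMeasurable (fun v : ℝ => Real.exp (-(v - b / v) ^ 2))
      (volume.restrict (Ioi 0)) := by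
    apply Measurable.aestronglyMeasurable
    fun_prop
  have hI : IntegrableOn (fun v : ℝ => Real.exp (-(v - b / v) ^ 2)) (Ioi 0) := by
    refine Integrable.mono' hI1 hmeas (Eventually.of_forall fun v => ?_)
    rw [norm_of_nonneg (Real.exp_nonneg _), abs_of_pos (by positivity), smul_eq_mul]
    have : 0 ≤ b / v ^ 2 := by positivity
    nlinarith [Real.exp_nonneg (-(v - b / v) ^ 2)]
  refine ⟨hI, ?_⟩
  have hsplit : ∀ v : ℝ, |1 + b / v ^ 2| • Real.exp (-(v - b / v) ^ 2) =
      Real.exp (-(v - b / v) ^ 2) + |-(b / v ^ 2)| • Real.exp (-(v - b / v) ^ 2) := by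
    intro v
    have : 0 ≤ b / v ^ 2 := by positivity
    rw [abs_neg, abs_of_nonneg this, abs_of_nonneg (by positivity)]
    simp [add_mul]
  have hI2 : IntegrableOn (fun v : ℝ => |-(b / v ^ 2)| • Real.exp (-(v - b / v) ^ 2)) (Ioi 0) := by
    have := hI1.sub hI
    refine this.congr (Eventually.of_forall fun v => ?_)
    simp only [Pi.sub_apply, hsplit v, add_sub_cancel_left]
  simp_rw [hsplit] at hE1
  rw [integral_add hI hI2, hE2] at hE1
  linarith

/-- The exponential function as a superposition of Gaussians. -/
theorem exp_neg_eq_integral {β : ℝ} (hβ : 0 ≤ β) :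
    IntegrableOn (fun v : ℝ => Real.exp (-v ^ 2 - β ^ 2 / (4 * v ^ 2))) (Ioi 0) ∧
    ∫ v in Ioi (0 : ℝ), Real.exp (-v ^ 2 - β ^ 2 / (4 * v ^ 2)) = √π / 2 * Real.exp (-β) := by
  obtain ⟨hi, he⟩ := cauchy_schlomilch_gaussian (b := β / 2) (by positivity)
  have hcongr : ∀ v ∈ Ioi (0 : ℝ), Real.exp (-(v - β / 2 / v) ^ 2) * Real.exp (-β) =
      Real.exp (-v ^ 2 - β ^ 2 / (4 * v ^ 2)) := by
    intro v hv
    have hv' : v ≠ 0 := (mem_Ioi.1 hv).ne'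
    rw [← Real.exp_add]
    congr 1
    field_simp
    ring
  constructor
  · exact IntegrableOn.congr_fun (hi.mul_const (Real.exp (-β))) hcongr measurableSet_Ioi
  · rw [← setIntegral_congr_fun measurableSet_Ioi hcongr, integral_mul_const, he]

/-! ### Exponentially damped symbols -/

theorem exp_neg_mul_le_rpow {c : ℝ} (hc : 0 < c) (N : ℕ) :
    ∃ C : ℝ, 0 < C ∧ ∀ r : ℝ, 0 ≤ r → Real.exp (-(c * r)) * (1 + r) ^ N ≤ C := by
  refine ⟨N.factorial * Real.exp c / c ^ N, by positivity, fun r hr => ?_⟩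
  have h := Real.pow_div_factorial_le_exp (x := c * (1 + r)) (by positivity) N
  have hf : (0 : ℝ) < N.factorial := by positivity
  rw [div_le_iff₀ hf, mul_pow] at h
  rw [le_div_iff₀ (by positivity)]
  calc Real.exp (-(c * r)) * (1 + r) ^ N * c ^ N = Real.exp (-(c * r)) * (c ^ N * (1 + r) ^ N) := by
        ring
    _ ≤ Real.exp (-(c * r)) * (Real.exp (c * (1 + r)) * N.factorial) := by gcongr
    _ = N.factorial * Real.exp c := by
        rw [← mul_assoc, ← Real.exp_add, mul_comm]; congr 2; ring

theorem integrable_pow_mul_exp_neg (m N : ℕ) {c : ℝ} (hc : 0 < c) :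
    Integrable (fun x : Eu m => (1 + ‖x‖) ^ N * Real.exp (-(c * ‖x‖))) := by
  obtain ⟨C, hC, h⟩ := exp_neg_mul_le_rpow hc (N + (m + 1))
  have hint : Integrable (fun x : Eu m => C * (1 + ‖x‖) ^ (-((m : ℝ) + 1))) :=
    (integrable_one_add_norm (by simp)).const_mul C
  refine hint.mono' (by fun_prop) (Eventually.of_forall fun x => ?_)
  have h1 : 0 < 1 + ‖x‖ := by positivity
  rw [norm_of_nonneg (by positivity), rpow_neg h1.le]
  rw [← div_eq_mul_inv, le_div_iff₀ (by positivity)]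
  have := h ‖x‖ (norm_nonneg x)
  rw [pow_add] at this
  have h2 : (1 + ‖x‖) ^ ((m : ℝ) + 1) = (1 + ‖x‖) ^ (m + 1) := by
    rw [← rpow_natCast]; push_cast; rfl
  rw [h2]
  linarith

/-- A measurable symbol of polynomial growth. -/
structure IsSymbol (p : Eu m → ℂ) : Prop where
  measurable : Measurable p
  growth : ∃ (C : ℝ) (N : ℕ), ∀ ξ, ‖p ξ‖ ≤ C * (1 + ‖ξ‖) ^ N

theorem IsSymbol.mul {p q : Eu m → ℂ} (hp : IsSymbol p) (hq : IsSymbol q) :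
    IsSymbol (fun ξ => p ξ * q ξ) := by
  obtain ⟨C, N, h⟩ := hp.growth
  obtain ⟨D, M, h'⟩ := hq.growth
  refine ⟨hp.measurable.mul hq.measurable, C * D, N + M, fun ξ => ?_⟩
  have h0 : 0 ≤ C * (1 + ‖ξ‖) ^ N := (norm_nonneg _).trans (h ξ)
  calc ‖p ξ * q ξ‖ = ‖p ξ‖ * ‖q ξ‖ := norm_mul _ _
    _ ≤ (C * (1 + ‖ξ‖) ^ N) * (D * (1 + ‖ξ‖) ^ M) := mul_le_mul (h ξ) (h' ξ) (norm_nonneg _) h0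
    _ = C * D * (1 + ‖ξ‖) ^ (N + M) := by ring

theorem IsSymbol.const (c : ℂ) : IsSymbol (fun _ : Eu m => c) :=
  ⟨measurable_const, ‖c‖, 0, fun ξ => by simp⟩

theorem IsSymbol.norm : IsSymbol (fun ξ : Eu m => (‖ξ‖ : ℂ)) :=
  ⟨by fun_prop, 1, 1, fun ξ => by simp⟩

theorem IsSymbol.coord (j : Fin m) : IsSymbol (fun ξ : Eu m => (ξ j : ℂ)) :=
  ⟨by fun_prop, 1, 1, fun ξ => by
    have := EuclideanSpace.norm_eq ξ ▸ PiLp.norm_apply_le ξ j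
    have h : ‖ξ j‖ ≤ ‖ξ‖ := PiLp.norm_apply_le ξ j
    rw [Complex.norm_real]; linarith⟩

theorem norm_coord_div_norm_le (j : Fin m) (ξ : Eu m) : ‖((ξ j : ℂ) / (‖ξ‖ : ℂ))‖ ≤ 1 := by
  rw [norm_div, Complex.norm_real, Complex.norm_real, norm_norm]
  exact div_le_one_of_le₀ (PiLp.norm_apply_le ξ j) (norm_nonneg _)

theorem IsSymbol.direction (j : Fin m) : IsSymbol (fun ξ : Eu m => (ξ j : ℂ) / (‖ξ‖ : ℂ)) :=
  ⟨by fun_prop, 1, 0, fun ξ => by simpa using norm_coord_div_norm_le j ξ⟩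

theorem IsSymbol.pow {p : Eu m → ℂ} (hp : IsSymbol p) (k : ℕ) :
    IsSymbol (fun ξ => p ξ ^ k) := by
  induction k with
  | zero => simpa using IsSymbol.const 1
  | succ k ih => simpa only [pow_succ] using ih.mul hp

theorem IsSymbol.integrable_mul {p : Eu m → ℂ} (hp : IsSymbol p) (f : 𝓢(Eu m, ℂ)) :
    Integrable (fun ξ => p ξ * f ξ) := by
  obtain ⟨C, N, h⟩ := hp.growth
  have h1 : Integrable (fun ξ : Eu m => |C| * (2 ^ N * (‖f ξ‖ + ‖ξ‖ ^ N * ‖f ξ‖))) := by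
    refine ((Integrable.add ?_ ?_).const_mul _).const_mul _
    · exact f.integrable.norm
    · exact f.integrable_pow_mul volume N
  refine h1.mono' ((hp.measurable.aestronglyMeasurable).mul f.continuous.aestronglyMeasurable)
    (Eventually.of_forall fun ξ => ?_)
  have h2 : (1 + ‖ξ‖) ^ N ≤ 2 ^ N * (1 + ‖ξ‖ ^ N) := by
    have := add_pow_le (zero_le_one) (norm_nonneg ξ) N
    refine this.trans ?_
    rw [one_pow]
    gcongr
    · norm_num
    · omega
  rw [norm_mul]
  calc ‖p ξ‖ * ‖f ξ‖ ≤ (|C| * (1 + ‖ξ‖) ^ N) * ‖f ξ‖ := by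
        gcongr; exact (h ξ).trans (by gcongr; exact le_abs_self C)
    _ ≤ (|C| * (2 ^ N * (1 + ‖ξ‖ ^ N))) * ‖f ξ‖ := by gcongr
    _ = _ := by ring

/-- The damped symbol `p(ξ) e^{-2πt|ξ|}`. -/
def damp (p : Eu m → ℂ) (t : ℝ) (ξ : Eu m) : ℂ :=
  p ξ * (Real.exp (-(2 * π * t * ‖ξ‖)) : ℝ)

theorem IsSymbol.integrable_damp {p : Eu m → ℂ} (hp : IsSymbol p) {t : ℝ} (ht : 0 < t) :
    Integrable (damp p t) := by
  obtain ⟨C, N, h⟩ := hp.growth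
  refine ((integrable_pow_mul_exp_neg m N (c := 2 * π * t) (by positivity)).const_mul C).mono'
    ?_ (Eventually.of_forall fun ξ => ?_)
  · refine Measurable.aestronglyMeasurable ?_
    exact hp.measurable.mul (by fun_prop)
  · rw [damp, norm_mul, Complex.norm_real, norm_of_nonneg (Real.exp_nonneg _), ← mul_assoc]
    gcongr
    exact h ξ

/-- The function with Fourier symbol `p(ξ) e^{-2πt|ξ|}`. -/
def symbolKernel (p : Eu m → ℂ) (t : ℝ) : Eu m → ℂ := 𝓕 (damp p t)

section

variable {p : Eu m → ℂ}

theorem symbolKernel_eq (p : Eu m → ℂ) (t : ℝ) (x : Eu m) :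
    symbolKernel p t x =
      ∫ ξ, Complex.exp (((-2 * π * inner ℝ ξ x : ℝ) : ℂ) * Complex.I) * damp p t ξ := by
  simp only [symbolKernel, Real.fourier_eq', smul_eq_mul]

theorem norm_phase_mul (a : ℝ) (z : ℂ) : ‖Complex.exp ((a : ℂ) * Complex.I) * z‖ = ‖z‖ := by
  rw [norm_mul, Complex.norm_exp_ofReal_mul_I, one_mul]

theorem norm_symbolKernel_le (p : Eu m → ℂ) (t : ℝ) (x : Eu m) :
    ‖symbolKernel p t x‖ ≤ ∫ ξ, ‖damp p t ξ‖ := by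
  rw [symbolKernel_eq]
  refine (norm_integral_le_integral_norm _).trans (le_of_eq ?_)
  simp only [norm_phase_mul]

theorem IsSymbol.continuous_symbolKernel (hp : IsSymbol p) {t : ℝ} (ht : 0 < t) :
    Continuous (symbolKernel p t) :=
  VectorFourier.fourierIntegral_continuous Real.continuous_fourierChar
    (by exact continuous_inner) (hp.integrable_damp ht)

theorem IsSymbol.hasDerivAt_symbolKernel_time (hp : IsSymbol p) {t : ℝ} (ht : 0 < t) (x : Eu m) :
    HasDerivAt (fun t => symbolKernel p t x)
      (symbolKernel (fun ξ => -(2 * π * ‖ξ‖ : ℝ) * p ξ) t x) t := by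
  simp only [symbolKernel_eq]
  have hp' : IsSymbol (fun ξ => -((2 * π * ‖ξ‖ : ℝ) : ℂ) * p ξ) := by
    have := ((IsSymbol.const (m := m) (-(2 * π : ℝ))).mul IsSymbol.norm).mul hp
    convert this using 2
    push_cast; ring
  have hmeas : ∀ (q : Eu m → ℂ), IsSymbol q → ∀ s : ℝ, AEStronglyMeasurable (fun ξ : Eu m =>
      Complex.exp (((-2 * π * inner ℝ ξ x : ℝ) : ℂ) * Complex.I) * damp q s ξ) := by
    intro q hq s
    have := hq.measurable
    unfold damp
    exact Measurable.aestronglyMeasurable (by fun_prop)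
  refine (hasDerivAt_integral_of_dominated_loc_of_deriv_le (s := Ioi (t / 2))
    (F := fun t ξ => Complex.exp (((-2 * π * inner ℝ ξ x : ℝ) : ℂ) * Complex.I) * damp p t ξ)
    (F' := fun t ξ => Complex.exp (((-2 * π * inner ℝ ξ x : ℝ) : ℂ) * Complex.I) *
      damp (fun ξ => -((2 * π * ‖ξ‖ : ℝ) : ℂ) * p ξ) t ξ)
    (bound := fun ξ => ‖damp (fun ξ => -((2 * π * ‖ξ‖ : ℝ) : ℂ) * p ξ) (t / 2) ξ‖)
    (Ioi_mem_nhds (by linarith)) (Eventually.of_forall fun s => hmeas p hp s) ?_ (hmeas _ hp' t)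
    (Eventually.of_forall fun ξ s hs => ?_) (hp'.integrable_damp (by linarith)).norm
    (Eventually.of_forall fun ξ s _ => ?_)).2
  · refine (hp.integrable_damp ht).norm.mono' (hmeas p hp t) (Eventually.of_forall fun ξ => ?_)
    rw [norm_phase_mul]
  · rw [norm_phase_mul]
    simp only [damp, norm_mul, Complex.norm_real, norm_of_nonneg (Real.exp_nonneg _)]
    have hs' : t / 2 ≤ s := le_of_lt hs
    gcongr
  · refine HasDerivAt.const_mul _ ?_
    have h1 : HasDerivAt (fun s : ℝ => Real.exp (-(2 * π * s * ‖ξ‖)))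
        (Real.exp (-(2 * π * s * ‖ξ‖)) * -(2 * π * ‖ξ‖)) s := by
      refine HasDerivAt.exp ?_
      have := (((hasDerivAt_id s).const_mul (2 * π)).mul_const ‖ξ‖).fun_neg
      simpa using this
    have h2 := (h1.ofReal_comp).const_mul (p ξ)
    refine h2.congr_deriv ?_
    simp only [damp]; push_cast; ring

theorem IsSymbol.hasDerivAt_symbolKernel_space (hp : IsSymbol p) {t : ℝ} (ht : 0 < t) (x : Eu m)
    (j : Fin m) :
    HasDerivAt (fun s : ℝ => symbolKernel p t (x + s • unitVec j))
      (symbolKernel (fun ξ => -((2 * π * ξ j : ℝ) : ℂ) * Complex.I * p ξ) t x) 0 := by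
  have hn : Integrable (fun ξ => ‖ξ‖ * ‖damp p t ξ‖) := by
    have := ((IsSymbol.norm.mul hp).integrable_damp ht).norm
    refine this.congr (Eventually.of_forall fun ξ => ?_)
    simp only [damp, norm_mul, Complex.norm_real, norm_norm]; ring
  have hn' : Integrable (fun ξ => VectorFourier.fourierSMulRight (innerSL ℝ) (damp p t) ξ) := by
    refine Integrable.mono' (hn.const_mul (2 * π * ‖innerSL ℝ (E := Eu m)‖)) ?_
      (Eventually.of_forall fun ξ => ?_)
    · exact (hp.integrable_damp ht).1.fourierSMulRight
    · refine (VectorFourier.norm_fourierSMulRight_le _ _ _).trans (le_of_eq (by ring))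
  have h1 := Real.hasFDerivAt_fourier (hp.integrable_damp ht) hn x
  have h2 : HasDerivAt (fun s : ℝ => x + s • unitVec j)
      (unitVec j) 0 := by
    simpa using ((hasDerivAt_id (0 : ℝ)).smul_const (unitVec j)).const_add x
  have h3 : HasFDerivAt (𝓕 (damp p t)) (𝓕 (VectorFourier.fourierSMulRight (innerSL ℝ) (damp p t)) x)
      (x + (0 : ℝ) • unitVec j) := by simpa using h1
  have h4 := h3.comp_hasDerivAt (0 : ℝ) h2
  refine h4.congr_deriv ?_
  rw [Real.fourier_continuousLinearMap_apply hn', symbolKernel]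
  refine congrArg (fun f : Eu m → ℂ => 𝓕 f x) (funext fun ξ => ?_)
  simp only [VectorFourier.fourierSMulRight_apply, damp]
  have : innerSL ℝ ξ (unitVec j) = ξ j := by
    rw [innerSL_apply_apply]
    simp [EuclideanSpace.inner_single_right]
  rw [this]
  simp only [Complex.real_smul, smul_eq_mul]
  push_cast; ring

theorem IsSymbol.integral_symbolKernel_mul (hp : IsSymbol p) {t : ℝ} (ht : 0 < t)
    {f : Eu m → ℂ} (hf : Integrable f) :
    ∫ x, symbolKernel p t x * f x = ∫ ξ, damp p t ξ * 𝓕 f ξ := by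
  have := VectorFourier.integral_fourierIntegral_smul_eq_flip (μ := (volume : Measure (Eu m)))
    (ν := (volume : Measure (Eu m))) (L := innerₗ (Eu m)) Real.continuous_fourierChar
    (by exact continuous_inner) (hp.integrable_damp ht) hf
  rw [flip_innerₗ] at this
  exact this

theorem IsSymbol.integrable_symbolKernel_mul (hp : IsSymbol p) {t : ℝ} (ht : 0 < t)
    (φ : 𝓢(Eu m, ℂ)) : Integrable (fun x => symbolKernel p t x * φ x) :=
  φ.integrable.bdd_mul (hp.continuous_symbolKernel ht).aestronglyMeasurable
    (Eventually.of_forall (norm_symbolKernel_le p t))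

/-- The boundary value of a kernel with a symbol. -/
theorem IsSymbol.tendsto_integral_symbolKernel (hp : IsSymbol p) (φ : 𝓢(Eu m, ℂ)) :
    Tendsto (fun t : ℝ => ∫ x, symbolKernel p t x * φ x) (𝓝[>] 0) (𝓝 (∫ ξ, p ξ * 𝓕 φ ξ)) := by
  have h1 : Tendsto (fun t : ℝ => ∫ ξ, damp p t ξ * 𝓕 φ ξ) (𝓝[>] 0) (𝓝 (∫ ξ, p ξ * 𝓕 φ ξ)) := by
    refine tendsto_integral_filter_of_dominated_convergence (fun ξ => ‖p ξ * 𝓕 φ ξ‖) ?_ ?_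
      (hp.integrable_mul (𝓕 φ)).norm ?_
    · refine Eventually.of_forall fun t => ?_
      have := hp.measurable
      have h2 : Measurable (𝓕 φ : 𝓢(Eu m, ℂ)) := (𝓕 φ).continuous.measurable
      unfold damp
      exact Measurable.aestronglyMeasurable (by fun_prop)
    · filter_upwards [self_mem_nhdsWithin] with t ht
      refine Eventually.of_forall fun ξ => ?_
      simp only [damp, norm_mul, Complex.norm_real, norm_of_nonneg (Real.exp_nonneg _)]
      have ht' : 0 < t := ht
      have : Real.exp (-(2 * π * t * ‖ξ‖)) ≤ 1 := Real.exp_le_one_iff.2 (by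
        have : 0 ≤ 2 * π * t * ‖ξ‖ := by positivity
        linarith)
      gcongr
      exact mul_le_of_le_one_right (norm_nonneg _) this
    · refine Eventually.of_forall fun ξ => ?_
      refine Tendsto.mono_left ?_ nhdsWithin_le_nhds
      have : Continuous (fun t : ℝ => damp p t ξ * 𝓕 φ ξ) := by
        unfold damp; fun_prop
      simpa [damp] using this.tendsto 0
  refine h1.congr' ?_
  filter_upwards [self_mem_nhdsWithin] with t ht
  exact (hp.integral_symbolKernel_mul ht φ.integrable).symm

theorem IsSymbol.tendsto_symbolKernel_atTop (hm : 1 ≤ m) (hp : IsSymbol p) (x : Eu m) :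
    Tendsto (fun t : ℝ => symbolKernel p t x) atTop (𝓝 0) := by
  have : Nontrivial (Eu m) := by
    have : Nonempty (Fin m) := ⟨⟨0, hm⟩⟩
    infer_instance
  simp only [symbolKernel_eq]
  have h0 : (0 : ℂ) = ∫ _ : Eu m, (0 : ℂ) := by simp
  rw [h0]
  refine tendsto_integral_filter_of_dominated_convergence (fun ξ => ‖damp p 1 ξ‖) ?_ ?_
      (hp.integrable_damp one_pos).norm ?_
  · refine Eventually.of_forall fun t => ?_
    have := hp.measurable
    unfold damp
    exact Measurable.aestronglyMeasurable (by fun_prop)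
  · filter_upwards [eventually_ge_atTop 1] with t ht
    refine Eventually.of_forall fun ξ => ?_
    rw [norm_phase_mul]
    simp only [damp, norm_mul, Complex.norm_real, norm_of_nonneg (Real.exp_nonneg _)]
    gcongr
  · have : ∀ᵐ ξ : Eu m, ξ ≠ 0 := by
      simp [ae_iff]
    filter_upwards [this] with ξ hξ
    have hn : 0 < ‖ξ‖ := norm_pos_iff.2 hξ
    have h1 : Tendsto (fun t : ℝ => Real.exp (-(2 * π * t * ‖ξ‖))) atTop (𝓝 0) := by
      refine Real.tendsto_exp_neg_atTop_nhds_zero.comp ?_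
      exact (tendsto_id.const_mul_atTop (by positivity)).atTop_mul_const hn
    have h2 : Tendsto (fun t : ℝ => ((Real.exp (-(2 * π * t * ‖ξ‖)) : ℝ) : ℂ)) atTop (𝓝 0) := by
      exact_mod_cast (Complex.continuous_ofReal.tendsto 0).comp h1
    have h3 := (h2.const_mul (p ξ)).const_mul
      (Complex.exp (((-2 * π * inner ℝ ξ x : ℝ) : ℂ) * Complex.I))
    simpa [damp] using h3

end

section

variable {p : Eu m → ℂ}

theorem nrm_pos {t : ℝ} (ht : 0 < t) (x : Eu m) : 0 < nrm t x := Real.sqrt_pos.2 (by positivity)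

theorem nrm_sq (t : ℝ) (x : Eu m) : nrm t x ^ 2 = t ^ 2 + ‖x‖ ^ 2 := Real.sq_sqrt (by positivity)

theorem two_div_sig (n : ℕ) (hn : 0 < n) :
    2 / sig n = Real.Gamma ((n : ℝ) / 2) / π ^ ((n : ℝ) / 2) := by
  have h1 : 0 < Real.Gamma ((n : ℝ) / 2) := Gamma_pos_of_pos (by positivity)
  have h2 : 0 < π ^ ((n : ℝ) / 2) := by positivity
  rw [sig]; field_simp

theorem two_div_sig_succ_pos (m : ℕ) : 0 < 2 / sig (m + 1) := by
  rw [two_div_sig _ (Nat.succ_pos m)]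
  have h1 : 0 < Real.Gamma (((m + 1 : ℕ) : ℝ) / 2) := Gamma_pos_of_pos (by positivity)
  positivity

theorem gaussian_scale {t v : ℝ} (ht : 0 < t) (hv : 0 < v) (x : Eu m) :
    ∫ ξ : Eu m, Complex.exp (((-2 * π * inner ℝ ξ x : ℝ) : ℂ) * Complex.I) *
      ((Real.exp (-v ^ 2 - (2 * π * t * ‖ξ‖) ^ 2 / (4 * v ^ 2)) : ℝ) : ℂ) =
    (((π * t ^ 2) ^ (-((m : ℝ) / 2)) * (v ^ (m : ℝ) *
      Real.exp (-(nrm t x ^ 2 / t ^ 2) * v ^ (2 : ℝ))) : ℝ) : ℂ) := by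
  have hb : 0 < (((π * t / v) ^ 2 : ℝ) : ℂ).re := by rw [Complex.ofReal_re]; positivity
  have h := fourier_gaussian_innerProductSpace hb x
  rw [Real.fourier_eq'] at h
  have h1 : ∀ ξ : Eu m, Complex.exp (((-2 * π * inner ℝ ξ x : ℝ) : ℂ) * Complex.I) *
      ((Real.exp (-v ^ 2 - (2 * π * t * ‖ξ‖) ^ 2 / (4 * v ^ 2)) : ℝ) : ℂ) =
      ((Real.exp (-v ^ 2) : ℝ) : ℂ) * (Complex.exp (((-2 * π * inner ℝ ξ x : ℝ) : ℂ) * Complex.I) •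
        Complex.exp (-(((π * t / v) ^ 2 : ℝ) : ℂ) * (‖ξ‖ : ℂ) ^ 2)) := by
    intro ξ
    have : Real.exp (-v ^ 2 - (2 * π * t * ‖ξ‖) ^ 2 / (4 * v ^ 2)) =
        Real.exp (-v ^ 2) * Real.exp (-((π * t / v) ^ 2) * ‖ξ‖ ^ 2) := by
      rw [← Real.exp_add]; congr 1; field_simp; ring
    rw [this, smul_eq_mul]; push_cast; ring
  simp_rw [h1]
  rw [integral_const_mul, h]
  have h2 : (π : ℂ) / (((π * t / v) ^ 2 : ℝ) : ℂ) = (((v ^ 2 / (π * t ^ 2)) : ℝ) : ℂ) := by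
    have : (v : ℂ) ≠ 0 := by exact_mod_cast hv.ne'
    have : (t : ℂ) ≠ 0 := by exact_mod_cast ht.ne'
    have : (π : ℂ) ≠ 0 := by exact_mod_cast pi_ne_zero
    push_cast; field_simp
  have h3 : (-(π : ℂ) ^ 2 * (‖x‖ : ℂ) ^ 2 / (((π * t / v) ^ 2 : ℝ) : ℂ)) =
      ((-(‖x‖ ^ 2 / t ^ 2) * v ^ 2 : ℝ) : ℂ) := by
    have : (v : ℂ) ≠ 0 := by exact_mod_cast hv.ne'
    have : (t : ℂ) ≠ 0 := by exact_mod_cast ht.ne'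
    have : (π : ℂ) ≠ 0 := by exact_mod_cast pi_ne_zero
    push_cast; field_simp
  have h4 : ((Module.finrank ℝ (Eu m) : ℂ) / 2) = (((m : ℝ) / 2 : ℝ) : ℂ) := by
    simp
  rw [h2, h3, h4, ← Complex.ofReal_cpow (by positivity), ← Complex.ofReal_exp, ← Complex.ofReal_mul,
    ← Complex.ofReal_mul]
  congr 1
  have h5 : (v ^ 2 / (π * t ^ 2)) ^ ((m : ℝ) / 2) = (π * t ^ 2) ^ (-((m : ℝ) / 2)) * v ^ (m : ℝ) := by
    rw [Real.div_rpow (by positivity) (by positivity), rpow_neg (by positivity),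
      ← rpow_natCast v 2, ← rpow_mul hv.le]
    rw [show ((2 : ℕ) : ℝ) * ((m : ℝ) / 2) = m by push_cast; ring]
    field_simp
  have h6 : Real.exp (-v ^ 2) * Real.exp (-(‖x‖ ^ 2 / t ^ 2) * v ^ 2) =
      Real.exp (-(nrm t x ^ 2 / t ^ 2) * v ^ (2 : ℝ)) := by
    rw [← Real.exp_add, nrm_sq, rpow_two]; congr 1; field_simp; ring
  rw [h5, ← h6]; ring

/-- The Poisson kernel is the Fourier transform of `e^{-2πt|ξ|}`. -/
theorem poisson_eq_symbolKernel {t : ℝ} (ht : 0 < t) (x : Eu m) :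
    symbolKernel (fun _ => 1) t x = (poisson m t x : ℂ) := by
  have hpi : (0 : ℝ) < √π := Real.sqrt_pos.2 pi_pos
  rw [symbolKernel_eq]
  have h1 : ∀ ξ : Eu m, Complex.exp (((-2 * π * inner ℝ ξ x : ℝ) : ℂ) * Complex.I) *
      damp (fun _ => 1) t ξ = ((2 / √π : ℝ) : ℂ) * ∫ v in Ioi (0 : ℝ),
        Complex.exp (((-2 * π * inner ℝ ξ x : ℝ) : ℂ) * Complex.I) *
          ((Real.exp (-v ^ 2 - (2 * π * t * ‖ξ‖) ^ 2 / (4 * v ^ 2)) : ℝ) : ℂ) := by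
    intro ξ
    rw [integral_const_mul, integral_complex_ofReal,
      (exp_neg_eq_integral (β := 2 * π * t * ‖ξ‖) (by positivity)).2, damp, one_mul,
      mul_left_comm, ← Complex.ofReal_mul]
    congr 3
    field_simp
  simp_rw [h1]
  rw [integral_const_mul, integral_integral_swap]
  · have h2 : ∀ v ∈ Ioi (0 : ℝ), (∫ ξ : Eu m, Complex.exp (((-2 * π * inner ℝ ξ x : ℝ) : ℂ) *
        Complex.I) * ((Real.exp (-v ^ 2 - (2 * π * t * ‖ξ‖) ^ 2 / (4 * v ^ 2)) : ℝ) : ℂ)) =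
        (((π * t ^ 2) ^ (-((m : ℝ) / 2)) * (v ^ (m : ℝ) *
          Real.exp (-(nrm t x ^ 2 / t ^ 2) * v ^ (2 : ℝ))) : ℝ) : ℂ) :=
      fun v hv => gaussian_scale ht hv x
    rw [setIntegral_congr_fun measurableSet_Ioi h2, integral_complex_ofReal, integral_const_mul,
      integral_rpow_mul_exp_neg_mul_rpow two_pos
        (by have : (0 : ℝ) ≤ m := by positivity
            linarith) (by have := nrm_pos ht x; positivity),
      ← Complex.ofReal_mul]
    congr 1
    have hn := nrm_pos ht x
    rw [poisson, two_div_sig _ (Nat.succ_pos m)]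
    have e1 : (nrm t x ^ 2 / t ^ 2) ^ (-((m : ℝ) + 1) / 2) = t ^ (m + 1) / nrm t x ^ (m + 1) := by
      rw [← div_pow, ← rpow_natCast (nrm t x / t) 2, ← rpow_mul (by positivity),
        show ((2 : ℕ) : ℝ) * (-((m : ℝ) + 1) / 2) = -((m + 1 : ℕ) : ℝ) by push_cast; ring,
        rpow_neg (by positivity), rpow_natCast, div_pow, inv_div]
    have e2 : (π * t ^ 2) ^ (-((m : ℝ) / 2)) = (π ^ ((m : ℝ) / 2))⁻¹ * (t ^ m)⁻¹ := by
      rw [rpow_neg (by positivity), Real.mul_rpow pi_pos.le (by positivity), mul_inv,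
        ← rpow_natCast t 2, ← rpow_mul ht.le,
        show ((2 : ℕ) : ℝ) * ((m : ℝ) / 2) = m by push_cast; ring, rpow_natCast]
    have e3 : π ^ (((m + 1 : ℕ) : ℝ) / 2) = π ^ ((m : ℝ) / 2) * √π := by
      rw [Real.sqrt_eq_rpow, ← rpow_add pi_pos]; congr 1; push_cast; ring
    rw [e1, e2, e3]
    push_cast
    have : 0 < π ^ ((m : ℝ) / 2) := by positivity
    field_simp
    ring
  · have hmeas : AEStronglyMeasurable (Function.uncurry fun (ξ : Eu m) (v : ℝ) =>
        Complex.exp (((-2 * π * inner ℝ ξ x : ℝ) : ℂ) * Complex.I) *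
          ((Real.exp (-v ^ 2 - (2 * π * t * ‖ξ‖) ^ 2 / (4 * v ^ 2)) : ℝ) : ℂ))
        (volume.prod (volume.restrict (Ioi 0))) := by
      unfold Function.uncurry
      exact Measurable.aestronglyMeasurable (by fun_prop)
    rw [integrable_prod_iff hmeas]
    simp only [Function.uncurry_apply_pair, norm_phase_mul, Complex.norm_real,
      norm_of_nonneg (Real.exp_nonneg _)]
    constructor
    · refine Eventually.of_forall fun ξ => ?_
      exact ((exp_neg_eq_integral (β := 2 * π * t * ‖ξ‖) (by positivity)).1.ofReal).const_mul _
    · have : ∀ ξ : Eu m, ∫ v in Ioi (0 : ℝ),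
          Real.exp (-v ^ 2 - (2 * π * t * ‖ξ‖) ^ 2 / (4 * v ^ 2)) =
          √π / 2 * Real.exp (-(2 * π * t * ‖ξ‖)) := fun ξ =>
        (exp_neg_eq_integral (β := 2 * π * t * ‖ξ‖) (by positivity)).2
      simp_rw [this]
      simpa using (integrable_pow_mul_exp_neg m 0 (c := 2 * π * t) (by positivity)).const_mul (√π / 2)

theorem poisson_nonneg {t : ℝ} (ht : 0 < t) (x : Eu m) : 0 ≤ poisson m t x := by
  have := two_div_sig_succ_pos m
  have := nrm_pos ht x
  unfold poisson; positivity

theorem poisson_neg (t : ℝ) (x : Eu m) : poisson m t (-x) = poisson m t x := by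
  simp [poisson, nrm]

theorem continuous_nrm : Continuous (fun q : ℝ × Eu m => nrm q.1 q.2) := by
  unfold nrm; fun_prop

theorem continuous_poisson {t : ℝ} (ht : 0 < t) : Continuous (poisson m t) := by
  unfold poisson
  have h : Continuous (nrm t : Eu m → ℝ) := by unfold nrm; fun_prop
  refine continuous_const.mul (continuous_const.div (h.pow _) fun x => ?_)
  exact pow_ne_zero _ (nrm_pos ht x).ne'

theorem integrable_poisson {t : ℝ} (ht : 0 < t) : Integrable (poisson m t) := by
  have hint : Integrable (fun x : Eu m => (2 / sig (m + 1) * (t / (min t 1 / 2) ^ (m + 1))) *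
      (1 + ‖x‖) ^ (-((m : ℝ) + 1))) :=
    (integrable_one_add_norm (by simp)).const_mul _
  refine hint.mono' (continuous_poisson ht).aestronglyMeasurable (Eventually.of_forall fun x => ?_)
  rw [norm_of_nonneg (poisson_nonneg ht x)]
  have h0 := two_div_sig_succ_pos m
  have hmin : 0 < min t 1 := lt_min ht one_pos
  have h1 : min t 1 / 2 * (1 + ‖x‖) ≤ nrm t x := by
    refine Real.le_sqrt_of_sq_le ?_
    have hx := norm_nonneg x
    have h2 : min t 1 ≤ t := min_le_left _ _
    have h3 : min t 1 ≤ 1 := min_le_right _ _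
    nlinarith [sq_nonneg (min t 1 * (1 - ‖x‖)), mul_nonneg hmin.le hx, sq_nonneg (min t 1),
      mul_le_mul h2 h2 hmin.le ht.le, mul_le_mul h3 h3 hmin.le zero_le_one,
      mul_nonneg (sub_nonneg.2 (mul_le_mul h3 h3 hmin.le zero_le_one)) (sq_nonneg ‖x‖)]
  have h4 : (1 + ‖x‖) ^ (-((m : ℝ) + 1)) = ((1 + ‖x‖) ^ (m + 1))⁻¹ := by
    rw [rpow_neg (by positivity)]; congr 1; rw [← rpow_natCast]; push_cast; rfl
  rw [poisson, h4, mul_assoc]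
  gcongr
  rw [← div_eq_mul_inv, div_div, ← mul_pow]
  gcongr

theorem fourierInv_poisson {t : ℝ} (ht : 0 < t) :
    𝓕⁻ (fun x : Eu m => (poisson m t x : ℂ)) = damp (fun _ => 1) t := by
  have h : symbolKernel (fun _ : Eu m => (1 : ℂ)) t = fun x => (poisson m t x : ℂ) :=
    funext fun x => poisson_eq_symbolKernel ht x
  rw [← h]
  refine Continuous.fourierInv_fourier_eq ?_ ((IsSymbol.const 1).integrable_damp ht) ?_
  · unfold damp; fun_prop
  · rw [← symbolKernel, h]; exact (integrable_poisson ht).ofReal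

/-- The action of the Poisson semigroup on a kernel with a symbol. -/
theorem IsSymbol.poisson_conv (hp : IsSymbol p) {s t : ℝ} (hs : 0 < s) (ht : 0 < t) (x : Eu m) :
    ∫ y, (poisson m s y : ℂ) * symbolKernel p t (x - y) = symbolKernel p (s + t) x := by
  set g : Eu m → ℂ := fun ξ =>
    Complex.exp (((-2 * π * inner ℝ ξ x : ℝ) : ℂ) * Complex.I) * damp p t ξ with hg
  have hgi : Integrable g := by
    refine (hp.integrable_damp ht).norm.mono' ?_ (Eventually.of_forall fun ξ => ?_)
    · have := hp.measurable
      unfold damp at hg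
      rw [hg]
      exact Measurable.aestronglyMeasurable (by fun_prop)
    · rw [hg]; simp only [norm_phase_mul]; rfl
  have h1 : ∀ y, symbolKernel p t (x - y) = 𝓕⁻ g y := by
    intro y
    rw [symbolKernel_eq, Real.fourierInv_eq']
    refine integral_congr_of_eq fun ξ => ?_
    simp only [hg, smul_eq_mul, ← mul_assoc, ← Complex.exp_add, inner_sub_right]
    congr 2
    push_cast; ring
  have h2 := VectorFourier.integral_fourierIntegral_smul_eq_flip (μ := (volume : Measure (Eu m)))
    (ν := (volume : Measure (Eu m))) (L := -innerₗ (Eu m)) Real.continuous_fourierChar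
    (by exact continuous_inner.neg) (integrable_poisson hs).ofReal hgi (𝕜 := ℝ)
  have h3 : (-innerₗ (Eu m)).flip = -innerₗ (Eu m) := by
    ext a b; simp [real_inner_comm]
  rw [h3] at h2
  have h4 : ∫ ξ, 𝓕⁻ (fun x : Eu m => (poisson m s x : ℂ)) ξ • g ξ =
    ∫ y, (poisson m s y : ℂ) • 𝓕⁻ g y := h2
  simp_rw [h1]
  simp only [smul_eq_mul] at h4
  rw [← h4, fourierInv_poisson hs, symbolKernel_eq]
  refine integral_congr_of_eq fun ξ => ?_
  simp only [hg, damp, one_mul]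
  have : Real.exp (-(2 * π * (s + t) * ‖ξ‖)) =
      Real.exp (-(2 * π * s * ‖ξ‖)) * Real.exp (-(2 * π * t * ‖ξ‖)) := by
    rw [← Real.exp_add]; congr 1; ring
  rw [this]; push_cast; ring

/-- The semigroup property of the Poisson kernel. -/
theorem poisson_conv_poisson {s t : ℝ} (hs : 0 < s) (ht : 0 < t) (x : Eu m) :
    ∫ y, poisson m s y * poisson m t (x - y) = poisson m (s + t) x := by
  have h := (IsSymbol.const (m := m) 1).poisson_conv hs ht x
  simp_rw [poisson_eq_symbolKernel ht, poisson_eq_symbolKernel (add_pos hs ht),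
    ← Complex.ofReal_mul] at h
  rw [integral_complex_ofReal] at h
  exact_mod_cast h

end

section

variable {p : Eu m → ℂ}

theorem hasDerivAt_nrm_time {t : ℝ} (ht : 0 < t) (x : Eu m) :
    HasDerivAt (fun t => nrm t x) (t / nrm t x) t := by
  have hn := nrm_pos ht x
  have h : HasDerivAt (fun t : ℝ => t ^ 2 + ‖x‖ ^ 2) (2 * t) t := by
    simpa using (hasDerivAt_pow 2 t).add_const (‖x‖ ^ 2)
  refine (h.sqrt (by positivity)).congr_deriv ?_
  change 2 * t / (2 * nrm t x) = _
  field_simp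

theorem hasDerivAt_norm_sq_line (x : Eu m) (j : Fin m) :
    HasDerivAt (fun s : ℝ => ‖x + s • unitVec j‖ ^ 2) (2 * x j) 0 := by
  have h2 : HasDerivAt (fun s : ℝ => x + s • unitVec j)
      (unitVec j) 0 := by
    simpa using ((hasDerivAt_id (0 : ℝ)).smul_const (unitVec j)).const_add x
  refine h2.norm_sq.congr_deriv ?_
  simp [EuclideanSpace.inner_single_right]

theorem hasDerivAt_nrm_space {t : ℝ} (ht : 0 < t) (x : Eu m) (j : Fin m) :
    HasDerivAt (fun s : ℝ => nrm t (x + s • unitVec j))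
      (x j / nrm t x) 0 := by
  have hn := nrm_pos ht x
  have h := ((hasDerivAt_norm_sq_line x j).const_add (t ^ 2)).sqrt (by positivity)
  refine h.congr_deriv ?_
  simp only [zero_smul, add_zero]
  change 2 * x j / (2 * nrm t x) = _
  field_simp

theorem hasDerivAt_poisson_space {t : ℝ} (ht : 0 < t) (x : Eu m) (j : Fin m) :
    HasDerivAt (fun s : ℝ => poisson m t (x + s • unitVec j))
      (-(2 / sig (m + 1) * ((m + 1) * t * x j / nrm t x ^ (m + 3)))) 0 := by
  have hn := nrm_pos ht x
  have h := (((hasDerivAt_nrm_space ht x j).pow (m + 1)).inv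
    (pow_ne_zero _ (nrm_pos ht _).ne')).const_mul (2 / sig (m + 1) * t)
  refine (h.congr_deriv ?_).congr_of_eventuallyEq (Eventually.of_forall fun s => ?_)
  · simp only [zero_smul, add_zero, add_tsub_cancel_right, Pi.pow_apply]
    push_cast
    field_simp
    ring
  · simp only [poisson, Pi.inv_apply, Pi.pow_apply]
    ring

theorem hasDerivAt_conjPoisson_time {t : ℝ} (ht : 0 < t) (x : Eu m) (j : Fin m) :
    HasDerivAt (fun t : ℝ => conjPoisson m t x j)
      (2 / sig (m + 1) * ((m + 1) * t * x j / nrm t x ^ (m + 3))) t := by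
  have hn := nrm_pos ht x
  have h := (((hasDerivAt_nrm_time ht x).pow (m + 1)).inv
    (pow_ne_zero _ hn.ne')).const_mul (-(2 / sig (m + 1)) * x j)
  refine (h.congr_deriv ?_).congr_of_eventuallyEq (Eventually.of_forall fun s => ?_)
  · simp only [add_tsub_cancel_right, Pi.pow_apply]
    push_cast
    field_simp
    ring
  · simp only [conjPoisson, Pi.inv_apply, Pi.pow_apply, PiLp.smul_apply, smul_eq_mul]
    ring

theorem le_nrm (t : ℝ) (x : Eu m) : t ≤ nrm t x :=
  Real.le_sqrt_of_sq_le (by nlinarith [sq_nonneg ‖x‖])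

theorem norm_le_nrm (t : ℝ) (x : Eu m) : ‖x‖ ≤ nrm t x :=
  Real.le_sqrt_of_sq_le (by nlinarith [sq_nonneg t])

theorem norm_conjPoisson {t : ℝ} (ht : 0 < t) (x : Eu m) :
    ‖conjPoisson m t x‖ = 2 / sig (m + 1) * (‖x‖ / nrm t x ^ (m + 1)) := by
  have h0 := two_div_sig_succ_pos m
  have hn := nrm_pos ht x
  rw [conjPoisson, norm_smul, neg_div, norm_neg, norm_of_nonneg (by positivity)]
  ring

theorem tendsto_conjPoisson_atTop (hm : 1 ≤ m) (x : Eu m) :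
    Tendsto (fun t : ℝ => conjPoisson m t x) atTop (𝓝 0) := by
  have h0 := two_div_sig_succ_pos m
  refine squeeze_zero_norm' (a := fun t : ℝ => 2 / sig (m + 1) * ‖x‖ * t⁻¹) ?_ ?_
  · filter_upwards [eventually_ge_atTop 1] with t ht
    have ht' : 0 < t := by linarith
    have hn := nrm_pos ht' x
    rw [norm_conjPoisson ht', mul_assoc, div_eq_mul_inv]
    refine mul_le_mul_of_nonneg_left (mul_le_mul_of_nonneg_left (inv_anti₀ ht' ?_)
      (norm_nonneg x)) h0.le
    calc t = t ^ 1 := (pow_one t).symm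
      _ ≤ t ^ (m + 1) := pow_le_pow_right₀ ht (by omega)
      _ ≤ nrm t x ^ (m + 1) := by gcongr; exact le_nrm t x
  · simpa using tendsto_inv_atTop_zero.const_mul (2 / sig (m + 1) * ‖x‖)

/-- The symbol of `∂_t^k P_t`. -/
def symA (k : ℕ) (ξ : Eu m) : ℂ := (-(2 * π * ‖ξ‖ : ℝ)) ^ k

/-- The symbol of the `e_j`-component of `∂_t^k Q_t`. -/
def symB (j : Fin m) (k : ℕ) (ξ : Eu m) : ℂ :=
  (-(2 * π * ‖ξ‖ : ℝ)) ^ k * (-Complex.I * ((ξ j : ℂ) / (‖ξ‖ : ℂ)))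

theorem isSymbol_norm_factor : IsSymbol (fun ξ : Eu m => -((2 * π * ‖ξ‖ : ℝ) : ℂ)) := by
  have := (IsSymbol.const (m := m) (-(2 * π : ℝ))).mul IsSymbol.norm
  convert this using 2
  push_cast; ring

theorem isSymbol_symA (k : ℕ) : IsSymbol (symA k : Eu m → ℂ) := isSymbol_norm_factor.pow k

theorem isSymbol_symB (j : Fin m) (k : ℕ) : IsSymbol (symB j k) :=
  (isSymbol_norm_factor.pow k).mul ((IsSymbol.const _).mul (IsSymbol.direction j))

theorem symA_succ (k : ℕ) :
    (fun ξ : Eu m => -((2 * π * ‖ξ‖ : ℝ) : ℂ) * symA k ξ) = symA (k + 1) := by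
  ext ξ; simp only [symA, pow_succ]; ring

theorem symB_succ (j : Fin m) (k : ℕ) :
    (fun ξ : Eu m => -((2 * π * ‖ξ‖ : ℝ) : ℂ) * symB j k ξ) = symB j (k + 1) := by
  ext ξ; simp only [symB, pow_succ]; ring

theorem norm_mul_coord_div (ξ : Eu m) (j : Fin m) : (‖ξ‖ : ℂ) * ((ξ j : ℂ) / (‖ξ‖ : ℂ)) = ξ j := by
  rcases eq_or_ne ξ 0 with rfl | h
  · simp
  · have : (‖ξ‖ : ℂ) ≠ 0 := by exact_mod_cast norm_ne_zero_iff.2 h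
    field_simp

/-- The symbol of `∂_j ∂_t^k P_t` is the opposite of that of `∂_t^{k+1} Q_t`. -/
theorem symA_space (j : Fin m) (k : ℕ) :
    (fun ξ : Eu m => -((2 * π * ξ j : ℝ) : ℂ) * Complex.I * symA k ξ) =
      fun ξ => -symB j (k + 1) ξ := by
  ext ξ
  have := norm_mul_coord_div ξ j
  simp only [symA, symB, pow_succ]
  push_cast
  linear_combination (-2 * π * Complex.I * (-(2 * π * (‖ξ‖ : ℂ))) ^ k : ℂ) * -this

theorem symB_space_comm (i j : Fin m) (k : ℕ) (ξ : Eu m) :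
    -((2 * π * ξ i : ℝ) : ℂ) * Complex.I * symB j k ξ =
    -((2 * π * ξ j : ℝ) : ℂ) * Complex.I * symB i k ξ := by
  simp only [symB]; push_cast; ring

theorem sum_coord_sq (ξ : Eu m) : ∑ j, (ξ j : ℂ) * (ξ j : ℂ) = (‖ξ‖ : ℂ) * (‖ξ‖ : ℂ) := by
  have : ‖ξ‖ * ‖ξ‖ = ∑ j, ξ j * ξ j := by
    rw [← sq, EuclideanSpace.real_norm_sq_eq]; simp [sq]
  exact_mod_cast this.symm

theorem sum_symB_space (k : ℕ) (ξ : Eu m) :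
    ∑ j, -((2 * π * ξ j : ℝ) : ℂ) * Complex.I * symB j k ξ = symA (k + 1) ξ := by
  have h1 : ∀ j, -((2 * π * ξ j : ℝ) : ℂ) * Complex.I * symB j k ξ =
      -((2 * π : ℝ) : ℂ) * symA k ξ * ((ξ j : ℂ) * (ξ j : ℂ) / (‖ξ‖ : ℂ)) := by
    intro j
    simp only [symA, symB]; push_cast
    linear_combination (2 * π * ξ j * (-(2 * π * (‖ξ‖ : ℂ))) ^ k * ((ξ j : ℂ) / (‖ξ‖ : ℂ)) : ℂ) *
      Complex.I_mul_I
  simp_rw [h1]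
  rw [← Finset.mul_sum, ← Finset.sum_div, sum_coord_sq]
  have h2 : (‖ξ‖ : ℂ) * ‖ξ‖ / ‖ξ‖ = ‖ξ‖ := by
    rcases eq_or_ne (‖ξ‖ : ℂ) 0 with h | h
    · simp [h]
    · field_simp
  rw [h2]
  simp only [symA, pow_succ]; push_cast; ring

theorem conjPoisson_eq_symbolKernel (hm : 1 ≤ m) {t : ℝ} (ht : 0 < t) (x : Eu m) (j : Fin m) :
    symbolKernel (symB j 0) t x = (conjPoisson m t x j : ℂ) := by
  set f : ℝ → ℂ := fun t => symbolKernel (symB j 0) t x - (conjPoisson m t x j : ℂ) with hf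
  have hder : ∀ s : ℝ, 0 < s → HasDerivAt f 0 s := by
    intro s hs
    have h1 := (isSymbol_symB j 0).hasDerivAt_symbolKernel_time hs x
    rw [symB_succ] at h1
    have h2 := (hasDerivAt_conjPoisson_time hs x j).ofReal_comp
    have h3 := (isSymbol_symA (m := m) 0).hasDerivAt_symbolKernel_space hs x j
    rw [symA_space] at h3
    have h4 := (hasDerivAt_poisson_space hs x j).ofReal_comp
    have h5 : (fun s' : ℝ => symbolKernel (symA 0) s (x + s' • unitVec j)) =
        fun s' : ℝ => ((poisson m s (x + s' • unitVec j) : ℝ) : ℂ) := by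
      ext s'
      rw [← poisson_eq_symbolKernel hs]
      congr 1
    rw [h5] at h3
    have h6 := h3.unique h4
    have h7 : symbolKernel (fun ξ => -symB j (0 + 1) ξ) s x = -symbolKernel (symB j (0 + 1)) s x := by
      simp only [symbolKernel_eq, damp, neg_mul, mul_neg, integral_neg]
    rw [h7, Complex.ofReal_neg, neg_inj] at h6
    refine (h1.sub h2).congr_deriv ?_
    rw [h6]; simp
  have hconst : ∀ s : ℝ, 0 < s → f s = f t := by
    intro s hs
    refine isOpen_Ioi.is_const_of_deriv_eq_zero (convex_Ioi (0 : ℝ)).isPreconnected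
      (fun u hu => (hder u hu).differentiableAt.differentiableWithinAt)
      (fun u hu => (hder u hu).deriv) hs ht
  have hlim : Tendsto f atTop (𝓝 0) := by
    have h1 := (isSymbol_symB j 0).tendsto_symbolKernel_atTop hm x
    have h2 : Tendsto (fun t : ℝ => ((conjPoisson m t x j : ℝ) : ℂ)) atTop (𝓝 0) := by
      have h3 : Continuous (fun v : Eu m => ((v j : ℝ) : ℂ)) := by fun_prop
      have h4 := (h3.tendsto 0).comp (tendsto_conjPoisson_atTop hm x)
      simpa [Function.comp_def] using h4
    simpa using h1.sub h2
  have h8 : Tendsto f atTop (𝓝 (f t)) := by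
    refine tendsto_const_nhds.congr' ?_
    filter_upwards [eventually_gt_atTop 0] with s hs
    exact (hconst s hs).symm
  exact sub_eq_zero.1 (tendsto_nhds_unique h8 hlim)

theorem iteratedDeriv_eq_of_chain {V : Type*} [NormedAddCommGroup V] [NormedSpace ℝ V]
    {f : ℝ → V} {H : ℕ → ℝ → V} (h0 : ∀ t, 0 < t → f t = H 0 t)
    (h : ∀ k t, 0 < t → HasDerivAt (H k) (H (k + 1) t) t) (k : ℕ) :
    ∀ t, 0 < t → iteratedDeriv k f t = H k t := by
  induction k with
  | zero => simpa using h0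
  | succ k ih =>
    intro t ht
    rw [iteratedDeriv_succ]
    refine ((h k t ht).congr_of_eventuallyEq ?_).deriv
    filter_upwards [Ioi_mem_nhds ht] with s hs
    exact ih s hs

theorem im_eq_zero_of_chain {G : ℕ → ℝ → ℂ} (h0 : ∀ t, 0 < t → (G 0 t).im = 0)
    (h : ∀ k t, 0 < t → HasDerivAt (G k) (G (k + 1) t) t) (k : ℕ) :
    ∀ t, 0 < t → (G k t).im = 0 := by
  induction k with
  | zero => exact h0
  | succ k ih =>
    intro t ht
    have h1 : HasDerivAt (fun s => (G k s).im) (G (k + 1) t).im t :=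
      (Complex.imCLM.hasFDerivAt.comp_hasDerivAt t (h k t ht))
    refine h1.unique ((hasDerivAt_const t (0 : ℝ)).congr_of_eventuallyEq ?_)
    filter_upwards [Ioi_mem_nhds ht] with s hs
    exact ih s hs

theorem hasDerivAt_symbolKernel_symA {t : ℝ} (ht : 0 < t) (x : Eu m) (k : ℕ) :
    HasDerivAt (fun t => symbolKernel (symA k) t x) (symbolKernel (symA (k + 1)) t x) t := by
  rw [← symA_succ]; exact (isSymbol_symA k).hasDerivAt_symbolKernel_time ht x

theorem hasDerivAt_symbolKernel_symB {t : ℝ} (ht : 0 < t) (x : Eu m) (j : Fin m) (k : ℕ) :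
    HasDerivAt (fun t => symbolKernel (symB j k) t x) (symbolKernel (symB j (k + 1)) t x) t := by
  rw [← symB_succ]; exact (isSymbol_symB j k).hasDerivAt_symbolKernel_time ht x

theorem potA_negSucc_eq (k : ℕ) {t : ℝ} (ht : 0 < t) (x : Eu m) :
    (potA m (Int.negSucc k) t x : ℂ) = symbolKernel (symA k) t x := by
  have h0 : ∀ s : ℝ, 0 < s → symbolKernel (symA 0) s x = (poisson m s x : ℂ) := by
    intro s hs
    rw [← poisson_eq_symbolKernel hs]; congr 1
  have him := im_eq_zero_of_chain (G := fun k s => symbolKernel (symA k) s x)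
    (fun s hs => by simp [h0 s hs]) (fun k s hs => hasDerivAt_symbolKernel_symA hs x k) k t ht
  have hre := iteratedDeriv_eq_of_chain (f := fun s => poisson m s x)
    (H := fun k s => (symbolKernel (symA k) s x).re) (fun s hs => by simp [h0 s hs])
    (fun k s hs => Complex.reCLM.hasFDerivAt.comp_hasDerivAt s
      (hasDerivAt_symbolKernel_symA hs x k)) k t ht
  apply Complex.ext
  · rw [Complex.ofReal_re]; exact hre
  · rw [Complex.ofReal_im]; exact him.symm

theorem potB_negSucc_eq (hm : 1 ≤ m) (k : ℕ) {t : ℝ} (ht : 0 < t) (x : Eu m) (j : Fin m) :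
    (potB m (Int.negSucc k) t x j : ℂ) = symbolKernel (symB j k) t x := by
  have him := im_eq_zero_of_chain (G := fun k s => symbolKernel (symB j k) s x)
    (fun s hs => by simp [conjPoisson_eq_symbolKernel hm hs])
    (fun k s hs => hasDerivAt_symbolKernel_symB hs x j k) k t ht
  have hre := iteratedDeriv_eq_of_chain (f := fun s => conjPoisson m s x)
    (H := fun k s => WithLp.toLp 2 fun i => (symbolKernel (symB i k) s x).re)
    (fun s hs => by ext i; simp [conjPoisson_eq_symbolKernel hm hs])
    (fun k s hs => by
      have h1 : HasDerivAt (fun (s : ℝ) (i : Fin m) => (symbolKernel (symB i k) s x).re)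
          (fun i => (symbolKernel (symB i (k + 1)) s x).re) s := hasDerivAt_pi.2 fun i => ?_
      · exact (PiLp.hasFDerivAt_toLp 2 _).comp_hasDerivAt s h1
      exact Complex.reCLM.hasFDerivAt.comp_hasDerivAt s
        (hasDerivAt_symbolKernel_symB hs x i k)) k t ht
  have hre' := congrArg (fun v : Eu m => v j) hre
  apply Complex.ext
  · rw [Complex.ofReal_re]; exact hre'
  · rw [Complex.ofReal_im]; exact him.symm

end

/-! ### Clifford identities and the chain of potentials -/

theorem e_mul_e_anticomm {n : ℕ} {i j : Fin n} (h : i ≠ j) : e i * e j = -(e j * e i) := by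
  rw [eq_neg_iff_add_eq_zero, e, e, CliffordAlgebra.ι_mul_ι_add_swap]
  have : QuadraticMap.polar (cliffordForm n) (Pi.single i 1) (Pi.single j 1) = 0 := by
    simp only [QuadraticMap.polar, cliffordForm, neg_apply,
      QuadraticMap.weightedSumSquares_apply, one_smul, Pi.add_apply]
    rw [← Finset.sum_neg_distrib, ← Finset.sum_neg_distrib, ← Finset.sum_neg_distrib,
      ← Finset.sum_sub_distrib, ← Finset.sum_sub_distrib]
    refine Finset.sum_eq_zero fun k _ => ?_
    simp only [Pi.single_apply]
    split_ifs with h1 h2 <;> simp_all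
  rw [this, map_zero]

/-- Contraction of anticommuting units with a symmetric matrix. -/
theorem sum_symm_smul_mul {A : Type*} [Ring A] [Algebra ℂ A] {n : ℕ} (u : Fin n → A)
    (hsq : ∀ i, u i * u i = -1) (hanti : ∀ i j, i ≠ j → u i * u j = -(u j * u i))
    (M : Fin n → Fin n → ℂ) (hM : ∀ i j, M i j = M j i) :
    ∑ i, ∑ j, M i j • (u i * u j) = -((∑ i, M i i) • (1 : A)) := by
  have h1 : ∀ i j, M i j • (u i * u j) + M j i • (u j * u i) =
      if i = j then -((2 * M i i) • (1 : A)) else 0 := by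
    intro i j
    split_ifs with h
    · subst h; rw [hsq, ← two_smul ℂ, smul_smul, smul_neg]
    · rw [hanti i j h, hM i j, smul_neg, neg_add_cancel]
  have h2 : ∑ i, ∑ j, (M i j • (u i * u j) + M j i • (u j * u i)) =
      -((2 * ∑ i, M i i) • (1 : A)) := by
    simp_rw [h1]
    simp [Finset.sum_neg_distrib, Finset.mul_sum, Finset.sum_smul]
  have h3 : ∑ i, ∑ j, M j i • (u j * u i) = ∑ i, ∑ j, M i j • (u i * u j) := Finset.sum_comm
  simp_rw [Finset.sum_add_distrib] at h2
  rw [h3, ← two_smul ℂ, mul_smul, ← smul_neg] at h2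
  exact smul_right_injective A (two_ne_zero (α := ℂ)) h2

theorem sum_sum_e_mul_e {n : ℕ} (M : Fin n → Fin n → ℂ) (hM : ∀ i j, M i j = M j i) :
    ∑ i, ∑ j, M i j • (e i * e j : Cl n) = -sc (∑ i, M i i) := by
  rw [sum_symm_smul_mul e e_mul_self (fun i j h => e_mul_e_anticomm h) M hM, sc,
    Algebra.algebraMap_eq_smul_one]

/-- The paravector `½ a + ½ ē_0 ∑ b_j e_j`. -/
def paravector (a : ℂ) (b : Fin m → ℂ) : Cl (m + 1) :=
  (1 / 2 : ℂ) • sc a + (1 / 2 : ℂ) • (e0bar m * ∑ j : Fin m, b j • e j.succ)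

theorem potC_eq_paravector (k : ℤ) (t : ℝ) (x : Eu m) :
    potC m k t x = paravector (potA m k t x : ℂ) (fun j => (potB m k t x j : ℂ)) := rfl

theorem apply_paravector (ℓ : Cl (m + 1) →ₗ[ℂ] ℂ) (a : ℂ) (b : Fin m → ℂ) :
    ℓ (paravector a b) = (1 / 2) * (a * ℓ 1) + (1 / 2) * ∑ j, b j * ℓ (e0bar m * e j.succ) := by
  simp only [paravector, sc, Algebra.algebraMap_eq_smul_one, map_add, map_smul, smul_eq_mul,
    Finset.mul_sum, mul_smul_comm, map_sum]

theorem e0bar_mul_self (m : ℕ) : e0bar m * e0bar m = -1 := by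
  rw [e0bar, neg_mul_neg, e_mul_self]

theorem e_succ_mul_e0bar (j : Fin m) : (e j.succ : Cl (m + 1)) * e0bar m = -(e0bar m * e j.succ) := by
  rw [e0bar, mul_neg, neg_mul, neg_neg, e_mul_e_anticomm (Fin.succ_ne_zero j), neg_neg]

theorem potC_neg_one (t : ℝ) (x : Eu m) : potC m (-1) t x = cauchyKernel m t x := by
  have hA : potA m (-1) t x = poisson m t x := by
    change iteratedDeriv 0 (fun t => poisson m t x) t = _
    simp
  have hB : potB m (-1) t x = conjPoisson m t x := by
    change iteratedDeriv 0 (fun t => conjPoisson m t x) t = _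
    simp
  have hv : vecSucc (conjPoisson m t x) =
      ((-(2 / sig (m + 1)) / nrm t x ^ (m + 1) : ℝ) : ℂ) • vecSucc x := by
    simp only [vecSucc, conjPoisson, PiLp.smul_apply, smul_eq_mul, Finset.smul_sum, smul_smul,
      Complex.ofReal_mul]
  have h0 : (e 0 : Cl (m + 1)) * e0bar m = 1 := by rw [e0bar, mul_neg, e_mul_self, neg_neg]
  have hx : vecSucc x * e0bar m = -(e0bar m * vecSucc x) := by
    simp only [vecSucc, Finset.sum_mul, Finset.mul_sum, smul_mul_assoc, mul_smul_comm,
      e_succ_mul_e0bar, smul_neg, Finset.sum_neg_distrib]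
  rw [potC, hA, hB, hv, cauchyKernel, add_mul, smul_mul_assoc, h0, hx, sc,
    Algebra.algebraMap_eq_smul_one, poisson]
  simp only [mul_smul_comm, smul_add, smul_smul, smul_neg, ← neg_smul]
  congr 2 <;> · push_cast; ring

theorem dbar_paravector (B' : Fin m → ℂ) (M : Fin m → Fin m → ℂ) (hM : ∀ i j, M i j = M j i) :
    paravector (∑ j, M j j) B' = (1 / 2 : ℂ) • (paravector (∑ j, M j j) B' -
      e0bar m * ∑ j : Fin m, e j.succ * paravector (-B' j) (M j)) := by
  have hMs := sum_symm_smul_mul (fun j : Fin m => (e j.succ : Cl (m + 1)))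
    (fun j => e_mul_self _)
    (fun i j h => e_mul_e_anticomm (fun h' => h (Fin.succ_injective _ h'))) M hM
  have h1 : ∑ j : Fin m, e j.succ * paravector (-B' j) (M j) =
      -((1 / 2 : ℂ) • ∑ j : Fin m, B' j • e j.succ) +
        (1 / 2 : ℂ) • (e0bar m * ((∑ j, M j j) • 1)) := by
    have h2 : ∀ j : Fin m, (e j.succ : Cl (m + 1)) * paravector (-B' j) (M j) =
        -((1 / 2 : ℂ) • B' j • e j.succ) -
          (1 / 2 : ℂ) • (e0bar m * ∑ i : Fin m, M j i • (e j.succ * e i.succ)) := by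
      intro j
      rw [paravector, mul_add, mul_smul_comm, mul_smul_comm, ← mul_assoc, e_succ_mul_e0bar, sc,
        Algebra.algebraMap_eq_smul_one, mul_smul_comm, mul_one, neg_smul, smul_neg, neg_mul,
        smul_neg, sub_eq_add_neg, mul_assoc, Finset.mul_sum]
      simp only [mul_smul_comm]
    simp_rw [h2]
    rw [Finset.sum_sub_distrib, Finset.sum_neg_distrib, ← Finset.smul_sum, ← Finset.smul_sum,
      ← Finset.mul_sum, hMs, mul_neg, smul_neg, sub_neg_eq_add]
  rw [h1, mul_add, mul_neg, mul_smul_comm, mul_smul_comm, ← mul_assoc, e0bar_mul_self, neg_one_mul,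
    paravector, sc, Algebra.algebraMap_eq_smul_one, smul_neg]
  module

theorem isDbar_potC (hm : 1 ≤ m) (k : ℕ) (hk : 1 ≤ k) :
    IsDbar (potC m (-k)) (potC m (-k - 1)) := by
  obtain ⟨k, rfl⟩ := Nat.exists_eq_add_of_le' hk
  have e1 : (-((k + 1 : ℕ) : ℤ)) = Int.negSucc k := rfl
  have e2 : Int.negSucc k - 1 = Int.negSucc (k + 1) := rfl
  rw [e1, e2]
  intro t ht x
  set M : Fin m → Fin m → ℂ := fun j i =>
    symbolKernel (fun ξ => -((2 * π * ξ j : ℝ) : ℂ) * Complex.I * symB i k ξ) t x with hMdef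
  have hM : ∀ i j, M i j = M j i := by
    intro i j
    simp only [hMdef]
    congr 1; ext ξ; exact symB_space_comm i j k ξ
  have htr : ∑ j, M j j = (potA m (Int.negSucc (k + 1)) t x : ℂ) := by
    rw [potA_negSucc_eq (k + 1) ht x]
    simp only [hMdef, symbolKernel_eq]
    rw [← integral_finsetSum]
    · refine integral_congr_of_eq fun ξ => ?_
      simp only [damp, ← sum_symB_space k ξ, Finset.sum_mul, Finset.mul_sum]
    · intro j _
      have hs : IsSymbol (fun ξ : Eu m => -((2 * π * ξ j : ℝ) : ℂ) * Complex.I * symB j k ξ) := by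
        have := (((IsSymbol.const (m := m) (-(2 * π : ℝ))).mul (IsSymbol.coord j)).mul
          (IsSymbol.const Complex.I)).mul (isSymbol_symB j k)
        convert this using 2
        push_cast; ring
      refine (hs.integrable_damp ht).norm.mono' ?_ (Eventually.of_forall fun ξ => ?_)
      · have := hs.measurable
        unfold damp
        exact Measurable.aestronglyMeasurable (by fun_prop)
      · rw [norm_phase_mul]
  refine ⟨paravector (potA m (Int.negSucc (k + 1)) t x : ℂ)
      (fun j => (potB m (Int.negSucc (k + 1)) t x j : ℂ)),
    fun j => paravector (-(potB m (Int.negSucc (k + 1)) t x j : ℂ)) (M j), ?_, ?_, ?_⟩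
  · intro ℓ
    have hd : HasDerivAt (fun s : ℝ => (1 / 2 : ℂ) * (symbolKernel (symA k) s x * ℓ 1) +
        (1 / 2 : ℂ) * ∑ j, symbolKernel (symB j k) s x * ℓ (e0bar m * e j.succ))
        ((1 / 2 : ℂ) * (symbolKernel (symA (k + 1)) t x * ℓ 1) +
        (1 / 2 : ℂ) * ∑ j, symbolKernel (symB j (k + 1)) t x * ℓ (e0bar m * e j.succ)) t :=
      (((hasDerivAt_symbolKernel_symA ht x k).mul_const _).const_mul _).add
        ((HasDerivAt.fun_sum fun j _ =>
          (hasDerivAt_symbolKernel_symB ht x j k).mul_const _).const_mul _)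
    rw [apply_paravector]
    simp only [potA_negSucc_eq _ ht, potB_negSucc_eq hm _ ht]
    refine hd.congr_of_eventuallyEq ?_
    filter_upwards [Ioi_mem_nhds ht] with s hs
    simp only [potC_eq_paravector, apply_paravector, potA_negSucc_eq _ hs, potB_negSucc_eq hm _ hs]
  · intro j ℓ
    simp only [potC_eq_paravector, apply_paravector, potA_negSucc_eq _ ht, potB_negSucc_eq hm _ ht]
    have hA := (isSymbol_symA (m := m) k).hasDerivAt_symbolKernel_space ht x j
    rw [symA_space] at hA
    have hneg : symbolKernel (fun ξ => -symB j (k + 1) ξ) t x = -symbolKernel (symB j (k + 1)) t x := by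
      simp only [symbolKernel_eq, damp, neg_mul, mul_neg, integral_neg]
    rw [hneg] at hA
    exact ((hA.mul_const _).const_mul _).add
        ((HasDerivAt.fun_sum fun i _ =>
          ((isSymbol_symB i k).hasDerivAt_symbolKernel_space ht x j).mul_const _).const_mul _)
  · rw [potC_eq_paravector, ← htr]
    exact dbar_paravector _ M hM

/-! ### Iterated integrals along the vertical direction -/

theorem integrable_rpow_smul_add {V : Type*} [NormedAddCommGroup V] [NormedSpace ℝ V] [CompleteSpace V]
    {a : ℝ} (ha : -1 < a) {F : ℝ → V} (hF : StronglyMeasurable F)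
    (hint : IntegrableOn (fun w => w ^ (a + 1) • F w) (Ioi 0)) :
    Integrable (fun q : ℝ × ℝ => q.1 ^ a • F (q.1 + q.2))
      ((volume.restrict (Ioi 0)).prod (volume.restrict (Ioi 0))) ∧
    ∫ q : ℝ × ℝ, q.1 ^ a • F (q.1 + q.2)
      ∂((volume.restrict (Ioi 0)).prod (volume.restrict (Ioi 0))) =
      (a + 1)⁻¹ • ∫ w in Ioi (0 : ℝ), w ^ (a + 1) • F w := by
  set K : ℝ × ℝ → V := fun q => (Ioo 0 q.2).indicator (fun v => v ^ a) q.1 • F q.2 with hK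
  have hset : MeasurableSet {q : ℝ × ℝ | 0 < q.1 ∧ q.1 < q.2} :=
    (measurableSet_lt measurable_const measurable_fst).inter
      (measurableSet_lt measurable_fst measurable_snd)
  have hKm : AEStronglyMeasurable K (volume.prod volume) := by
    refine (StronglyMeasurable.smul ?_ (hF.comp_measurable measurable_snd)).aestronglyMeasurable
    have : (fun q : ℝ × ℝ => (Ioo 0 q.2).indicator (fun v => v ^ a) q.1) =
        {q : ℝ × ℝ | 0 < q.1 ∧ q.1 < q.2}.indicator (fun q => q.1 ^ a) := by
      ext q; simp [indicator, mem_Ioo]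
    rw [this]
    refine (Measurable.indicator ?_ hset).stronglyMeasurable
    fun_prop
  have hin : ∀ w : ℝ, 0 < w → ∫ v, (Ioo 0 w).indicator (fun v => v ^ a) v = w ^ (a + 1) / (a + 1) := by
    intro w hw
    rw [integral_indicator measurableSet_Ioo, ← integral_Ioc_eq_integral_Ioo,
      ← intervalIntegral.integral_of_le hw.le, integral_rpow (Or.inl ha),
      Real.zero_rpow (by linarith), sub_zero]
  have hin0 : ∀ w : ℝ, w ≤ 0 → (Ioo 0 w).indicator (fun v : ℝ => v ^ a) = 0 := by
    intro w hw; rw [Ioo_eq_empty (not_lt.2 hw), indicator_empty]; rfl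
  have hii : ∀ w : ℝ, Integrable ((Ioo 0 w).indicator (fun v : ℝ => v ^ a)) := by
    intro w
    rcases le_or_gt w 0 with hw | hw
    · rw [hin0 w hw]; exact integrable_zero _ _ _
    · rw [integrable_indicator_iff measurableSet_Ioo]
      exact (intervalIntegral.integrableOn_Ioo_rpow_iff hw).2 ha
  have hnn : ∀ w v : ℝ, 0 ≤ (Ioo 0 w).indicator (fun v : ℝ => v ^ a) v := fun w v =>
    indicator_nonneg (fun v hv => rpow_nonneg hv.1.le _) v
  have hKv : ∀ w, ∫ v, K (v, w) = (Ioi (0 : ℝ)).indicator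
      (fun w => (a + 1)⁻¹ • (w ^ (a + 1) • F w)) w := by
    intro w
    simp only [hK]
    rw [integral_smul_const]
    rcases le_or_gt w 0 with hw | hw
    · rw [hin0 w hw, indicator_of_notMem (by simpa using hw)]; simp
    · rw [hin w hw, indicator_of_mem (mem_Ioi.2 hw), smul_smul]; congr 1; ring
  have hKn : ∀ w, ∫ v, ‖K (v, w)‖ = (Ioi (0 : ℝ)).indicator
      (fun w => (a + 1)⁻¹ * ‖w ^ (a + 1) • F w‖) w := by
    intro w
    simp only [hK, norm_smul, norm_of_nonneg (hnn _ _)]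
    rw [integral_mul_const]
    rcases le_or_gt w 0 with hw | hw
    · rw [hin0 w hw, indicator_of_notMem (by simpa using hw)]; simp
    · rw [hin w hw, indicator_of_mem (mem_Ioi.2 hw),
        norm_of_nonneg (rpow_nonneg hw.le _)]; ring
  have hKi : Integrable K (volume.prod volume) := by
    rw [integrable_prod_iff' hKm]
    refine ⟨Eventually.of_forall fun w => (hii w).smul_const (F w), ?_⟩
    simp_rw [hKn]
    rw [integrable_indicator_iff measurableSet_Ioi]
    exact hint.norm.const_mul _
  have hmp := measurePreserving_prod_add (volume : Measure ℝ) (volume : Measure ℝ)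
  have hcomp : (fun q : ℝ × ℝ => K (q.1, q.1 + q.2)) =
      (Ioi (0 : ℝ) ×ˢ Ioi (0 : ℝ)).indicator (fun q => q.1 ^ a • F (q.1 + q.2)) := by
    ext q
    simp only [hK, indicator, mem_Ioo, mem_prod, mem_Ioi]
    by_cases h1 : 0 < q.1 <;> by_cases h2 : 0 < q.2 <;> simp [h1, h2]
  rw [Measure.prod_restrict]
  have hset2 : MeasurableSet (Ioi (0 : ℝ) ×ˢ Ioi (0 : ℝ)) := measurableSet_Ioi.prod measurableSet_Ioi
  constructor
  · rw [← IntegrableOn, ← integrable_indicator_iff hset2, ← hcomp]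
    exact hmp.integrable_comp_of_integrable hKi
  · rw [← integral_indicator hset2, ← hcomp]
    have hemb : MeasurableEmbedding (fun z : ℝ × ℝ => (z.1, z.1 + z.2)) :=
      (MeasurableEquiv.shearAddRight ℝ).measurableEmbedding
    rw [hmp.integral_comp hemb K, integral_prod_symm _ hKi]
    simp_rw [hKv]
    rw [integral_indicator measurableSet_Ioi, integral_smul]

theorem nrm_mono {s t : ℝ} (hs : 0 ≤ s) (hst : s ≤ t) (x : Eu m) : nrm s x ≤ nrm t x := by
  unfold nrm; gcongr

theorem nrm_zero (x : Eu m) : nrm 0 x = ‖x‖ := by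
  simp [nrm, Real.sqrt_sq]

theorem nrm_neg (t : ℝ) (x : Eu m) : nrm t (-x) = nrm t x := by simp [nrm]

theorem self_le_nrm (t : ℝ) (x : Eu m) : t ≤ nrm t x := le_nrm t x

theorem nrm_triangle (t : ℝ) (x y : Eu m) : nrm t x ≤ nrm t y + ‖x - y‖ := by
  have h1 : ‖x‖ ≤ ‖y‖ + ‖x - y‖ := by
    have := norm_add_le y (x - y); rwa [add_sub_cancel] at this
  have h2 := norm_le_nrm t y
  have h3 : 0 ≤ nrm t y := Real.sqrt_nonneg _
  refine Real.sqrt_le_iff.2 ⟨by positivity, ?_⟩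
  nlinarith [nrm_sq t y, norm_nonneg x, norm_nonneg y, norm_nonneg (x - y),
    mul_le_mul h1 h1 (norm_nonneg x) (by positivity),
    mul_le_mul_of_nonneg_right h2 (norm_nonneg (x - y))]

theorem measurable_nrm_time (x : Eu m) : Measurable (fun w : ℝ => nrm w x) := by
  unfold nrm; fun_prop

theorem integrableOn_rpow_mul_nrm {b : ℝ} {c : ℕ} (hb : -1 < b) (hbc : b - c < -1) {t : ℝ}
    (ht : 0 ≤ t) {x : Eu m} (h0 : 0 < nrm t x) :
    IntegrableOn (fun w : ℝ => w ^ b * (nrm (t + w) x ^ c)⁻¹) (Ioi 0) := by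
  have hmeas : Measurable (fun w : ℝ => w ^ b * (nrm (t + w) x ^ c)⁻¹) := by
    have := (measurable_nrm_time x).comp (measurable_const_add t)
    simp only [Function.comp_def] at this
    fun_prop
  rw [← Ioc_union_Ioi_eq_Ioi (zero_le_one (α := ℝ))]
  refine IntegrableOn.union ?_ ?_
  · have h1 : IntegrableOn (fun w : ℝ => w ^ b * (nrm t x ^ c)⁻¹) (Ioc 0 1) := by
      rw [integrableOn_Ioc_iff_integrableOn_Ioo]
      exact ((intervalIntegral.integrableOn_Ioo_rpow_iff one_pos).2 hb).mul_const _
    refine h1.mono' hmeas.aestronglyMeasurable ?_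
    filter_upwards [ae_restrict_mem measurableSet_Ioc] with w hw
    have hn : nrm t x ≤ nrm (t + w) x := nrm_mono ht (by linarith [hw.1]) x
    have hw0 := hw.1.le
    have hn0 : 0 < nrm (t + w) x := h0.trans_le hn
    rw [norm_of_nonneg (by positivity)]
    gcongr
  · refine (integrableOn_Ioi_rpow_of_lt hbc one_pos).mono' hmeas.aestronglyMeasurable ?_
    filter_upwards [ae_restrict_mem measurableSet_Ioi] with w hw
    have hw0 : 0 < w := lt_trans one_pos hw
    have hn : w ≤ nrm (t + w) x := by
      have := self_le_nrm (t + w) x; linarith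
    have hn0 : 0 < nrm (t + w) x := hw0.trans_le hn
    rw [norm_of_nonneg (by positivity), rpow_sub hw0, rpow_natCast, div_eq_mul_inv]
    gcongr

theorem poisson_le {t : ℝ} {x : Eu m} (h0 : 0 < nrm t x) :
    poisson m t x ≤ 2 / sig (m + 1) * (nrm t x ^ m)⁻¹ := by
  have h := two_div_sig_succ_pos m
  rw [poisson]
  gcongr
  rw [div_le_iff₀ (by positivity), pow_succ, ← mul_assoc, inv_mul_cancel₀ (by positivity), one_mul]
  exact self_le_nrm t x

theorem nrm_add_pos {t : ℝ} (ht : 0 ≤ t) {x : Eu m} (h0 : 0 < nrm t x) {w : ℝ} (hw : 0 < w) :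
    0 < nrm (t + w) x := h0.trans_le (nrm_mono ht (by linarith) x)

theorem measurable_poisson_add (t : ℝ) (x : Eu m) : Measurable (fun w => poisson m (t + w) x) := by
  unfold poisson nrm; fun_prop

theorem measurable_conjPoisson_add (t : ℝ) (x : Eu m) :
    Measurable (fun w => conjPoisson m (t + w) x) := by
  unfold conjPoisson nrm; fun_prop

theorem integrableOn_rpow_smul_poisson {b : ℝ} (hb : -1 < b) (hbm : b + 1 < m) {t : ℝ}
    (ht : 0 ≤ t) {x : Eu m} (h0 : 0 < nrm t x) :
    IntegrableOn (fun w : ℝ => w ^ b • poisson m (t + w) x) (Ioi 0) := by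
  refine ((integrableOn_rpow_mul_nrm (c := m) hb (by linarith) ht h0).const_mul
    (2 / sig (m + 1))).mono' ?_ ?_
  · have := measurable_poisson_add (m := m) t x
    exact Measurable.aestronglyMeasurable (by fun_prop)
  · filter_upwards [ae_restrict_mem measurableSet_Ioi] with w hw
    have hw0 : 0 < w := hw
    rw [norm_smul, norm_of_nonneg (by positivity),
      norm_of_nonneg (poisson_nonneg (by linarith) x)]
    have := poisson_le (nrm_add_pos ht h0 hw0)
    have h2 : 0 ≤ w ^ b := by positivity
    nlinarith

theorem integrableOn_rpow_smul_conjPoisson {b : ℝ} (hb : -1 < b) (hbm : b < m) {t : ℝ}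
    (ht : 0 ≤ t) {x : Eu m} (h0 : 0 < nrm t x) :
    IntegrableOn (fun w : ℝ => w ^ b • conjPoisson m (t + w) x) (Ioi 0) := by
  refine ((integrableOn_rpow_mul_nrm (c := m + 1) hb (by push_cast; linarith) ht h0).const_mul
    (2 / sig (m + 1) * ‖x‖)).mono' ?_ ?_
  · have := measurable_conjPoisson_add (m := m) t x
    exact Measurable.aestronglyMeasurable (by fun_prop)
  · filter_upwards [ae_restrict_mem measurableSet_Ioi] with w hw
    have hw0 : 0 < w := hw
    rw [norm_smul, norm_of_nonneg (by positivity), norm_conjPoisson (by linarith)]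
    apply le_of_eq
    ring

/-- The closed form of the upstream potential `A_k`. -/
def upInt {V : Type*} [NormedAddCommGroup V] [NormedSpace ℝ V] (F : ℝ → V) (k : ℕ) (t : ℝ) : V :=
  ((-1 : ℝ) ^ (k + 1) / (k.factorial : ℝ)) • ∫ w in Ioi (0 : ℝ), w ^ (k : ℝ) • F (t + w)

theorem hasDerivAt_A0 (hm : 2 ≤ m) {t : ℝ} (ht : 0 < t) (x : Eu m) :
    HasDerivAt (fun t => A0 m t x) (poisson m t x) t := by
  obtain ⟨m, rfl⟩ := Nat.exists_eq_add_of_le' hm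
  have hn := nrm_pos ht x
  have h := (((hasDerivAt_nrm_time ht x).pow (m + 2 - 1)).inv
    (pow_ne_zero _ hn.ne')).const_mul (-(2 / (((m + 2 : ℕ) : ℝ) - 1)) * (1 / sig (m + 2 + 1)))
  refine (h.congr_deriv ?_).congr_of_eventuallyEq (Eventually.of_forall fun s => ?_)
  · have e1 : m + 2 - 1 = m + 1 := rfl
    have h1 : (m : ℝ) + 2 - 1 ≠ 0 := by
      have : (0 : ℝ) ≤ m := by positivity
      linarith
    simp only [e1, add_tsub_cancel_right, Pi.pow_apply, poisson]
    push_cast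
    have h2 : (m : ℝ) + 1 ≠ 0 := by positivity
    have h3 : (m : ℝ) + 2 - 1 = m + 1 := by ring
    have hs : sig (m + 2 + 1) ≠ 0 := by
      have h := two_div_sig_succ_pos (m + 2)
      intro h0; rw [h0] at h; simp at h
    rw [h3]
    field_simp
    ring
  · simp only [A0, Pi.inv_apply, Pi.pow_apply, one_div]

theorem A0_eq_integral (hm : 2 ≤ m) {t : ℝ} (ht : 0 ≤ t) {x : Eu m} (h0 : 0 < nrm t x) :
    A0 m t x = -∫ w in Ioi (0 : ℝ), poisson m (t + w) x := by
  have hint : IntegrableOn (fun w : ℝ => poisson m (t + w) x) (Ioi 0) := by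
    have := integrableOn_rpow_smul_poisson (b := 0) (by norm_num)
      (by have : (2 : ℝ) ≤ m := by exact_mod_cast hm
          linarith) ht h0
    simpa using this
  have hcont : ContinuousWithinAt (fun w : ℝ => A0 m (t + w) x) (Ici 0) 0 := by
    have h1 : ContinuousAt (fun w : ℝ => nrm (t + w) x) 0 := by unfold nrm; fun_prop
    refine ContinuousAt.continuousWithinAt ?_
    unfold A0
    refine continuousAt_const.mul (continuousAt_const.div (h1.pow _) ?_)
    simp only [add_zero]; positivity
  have hlim : Tendsto (fun w : ℝ => A0 m (t + w) x) atTop (𝓝 0) := by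
    have h1 : Tendsto (fun w : ℝ => nrm (t + w) x) atTop atTop := by
      refine tendsto_atTop_mono (fun w => ?_) tendsto_id
      have := self_le_nrm (t + w) x
      simp only [id]; linarith
    have h2 : Tendsto (fun w : ℝ => nrm (t + w) x ^ (m - 1)) atTop atTop :=
      (tendsto_pow_atTop (by omega)).comp h1
    have h3 := (tendsto_inv_atTop_zero.comp h2).const_mul
      (-(2 / ((m : ℝ) - 1)) * (1 / sig (m + 1)))
    simpa [A0, Function.comp_def] using h3
  have hder : ∀ w ∈ Ioi (0 : ℝ), HasDerivAt (fun w : ℝ => A0 m (t + w) x) (poisson m (t + w) x) w := by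
    intro w hw
    have hw' : 0 < w := hw
    exact (hasDerivAt_A0 hm (by linarith : 0 < t + w) x).comp_const_add t w
  have h := integral_Ioi_of_hasDerivAt_of_tendsto hcont hder hint hlim
  simp only [add_zero, zero_sub] at h
  rw [h, neg_neg]

theorem a0_eq_A0 (y : Eu m) : a0 m y = A0 m 0 y := by simp [a0, A0, nrm_zero]

theorem a0_eq_integral (hm : 2 ≤ m) {y : Eu m} (hy : y ≠ 0) :
    a0 m y = -∫ s in Ioi (0 : ℝ), poisson m s y := by
  rw [a0_eq_A0, A0_eq_integral hm le_rfl (by rw [nrm_zero]; exact norm_pos_iff.2 hy)]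
  simp

theorem hasDerivAt_B0 (hm : 1 ≤ m) {t : ℝ} (ht : 0 < t) (x : Eu m) :
    HasDerivAt (fun t => B0 m t x) (conjPoisson m t x) t := by
  have hn := nrm_pos ht x
  rcases eq_or_ne x 0 with rfl | hx
  · simp only [B0, smul_zero, conjPoisson]
    exact hasDerivAt_const _ _
  have hr : 0 < ‖x‖ := norm_pos_iff.2 hx
  have hc : Continuous (fun η : ℝ => η ^ (m - 1) / (1 + η ^ 2) ^ (((m : ℝ) + 1) / 2)) := by
    refine (continuous_pow _).div ?_ fun η => by positivity
    exact (by fun_prop : Continuous fun η : ℝ => 1 + η ^ 2).rpow_const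
      fun η => Or.inl (by positivity)
  have h1 : HasDerivAt (Fm m) ((‖x‖ / t) ^ (m - 1) / (1 + (‖x‖ / t) ^ 2) ^ (((m : ℝ) + 1) / 2))
      (‖x‖ / t) := intervalIntegral.integral_hasDerivAt_right (hc.intervalIntegrable _ _)
        (hc.stronglyMeasurableAtFilter _ _) hc.continuousAt
  have h2 : HasDerivAt (fun t : ℝ => ‖x‖ / t) (-(‖x‖ / t ^ 2)) t := by
    have := (hasDerivAt_inv ht.ne').const_mul ‖x‖
    refine (this.congr_deriv (by field_simp)).congr_of_eventuallyEq
      (Eventually.of_forall fun s => by simp [div_eq_mul_inv])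
  have h3 := ((h1.comp t h2).const_mul (2 / sig (m + 1) / ‖x‖ ^ m)).smul_const x
  refine h3.congr_deriv ?_
  rw [conjPoisson]
  congr 1
  have e1 : 1 + (‖x‖ / t) ^ 2 = (nrm t x / t) ^ 2 := by
    rw [div_pow, div_pow, nrm_sq]; field_simp
  have e2 : ((nrm t x / t) ^ 2) ^ (((m : ℝ) + 1) / 2) = (nrm t x / t) ^ (m + 1) := by
    rw [← rpow_natCast (nrm t x / t) 2, ← rpow_mul (by positivity),
      ← rpow_natCast]
    congr 1; push_cast; ring
  rw [e1, e2]
  obtain ⟨m, rfl⟩ := Nat.exists_eq_add_of_le' hm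
  simp only [add_tsub_cancel_right, div_pow]
  field_simp
  ring

theorem B0_eq_integral (hm : 1 ≤ m) {t : ℝ} (ht : 0 < t) (x : Eu m) :
    B0 m t x = -∫ w in Ioi (0 : ℝ), conjPoisson m (t + w) x := by
  have hint : IntegrableOn (fun w : ℝ => conjPoisson m (t + w) x) (Ioi 0) := by
    have := integrableOn_rpow_smul_conjPoisson (b := 0) (by norm_num)
      (by exact_mod_cast hm) ht.le (nrm_pos ht x)
    simpa using this
  have hder : ∀ w ∈ Ici (0 : ℝ),
      HasDerivAt (fun w : ℝ => B0 m (t + w) x) (conjPoisson m (t + w) x) w := by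
    intro w hw
    have hw' : 0 ≤ w := hw
    exact (hasDerivAt_B0 hm (by linarith : 0 < t + w) x).comp_const_add t w
  have hlim : Tendsto (fun w : ℝ => B0 m (t + w) x) atTop (𝓝 0) := by
    have hc : Continuous (fun η : ℝ => η ^ (m - 1) / (1 + η ^ 2) ^ (((m : ℝ) + 1) / 2)) := by
      refine (continuous_pow _).div ?_ fun η => by positivity
      exact (by fun_prop : Continuous fun η : ℝ => 1 + η ^ 2).rpow_const
        fun η => Or.inl (by positivity)
    have h1 : Continuous (Fm m) := intervalIntegral.continuous_primitive
      (fun a b => hc.intervalIntegrable a b) 0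
    have h2 : Tendsto (fun w : ℝ => ‖x‖ / (t + w)) atTop (𝓝 0) :=
      (tendsto_const_nhds (x := ‖x‖)).div_atTop (tendsto_atTop_add_const_left _ t tendsto_id)
    have h3 := (h1.tendsto 0).comp h2
    have h4 : Fm m 0 = 0 := intervalIntegral.integral_same
    rw [h4] at h3
    have h5 := (h3.const_mul (2 / sig (m + 1) / ‖x‖ ^ m)).smul_const x
    simpa [B0, Function.comp_def] using h5
  have h := integral_Ioi_of_hasDerivAt_of_tendsto' hder hint hlim
  simp only [add_zero, zero_sub] at h
  rw [h, neg_neg]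

section

variable {V : Type*} [NormedAddCommGroup V] [NormedSpace ℝ V] [CompleteSpace V]

/-! ### Convolution with `a_0` -/

theorem measurable_poisson_uncurry : Measurable (fun q : ℝ × Eu m => poisson m q.1 q.2) := by
  unfold poisson nrm; fun_prop

theorem measurable_conjPoisson_uncurry : Measurable (fun q : ℝ × Eu m => conjPoisson m q.1 q.2) := by
  unfold conjPoisson nrm; fun_prop

theorem integrable_poisson_mul_poisson {s t : ℝ} (hs : 0 < s) (ht : 0 < t) (x : Eu m) :
    Integrable (fun y => poisson m s y * poisson m t (x - y)) := by
  have hc : Continuous fun y : Eu m => poisson m t (x - y) :=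
    (continuous_poisson ht).comp (by fun_prop)
  refine (integrable_poisson hs).mul_bdd (c := 2 / sig (m + 1) * (t ^ m)⁻¹) hc.aestronglyMeasurable
    (Eventually.of_forall fun y => ?_)
  rw [norm_of_nonneg (poisson_nonneg ht _)]
  refine (poisson_le (nrm_pos ht _)).trans ?_
  have := two_div_sig_succ_pos m
  gcongr
  exact self_le_nrm t _

theorem a0_convolution (hm : 2 ≤ m) {k : ℕ} {c C t : ℝ} (hc : c < 1) (hck : (k : ℝ) - c + 2 < m)
    (_ : 0 ≤ c)
    (ht : 0 < t) {z : Eu m} {Φ : ℝ → Eu m → V} {F : ℝ → V}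
    (hΦm : StronglyMeasurable (Function.uncurry Φ)) (hFm : StronglyMeasurable F)
    (hFi : IntegrableOn (fun w : ℝ => w ^ ((k : ℝ) + 1) • F w) (Ioi 0))
    (hconv : ∀ v s, 0 < v → 0 < s → ∫ y, poisson m s y • Φ v y = F (v + s))
    (hdom : ∀ v y, 0 < v → ‖Φ v y‖ ≤ C * v ^ (-c) * poisson m (t + v) (z - y)) :
    Integrable (fun y => a0 m y • ∫ v in Ioi (0 : ℝ), v ^ (k : ℝ) • Φ v y) ∧
    ∫ y, a0 m y • ∫ v in Ioi (0 : ℝ), v ^ (k : ℝ) • Φ v y =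
      -(((k : ℝ) + 1)⁻¹ • ∫ w in Ioi (0 : ℝ), w ^ ((k : ℝ) + 1) • F w) := by
  have hk0 : (0 : ℝ) ≤ k := by positivity
  set ν : Measure ℝ := volume.restrict (Ioi 0) with hν
  set G : (ℝ × ℝ) × Eu m → V := fun q => q.1.1 ^ (k : ℝ) • (poisson m q.1.2 q.2 • Φ q.1.1 q.2)
    with hG
  have hGm : StronglyMeasurable G := by
    refine StronglyMeasurable.smul (Measurable.stronglyMeasurable (by fun_prop))
      (StronglyMeasurable.smul ?_ ?_)
    · exact (measurable_poisson_uncurry.comp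
        (by fun_prop : Measurable fun q : (ℝ × ℝ) × Eu m => (q.1.2, q.2))).stronglyMeasurable
    · exact hΦm.comp_measurable (by fun_prop : Measurable fun q : (ℝ × ℝ) × Eu m => (q.1.1, q.2))
  have hmem : ∀ᵐ q ∂(ν.prod ν), 0 < q.1 ∧ 0 < q.2 := by
    rw [hν, Measure.prod_restrict]
    filter_upwards [ae_restrict_mem (measurableSet_Ioi.prod measurableSet_Ioi)] with q hq
    exact hq
  have hslice : ∀ q : ℝ × ℝ, 0 < q.1 → 0 < q.2 → Integrable (fun y => G (q, y)) ∧
      ∫ y, ‖G (q, y)‖ ≤ C * (q.1 ^ ((k : ℝ) - c) • poisson m (t + (q.1 + q.2)) z) := by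
    intro q h1 h2
    have hb : ∀ y, ‖G (q, y)‖ ≤
        C * q.1 ^ ((k : ℝ) - c) * (poisson m q.2 y * poisson m (t + q.1) (z - y)) := by
      intro y
      have hp := poisson_nonneg h2 y
      simp only [hG, norm_smul, norm_of_nonneg hp,
        norm_of_nonneg (rpow_nonneg h1.le _)]
      have h3 : q.1 ^ ((k : ℝ) - c) = q.1 ^ (k : ℝ) * q.1 ^ (-c) := by
        rw [← rpow_add h1]; rfl
      have h4 := hdom q.1 y h1
      calc q.1 ^ (k : ℝ) * (poisson m q.2 y * ‖Φ q.1 y‖)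
          ≤ q.1 ^ (k : ℝ) * (poisson m q.2 y *
            (C * q.1 ^ (-c) * poisson m (t + q.1) (z - y))) := by gcongr
        _ = _ := by rw [h3]; ring
    have hi := (integrable_poisson_mul_poisson h2 (by linarith : 0 < t + q.1) z).const_mul
      (C * q.1 ^ ((k : ℝ) - c))
    have hGi : Integrable (fun y => G (q, y)) :=
      hi.mono' (hGm.comp_measurable (by fun_prop)).aestronglyMeasurable (Eventually.of_forall hb)
    refine ⟨hGi, ?_⟩
    refine (integral_mono hGi.norm hi hb).trans (le_of_eq ?_)
    rw [integral_const_mul, poisson_conv_poisson h2 (by linarith), smul_eq_mul, ← mul_assoc,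
      show q.2 + (t + q.1) = t + (q.1 + q.2) by ring]
  have hGi : Integrable G ((ν.prod ν).prod volume) := by
    rw [integrable_prod_iff hGm.aestronglyMeasurable]
    refine ⟨hmem.mono fun q hq => (hslice q hq.1 hq.2).1, ?_⟩
    have h1 := (integrable_rpow_smul_add (a := (k : ℝ) - c) (by linarith)
      (measurable_poisson_add t z).stronglyMeasurable
      (integrableOn_rpow_smul_poisson (by linarith) (by linarith) ht.le (nrm_pos ht z))).1
    refine (h1.const_mul C).mono' hGm.norm.integral_prod_right'.aestronglyMeasurable ?_
    filter_upwards [hmem] with q hq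
    rw [norm_of_nonneg (integral_nonneg fun _ => norm_nonneg _)]
    exact (hslice q hq.1 hq.2).2
  have hy : ∀ᵐ y : Eu m, ∫ q, G (q, y) ∂(ν.prod ν) =
      -(a0 m y • ∫ v in Ioi (0 : ℝ), v ^ (k : ℝ) • Φ v y) := by
    have h0 : ∀ᵐ y : Eu m, y ≠ 0 := by
      have : Nonempty (Fin m) := ⟨⟨0, by omega⟩⟩
      have : Nontrivial (Eu m) := inferInstance
      exact compl_mem_ae_iff.2 (measure_singleton 0)
    filter_upwards [h0] with y hy
    rw [a0_eq_integral hm hy, neg_smul, neg_neg, ← integral_prod_smul (μ := ν) (ν := ν),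
      ← integral_prod_swap]
    refine integral_congr_of_eq fun q => ?_
    simp only [hG, Prod.fst_swap, Prod.snd_swap]
    rw [smul_comm]
  have key : ∫ y, ∫ q, G (q, y) ∂(ν.prod ν) =
      ((k : ℝ) + 1)⁻¹ • ∫ w in Ioi (0 : ℝ), w ^ ((k : ℝ) + 1) • F w := by
    rw [← integral_prod_symm _ hGi, integral_prod _ hGi,
      ← (integrable_rpow_smul_add (by linarith) hFm hFi).2]
    refine integral_congr_ae ?_
    filter_upwards [hmem] with q hq
    simp only [hG]
    rw [integral_smul, hconv _ _ hq.1 hq.2]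
  constructor
  · have := hGi.integral_prod_right
    refine this.neg.congr ?_
    filter_upwards [hy] with y hy
    rw [Pi.neg_apply, hy, neg_neg]
  · rw [← key, ← integral_neg]
    refine integral_congr_ae ?_
    filter_upwards [hy] with y hy
    rw [hy, neg_neg]

theorem a0Conv_eq_of_tendsto {V : Type} [NormedAddCommGroup V] [NormedSpace ℝ V]
    {G : ℝ → Eu m → V} {x₀ : ℝ} {x : Eu m} {v : V} (h : Tendsto (truncConv G x₀ x) atTop (𝓝 v)) :
    a0Conv G x₀ x = v := h.limUnder_eq

theorem upInt_succ_eq {V : Type*} [NormedAddCommGroup V] [NormedSpace ℝ V] (F : ℝ → V) (k : ℕ) (t : ℝ) :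
    ((-1 : ℝ) ^ (k + 1) / (k.factorial : ℝ)) •
      -(((k : ℝ) + 1)⁻¹ • ∫ w in Ioi (0 : ℝ), w ^ ((k : ℝ) + 1) • F (t + w)) = upInt F (k + 1) t := by
  rw [upInt, smul_neg, smul_smul, ← neg_smul]
  have h : (k : ℝ) + 1 ≠ 0 := by positivity
  have h2 : (k.factorial : ℝ) ≠ 0 := by positivity
  congr 1
  · rw [Nat.factorial_succ]; push_cast; field_simp; ring
  · push_cast; rfl

theorem a0_convolution_poisson {k : ℕ} (hk : k + 2 < m) {t : ℝ} (ht : 0 < t) (x : Eu m) :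
    Integrable (fun y => a0 m y • upInt (fun t => poisson m t (x - y)) k t) ∧
    ∫ y, a0 m y • upInt (fun t => poisson m t (x - y)) k t =
      upInt (fun t => poisson m t x) (k + 1) t := by
  have hkm : (k : ℝ) + 2 < m := by exact_mod_cast hk
  have h := a0_convolution (by omega : 2 ≤ m) (k := k) (c := 0) (C := 1) (t := t) one_pos
    (by linarith) le_rfl ht (z := x) (Φ := fun v y => poisson m (t + v) (x - y))
    (F := fun w => poisson m (t + w) x)
    (measurable_poisson_uncurry.comp (by fun_prop : Measurable
      fun q : ℝ × Eu m => (t + q.1, x - q.2))).stronglyMeasurable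
    (measurable_poisson_add t x).stronglyMeasurable
    (integrableOn_rpow_smul_poisson (by linarith) (by linarith) ht.le (nrm_pos ht x))
    (fun v s hv hs => by
      simp only [smul_eq_mul]
      rw [poisson_conv_poisson hs (by linarith)]
      congr 1; ring)
    (fun v y hv => by
      rw [norm_of_nonneg (poisson_nonneg (by linarith) _)]; simp)
  rw [← upInt_succ_eq, ← h.2, ← integral_smul]
  simp only [upInt]
  constructor
  · exact (h.1.smul (((-1 : ℝ) ^ (k + 1) / (k.factorial : ℝ)))).congr
      (Eventually.of_forall fun y => smul_comm ((-1 : ℝ) ^ (k + 1) / (k.factorial : ℝ)) _ _)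
  · exact integral_congr_of_eq (fun y => smul_comm _ _ _)

theorem upA_eq : ∀ {k : ℕ}, k + 1 < m → ∀ {t : ℝ}, 0 < t → ∀ x : Eu m,
    upA m k t x = upInt (fun t => poisson m t x) k t
  | 0, hk, t, ht, x => by
    simp [upA, upInt, A0_eq_integral (by omega : 2 ≤ m) ht.le (nrm_pos ht x)]
  | k + 1, hk, t, ht, x => by
    refine a0Conv_eq_of_tendsto ?_
    have h := a0_convolution_poisson (by omega : k + 2 < m) ht x
    rw [← h.2]
    refine ((aecover_ball (x := 0) tendsto_id).integral_tendsto_of_countably_generated h.1).congr fun R => ?_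
    simp only [truncConv, id]
    simp_rw [upA_eq (by omega : k + 1 < m) ht]

theorem a0Convolvable_potA {k : ℕ} (hk : k + 2 < m) : A0Convolvable (potA m k) := by
  intro t ht x
  have h := a0_convolution_poisson hk ht x
  have e : ∀ y, potA m k t y = upInt (fun t => poisson m t y) k t := fun y =>
    upA_eq (by omega : k + 1 < m) ht y
  have hlim : Tendsto (truncConv (potA m k) t x) atTop
      (𝓝 (upInt (fun t => poisson m t x) (k + 1) t)) := by
    rw [← h.2]
    refine ((aecover_ball (x := 0) tendsto_id).integral_tendsto_of_countably_generated h.1).congr fun R => ?_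
    simp only [truncConv, id, e]
  refine ⟨fun R => ?_, ?_⟩
  · simp only [e]; exact h.1.integrableOn
  · rwa [a0Conv_eq_of_tendsto hlim]

/-! ### The vector-valued case -/

theorem norm_conjPoisson_add_le {t : ℝ} (ht : 0 < t) (x : Eu m) :
    ∃ C, 0 ≤ C ∧ ∀ (u : ℝ) (y : Eu m), t ≤ u →
      ‖conjPoisson m u (x - y) + conjPoisson m u (x + y)‖ ≤ C * (poisson m u y / u) := by
  set D : ℝ := 1 + ‖x‖ / t with hD
  have hD0 : 0 < D := by positivity
  refine ⟨2 * ‖x‖ * D ^ (m + 1) + 2 * (m + 1) * ‖x‖ * D ^ m * D ^ (2 * (m + 1)), by positivity, ?_⟩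
  intro u y hu
  have hu0 : 0 < u := ht.trans_le hu
  set n := nrm u y
  set a := nrm u (x - y)
  set b := nrm u (x + y)
  have hn : 0 < n := nrm_pos hu0 y
  have ha : 0 < a := nrm_pos hu0 _
  have hb : 0 < b := nrm_pos hu0 _
  have hnt : t ≤ n := hu.trans (self_le_nrm _ _)
  have hat : t ≤ a := hu.trans (self_le_nrm _ _)
  have hbt : t ≤ b := hu.trans (self_le_nrm _ _)
  have haux : ∀ c : ℝ, t ≤ c → c + ‖x‖ ≤ D * c := by
    intro c hc
    have : ‖x‖ ≤ ‖x‖ / t * c := by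
      rw [div_mul_eq_mul_div, le_div_iff₀ ht]; gcongr
    rw [hD]; linarith
  have hna : n ≤ D * a := by
    refine le_trans ?_ (haux a hat)
    have := nrm_triangle u (-y) (x - y)
    rw [nrm_neg] at this
    rwa [show -y - (x - y) = -x by abel, norm_neg] at this
  have hnb : n ≤ D * b := by
    refine le_trans ?_ (haux b hbt)
    have := nrm_triangle u y (x + y)
    rwa [show y - (x + y) = -x by abel, norm_neg] at this
  have han : a ≤ D * n := by
    refine le_trans ?_ (haux n hnt)
    have := nrm_triangle u (x - y) (-y)
    rw [nrm_neg] at this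
    rwa [show x - y - -y = x by abel] at this
  have hbn : b ≤ D * n := by
    refine le_trans ?_ (haux n hnt)
    have := nrm_triangle u (x + y) y
    rwa [show x + y - y = x by abel] at this
  have hab : |a - b| ≤ 2 * ‖x‖ := by
    have h1 := nrm_triangle u (x - y) (-(x + y))
    have h2 := nrm_triangle u (x + y) (-(x - y))
    rw [nrm_neg, show x - y - -(x + y) = (2 : ℝ) • x by rw [two_smul]; abel, norm_smul] at h1
    rw [nrm_neg, show x + y - -(x - y) = (2 : ℝ) • x by rw [two_smul]; abel, norm_smul] at h2
    norm_num at h1 h2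
    rw [abs_le]; constructor <;> linarith
  have hyn : ‖y‖ ≤ n := norm_le_nrm u y
  have hc := two_div_sig_succ_pos m
  have hinv : ∀ c, 0 < c → n ≤ D * c → (c ^ (m + 1))⁻¹ ≤ D ^ (m + 1) * (n ^ (m + 1))⁻¹ := by
    intro c hc hnc
    rw [← div_eq_mul_inv, le_div_iff₀ (by positivity), inv_mul_le_iff₀ (by positivity), ← mul_pow,
      mul_comm c D]
    gcongr
  have hdiff : |(b ^ (m + 1))⁻¹ - (a ^ (m + 1))⁻¹| ≤
      2 * (m + 1) * ‖x‖ * D ^ m * D ^ (2 * (m + 1)) * (n ^ (m + 1))⁻¹ * n⁻¹ := by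
    rw [inv_sub_inv (by positivity) (by positivity), abs_div, div_eq_mul_inv,
      abs_of_pos (by positivity : 0 < b ^ (m + 1) * a ^ (m + 1)), mul_inv]
    have h1 : |a ^ (m + 1) - b ^ (m + 1)| ≤ 2 * ‖x‖ * ((m + 1 : ℕ) : ℝ) * (D * n) ^ m := by
      refine (abs_pow_sub_pow_le a b (m + 1)).trans ?_
      rw [abs_of_pos ha, abs_of_pos hb, add_tsub_cancel_right]
      gcongr
      exact max_le han hbn
    calc |a ^ (m + 1) - b ^ (m + 1)| * ((b ^ (m + 1))⁻¹ * (a ^ (m + 1))⁻¹)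
        ≤ (2 * ‖x‖ * ((m + 1 : ℕ) : ℝ) * (D * n) ^ m) *
          ((D ^ (m + 1) * (n ^ (m + 1))⁻¹) * (D ^ (m + 1) * (n ^ (m + 1))⁻¹)) := by
          gcongr
          · exact hinv b hb hnb
          · exact hinv a ha hna
      _ = _ := by
          push_cast
          field_simp
          ring
  have hsum : conjPoisson m u (x - y) + conjPoisson m u (x + y) =
      (-(2 / sig (m + 1))) • (((a ^ (m + 1))⁻¹ + (b ^ (m + 1))⁻¹) • x +
        ((b ^ (m + 1))⁻¹ - (a ^ (m + 1))⁻¹) • y) := by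
    simp only [conjPoisson, div_eq_mul_inv (-(2 / sig (m + 1)))]
    change (_ * (a ^ (m + 1))⁻¹) • (x - y) + (_ * (b ^ (m + 1))⁻¹) • (x + y) = _
    module
  rw [hsum, norm_smul, norm_neg, norm_of_nonneg hc.le, poisson, mul_div_assoc,
    div_right_comm, div_self hu0.ne', ← mul_assoc, mul_comm _ (2 / sig (m + 1)), mul_assoc]
  gcongr
  refine (norm_add_le _ _).trans ?_
  rw [norm_smul, norm_smul, norm_of_nonneg (by positivity), Real.norm_eq_abs, add_mul]
  have h1 := hinv a ha hna
  have h2 := hinv b hb hnb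
  have h3 : ((a ^ (m + 1))⁻¹ + (b ^ (m + 1))⁻¹) * ‖x‖ ≤
      2 * ‖x‖ * D ^ (m + 1) * (1 / n ^ (m + 1)) := by
    calc ((a ^ (m + 1))⁻¹ + (b ^ (m + 1))⁻¹) * ‖x‖ ≤
        (D ^ (m + 1) * (n ^ (m + 1))⁻¹ + D ^ (m + 1) * (n ^ (m + 1))⁻¹) * ‖x‖ := by gcongr
      _ = _ := by rw [one_div]; ring
  have h4 : |(b ^ (m + 1))⁻¹ - (a ^ (m + 1))⁻¹| * ‖y‖ ≤
      2 * (m + 1) * ‖x‖ * D ^ m * D ^ (2 * (m + 1)) * (1 / n ^ (m + 1)) := by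
    calc |(b ^ (m + 1))⁻¹ - (a ^ (m + 1))⁻¹| * ‖y‖ ≤
        (2 * (m + 1) * ‖x‖ * D ^ m * D ^ (2 * (m + 1)) * (n ^ (m + 1))⁻¹ * n⁻¹) * n := by gcongr
      _ = _ := by rw [one_div]; field_simp
  linarith

theorem continuous_conjPoisson {t : ℝ} (ht : 0 < t) : Continuous (conjPoisson m t) := by
  have h : Continuous fun x : Eu m => nrm t x ^ (m + 1) :=
    (continuous_nrm.comp (by fun_prop : Continuous fun x : Eu m => (t, x))).pow _
  have h2 : Continuous fun x : Eu m => -(2 / sig (m + 1)) / nrm t x ^ (m + 1) := by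
    refine continuous_const.div h fun x => ?_
    have := nrm_pos ht x; positivity
  exact h2.smul continuous_id

theorem norm_conjPoisson_le {t : ℝ} (ht : 0 < t) (x : Eu m) :
    ‖conjPoisson m t x‖ ≤ 2 / sig (m + 1) * (t ^ m)⁻¹ := by
  have h := two_div_sig_succ_pos m
  have hn := nrm_pos ht x
  rw [norm_conjPoisson ht]
  gcongr
  rw [div_le_iff₀ (by positivity), pow_succ]
  have h1 := self_le_nrm t x
  calc ‖x‖ ≤ nrm t x := norm_le_nrm t x
    _ = (t ^ m)⁻¹ * (t ^ m * nrm t x) := by field_simp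
    _ ≤ _ := by gcongr

theorem integrable_poisson_smul_conjPoisson {s t : ℝ} (hs : 0 < s) (ht : 0 < t) {g : Eu m → Eu m}
    (hg : Continuous g) : Integrable (fun y => poisson m s y • conjPoisson m t (g y)) :=
  (integrable_poisson hs).smul_bdd _ ((continuous_conjPoisson ht).comp hg).aestronglyMeasurable
    (Eventually.of_forall fun y => norm_conjPoisson_le ht (g y))

theorem poisson_conv_conjPoisson (hm : 1 ≤ m) {s t : ℝ} (hs : 0 < s) (ht : 0 < t) (x : Eu m) :
    ∫ y, poisson m s y • conjPoisson m t (x - y) = conjPoisson m (s + t) x := by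
  ext j
  have h := ContinuousLinearMap.integral_comp_comm (EuclideanSpace.proj (𝕜 := ℝ) j)
    (integrable_poisson_smul_conjPoisson hs ht (g := fun y => x - y) (by fun_prop))
  have h' := (isSymbol_symB j 0).poisson_conv hs ht x
  simp_rw [conjPoisson_eq_symbolKernel hm ht, conjPoisson_eq_symbolKernel hm (add_pos hs ht),
    ← Complex.ofReal_mul] at h'
  rw [integral_complex_ofReal] at h'
  have h2 := Complex.ofReal_injective h'
  rw [← h2]
  simpa using h.symm

theorem a0_convolution_conjPoisson {k : ℕ} (hk : k + 1 < m) {t : ℝ} (ht : 0 < t) (x : Eu m) :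
    Integrable (fun y => a0 m y • ((1 / 2 : ℝ) • (upInt (fun t => conjPoisson m t (x - y)) k t +
      upInt (fun t => conjPoisson m t (x + y)) k t))) ∧
    ∫ y, a0 m y • ((1 / 2 : ℝ) • (upInt (fun t => conjPoisson m t (x - y)) k t +
      upInt (fun t => conjPoisson m t (x + y)) k t)) =
      upInt (fun t => conjPoisson m t x) (k + 1) t := by
  have hkm : (k : ℝ) + 2 ≤ m := by exact_mod_cast hk
  have hk0 : (0 : ℝ) ≤ k := by positivity
  obtain ⟨C, hC0, hC⟩ := norm_conjPoisson_add_le (m := m) ht x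
  have hdom : ∀ v y, 0 < v → ‖(1 / 2 : ℝ) • (conjPoisson m (t + v) (x - y) +
      conjPoisson m (t + v) (x + y))‖ ≤
      C / (4 * t ^ (1 / 2 : ℝ)) * v ^ (-(1 / 2) : ℝ) * poisson m (t + v) (0 - y) := by
    intro v y hv
    rw [norm_smul, zero_sub, poisson_neg]
    have h1 := hC (t + v) y (by linarith)
    have h2 := poisson_nonneg (m := m) (by linarith : 0 < t + v) y
    have h3 : (t + v)⁻¹ ≤ 1 / (2 * t ^ (1 / 2 : ℝ)) * v ^ (-(1 / 2) : ℝ) := by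
      rw [rpow_neg hv.le, ← Real.sqrt_eq_rpow, ← Real.sqrt_eq_rpow]
      have hs := Real.sqrt_pos.2 ht
      have hs' := Real.sqrt_pos.2 hv
      rw [one_div, ← mul_inv]
      refine inv_anti₀ (by positivity) ?_
      nlinarith [Real.sq_sqrt ht.le, Real.sq_sqrt hv.le, sq_nonneg (√t - √v)]
    calc ‖(1 / 2 : ℝ)‖ * _ ≤ (1 / 2) * (C * (poisson m (t + v) y / (t + v))) := by
          rw [norm_of_nonneg (by norm_num)]; gcongr
      _ = (1 / 2) * C * poisson m (t + v) y * (t + v)⁻¹ := by ring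
      _ ≤ (1 / 2) * C * poisson m (t + v) y * (1 / (2 * t ^ (1 / 2 : ℝ)) * v ^ (-(1 / 2) : ℝ)) := by
          gcongr
      _ = _ := by ring
  have h := a0_convolution (by omega : 2 ≤ m) (k := k) (c := 1 / 2) (t := t) (by norm_num)
    (by linarith) (by norm_num) ht (z := 0)
    (Φ := fun v y => (1 / 2 : ℝ) • (conjPoisson m (t + v) (x - y) + conjPoisson m (t + v) (x + y)))
    (F := fun w => conjPoisson m (t + w) x)
    (((measurable_conjPoisson_uncurry.comp (by fun_prop : Measurable
      fun q : ℝ × Eu m => (t + q.1, x - q.2))).add (measurable_conjPoisson_uncurry.comp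
      (by fun_prop : Measurable fun q : ℝ × Eu m => (t + q.1, x + q.2)))).const_smul
        (1 / 2 : ℝ)).stronglyMeasurable
    (measurable_conjPoisson_add t x).stronglyMeasurable
    (integrableOn_rpow_smul_conjPoisson (by linarith) (by linarith) ht.le (nrm_pos ht x))
    (fun v s hv hs => by
      have hv' : 0 < t + v := by linarith
      have i1 := integrable_poisson_smul_conjPoisson hs hv' (g := fun y => x - y) (by fun_prop)
      have i2 := integrable_poisson_smul_conjPoisson hs hv' (g := fun y => x + y) (by fun_prop)
      have e1 := poisson_conv_conjPoisson (by omega : 1 ≤ m) hs hv' x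
      have e2 : ∫ y, poisson m s y • conjPoisson m (t + v) (x + y) = conjPoisson m (s + (t + v)) x := by
        rw [← integral_neg_eq_self, ← e1]
        refine integral_congr_of_eq fun y => ?_
        simp only [poisson_neg, sub_eq_add_neg]
      simp_rw [smul_comm (poisson m s _) (1 / 2 : ℝ), smul_add]
      have i1' := i1.smul (1 / 2 : ℝ)
      have i2' := i2.smul (1 / 2 : ℝ)
      simp only [Pi.smul_def] at i1' i2'
      rw [integral_add i1' i2', integral_smul, integral_smul, e1, e2,
        ← add_smul]
      norm_num
      congr 1; ring_nf)
    hdom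
  have hsm : ∀ y, upInt (fun t => conjPoisson m t (x - y)) k t +
      upInt (fun t => conjPoisson m t (x + y)) k t = ((-1 : ℝ) ^ (k + 1) / (k.factorial : ℝ)) •
      ∫ v in Ioi (0 : ℝ), v ^ (k : ℝ) • (conjPoisson m (t + v) (x - y) +
        conjPoisson m (t + v) (x + y)) := by
    intro y
    simp only [smul_add, upInt]
    rw [integral_add, smul_add]
    · exact integrableOn_rpow_smul_conjPoisson (by linarith) (by linarith) ht.le (nrm_pos ht _)
    · exact integrableOn_rpow_smul_conjPoisson (by linarith) (by linarith) ht.le (nrm_pos ht _)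
  have hsm2 : ∀ y, ((-1 : ℝ) ^ (k + 1) / (k.factorial : ℝ)) • (a0 m y • ∫ v in Ioi (0 : ℝ),
      v ^ (k : ℝ) • (1 / 2 : ℝ) • (conjPoisson m (t + v) (x - y) + conjPoisson m (t + v) (x + y))) =
      a0 m y • ((1 / 2 : ℝ) • (upInt (fun t => conjPoisson m t (x - y)) k t +
      upInt (fun t => conjPoisson m t (x + y)) k t)) := by
    intro y
    rw [hsm y]
    simp_rw [smul_comm (_ ^ (k : ℝ)) (1 / 2 : ℝ)]
    rw [integral_smul, smul_comm _ (a0 m y), smul_comm _ (1 / 2 : ℝ)]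
  rw [← upInt_succ_eq, ← h.2, ← integral_smul]
  constructor
  · exact (h.1.smul (((-1 : ℝ) ^ (k + 1) / (k.factorial : ℝ)))).congr
      (Eventually.of_forall hsm2)
  · exact integral_congr_of_eq (fun y => (hsm2 y).symm)

theorem stronglyMeasurable_upInt_conjPoisson (k : ℕ) (t : ℝ) :
    StronglyMeasurable (fun z : Eu m => upInt (fun t => conjPoisson m t z) k t) := by
  have : StronglyMeasurable (fun q : Eu m × ℝ => q.2 ^ (k : ℝ) • conjPoisson m (t + q.2) q.1) := by
    refine Measurable.stronglyMeasurable ?_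
    have := measurable_conjPoisson_uncurry.comp
      (by fun_prop : Measurable fun q : Eu m × ℝ => (t + q.2, q.1))
    exact (by fun_prop : Measurable fun q : Eu m × ℝ => q.2 ^ (k : ℝ)).smul this
  exact (this.integral_prod_right' (ν := volume.restrict (Ioi 0))).const_smul
    ((-1 : ℝ) ^ (k + 1) / (k.factorial : ℝ))

theorem norm_upInt_conjPoisson_le {k : ℕ} (hk : k < m) {t : ℝ} (ht : 0 < t) :
    ∃ C, 0 ≤ C ∧ ∀ z : Eu m, ‖upInt (fun t => conjPoisson m t z) k t‖ ≤ C * ‖z‖ := by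
  have hkm : (k : ℝ) + 1 ≤ m := by exact_mod_cast hk
  have hk0 : (0 : ℝ) ≤ k := by positivity
  have h0 : 0 < nrm t (0 : Eu m) := nrm_pos ht 0
  have hi := integrableOn_rpow_mul_nrm (b := k) (c := m + 1) (by linarith)
    (by push_cast; linarith) ht.le h0
  have hc := two_div_sig_succ_pos m
  set J := ∫ w in Ioi (0 : ℝ), w ^ (k : ℝ) * (nrm (t + w) (0 : Eu m) ^ (m + 1))⁻¹ with hJ
  have hn : ∀ w : ℝ, 0 ≤ nrm w (0 : Eu m) := fun w => Real.sqrt_nonneg _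
  have hJ0 : 0 ≤ J := setIntegral_nonneg measurableSet_Ioi fun w hw => by
    have := hn (t + w); have : (0:ℝ) < w := hw; positivity
  refine ⟨‖(-1 : ℝ) ^ (k + 1) / (k.factorial : ℝ)‖ * (2 / sig (m + 1) * J), by positivity, ?_⟩
  intro z
  rw [upInt, norm_smul, mul_assoc]
  gcongr
  refine (norm_integral_le_integral_norm _).trans ?_
  rw [hJ, ← integral_const_mul, ← integral_mul_const]
  refine setIntegral_mono_on (integrableOn_rpow_smul_conjPoisson (by linarith) (by linarith) ht.le
    (nrm_pos ht _)).norm ((hi.const_mul _).mul_const _) measurableSet_Ioi fun w hw => ?_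
  have hw0 : 0 < w := hw
  have h1 : nrm (t + w) (0 : Eu m) ≤ nrm (t + w) z := by
    unfold nrm; gcongr; simp
  have h2 : 0 < nrm (t + w) (0 : Eu m) := nrm_pos (by linarith) 0
  rw [norm_smul, norm_of_nonneg (by positivity), norm_conjPoisson (by linarith),
    div_eq_mul_inv ‖z‖]
  calc _ = 2 / sig (m + 1) * (w ^ (k : ℝ) * (nrm (t + w) z ^ (m + 1))⁻¹) * ‖z‖ := by ring
    _ ≤ _ := by gcongr

theorem measurable_a0 : Measurable (a0 m) := by unfold a0; fun_prop

theorem integrableOn_a0_smul_upInt_conjPoisson {k : ℕ} (hk : k + 1 < m) {t : ℝ} (ht : 0 < t)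
    (x : Eu m) (R : ℝ) :
    IntegrableOn (fun y => a0 m y • upInt (fun t => conjPoisson m t (x - y)) k t)
      (Metric.ball (0 : Eu m) R) := by
  obtain ⟨C, hC0, hC⟩ := norm_upInt_conjPoisson_le (by omega : k < m) ht
  have hmeas : AEStronglyMeasurable
      (fun y : Eu m => a0 m y • upInt (fun t => conjPoisson m t (x - y)) k t) :=
    (measurable_a0.stronglyMeasurable.smul ((stronglyMeasurable_upInt_conjPoisson k t).comp_measurable
      (by fun_prop : Measurable fun y : Eu m => x - y))).aestronglyMeasurable
  set c0 : ℝ := ‖-(2 / ((m : ℝ) - 1)) * (1 / sig (m + 1))‖ with hc0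
  refine integrableOn_ball_of_norm_le_rpow (C := c0 * (C * (‖x‖ + R))) (α := (m : ℝ) - 1)
    (by simp; omega) (by simp) ?_ hmeas
  filter_upwards [ae_restrict_mem measurableSet_ball] with y hy
  have hyR : ‖y‖ < R := by simpa using hy
  have h1 : ‖a0 m y‖ = c0 * ‖y‖ ^ (-((m : ℝ) - 1)) := by
    rw [a0, norm_mul, ← hc0, rpow_neg (norm_nonneg _), norm_div, norm_one, one_div, norm_pow,
      norm_norm]
    congr 2
    rw [← rpow_natCast]
    congr 1
    rw [Nat.cast_sub (by omega), Nat.cast_one]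
  rw [norm_smul, h1]
  have h2 : ‖upInt (fun t => conjPoisson m t (x - y)) k t‖ ≤ C * (‖x‖ + R) := by
    refine (hC _).trans ?_
    gcongr
    exact (norm_sub_le _ _).trans (by linarith)
  calc c0 * ‖y‖ ^ (-((m : ℝ) - 1)) * ‖upInt (fun t => conjPoisson m t (x - y)) k t‖
      ≤ c0 * ‖y‖ ^ (-((m : ℝ) - 1)) * (C * (‖x‖ + R)) := by gcongr
    _ = _ := by ring

theorem a0_neg (y : Eu m) : a0 m (-y) = a0 m y := by simp [a0]

theorem tendsto_truncConv_conjPoisson {k : ℕ} (hk : k + 1 < m) {t : ℝ} (ht : 0 < t) (x : Eu m) :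
    Tendsto (truncConv (fun s z => upInt (fun t => conjPoisson m t z) k s) t x) atTop
      (𝓝 (upInt (fun t => conjPoisson m t x) (k + 1) t)) := by
  have h := a0_convolution_conjPoisson hk ht x
  rw [← h.2]
  refine ((aecover_ball (x := 0) tendsto_id).integral_tendsto_of_countably_generated h.1).congr
    fun R => ?_
  simp only [truncConv, id]
  have i1 := integrableOn_a0_smul_upInt_conjPoisson hk ht x R
  have hneg : MeasurePreserving (fun y : Eu m => -y) volume volume := Measure.measurePreserving_neg _
  have hemb : MeasurableEmbedding (fun y : Eu m => -y) := (MeasurableEquiv.neg _).measurableEmbedding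
  have hpre : (fun y : Eu m => -y) ⁻¹' Metric.ball (0 : Eu m) R = Metric.ball 0 R := by
    ext y; simp
  have i2 : IntegrableOn (fun y => a0 m y • upInt (fun t => conjPoisson m t (x + y)) k t)
      (Metric.ball (0 : Eu m) R) := by
    have := (hneg.integrableOn_comp_preimage hemb).2 i1
    rw [hpre] at this
    simpa [Function.comp_def, a0_neg] using this
  have e2 : ∫ y in Metric.ball (0 : Eu m) R, a0 m y • upInt (fun t => conjPoisson m t (x + y)) k t =
      ∫ y in Metric.ball (0 : Eu m) R, a0 m y • upInt (fun t => conjPoisson m t (x - y)) k t := by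
    rw [← hneg.setIntegral_preimage_emb hemb, hpre]
    simp [a0_neg, sub_eq_add_neg]
  simp_rw [smul_comm (a0 m _) (1 / 2 : ℝ), smul_add]
  have i1' := i1.smul (1 / 2 : ℝ)
  have i2' := i2.smul (1 / 2 : ℝ)
  simp only [Pi.smul_def] at i1' i2'
  rw [integral_add i1' i2', integral_smul, integral_smul, e2, ← add_smul]
  norm_num

theorem upB_eq : ∀ {k : ℕ}, k < m → ∀ {t : ℝ}, 0 < t → ∀ x : Eu m,
    upB m k t x = upInt (fun t => conjPoisson m t x) k t
  | 0, hk, t, ht, x => by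
    simp [upB, upInt, B0_eq_integral (by omega : 1 ≤ m) ht]
  | k + 1, hk, t, ht, x => by
    refine a0Conv_eq_of_tendsto ?_
    refine (tendsto_truncConv_conjPoisson (by omega : k + 1 < m) ht x).congr fun R => ?_
    simp only [truncConv]
    simp_rw [upB_eq (by omega : k < m) ht]

theorem a0Convolvable_potB {k : ℕ} (hk : k + 1 < m) : A0Convolvable (potB m k) := by
  intro t ht x
  have e : ∀ y, potB m k t y = upInt (fun t => conjPoisson m t y) k t := fun y =>
    upB_eq (by omega : k < m) ht y
  have hlim : Tendsto (truncConv (potB m k) t x) atTop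
      (𝓝 (upInt (fun t => conjPoisson m t x) (k + 1) t)) := by
    refine (tendsto_truncConv_conjPoisson hk ht x).congr fun R => ?_
    simp only [truncConv, e]
  refine ⟨fun R => ?_, ?_⟩
  · simp only [e]; exact integrableOn_a0_smul_upInt_conjPoisson hk ht x R
  · rwa [a0Conv_eq_of_tendsto hlim]

end

section

variable {d : ℕ} {f : ℝ → Eu m → ℂ}

/-! ### Homogeneous kernels in the upper half-space -/

/-- Kernels on the upper half-space that are homogeneous of degree `-d` and smooth up to the
boundary outside the origin: sums of products of coordinates divided by powers of `|x|`. -/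
inductive IsHomKernel : ℕ → (ℝ → Eu m → ℂ) → Prop
  | base (d : ℕ) : IsHomKernel d fun t x => (((nrm t x ^ d)⁻¹ : ℝ) : ℂ)
  | time {d : ℕ} {f : ℝ → Eu m → ℂ} : IsHomKernel (d + 1) f → IsHomKernel d fun t x => (t : ℂ) * f t x
  | coord {d : ℕ} {f : ℝ → Eu m → ℂ} (j : Fin m) :
      IsHomKernel (d + 1) f → IsHomKernel d fun t x => (x j : ℂ) * f t x
  | add {d : ℕ} {f g : ℝ → Eu m → ℂ} :
      IsHomKernel d f → IsHomKernel d g → IsHomKernel d fun t x => f t x + g t x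
  | const_mul {d : ℕ} {f : ℝ → Eu m → ℂ} (c : ℂ) :
      IsHomKernel d f → IsHomKernel d fun t x => c * f t x

theorem IsHomKernel.bound (h : IsHomKernel d f) :
    ∃ C, 0 ≤ C ∧ ∀ t, 0 < t → ∀ x, ‖f t x‖ ≤ C * (nrm t x ^ d)⁻¹ := by
  induction h with
  | base d =>
    refine ⟨1, zero_le_one, fun t ht x => ?_⟩
    have := nrm_pos ht x
    rw [Complex.norm_real, norm_of_nonneg (by positivity), one_mul]
  | time _ ih =>
    obtain ⟨C, hC0, hC⟩ := ih
    refine ⟨C, hC0, fun t ht x => ?_⟩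
    have hn := nrm_pos ht x
    rw [norm_mul, Complex.norm_real, norm_of_nonneg ht.le]
    calc _ ≤ nrm t x * (C * (nrm t x ^ (_ + 1))⁻¹) :=
          mul_le_mul (le_nrm t x) (hC t ht x) (norm_nonneg _) hn.le
      _ = _ := by rw [pow_succ]; field_simp
  | coord j _ ih =>
    obtain ⟨C, hC0, hC⟩ := ih
    refine ⟨C, hC0, fun t ht x => ?_⟩
    have hn := nrm_pos ht x
    rw [norm_mul, Complex.norm_real]
    calc _ ≤ nrm t x * (C * (nrm t x ^ (_ + 1))⁻¹) :=
          mul_le_mul ((PiLp.norm_apply_le x j).trans (norm_le_nrm t x)) (hC t ht x)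
            (norm_nonneg _) hn.le
      _ = _ := by rw [pow_succ]; field_simp
  | add _ _ ih ih' =>
    obtain ⟨C, hC0, hC⟩ := ih
    obtain ⟨C', hC0', hC'⟩ := ih'
    refine ⟨C + C', by positivity, fun t ht x => ?_⟩
    rw [add_mul]
    exact (norm_add_le _ _).trans (add_le_add (hC t ht x) (hC' t ht x))
  | const_mul c _ ih =>
    obtain ⟨C, hC0, hC⟩ := ih
    refine ⟨‖c‖ * C, by positivity, fun t ht x => ?_⟩
    rw [norm_mul, mul_assoc]
    exact mul_le_mul_of_nonneg_left (hC t ht x) (norm_nonneg _)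

theorem IsHomKernel.hasDerivAt_time (h : IsHomKernel d f) :
    ∃ f', IsHomKernel (d + 1) f' ∧
      ∀ t, 0 < t → ∀ x, HasDerivAt (fun t => f t x) (f' t x) t := by
  induction h with
  | base d =>
    refine ⟨_, ((IsHomKernel.base (d + 2)).time).const_mul (-(d : ℂ)), fun t ht x => ?_⟩
    have hn := nrm_pos ht x
    have h := (((hasDerivAt_nrm_time ht x).fun_pow d).fun_inv (pow_ne_zero _ hn.ne')).ofReal_comp
    refine h.congr_deriv ?_
    norm_cast
    rcases d with _ | d
    · simp
    · simp only [add_tsub_cancel_right]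
      push_cast
      field_simp
      ring
  | time _ ih =>
    obtain ⟨f', hf', hd⟩ := ih
    rename_i f hf
    refine ⟨_, hf.add hf'.time, fun t ht x => ?_⟩
    refine ((hasDerivAt_id t).ofReal_comp.mul (hd t ht x)).congr_deriv ?_
    simp
  | coord j _ ih =>
    obtain ⟨f', hf', hd⟩ := ih
    exact ⟨_, hf'.coord j, fun t ht x => (hd t ht x).const_mul _⟩
  | add _ _ ih ih' =>
    obtain ⟨f', hf', hd⟩ := ih
    obtain ⟨g', hg', hd'⟩ := ih'
    exact ⟨_, hf'.add hg', fun t ht x => (hd t ht x).add (hd' t ht x)⟩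
  | const_mul c _ ih =>
    obtain ⟨f', hf', hd⟩ := ih
    exact ⟨_, hf'.const_mul c, fun t ht x => (hd t ht x).const_mul c⟩

theorem hasDerivAt_coord_line (x : Eu m) (i j : Fin m) :
    HasDerivAt (fun s : ℝ => (((x + s • unitVec j) i : ℝ) : ℂ))
      (if i = j then 1 else 0) 0 := by
  have h : HasDerivAt (fun s : ℝ => (x + s • unitVec j) i)
      (if i = j then 1 else 0) 0 := by
    have := ((hasDerivAt_id (0 : ℝ)).mul_const (if i = j then (1 : ℝ) else 0)).const_add (x i)
    simpa [PiLp.single_apply] using this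
  refine h.ofReal_comp.congr_deriv ?_
  split_ifs <;> simp

theorem IsHomKernel.hasDerivAt_space (h : IsHomKernel d f) (j : Fin m) :
    ∃ f', IsHomKernel (d + 1) f' ∧ ∀ t, 0 < t → ∀ x,
      HasDerivAt (fun s : ℝ => f t (x + s • unitVec j)) (f' t x) 0 := by
  induction h with
  | base d =>
    refine ⟨_, ((IsHomKernel.base (d + 2)).coord j).const_mul (-(d : ℂ)), fun t ht x => ?_⟩
    have hn := nrm_pos ht x
    have h := (((hasDerivAt_nrm_space ht x j).fun_pow d).fun_inv
      (by simpa using pow_ne_zero _ hn.ne')).ofReal_comp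
    refine h.congr_deriv ?_
    simp only [zero_smul, add_zero]
    norm_cast
    rcases d with _ | d
    · simp
    · simp only [add_tsub_cancel_right]
      push_cast
      field_simp
      ring
  | time _ ih =>
    obtain ⟨f', hf', hd⟩ := ih
    exact ⟨_, hf'.time, fun t ht x => (hd t ht x).const_mul _⟩
  | coord i _ ih =>
    obtain ⟨f', hf', hd⟩ := ih
    rename_i f hf
    refine ⟨_, (hf.const_mul (if i = j then 1 else 0)).add (hf'.coord i), fun t ht x => ?_⟩
    refine ((hasDerivAt_coord_line x i j).mul (hd t ht x)).congr_deriv ?_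
    simp
  | add _ _ ih ih' =>
    obtain ⟨f', hf', hd⟩ := ih
    obtain ⟨g', hg', hd'⟩ := ih'
    exact ⟨_, hf'.add hg', fun t ht x => (hd t ht x).add (hd' t ht x)⟩
  | const_mul c _ ih =>
    obtain ⟨f', hf', hd⟩ := ih
    exact ⟨_, hf'.const_mul c, fun t ht x => (hd t ht x).const_mul c⟩

theorem symbolKernel_congr_of_chain {p : ℕ → Eu m → ℂ} (hp : ∀ k, IsSymbol (p k))
    (hsucc : ∀ k, (fun ξ : Eu m => -((2 * π * ‖ξ‖ : ℝ) : ℂ) * p k ξ) = p (k + 1))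
    (h0 : IsHomKernel d f) (h : ∀ t, 0 < t → ∀ x, symbolKernel (p 0) t x = f t x) (k : ℕ) :
    ∃ g, IsHomKernel (d + k) g ∧ ∀ t, 0 < t → ∀ x, symbolKernel (p k) t x = g t x := by
  induction k with
  | zero => exact ⟨f, h0, h⟩
  | succ k ih =>
    obtain ⟨g, hg, he⟩ := ih
    obtain ⟨g', hg', hd⟩ := hg.hasDerivAt_time
    refine ⟨g', hg', fun t ht x => ?_⟩
    have h1 := (hp k).hasDerivAt_symbolKernel_time ht x
    rw [hsucc] at h1
    have h2 : HasDerivAt (fun t => g t x) (symbolKernel (p (k + 1)) t x) t :=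
      h1.congr_of_eventuallyEq (by
        filter_upwards [Ioi_mem_nhds ht] with s hs
        exact (he s hs x).symm)
    exact h2.unique (hd t ht x)

theorem exists_isHomKernel_symA (k : ℕ) : ∃ g : ℝ → Eu m → ℂ, IsHomKernel (m + k) g ∧
    ∀ t, 0 < t → ∀ x, symbolKernel (symA k) t x = g t x := by
  refine symbolKernel_congr_of_chain isSymbol_symA symA_succ
    (((IsHomKernel.base (m + 1)).time).const_mul ((2 / sig (m + 1) : ℝ) : ℂ)) (fun t ht x => ?_) k
  have : (symA 0 : Eu m → ℂ) = fun _ => 1 := by ext; simp [symA]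
  rw [this, poisson_eq_symbolKernel ht, poisson]
  push_cast
  ring

theorem exists_isHomKernel_symB (hm : 1 ≤ m) (j : Fin m) (k : ℕ) : ∃ g : ℝ → Eu m → ℂ,
    IsHomKernel (m + k) g ∧ ∀ t, 0 < t → ∀ x, symbolKernel (symB j k) t x = g t x := by
  refine symbolKernel_congr_of_chain (isSymbol_symB j) (symB_succ j)
    (((IsHomKernel.base (m + 1)).coord j).const_mul ((-(2 / sig (m + 1)) : ℝ) : ℂ))
    (fun t ht x => ?_) k
  rw [conjPoisson_eq_symbolKernel hm ht, conjPoisson]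
  simp only [PiLp.smul_apply, smul_eq_mul]
  push_cast
  ring

theorem exists_isHomKernel_space {p : Eu m → ℂ} (hp : IsSymbol p) {g : ℝ → Eu m → ℂ}
    (hg : IsHomKernel d g) (h : ∀ t, 0 < t → ∀ x, symbolKernel p t x = g t x) (j : Fin m) :
    ∃ g', IsHomKernel (d + 1) g' ∧ ∀ t, 0 < t → ∀ x,
      symbolKernel (fun ξ => -((2 * π * ξ j : ℝ) : ℂ) * Complex.I * p ξ) t x = g' t x := by
  obtain ⟨g', hg', hd⟩ := hg.hasDerivAt_space j
  refine ⟨g', hg', fun t ht x => ?_⟩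
  have h1 := hp.hasDerivAt_symbolKernel_space ht x j
  simp_rw [h t ht] at h1
  exact h1.unique (hd t ht x)

/-- The symbol kernel of `p` decays like `|x|^{-d}`, uniformly up to the boundary. -/
def HasKernelDecay (p : Eu m → ℂ) (d : ℕ) : Prop :=
  ∃ C, 0 ≤ C ∧ ∀ t, 0 < t → ∀ x, ‖symbolKernel p t x‖ ≤ C * (nrm t x ^ d)⁻¹

theorem hasKernelDecay_symA (k : ℕ) : HasKernelDecay (symA k : Eu m → ℂ) (m + k) := by
  obtain ⟨g, hg, he⟩ := exists_isHomKernel_symA (m := m) k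
  obtain ⟨C, hC0, hC⟩ := hg.bound
  exact ⟨C, hC0, fun t ht x => by rw [he t ht]; exact hC t ht x⟩

theorem hasKernelDecay_symB (hm : 1 ≤ m) (j : Fin m) (k : ℕ) : HasKernelDecay (symB j k) (m + k) := by
  obtain ⟨g, hg, he⟩ := exists_isHomKernel_symB hm j k
  obtain ⟨C, hC0, hC⟩ := hg.bound
  exact ⟨C, hC0, fun t ht x => by rw [he t ht]; exact hC t ht x⟩

theorem hasKernelDecay_symB_space (hm : 1 ≤ m) (i j : Fin m) (k : ℕ) :
    HasKernelDecay (fun ξ => -((2 * π * ξ i : ℝ) : ℂ) * Complex.I * symB j k ξ) (m + k + 1) := by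
  obtain ⟨g, hg, he⟩ := exists_isHomKernel_symB hm j k
  obtain ⟨g', hg', he'⟩ := exists_isHomKernel_space (isSymbol_symB j k) hg he i
  obtain ⟨C, hC0, hC⟩ := hg'.bound
  exact ⟨C, hC0, fun t ht x => by rw [he' t ht]; exact hC t ht x⟩

end

section

/-! ### Boundary values of the upstream potentials -/

theorem integral_rpow_mul_nrm {a : ℝ} {c : ℕ} (ha : -1 < a) (hac : a + 1 < c) {x : Eu m}
    (hx : x ≠ 0) :
    ∫ w in Ioi (0 : ℝ), w ^ a * (nrm w x ^ c)⁻¹ =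
      1 / 2 * Gamma ((a + 1) / 2) * Gamma ((c - a - 1) / 2) / Gamma ((c : ℝ) / 2) *
        ‖x‖ ^ (a + 1 - c) := by
  have hr : 0 < ‖x‖ := norm_pos_iff.2 hx
  have hc : (0 : ℝ) < c := by linarith
  set ν : Measure ℝ := volume.restrict (Ioi 0) with hν
  set f : ℝ × ℝ → ℝ := fun q => q.1 ^ a * (q.2 ^ ((c : ℝ) / 2 - 1) *
    exp (-((q.1 ^ 2 + ‖x‖ ^ 2) * q.2))) with hf
  have hfm : AEStronglyMeasurable f (ν.prod ν) := Measurable.aestronglyMeasurable (by fun_prop)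
  have hG : 0 < Gamma ((c : ℝ) / 2) := Gamma_pos_of_pos (by positivity)
  have hw : ∀ w : ℝ, ∫ s in Ioi (0 : ℝ), f (w, s) =
      Gamma ((c : ℝ) / 2) * (w ^ a * (nrm w x ^ c)⁻¹) := by
    intro w
    simp only [hf]
    rw [integral_const_mul, integral_rpow_mul_exp_neg_mul_Ioi (by positivity) (by positivity)]
    have : (1 / (w ^ 2 + ‖x‖ ^ 2)) ^ ((c : ℝ) / 2) = (nrm w x ^ c)⁻¹ := by
      rw [nrm, Real.sqrt_eq_rpow, ← rpow_natCast _ c, ← rpow_mul (by positivity), one_div,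
        Real.inv_rpow (by positivity)]
      congr 2; ring
    rw [this]; ring
  have hws : ∀ w : ℝ, 0 < w → IntegrableOn (fun s => f (w, s)) (Ioi 0) := by
    intro w hw0
    simp only [hf]
    have := integrableOn_rpow_mul_exp_neg_mul_rpow (p := 1) (s := (c : ℝ) / 2 - 1)
      (b := w ^ 2 + ‖x‖ ^ 2) (by linarith) one_pos (by positivity)
    refine (this.const_mul (w ^ a)).congr (Eventually.of_forall fun s => ?_)
    simp only [rpow_one, neg_mul]
  have hf0 : ∀ w s : ℝ, 0 < w → 0 < s → 0 ≤ f (w, s) := by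
    intro w s hw hs; simp only [hf]; positivity
  have hI := integrableOn_rpow_mul_nrm (c := c) ha (by linarith) le_rfl
    (x := x) (by rw [nrm_zero]; exact hr)
  simp only [zero_add] at hI
  have hfi : Integrable f (ν.prod ν) := by
    rw [integrable_prod_iff hfm]
    constructor
    · filter_upwards [ae_restrict_mem measurableSet_Ioi] with w hw0
      exact hws w hw0
    · refine (hI.const_mul (Gamma ((c : ℝ) / 2))).congr ?_
      filter_upwards [ae_restrict_mem measurableSet_Ioi] with w hw0
      rw [← hw w]
      refine setIntegral_congr_fun measurableSet_Ioi fun s hs => ?_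
      exact (norm_of_nonneg (hf0 w s hw0 hs)).symm
  have h1 : ∫ w in Ioi (0 : ℝ), ∫ s in Ioi (0 : ℝ), f (w, s) =
      Gamma ((c : ℝ) / 2) * ∫ w in Ioi (0 : ℝ), w ^ a * (nrm w x ^ c)⁻¹ := by
    rw [← integral_const_mul]
    exact integral_congr_ae (Eventually.of_forall hw)
  have h2 : ∫ s in Ioi (0 : ℝ), ∫ w in Ioi (0 : ℝ), f (w, s) =
      1 / 2 * Gamma ((a + 1) / 2) * ((1 / ‖x‖ ^ 2) ^ ((c - a - 1) / 2) * Gamma ((c - a - 1) / 2)) := by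
    rw [← integral_rpow_mul_exp_neg_mul_Ioi (by linarith) (by positivity), ← integral_const_mul]
    refine setIntegral_congr_fun measurableSet_Ioi fun s hs => ?_
    have hs0 : 0 < s := hs
    have h3 := integral_rpow_mul_exp_neg_mul_rpow (p := 2) (q := a) (b := s) two_pos ha hs0
    simp only [hf]
    calc ∫ w in Ioi (0 : ℝ), w ^ a * (s ^ ((c : ℝ) / 2 - 1) * exp (-((w ^ 2 + ‖x‖ ^ 2) * s)))
        = ∫ w in Ioi (0 : ℝ), (s ^ ((c : ℝ) / 2 - 1) * exp (-(‖x‖ ^ 2 * s))) *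
          (w ^ a * exp (-s * w ^ (2 : ℝ))) := by
          refine integral_congr_of_eq fun w => ?_
          have : -((w ^ 2 + ‖x‖ ^ 2) * s) = -(‖x‖ ^ 2 * s) + -s * w ^ (2 : ℝ) := by
            rw [rpow_two]; ring
          simp only [this, Real.exp_add]; ring
      _ = _ := by
          rw [integral_const_mul, h3]
          have : s ^ ((c - a - 1) / 2 - 1) = s ^ ((c : ℝ) / 2 - 1) * s ^ (-(a + 1) / 2) := by
            rw [← rpow_add hs0]; congr 1; ring
          rw [this]; ring
  have h4 := integral_integral_swap (μ := ν) (ν := ν) (f := fun w s => f (w, s)) hfi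
  rw [h1, h2] at h4
  have h5 : (1 / ‖x‖ ^ 2) ^ ((c - a - 1) / 2) = ‖x‖ ^ (a + 1 - c) := by
    rw [one_div, ← rpow_natCast, ← rpow_neg hr.le, ← rpow_mul hr.le]
    congr 1; push_cast; ring
  rw [h5] at h4
  rw [div_mul_eq_mul_div, eq_div_iff hG.ne']
  linarith

theorem Gamma_half_mul (n : ℕ) :
    Gamma (((n + 1 : ℕ) : ℝ) / 2) * Gamma (((n + 1 : ℕ) + 1 : ℝ) / 2) =
      (n.factorial : ℝ) * (2 ^ n)⁻¹ * √π := by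
  have h := Gamma_mul_Gamma_add_half (((n + 1 : ℕ) : ℝ) / 2)
  have e1 : ((n + 1 : ℕ) : ℝ) / 2 + 1 / 2 = ((n + 1 : ℕ) + 1 : ℝ) / 2 := by ring
  have e2 : 2 * (((n + 1 : ℕ) : ℝ) / 2) = (n : ℝ) + 1 := by push_cast; ring
  rw [e1, e2, Gamma_nat_eq_factorial] at h
  rw [h]
  congr 2
  rw [show (1 : ℝ) - ((n : ℝ) + 1) = -n by ring, rpow_neg two_pos.le, rpow_natCast]

/-- The coefficient of the Riesz kernel with symbol `|2πξ|^{-N}`. -/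
def rieszCoeff (m N : ℕ) : ℝ :=
  (2 ^ N)⁻¹ * Gamma (((m : ℝ) - N) / 2) / (π ^ ((m : ℝ) / 2) * Gamma ((N : ℝ) / 2))

/-- The coefficient of the kernel with symbol `-i (ξ / |ξ|) |2πξ|^{-N}`. -/
def hilbertRieszCoeff (m N : ℕ) : ℝ :=
  -((2 ^ N)⁻¹ * Gamma (((m : ℝ) - N + 1) / 2) / (π ^ ((m : ℝ) / 2) * Gamma (((N : ℝ) + 1) / 2)))

theorem integral_rpow_mul_poisson {n : ℕ} (hn : n + 1 < m) {x : Eu m} (hx : x ≠ 0) :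
    (n.factorial : ℝ)⁻¹ * ∫ w in Ioi (0 : ℝ), w ^ (n : ℝ) * poisson m w x =
      rieszCoeff m (n + 1) * ‖x‖ ^ (((n + 1 : ℕ) : ℝ) - m) := by
  have hnm : (n : ℝ) + 1 < m := by exact_mod_cast hn
  have hn0 : (0 : ℝ) ≤ n := by positivity
  have h := integral_rpow_mul_nrm (a := (n : ℝ) + 1) (c := m + 1) (by linarith)
    (by push_cast; linarith) hx
  have e : ∀ w ∈ Ioi (0 : ℝ), w ^ (n : ℝ) * poisson m w x =
      2 / sig (m + 1) * (w ^ ((n : ℝ) + 1) * (nrm w x ^ (m + 1))⁻¹) := by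
    intro w hw
    have hw0 : 0 < w := hw
    rw [poisson, rpow_add hw0, rpow_one]; ring
  rw [setIntegral_congr_fun measurableSet_Ioi e, integral_const_mul, h, two_div_sig _ (by omega),
    rieszCoeff]
  have h1 := Gamma_half_mul n
  have hG1 : 0 < Gamma (((n + 1 : ℕ) : ℝ) / 2) := Gamma_pos_of_pos (by positivity)
  have hG2 : 0 < Gamma (((m + 1 : ℕ) : ℝ) / 2) := Gamma_pos_of_pos (by positivity)
  have e2 : ((n : ℝ) + 1 + 1) / 2 = ((n + 1 : ℕ) + 1 : ℝ) / 2 := by push_cast; ring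
  have e3 : (((m + 1 : ℕ) : ℝ) - (n + 1) - 1) / 2 = ((m : ℝ) - (n + 1 : ℕ)) / 2 := by
    push_cast; ring
  have e4 : (n : ℝ) + 1 + 1 - (m + 1 : ℕ) = ((n + 1 : ℕ) : ℝ) - m := by push_cast; ring
  have e5 : π ^ (((m + 1 : ℕ) : ℝ) / 2) = π ^ ((m : ℝ) / 2) * √π := by
    rw [Real.sqrt_eq_rpow, ← rpow_add pi_pos]; congr 1; push_cast; ring
  rw [e2, e3, e4, e5]
  have hG3 : Gamma (((n + 1 : ℕ) + 1 : ℝ) / 2) =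
      (n.factorial : ℝ) * (2 ^ n)⁻¹ * √π / Gamma (((n + 1 : ℕ) : ℝ) / 2) := by
    rw [eq_div_iff hG1.ne', mul_comm]; exact h1
  rw [hG3]
  have hp : 0 < √π := Real.sqrt_pos.2 pi_pos
  have hp2 : 0 < π ^ ((m : ℝ) / 2) := by positivity
  have hfac : (0 : ℝ) < n.factorial := by positivity
  field_simp
  ring

theorem integral_rpow_mul_conjPoisson {n : ℕ} (hn : n < m) {x : Eu m} (hx : x ≠ 0) (j : Fin m) :
    (n.factorial : ℝ)⁻¹ * ∫ w in Ioi (0 : ℝ), w ^ (n : ℝ) * conjPoisson m w x j =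
      hilbertRieszCoeff m (n + 1) * (‖x‖ ^ (((n + 1 : ℕ) : ℝ) - m - 1) * x j) := by
  have hnm : (n : ℝ) + 1 ≤ m := by exact_mod_cast hn
  have hn0 : (0 : ℝ) ≤ n := by positivity
  have h := integral_rpow_mul_nrm (a := (n : ℝ)) (c := m + 1) (by linarith)
    (by push_cast; linarith) hx
  have e : ∀ w ∈ Ioi (0 : ℝ), w ^ (n : ℝ) * conjPoisson m w x j =
      -(2 / sig (m + 1) * x j) * (w ^ (n : ℝ) * (nrm w x ^ (m + 1))⁻¹) := by
    intro w hw
    simp only [conjPoisson, PiLp.smul_apply, smul_eq_mul]; ring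
  rw [setIntegral_congr_fun measurableSet_Ioi e, integral_const_mul, h, two_div_sig _ (by omega),
    hilbertRieszCoeff]
  have h1 := Gamma_half_mul n
  have hG1 : 0 < Gamma (((n + 1 : ℕ) + 1 : ℝ) / 2) := Gamma_pos_of_pos (by positivity)
  have hG2 : 0 < Gamma (((m + 1 : ℕ) : ℝ) / 2) := Gamma_pos_of_pos (by positivity)
  have e2 : ((n : ℝ) + 1) / 2 = ((n + 1 : ℕ) : ℝ) / 2 := by push_cast; ring
  have e3 : (((m + 1 : ℕ) : ℝ) - n - 1) / 2 = ((m : ℝ) - (n + 1 : ℕ) + 1) / 2 := by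
    push_cast; ring
  have e4 : (n : ℝ) + 1 - (m + 1 : ℕ) = ((n + 1 : ℕ) : ℝ) - m - 1 := by push_cast; ring
  have e5 : π ^ (((m + 1 : ℕ) : ℝ) / 2) = π ^ ((m : ℝ) / 2) * √π := by
    rw [Real.sqrt_eq_rpow, ← rpow_add pi_pos]; congr 1; push_cast; ring
  rw [e2, e3, e4, e5]
  have hG3 : Gamma (((n + 1 : ℕ) : ℝ) / 2) =
      (n.factorial : ℝ) * (2 ^ n)⁻¹ * √π / Gamma (((n + 1 : ℕ) + 1 : ℝ) / 2) := by
    rw [eq_div_iff hG1.ne']; exact h1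
  rw [hG3]
  have hp : 0 < √π := Real.sqrt_pos.2 pi_pos
  have hp2 : 0 < π ^ ((m : ℝ) / 2) := by positivity
  have hfac : (0 : ℝ) < n.factorial := by positivity
  field_simp
  ring

/-- Upstream integrals of a kernel: the `(n+1)`-fold primitive in `u` vanishing at infinity. -/
def primInt {V : Type*} [NormedAddCommGroup V] [NormedSpace ℝ V]
    (K : ℝ → Eu m → V) (n : ℕ) (u : ℝ) (x : Eu m) : V :=
  (n.factorial : ℝ)⁻¹ • ∫ w in Ioi (0 : ℝ), w ^ (n : ℝ) • K (u + w) x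

theorem upInt_eq_primInt {V : Type*} [NormedAddCommGroup V] [NormedSpace ℝ V] (K : ℝ → Eu m → V)
    (n : ℕ) (u : ℝ) (x : Eu m) :
    upInt (fun t => K t x) n u = (-1 : ℝ) ^ (n + 1) • primInt K n u x := by
  rw [upInt, primInt, smul_smul, div_eq_mul_inv]

section Dominated

variable {V : Type*} [NormedAddCommGroup V] [NormedSpace ℝ V]
  {K : ℝ → Eu m → V} {h : Eu m → ℝ} {n c : ℕ}

theorem integrableOn_primInt (hK : ∀ x, StronglyMeasurable fun v => K v x)
    (hn : n + 1 < c) (hb : ∀ v, 0 < v → ∀ x, ‖K v x‖ ≤ h x * (nrm v x ^ c)⁻¹)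
    {u : ℝ} (hu : 0 ≤ u) {x : Eu m} (h0 : 0 < nrm u x) :
    IntegrableOn (fun w => w ^ (n : ℝ) • K (u + w) x) (Ioi 0) := by
  have hnc : (n : ℝ) + 1 < c := by exact_mod_cast hn
  have hn0 : (0 : ℝ) ≤ n := by positivity
  refine ((integrableOn_rpow_mul_nrm (b := n) (c := c) (by linarith) (by linarith) hu h0).const_mul
    (h x)).mono' ?_ ?_
  · exact ((by fun_prop : Measurable fun w : ℝ => w ^ (n : ℝ)).stronglyMeasurable.smul
      ((hK x).comp_measurable (measurable_const_add u))).aestronglyMeasurable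
  · filter_upwards [ae_restrict_mem measurableSet_Ioi] with w hw
    have hw0 : 0 < w := hw
    rw [norm_smul, norm_of_nonneg (by positivity)]
    calc _ ≤ w ^ (n : ℝ) * (h x * (nrm (u + w) x ^ c)⁻¹) := by
          gcongr; exact hb _ (by linarith) x
      _ = _ := by ring

theorem integral_norm_primInt_le (hK : ∀ x, StronglyMeasurable fun v => K v x)
    (hn : n + 1 < c) (hb : ∀ v, 0 < v → ∀ x, ‖K v x‖ ≤ h x * (nrm v x ^ c)⁻¹)
    {u : ℝ} (hu : 0 ≤ u) {x : Eu m} (hx : x ≠ 0) :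
    ∫ w in Ioi (0 : ℝ), ‖w ^ (n : ℝ) • K (u + w) x‖ ≤
      1 / 2 * Gamma (((n : ℝ) + 1) / 2) * Gamma ((c - n - 1) / 2) / Gamma ((c : ℝ) / 2) *
        (h x * ‖x‖ ^ ((n : ℝ) + 1 - c)) := by
  have hnc : (n : ℝ) + 1 < c := by exact_mod_cast hn
  have hn0 : (0 : ℝ) ≤ n := by positivity
  have h00 : 0 < nrm 0 x := by rw [nrm_zero]; exact norm_pos_iff.2 hx
  have hux : 0 < nrm u x := h00.trans_le (nrm_mono le_rfl hu x)
  have hI := integrableOn_rpow_mul_nrm (b := n) (c := c) (by linarith) (by linarith) le_rfl h00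
  have hv := integral_rpow_mul_nrm (a := n) (c := c) (by linarith) (by linarith) hx
  simp only [zero_add] at hI
  have hh : 0 ≤ h x := by
    have := (norm_nonneg _).trans (hb 1 one_pos x)
    have hp : 0 < (nrm 1 x ^ c)⁻¹ := by have := nrm_pos one_pos x; positivity
    exact nonneg_of_mul_nonneg_left this hp
  calc _ ≤ ∫ w in Ioi (0 : ℝ), h x * (w ^ (n : ℝ) * (nrm w x ^ c)⁻¹) := by
        refine setIntegral_mono_on (integrableOn_primInt hK hn hb hu hux).norm (hI.const_mul _)
          measurableSet_Ioi fun w hw => ?_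
        have hw0 : 0 < w := hw
        have hnw := nrm_pos hw0 x
        rw [norm_smul, norm_of_nonneg (by positivity)]
        calc _ ≤ w ^ (n : ℝ) * (h x * (nrm (u + w) x ^ c)⁻¹) := by
              gcongr; exact hb _ (by linarith) x
          _ ≤ w ^ (n : ℝ) * (h x * (nrm w x ^ c)⁻¹) := by
              gcongr; exact nrm_mono hw0.le (by linarith) x
          _ = _ := by ring
    _ = _ := by rw [integral_const_mul, hv]; ring

theorem norm_primInt_le (hK : ∀ x, StronglyMeasurable fun v => K v x)
    (hn : n + 1 < c) (hb : ∀ v, 0 < v → ∀ x, ‖K v x‖ ≤ h x * (nrm v x ^ c)⁻¹)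
    {u : ℝ} (hu : 0 ≤ u) {x : Eu m} (hx : x ≠ 0) :
    ‖primInt K n u x‖ ≤ (n.factorial : ℝ)⁻¹ *
      (1 / 2 * Gamma (((n : ℝ) + 1) / 2) * Gamma ((c - n - 1) / 2) / Gamma ((c : ℝ) / 2) *
        (h x * ‖x‖ ^ ((n : ℝ) + 1 - c))) := by
  rw [primInt, norm_smul, norm_of_nonneg (by positivity)]
  gcongr
  exact (norm_integral_le_integral_norm _).trans (integral_norm_primInt_le hK hn hb hu hx)

theorem tendsto_primInt (hK : ∀ x, StronglyMeasurable fun v => K v x)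
    (hcont : ∀ x v, 0 < v → ContinuousAt (fun v => K v x) v)
    (hn : n + 1 < c) (hb : ∀ v, 0 < v → ∀ x, ‖K v x‖ ≤ h x * (nrm v x ^ c)⁻¹)
    {x : Eu m} (hx : x ≠ 0) :
    Tendsto (fun u => primInt K n u x) (𝓝[>] 0) (𝓝 (primInt K n 0 x)) := by
  have hnc : (n : ℝ) + 1 < c := by exact_mod_cast hn
  have hn0 : (0 : ℝ) ≤ n := by positivity
  have h00 : 0 < nrm 0 x := by rw [nrm_zero]; exact norm_pos_iff.2 hx
  have hI := integrableOn_rpow_mul_nrm (b := n) (c := c) (by linarith) (by linarith) le_rfl h00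
  simp only [zero_add] at hI
  have hh : 0 ≤ h x := by
    have := (norm_nonneg _).trans (hb 1 one_pos x)
    have hp : 0 < (nrm 1 x ^ c)⁻¹ := by have := nrm_pos one_pos x; positivity
    exact nonneg_of_mul_nonneg_left this hp
  refine Tendsto.const_smul ?_ _
  refine tendsto_integral_filter_of_dominated_convergence
    (fun w => h x * (w ^ (n : ℝ) * (nrm w x ^ c)⁻¹)) ?_ ?_ (hI.const_mul _) ?_
  · refine Eventually.of_forall fun u => ?_
    exact ((by fun_prop : Measurable fun w : ℝ => w ^ (n : ℝ)).stronglyMeasurable.smul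
      ((hK x).comp_measurable (measurable_const_add u))).aestronglyMeasurable
  · filter_upwards [self_mem_nhdsWithin] with u hu
    have hu0 : 0 < u := hu
    filter_upwards [ae_restrict_mem measurableSet_Ioi] with w hw
    have hw0 : 0 < w := hw
    have hnw := nrm_pos hw0 x
    rw [norm_smul, norm_of_nonneg (by positivity)]
    calc _ ≤ w ^ (n : ℝ) * (h x * (nrm (u + w) x ^ c)⁻¹) := by
          gcongr; exact hb _ (by linarith) x
      _ ≤ w ^ (n : ℝ) * (h x * (nrm w x ^ c)⁻¹) := by
          gcongr; exact nrm_mono hw0.le (by linarith) x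
      _ = _ := by ring
  · filter_upwards [ae_restrict_mem measurableSet_Ioi] with w hw
    refine Tendsto.const_smul ?_ _
    have h1 : Tendsto (fun u : ℝ => u + w) (𝓝[>] 0) (𝓝 (0 + w)) :=
      ((continuous_add_const w).tendsto 0).mono_left nhdsWithin_le_nhds
    have h2 : ContinuousAt (fun v => K v x) (0 + w) := by
      rw [zero_add]; exact hcont x w hw
    exact h2.tendsto.comp h1

end Dominated

end

section

/-! ### Tempered functions -/

section Schwartz

variable {F : Type*} [NormedAddCommGroup F] [NormedSpace ℝ F]

theorem schwartz_norm_iteratedFDeriv_le (φ : 𝓢(Eu m, F)) (k n : ℕ) :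
    ∃ C, 0 ≤ C ∧ ∀ x, ‖iteratedFDeriv ℝ n φ x‖ ≤ C * ((1 + ‖x‖) ^ k)⁻¹ := by
  refine ⟨2 ^ k * (Finset.Iic (k, n)).sup (fun m => SchwartzMap.seminorm ℝ m.1 m.2) φ,
    by positivity, fun x => ?_⟩
  have h := SchwartzMap.one_add_le_sup_seminorm_apply (𝕜 := ℝ) (m := (k, n)) le_rfl le_rfl φ x
  rw [← div_eq_mul_inv, le_div_iff₀ (by positivity), mul_comm]
  exact h

theorem schwartz_norm_le (φ : 𝓢(Eu m, F)) (k : ℕ) :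
    ∃ C, 0 ≤ C ∧ ∀ x, ‖φ x‖ ≤ C * ((1 + ‖x‖) ^ k)⁻¹ := by
  obtain ⟨C, h0, h⟩ := schwartz_norm_iteratedFDeriv_le φ k 0
  exact ⟨C, h0, fun x => by simpa using h x⟩

theorem one_add_norm_le_mul {E : Type*} [NormedAddCommGroup E] (x y : E) :
    1 + ‖x‖ ≤ (1 + ‖y‖) * (1 + ‖x + y‖) := by
  have h : ‖x‖ ≤ ‖x + y‖ + ‖y‖ := by
    have := norm_sub_le (x + y) y; rwa [add_sub_cancel_right] at this
  nlinarith [norm_nonneg y, norm_nonneg (x + y), mul_nonneg (norm_nonneg y) (norm_nonneg (x + y))]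

theorem inv_one_add_norm_pow_le {E : Type*} [NormedAddCommGroup E] (x y : E) (k : ℕ) :
    ((1 + ‖x + y‖) ^ k)⁻¹ ≤ (1 + ‖x‖) ^ k * ((1 + ‖y‖) ^ k)⁻¹ := by
  rw [← div_eq_mul_inv, le_div_iff₀ (by positivity), inv_mul_le_iff₀ (by positivity), ← mul_pow]
  gcongr
  have := one_add_norm_le_mul y x
  rw [add_comm y x] at this
  linarith

end Schwartz

/-- Functions that define tempered distributions by integration. -/
def IsTempered (k : Eu m → ℂ) : Prop :=
  AEStronglyMeasurable k ∧ ∃ M : ℕ, Integrable fun x => k x * (((1 + ‖x‖) ^ M)⁻¹ : ℝ)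

section

variable {F : Type*} [NormedAddCommGroup F] [NormedSpace ℂ F] {k : Eu m → ℂ}

theorem IsTempered.exists_norm_le (h : IsTempered k) : ∃ (M : ℕ) (g : Eu m → ℝ), Integrable g ∧
    (∀ x, 0 ≤ g x) ∧ ∀ x, ‖k x‖ = g x * (1 + ‖x‖) ^ M := by
  obtain ⟨hm, M, hM⟩ := h
  refine ⟨M, _, hM.norm, fun _ => norm_nonneg _, fun x => ?_⟩
  rw [norm_mul, Complex.norm_real, norm_of_nonneg (by positivity)]
  field_simp

theorem IsTempered.integrable_smul_of_le (h : IsTempered k) {f : Eu m → F}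
    (hf : AEStronglyMeasurable f) (hb : ∀ M : ℕ, ∃ C, ∀ x, ‖f x‖ ≤ C * ((1 + ‖x‖) ^ M)⁻¹) :
    Integrable fun x => k x • f x := by
  obtain ⟨M, g, hg, hg0, hk⟩ := h.exists_norm_le
  obtain ⟨C, hC⟩ := hb M
  refine (hg.mul_const C).mono' (h.1.smul hf) (Eventually.of_forall fun x => ?_)
  rw [norm_smul, hk]
  calc _ ≤ g x * (1 + ‖x‖) ^ M * (C * ((1 + ‖x‖) ^ M)⁻¹) := by
        have := hg0 x
        gcongr; exact hC x
    _ = _ := by field_simp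

theorem IsTempered.integrable_smul (h : IsTempered k) (φ : 𝓢(Eu m, F)) (x : Eu m) :
    Integrable fun y => k y • φ (x + y) := by
  refine h.integrable_smul_of_le ((φ.continuous.comp (by fun_prop)).aestronglyMeasurable)
    fun M => ?_
  obtain ⟨C, hC0, hC⟩ := schwartz_norm_le φ M
  refine ⟨C * (1 + ‖x‖) ^ M, fun y => (hC _).trans ?_⟩
  rw [mul_assoc]
  gcongr
  exact inv_one_add_norm_pow_le x y M

theorem IsTempered.integrable_mul (h : IsTempered k) (φ : 𝓢(Eu m, ℂ)) :
    Integrable fun y => k y * φ y := by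
  simpa using h.integrable_smul φ 0

/-- The tempered distribution defined by a tempered function. -/
def IsTempered.toDist (h : IsTempered k) : 𝓢'(Eu m, ℂ) :=
  ContinuousLinearMap.toPointwiseConvergenceCLM _ _ _ _ <|
    SchwartzMap.mkCLMtoNormedSpace (𝕜 := ℂ) (𝕜' := ℂ) (fun φ : 𝓢(Eu m, ℂ) => ∫ x, k x * φ x)
      (fun φ ψ => by
        simp only [add_apply, mul_add]
        exact integral_add (h.integrable_mul φ) (h.integrable_mul ψ))
      (fun a φ => by
        simp only [smul_apply, smul_eq_mul, RingHom.id_apply]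
        rw [← integral_const_mul]
        congr 1; ext x; ring)
      (by
        obtain ⟨M, g, hg, hg0, hk⟩ := h.exists_norm_le
        refine ⟨Finset.Iic (M, 0), (∫ x, g x) * 2 ^ M,
          mul_nonneg (integral_nonneg hg0) (by positivity), fun φ => ?_⟩
        set S := (Finset.Iic (M, 0)).sup (schwartzSeminormFamily ℂ (Eu m) ℂ) φ
        refine (norm_integral_le_integral_norm _).trans ?_
        rw [mul_assoc, ← integral_mul_const]
        refine integral_mono (h.integrable_mul φ).norm (hg.mul_const _) fun x => ?_
        have h1 := SchwartzMap.one_add_le_sup_seminorm_apply (𝕜 := ℂ) (m := (M, 0)) le_rfl le_rfl φ x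
        rw [norm_iteratedFDeriv_zero] at h1
        simp only [norm_mul]
        rw [hk, mul_assoc]
        exact mul_le_mul_of_nonneg_left h1 (hg0 x))

theorem IsTempered.toDist_apply (h : IsTempered k) (φ : 𝓢(Eu m, ℂ)) :
    h.toDist φ = ∫ x, k x * φ x := rfl

/-- The correlation of a tempered function with a Schwartz function is smooth. -/
theorem IsTempered.hasFDerivAt_correlation (h : IsTempered k) (φ : 𝓢(Eu m, F)) (x : Eu m) :
    HasFDerivAt (fun x => ∫ y, k y • φ (x + y))
      (∫ y, k y • (SchwartzMap.fderivCLM ℝ (Eu m) F φ) (x + y)) x := by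
  obtain ⟨M, g, hg, hg0, hk⟩ := h.exists_norm_le
  obtain ⟨C, hC0, hC⟩ := schwartz_norm_le (SchwartzMap.fderivCLM ℝ (Eu m) F φ) M
  refine hasFDerivAt_integral_of_dominated_of_fderiv_le (s := Metric.ball x 1)
    (bound := fun y => g y * (C * (2 + ‖x‖) ^ M)) (F := fun x y => k y • φ (x + y))
    (F' := fun x y => k y • (SchwartzMap.fderivCLM ℝ (Eu m) F φ) (x + y))
    (Metric.ball_mem_nhds x one_pos)
    (Eventually.of_forall fun z => (h.integrable_smul φ z).1) (h.integrable_smul φ x)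
    (h.integrable_smul (SchwartzMap.fderivCLM ℝ (Eu m) F φ) x).1
    (Eventually.of_forall fun y z hz => ?_) (hg.mul_const _) (Eventually.of_forall fun y z _ => ?_)
  · have hz' : ‖z‖ ≤ 1 + ‖x‖ := by
      have h1 : ‖z - x‖ < 1 := by simpa [dist_eq_norm] using hz
      have h2 := norm_add_le (z - x) x
      rw [sub_add_cancel] at h2
      linarith
    rw [norm_smul, hk]
    calc _ ≤ g y * (1 + ‖y‖) ^ M * (C * ((2 + ‖x‖) ^ M * ((1 + ‖y‖) ^ M)⁻¹)) := by
          have := hg0 y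
          gcongr
          refine (hC _).trans ?_
          gcongr
          refine (inv_one_add_norm_pow_le z y M).trans ?_
          refine mul_le_mul_of_nonneg_right ?_ (by positivity)
          exact pow_le_pow_left₀ (by positivity) (by linarith) M
      _ = _ := by field_simp
  · have h1 := (φ.hasFDerivAt (z + y)).comp z ((hasFDerivAt_id z).add_const y)
    exact h1.const_smul (k y)

theorem IsTempered.contDiff_correlation {F : Type} [NormedAddCommGroup F] [NormedSpace ℂ F]
    (h : IsTempered k) (φ : 𝓢(Eu m, F)) (n : ℕ) :
    ContDiff ℝ n (fun x => ∫ y, k y • φ (x + y)) := by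
  induction n generalizing F with
  | zero =>
    exact contDiff_zero.2 (continuous_iff_continuousAt.2
      fun x => (h.hasFDerivAt_correlation φ x).continuousAt)
  | succ n ih =>
    refine contDiff_succ_iff_hasFDerivAt.2
      ⟨_, ih (SchwartzMap.fderivCLM ℝ (Eu m) F φ), fun x => h.hasFDerivAt_correlation φ x⟩

end

/-! ### Distributions with a symbol -/

variable {p q : Eu m → ℂ}

theorem IsSymbol.isTempered (hp : IsSymbol p) : IsTempered p := by
  obtain ⟨C, N, hC⟩ := hp.growth
  refine ⟨hp.measurable.aestronglyMeasurable, N + (m + 1), ?_⟩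
  have hi : Integrable (fun x : Eu m => C * (1 + ‖x‖) ^ (-((m : ℝ) + 1))) :=
    (integrable_one_add_norm (by simp)).const_mul C
  refine hi.mono' ?_ (Eventually.of_forall fun x => ?_)
  · have := hp.measurable
    exact Measurable.aestronglyMeasurable (by fun_prop)
  · rw [norm_mul, Complex.norm_real, norm_of_nonneg (by positivity), rpow_neg
      (by positivity), show (m : ℝ) + 1 = ((m + 1 : ℕ) : ℝ) by push_cast; ring, rpow_natCast]
    calc _ ≤ C * (1 + ‖x‖) ^ N * ((1 + ‖x‖) ^ (N + (m + 1)))⁻¹ := by gcongr; exact hC x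
      _ = _ := by rw [pow_add]; field_simp

/-- The tempered distribution with Fourier symbol `p`. -/
def IsSymbol.toDist (hp : IsSymbol p) : 𝓢'(Eu m, ℂ) :=
  ContinuousLinearMap.toPointwiseConvergenceCLM _ _ _ _ <|
    (show 𝓢(Eu m, ℂ) →L[ℂ] ℂ from hp.isTempered.toDist) ∘L (fourierCLM ℂ 𝓢(Eu m, ℂ))

theorem IsSymbol.toDist_apply (hp : IsSymbol p) (φ : 𝓢(Eu m, ℂ)) :
    hp.toDist φ = ∫ ξ, p ξ * 𝓕 φ ξ := rfl

theorem fourier_shift (x : Eu m) (φ : 𝓢(Eu m, ℂ)) (ξ : Eu m) :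
    𝓕 (shift x φ) ξ = Complex.exp (((2 * π * inner ℝ ξ x : ℝ) : ℂ) * Complex.I) * 𝓕 φ ξ := by
  have h := congrFun (VectorFourier.fourierIntegral_comp_add_right Real.fourierChar
    (volume : Measure (Eu m)) (innerₗ (Eu m)) φ x) ξ
  have e : (φ ∘ fun v => v + x) = shift x φ := by
    ext y; simp [shift_apply, add_comm]
  rw [e] at h
  refine h.trans ?_
  rw [Circle.smul_def, Real.fourierChar_apply, smul_eq_mul]
  congr 2
  simp only [innerₗ_apply_apply, real_inner_comm]

theorem IsSymbol.toDist_shift (hp : IsSymbol p) (φ : 𝓢(Eu m, ℂ)) (x : Eu m) :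
    hp.toDist (shift x φ) = 𝓕⁻ (fun ξ => p ξ * 𝓕 φ ξ) x := by
  rw [hp.toDist_apply, Real.fourierInv_eq']
  congr 1; ext ξ
  rw [fourier_shift, smul_eq_mul]
  ring

theorem IsSymbol.integrable_pow_mul (hp : IsSymbol p) (φ : 𝓢(Eu m, ℂ)) (n : ℕ) :
    Integrable fun ξ => ‖ξ‖ ^ n * ‖p ξ * φ ξ‖ := by
  have h := ((IsSymbol.norm.pow n).mul hp).integrable_mul φ
  refine h.norm.congr (Eventually.of_forall fun ξ => ?_)
  simp [mul_assoc]

theorem IsSymbol.contDiff_toDist_shift (hp : IsSymbol p) (φ : 𝓢(Eu m, ℂ)) :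
    ContDiff ℝ ∞ fun x => hp.toDist (shift x φ) := by
  have h : ContDiff ℝ ∞ (𝓕 (fun ξ => p ξ * 𝓕 φ ξ)) :=
    contDiff_infty.2 fun n => Real.contDiff_fourier (N := n)
      (fun k _ => hp.integrable_pow_mul (𝓕 φ) k)
  have h2 := h.comp (contDiff_neg (𝕜 := ℝ) (F := Eu m))
  have e : (fun x => hp.toDist (shift x φ)) = 𝓕 (fun ξ => p ξ * 𝓕 φ ξ) ∘ fun x => -x := by
    ext x
    rw [hp.toDist_shift, Real.fourierInv_eq_fourier_neg]
    rfl
  rw [e]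
  exact h2

/-- Correlation with a distribution whose kernel decays like `|x|^{-d}`. -/
theorem IsSymbol.norm_toDist_shift_le (hp : IsSymbol p) {d : ℕ} (hd : HasKernelDecay p d)
    (φ : 𝓢(Eu m, ℂ)) :
    ∃ C, 0 ≤ C ∧ ∀ x, ‖hp.toDist (shift x φ)‖ ≤ C * ((1 + ‖x‖) ^ d)⁻¹ := by
  obtain ⟨Ck, hCk0, hCk⟩ := hd
  let b : ContDiffBump (0 : Eu m) := ⟨1 / 2, 1, by norm_num, by norm_num⟩
  let χ : 𝓢(Eu m, ℂ) := (b.hasCompactSupport.comp_left (g := Complex.ofReal) rfl).toSchwartzMap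
    (Complex.ofRealCLM.contDiff.comp b.contDiff)
  have hχ : ∀ y, χ y = (b y : ℂ) := fun y => rfl
  have hgr : Function.HasTemperateGrowth (χ : Eu m → ℂ) := χ.hasTemperateGrowth
  -- the part near the origin
  obtain ⟨s, Cs, -, hCs⟩ := Seminorm.bound_of_continuous (schwartz_withSeminorms ℂ (Eu m) ℂ)
    ((normSeminorm ℂ ℂ).comp (show 𝓢(Eu m, ℂ) →L[ℂ] ℂ from hp.toDist).toLinearMap)
    (continuous_norm.comp (show 𝓢(Eu m, ℂ) →L[ℂ] ℂ from hp.toDist).continuous)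
  have hsem : ∀ k n : ℕ, ∃ C, 0 ≤ C ∧ ∀ x, SchwartzMap.seminorm ℂ k n
      (SchwartzMap.smulLeftCLM ℂ χ (shift x φ)) ≤ C * ((1 + ‖x‖) ^ d)⁻¹ := by
    intro k n
    choose A hA0 hA using fun i : ℕ => schwartz_norm_iteratedFDeriv_le χ (k + d) i
    choose B hB0 hB using fun i : ℕ => schwartz_norm_iteratedFDeriv_le φ d i
    refine ⟨∑ i ∈ Finset.range (n + 1), (n.choose i : ℝ) * A i * B (n - i),
      Finset.sum_nonneg fun i _ => by have := hA0 i; have := hB0 (n - i); positivity, fun x => ?_⟩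
    have hB0' : ∀ i, 0 ≤ B i := hB0
    have hA0' : ∀ i, 0 ≤ A i := hA0
    refine SchwartzMap.seminorm_le_bound ℂ k n _ (mul_nonneg (Finset.sum_nonneg fun i _ => by
      have := hA0 i; have := hB0 (n - i); positivity) (by positivity)) fun y => ?_
    rw [SchwartzMap.smulLeftCLM_apply hgr]
    simp only [smul_eq_mul]
    have h1 := norm_iteratedFDeriv_mul_le (𝕜 := ℝ) (χ.smooth n) ((shift x φ).smooth n) y le_rfl
    have h2 : ∀ i, ‖iteratedFDeriv ℝ i (shift x φ) y‖ ≤ B i * ((1 + ‖x + y‖) ^ d)⁻¹ := by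
      intro i
      have e : (shift x φ : Eu m → ℂ) = fun y => φ (x + y) := funext fun y => shift_apply x y φ
      rw [e, iteratedFDeriv_comp_add_left]
      exact hB i _
    have h3 : ((1 + ‖x + y‖) ^ d)⁻¹ ≤ (1 + ‖y‖) ^ d * ((1 + ‖x‖) ^ d)⁻¹ := by
      have := inv_one_add_norm_pow_le y x d
      rwa [add_comm y x] at this
    calc _ ≤ ‖y‖ ^ k * ∑ i ∈ Finset.range (n + 1), (n.choose i : ℝ) *
          ‖iteratedFDeriv ℝ i χ y‖ * ‖iteratedFDeriv ℝ (n - i) (shift x φ) y‖ := by gcongr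
      _ ≤ (1 + ‖y‖) ^ k * ∑ i ∈ Finset.range (n + 1), (n.choose i : ℝ) *
          (A i * ((1 + ‖y‖) ^ (k + d))⁻¹) *
            (B (n - i) * ((1 + ‖y‖) ^ d * ((1 + ‖x‖) ^ d)⁻¹)) := by
          gcongr with i hi
          · linarith [norm_nonneg y]
          · exact mul_nonneg (Nat.cast_nonneg _) (mul_nonneg (hA0 i) (by positivity))
          · exact hA i y
          · refine (h2 _).trans ?_
            gcongr
            exact hB0 _
      _ = _ := by
          rw [Finset.mul_sum, Finset.sum_mul]
          refine Finset.sum_congr rfl fun i _ => ?_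
          rw [pow_add]
          field_simp
  choose D hD0 hD using fun kn : ℕ × ℕ => hsem kn.1 kn.2
  have hnear : ∀ x, ‖hp.toDist (SchwartzMap.smulLeftCLM ℂ χ (shift x φ))‖ ≤
      (Cs * ∑ kn ∈ s, D kn) * ((1 + ‖x‖) ^ d)⁻¹ := by
    intro x
    have h1 := hCs (SchwartzMap.smulLeftCLM ℂ χ (shift x φ))
    refine le_trans h1 ?_
    rw [smul_apply, NNReal.smul_def, smul_eq_mul, mul_assoc]
    gcongr
    rw [Finset.sum_mul]
    refine (Seminorm.finset_sup_apply_le (Finset.sum_nonneg fun kn _ => mul_nonneg (hD0 kn)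
      (by positivity)) fun kn hkn => ?_)
    refine (hD kn x).trans ?_
    exact Finset.single_le_sum (f := fun kn => D kn * ((1 + ‖x‖) ^ d)⁻¹)
      (fun kn _ => mul_nonneg (hD0 kn) (by positivity)) hkn
  -- the part away from the origin
  obtain ⟨B, hB0, hB⟩ := schwartz_norm_le φ (d + (m + 1))
  have hI : Integrable fun z : Eu m => ((1 + ‖z‖) ^ (m + 1))⁻¹ := by
    have := integrable_one_add_norm (E := Eu m) (μ := volume) (r := (m : ℝ) + 1) (by simp)
    refine this.congr (Eventually.of_forall fun z => ?_)
    simp only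
    rw [rpow_neg (by positivity), show (m : ℝ) + 1 = ((m + 1 : ℕ) : ℝ) by push_cast; ring,
      rpow_natCast]
  set J := ∫ z : Eu m, ((1 + ‖z‖) ^ (m + 1))⁻¹
  have hJ0 : 0 ≤ J := integral_nonneg fun z => by positivity
  have hfar : ∀ x, ‖hp.toDist (shift x φ - SchwartzMap.smulLeftCLM ℂ χ (shift x φ))‖ ≤
      (Ck * 3 ^ d * B * J) * ((1 + ‖x‖) ^ d)⁻¹ := by
    intro x
    refine le_of_tendsto (hp.tendsto_integral_symbolKernel _).norm ?_
    filter_upwards [self_mem_nhdsWithin] with u hu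
    have hu0 : 0 < u := hu
    refine (norm_integral_le_integral_norm _).trans ?_
    have hJx : Integrable fun y : Eu m => ((1 + ‖x + y‖) ^ (m + 1))⁻¹ := by
      simpa using hI.comp_add_left x
    have hJxe : ∫ y : Eu m, ((1 + ‖x + y‖) ^ (m + 1))⁻¹ = J :=
      integral_add_left_eq_self (fun z : Eu m => ((1 + ‖z‖) ^ (m + 1))⁻¹) x
    rw [← hJxe, mul_right_comm, ← integral_const_mul]
    refine integral_mono (hp.integrable_symbolKernel_mul hu0 _).norm (hJx.const_mul _) fun y => ?_
    simp only [sub_apply, SchwartzMap.smulLeftCLM_apply_apply hgr, smul_eq_mul,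
      norm_mul, shift_apply, hχ]
    rcases le_or_gt ‖y‖ (1 / 2) with hy | hy
    · have : b y = 1 := b.one_of_mem_closedBall (by
        rw [mem_closedBall_zero_iff]; exact hy)
      rw [this]
      simp only [Complex.ofReal_one, one_mul, sub_self, norm_zero, mul_zero]
      positivity
    · have h1 : ‖φ (x + y) - (b y : ℂ) * φ (x + y)‖ ≤ ‖φ (x + y)‖ := by
        have e : φ (x + y) - (b y : ℂ) * φ (x + y) = ((1 - b y : ℝ) : ℂ) * φ (x + y) := by
          push_cast; ring
        rw [e, norm_mul, Complex.norm_real, norm_of_nonneg (by linarith [b.le_one (x := y)])]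
        have := b.nonneg (x := y)
        nlinarith [norm_nonneg (φ (x + y))]
      have h2 : (nrm u y ^ d)⁻¹ ≤ 3 ^ d * ((1 + ‖y‖) ^ d)⁻¹ := by
        have hy0 : 0 < ‖y‖ := by linarith
        have hle : 1 + ‖y‖ ≤ 3 * nrm u y := by linarith [norm_le_nrm u y]
        have hn := nrm_pos hu0 y
        rw [← div_eq_mul_inv, le_div_iff₀ (by positivity), inv_mul_le_iff₀ (by positivity),
          ← mul_pow]
        gcongr
        linarith
      have h3 := inv_one_add_norm_pow_le y x d
      have h4 : ((1 + ‖y‖) ^ d)⁻¹ ≤ (1 + ‖x + y‖) ^ d * ((1 + ‖x‖) ^ d)⁻¹ := by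
        have h5 := one_add_norm_le_mul x y
        rw [← div_eq_mul_inv, le_div_iff₀ (by positivity), inv_mul_le_iff₀ (by positivity),
          ← mul_pow]
        gcongr
      calc _ ≤ Ck * (3 ^ d * ((1 + ‖x + y‖) ^ d * ((1 + ‖x‖) ^ d)⁻¹)) *
            (B * ((1 + ‖x + y‖) ^ (d + (m + 1)))⁻¹) := by
            refine mul_le_mul ((hCk u hu0 y).trans ?_) (h1.trans (hB _)) (norm_nonneg _)
              (by positivity)
            refine mul_le_mul_of_nonneg_left (h2.trans ?_) hCk0
            gcongr
        _ = _ := by rw [pow_add]; field_simp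
  refine ⟨Cs * ∑ kn ∈ s, D kn + Ck * 3 ^ d * B * J, add_nonneg (mul_nonneg Cs.2
    (Finset.sum_nonneg fun kn _ => hD0 kn)) (by positivity), fun x => ?_⟩
  have e : hp.toDist (shift x φ) = hp.toDist (SchwartzMap.smulLeftCLM ℂ χ (shift x φ)) +
      hp.toDist (shift x φ - SchwartzMap.smulLeftCLM ℂ χ (shift x φ)) := by
    rw [← map_add]; congr 1; abel
  rw [e, add_mul]
  exact (norm_add_le _ _).trans (add_le_add (hnear x) (hfar x))

end

theorem integral_mul_fourierInv {f g : Eu m → ℂ} (hf : Integrable f) (hg : Integrable g) :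
    ∫ x, f x * 𝓕⁻ g x = ∫ ξ, 𝓕⁻ f ξ * g ξ := by
  have h2 := VectorFourier.integral_fourierIntegral_smul_eq_flip (μ := (volume : Measure (Eu m)))
    (ν := (volume : Measure (Eu m))) (L := -innerₗ (Eu m)) Real.continuous_fourierChar
    (by exact continuous_inner.neg) hf hg (𝕜 := ℝ)
  have h3 : (-innerₗ (Eu m)).flip = -innerₗ (Eu m) := by
    ext a b; simp [real_inner_comm]
  rw [h3] at h2
  exact h2.symm

/-- Pairing an integrable kernel with a function of known Fourier transform. -/
theorem integral_symbolKernel_mul_fourierInv {p g : Eu m → ℂ} (hp : IsSymbol p)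
    (hpc : Continuous p) {t : ℝ} (ht : 0 < t) (hK : Integrable (symbolKernel p t))
    (hg : Integrable g) :
    ∫ x, symbolKernel p t x * 𝓕⁻ g x = ∫ ξ, damp p t ξ * g ξ := by
  rw [integral_mul_fourierInv hK hg, symbolKernel, Continuous.fourierInv_fourier_eq _
    (hp.integrable_damp ht) hK]
  unfold damp; fun_prop

theorem integrableOn_rpow_mul_exp_neg (n : ℕ) {b : ℝ} (hb : 0 < b) :
    IntegrableOn (fun w : ℝ => w ^ (n : ℝ) * Real.exp (-(b * w))) (Ioi 0) := by
  have := integrableOn_rpow_mul_exp_neg_mul_rpow (s := n) (p := 1) (b := b)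
    (by have : (0 : ℝ) ≤ n := by positivity
        linarith) one_pos hb
  simpa using this

theorem integral_rpow_mul_exp_neg (n : ℕ) {b : ℝ} (hb : 0 < b) :
    ∫ w in Ioi (0 : ℝ), w ^ (n : ℝ) * Real.exp (-(b * w)) * b ^ (n + 1) = n.factorial := by
  have h := Real.integral_rpow_mul_exp_neg_mul_Ioi (a := n + 1) (r := b) (by positivity) hb
  rw [integral_mul_const]
  simp only [add_sub_cancel_right] at h
  rw [h, Gamma_nat_eq_factorial]
  have : ((n : ℝ) + 1) = ((n + 1 : ℕ) : ℝ) := by push_cast; ring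
  rw [this, rpow_natCast, one_div, inv_pow]
  field_simp

/-- Upstream kernels divide the Fourier transform by a power of `2π|ξ|`. -/
theorem integral_primInt_mul_fourierInv (hm : 1 ≤ m) {p g ρ : Eu m → ℂ} (hp : IsSymbol p)
    (hpc : Continuous p) {K : ℝ → Eu m → ℝ} (hKm : Measurable (Function.uncurry K))
    (hK : ∀ v, 0 < v → ∀ x, symbolKernel p v x = K v x) (hKi : ∀ v, 0 < v → Integrable (K v))
    {n : ℕ} {u : ℝ} (hu : 0 ≤ u) {G : Eu m → ℝ}
    (hKw : ∀ x, x ≠ 0 → IntegrableOn (fun w => w ^ (n : ℝ) • K (u + w) x) (Ioi 0))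
    (hG : ∀ x, x ≠ 0 → ∫ w in Ioi (0 : ℝ), ‖w ^ (n : ℝ) • K (u + w) x‖ ≤ G x)
    (hg : Integrable g) (hρ : Integrable ρ) (hGi : Integrable fun x => G x * ‖𝓕⁻ g x‖)
    (h : ∀ ξ, p ξ * g ξ = ((2 * π * ‖ξ‖ : ℝ) : ℂ) ^ (n + 1) * ρ ξ) :
    ∫ x, ((primInt K n u x : ℝ) : ℂ) * 𝓕⁻ g x =
      ∫ ξ, (Real.exp (-(2 * π * u * ‖ξ‖)) : ℂ) * ρ ξ := by
  have : Nonempty (Fin m) := ⟨⟨0, hm⟩⟩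
  have hae : ∀ᵐ x : Eu m, x ≠ 0 := by
    simp [ae_iff]
  have hτ : AEStronglyMeasurable (𝓕⁻ g) := by
    have : Continuous (𝓕⁻ g) := by
      have := VectorFourier.fourierIntegral_continuous (μ := (volume : Measure (Eu m)))
        Real.continuous_fourierChar (L := -innerₗ (Eu m)) (by exact continuous_inner.neg) hg
      exact this
    exact this.aestronglyMeasurable
  set μ : Measure ℝ := volume.restrict (Ioi 0) with hμ
  set f : ℝ × Eu m → ℂ := fun q => ((q.1 ^ (n : ℝ) • K (u + q.1) q.2 : ℝ) : ℂ) * 𝓕⁻ g q.2 with hf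
  have hfm : AEStronglyMeasurable f (μ.prod volume) := by
    refine AEStronglyMeasurable.mul ?_ (hτ.comp_snd)
    refine (Complex.measurable_ofReal.comp ?_).aestronglyMeasurable
    have : Measurable fun q : ℝ × Eu m => K (u + q.1) q.2 :=
      hKm.comp (f := fun q : ℝ × Eu m => (u + q.1, q.2)) (by fun_prop)
    simp only [smul_eq_mul]
    fun_prop
  have hfi : Integrable f (μ.prod volume) := by
    rw [integrable_prod_iff' hfm]
    constructor
    · filter_upwards [hae] with x hx
      have := ((hKw x hx).ofReal (𝕜 := ℂ)).mul_const (𝓕⁻ g x)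
      exact this
    · refine hGi.mono' ?_ ?_
      · exact hfm.norm.prod_swap.integral_prod_right'
      · filter_upwards [hae] with x hx
        rw [norm_of_nonneg (by positivity)]
        simp only [hf, norm_mul, Complex.norm_real]
        rw [integral_mul_const]
        exact mul_le_mul_of_nonneg_right (hG x hx) (norm_nonneg _)
  have h1 : ∫ x, ((primInt K n u x : ℝ) : ℂ) * 𝓕⁻ g x =
      (n.factorial : ℂ)⁻¹ * ∫ w, ∫ x, f (w, x) ∂volume ∂μ := by
    rw [integral_integral_swap (f := fun w x => f (w, x)) hfi, ← integral_const_mul]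
    refine integral_congr_of_eq fun x => ?_
    simp only [primInt, hf]
    rw [integral_mul_const]
    have := integral_complex_ofReal (μ := μ) (f := fun w => w ^ (n : ℝ) • K (u + w) x)
    rw [this]
    push_cast [smul_eq_mul]
    ring
  set q : ℝ × Eu m → ℂ := fun z => ((z.1 ^ (n : ℝ) * Real.exp (-(2 * π * ‖z.2‖ * z.1)) *
    (2 * π * ‖z.2‖) ^ (n + 1) : ℝ) : ℂ) * ((Real.exp (-(2 * π * u * ‖z.2‖)) : ℂ) * ρ z.2) with hq
  have h2 : ∀ w ∈ Ioi (0 : ℝ), ∫ x, f (w, x) = ∫ ξ, q (w, ξ) := by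
    intro w hw
    have hw' : 0 < u + w := add_pos_of_nonneg_of_pos hu hw
    have hKc : Integrable (symbolKernel p (u + w)) :=
      (hKi _ hw').ofReal.congr (Eventually.of_forall fun x => (hK _ hw' x).symm)
    have := integral_symbolKernel_mul_fourierInv hp hpc hw' hKc hg
    calc ∫ x, f (w, x) = ((w ^ (n : ℝ) : ℝ) : ℂ) * ∫ x, symbolKernel p (u + w) x * 𝓕⁻ g x := by
          rw [← integral_const_mul]
          refine integral_congr_of_eq fun x => ?_
          simp only [hf, hK _ hw', smul_eq_mul]; push_cast; ring
      _ = ∫ ξ, q (w, ξ) := by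
          rw [this, ← integral_const_mul]
          refine integral_congr_of_eq fun ξ => ?_
          simp only [hq, damp]
          have e : Real.exp (-(2 * π * (u + w) * ‖ξ‖)) = Real.exp (-(2 * π * ‖ξ‖ * w)) *
            Real.exp (-(2 * π * u * ‖ξ‖)) := by rw [← Real.exp_add]; congr 1; ring
          have h' := h ξ
          rw [e]
          push_cast at h' ⊢
          linear_combination ((w ^ (n : ℝ) : ℝ) : ℂ) * Complex.exp (-(2 * π * ‖ξ‖ * w)) *
            Complex.exp (-(2 * π * u * ‖ξ‖)) * h'
  have hqm : AEStronglyMeasurable q (μ.prod volume) := by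
    refine AEStronglyMeasurable.mul ?_ ?_
    · refine Measurable.aestronglyMeasurable ?_
      fun_prop
    · refine AEStronglyMeasurable.mul ?_ hρ.aestronglyMeasurable.comp_snd
      refine Measurable.aestronglyMeasurable ?_
      fun_prop
  have hpos : ∀ ξ : Eu m, ξ ≠ 0 → 0 < 2 * π * ‖ξ‖ := fun ξ hξ => by positivity
  have hei : Integrable fun ξ : Eu m => (Real.exp (-(2 * π * u * ‖ξ‖)) : ℂ) * ρ ξ := by
    refine hρ.norm.mono' (AEStronglyMeasurable.mul ?_ hρ.aestronglyMeasurable) ?_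
    · exact Measurable.aestronglyMeasurable (by fun_prop)
    · refine Eventually.of_forall fun ξ => ?_
      rw [norm_mul, Complex.norm_real, norm_of_nonneg (Real.exp_nonneg _)]
      refine mul_le_of_le_one_left (norm_nonneg _) (Real.exp_le_one_iff.2 ?_)
      have := pi_pos
      have : 0 ≤ 2 * π * u * ‖ξ‖ := by positivity
      linarith
  have hqi : Integrable q (μ.prod volume) := by
    rw [integrable_prod_iff' hqm]
    constructor
    · filter_upwards [hae] with ξ hξ
      have := (((integrableOn_rpow_mul_exp_neg n (hpos ξ hξ)).mul_const
        ((2 * π * ‖ξ‖) ^ (n + 1))).ofReal (𝕜 := ℂ)).mul_const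
        ((Real.exp (-(2 * π * u * ‖ξ‖)) : ℂ) * ρ ξ)
      exact this
    · refine (hei.norm.const_mul (n.factorial : ℝ)).congr ?_
      filter_upwards [hae] with ξ hξ
      simp only [hq]
      simp_rw [norm_mul _ ((Real.exp (-(2 * π * u * ‖ξ‖)) : ℂ) * ρ ξ)]
      rw [integral_mul_const]
      congr 1
      rw [← integral_rpow_mul_exp_neg n (hpos ξ hξ)]
      refine setIntegral_congr_fun measurableSet_Ioi fun w hw => ?_
      have hw : 0 < w := hw
      rw [Complex.norm_real, norm_of_nonneg (by positivity)]
  rw [h1, setIntegral_congr_fun measurableSet_Ioi h2,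
    integral_integral_swap (f := fun w ξ => q (w, ξ)) hqi, ← integral_const_mul]
  refine integral_congr_ae ?_
  filter_upwards [hae] with ξ hξ
  simp only [hq]
  rw [integral_mul_const, integral_complex_ofReal, integral_rpow_mul_exp_neg n (hpos ξ hξ)]
  have : (n.factorial : ℂ) ≠ 0 := by exact_mod_cast n.factorial_ne_zero
  push_cast
  field_simp

section

theorem integrable_rpow_mul_rpow_one_add_norm (hm : 1 ≤ m) {a r : ℝ} (ha : -(m : ℝ) < a)
    (hr : a + m < r) : Integrable fun x : Eu m => ‖x‖ ^ a * (1 + ‖x‖) ^ (-r) := by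
  have hmeas : Measurable fun x : Eu m => ‖x‖ ^ a * (1 + ‖x‖) ^ (-r) := by fun_prop
  rw [← integrableOn_univ, ← Set.union_compl_self (Metric.ball (0 : Eu m) 1)]
  refine IntegrableOn.union ?_ ?_
  · refine integrableOn_ball_of_norm_le_rpow (C := 2 ^ |r|) (α := -a) (by simpa using hm)
      (by simpa using by linarith) ?_ hmeas.aestronglyMeasurable
    filter_upwards [ae_restrict_mem measurableSet_ball] with x hx
    have hx1 : ‖x‖ < 1 := by simpa using hx
    rw [norm_of_nonneg (by positivity), neg_neg, mul_comm]
    gcongr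
    calc (1 + ‖x‖) ^ (-r) ≤ (1 + ‖x‖) ^ |r| :=
          rpow_le_rpow_of_exponent_le (by linarith [norm_nonneg x]) (neg_le_abs r)
      _ ≤ 2 ^ |r| := by gcongr; linarith
  · have hi := (integrable_one_add_norm (E := Eu m) (μ := volume) (r := r - a)
      (by simpa using by linarith)).const_mul ((2 : ℝ) ^ |a|)
    refine (hi.integrableOn (s := (Metric.ball (0 : Eu m) 1)ᶜ)).mono'
      hmeas.aestronglyMeasurable ?_
    filter_upwards [ae_restrict_mem measurableSet_ball.compl] with x hx
    have hx1 : 1 ≤ ‖x‖ := by simpa using hx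
    have h0 : 0 < 1 + ‖x‖ := by positivity
    rw [norm_of_nonneg (by positivity), neg_sub, sub_eq_add_neg, rpow_add h0, ← mul_assoc]
    gcongr
    rcases le_or_gt 0 a with h | h
    · rw [abs_of_nonneg h]
      calc ‖x‖ ^ a ≤ (1 + ‖x‖) ^ a := by gcongr; linarith
        _ ≤ _ := le_mul_of_one_le_left (by positivity) (Real.one_le_rpow (by norm_num) h)
    · rw [abs_of_neg h]
      calc ‖x‖ ^ a ≤ ((1 + ‖x‖) / 2) ^ a :=
            rpow_le_rpow_of_nonpos (by positivity) (by linarith) h.le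
        _ = 2 ^ (-a) * (1 + ‖x‖) ^ a := by
            rw [Real.div_rpow h0.le (by norm_num), rpow_neg (by norm_num)]; field_simp

theorem integrable_rpow_mul_one_add_norm (hm : 1 ≤ m) {a : ℝ} {k : ℕ} (ha : -(m : ℝ) < a)
    (hk : a + m < k) : Integrable fun x : Eu m => ‖x‖ ^ a * ((1 + ‖x‖) ^ k)⁻¹ := by
  refine (integrable_rpow_mul_rpow_one_add_norm hm ha hk).congr (Eventually.of_forall fun x => ?_)
  simp only
  rw [rpow_neg (by positivity), rpow_natCast]

theorem one_add_norm_le_mul_nrm {u : ℝ} (hu : 0 < u) (x : Eu m) :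
    1 + ‖x‖ ≤ (u⁻¹ + 1) * nrm u x := by
  have h1 := le_nrm u x
  have h2 := norm_le_nrm u x
  have h3 : 1 ≤ u⁻¹ * nrm u x := by
    rw [inv_mul_eq_div, one_le_div hu]; exact h1
  linarith

theorem inv_nrm_pow_le {u : ℝ} (hu : 0 < u) (d : ℕ) (x : Eu m) :
    (nrm u x ^ d)⁻¹ ≤ (u⁻¹ + 1) ^ d * ((1 + ‖x‖) ^ d)⁻¹ := by
  have h := one_add_norm_le_mul_nrm hu x
  have hn := nrm_pos hu x
  have hx : 0 < 1 + ‖x‖ := by positivity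
  rw [← div_eq_mul_inv, inv_le_comm₀ (by positivity) (by positivity), inv_div,
    div_le_iff₀ (by positivity), ← mul_pow, mul_comm]
  gcongr

/-- The time derivative of the `e_j`-component of the conjugate Poisson kernel. -/
def conjPoissonDeriv (m : ℕ) (j : Fin m) (t : ℝ) (x : Eu m) : ℝ :=
  2 / sig (m + 1) * ((m + 1) * t * x j / nrm t x ^ (m + 3))

theorem symbolKernel_symB_one (hm : 1 ≤ m) (j : Fin m) {t : ℝ} (ht : 0 < t) (x : Eu m) :
    symbolKernel (symB j 1) t x = conjPoissonDeriv m j t x := by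
  have h1 := hasDerivAt_symbolKernel_symB ht x j 0
  have h2 := (hasDerivAt_conjPoisson_time ht x j).ofReal_comp
  refine h1.unique (h2.congr_of_eventuallyEq ?_)
  filter_upwards [lt_mem_nhds ht] with s hs
  exact conjPoisson_eq_symbolKernel hm hs x j

theorem measurable_nrm_uncurry : Measurable (fun q : ℝ × Eu m => nrm q.1 q.2) :=
  continuous_nrm.measurable

theorem measurable_conjPoissonDeriv (j : Fin m) :
    Measurable (Function.uncurry (conjPoissonDeriv m j)) := by
  have := measurable_nrm_uncurry (m := m)
  unfold Function.uncurry conjPoissonDeriv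
  fun_prop

theorem norm_conjPoissonDeriv_le (j : Fin m) {t : ℝ} (ht : 0 < t) (x : Eu m) :
    ‖conjPoissonDeriv m j t x‖ ≤ 2 / sig (m + 1) * (m + 1) * ‖x‖ * (nrm t x ^ (m + 2))⁻¹ := by
  have hn := nrm_pos ht x
  have hs := two_div_sig_succ_pos m
  have hj : |x j| ≤ ‖x‖ := by simpa using PiLp.norm_apply_le x j
  have ht' := le_nrm t x
  rw [conjPoissonDeriv, norm_mul, norm_of_nonneg hs.le, norm_div, norm_mul, norm_mul,
    norm_of_nonneg (by positivity : (0 : ℝ) ≤ m + 1), norm_of_nonneg ht.le,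
    norm_of_nonneg (by positivity : 0 ≤ nrm t x ^ (m + 3)), Real.norm_eq_abs]
  rw [mul_assoc (2 / sig (m + 1)), mul_assoc (2 / sig (m + 1))]
  gcongr
  rw [div_le_iff₀ (by positivity)]
  calc (m + 1) * t * |x j| ≤ (m + 1) * nrm t x * ‖x‖ := by gcongr
    _ = _ := by field_simp; ring

theorem integrable_conjPoissonDeriv (hm : 1 ≤ m) (j : Fin m) {t : ℝ} (ht : 0 < t) :
    Integrable (conjPoissonDeriv m j t) := by
  have hi := (integrable_rpow_mul_one_add_norm hm (a := 1) (k := m + 2)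
    (by have : (0 : ℝ) ≤ m := by positivity
        linarith) (by push_cast; linarith)).const_mul
    (2 / sig (m + 1) * (m + 1) * (t⁻¹ + 1) ^ (m + 2))
  refine hi.mono' ?_ (Eventually.of_forall fun x => ?_)
  · exact ((measurable_conjPoissonDeriv j).comp measurable_prodMk_left).aestronglyMeasurable
  · have hs := two_div_sig_succ_pos m
    refine (norm_conjPoissonDeriv_le j ht x).trans ?_
    calc _ ≤ 2 / sig (m + 1) * (m + 1) * ‖x‖ *
          ((t⁻¹ + 1) ^ (m + 2) * ((1 + ‖x‖) ^ (m + 2))⁻¹) := by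
          gcongr; exact inv_nrm_pow_le ht _ x
      _ = _ := by rw [rpow_one]; ring

theorem primInt_conjPoissonDeriv {N : ℕ} (hN : N ≤ m) {x : Eu m} (hx : x ≠ 0) (j : Fin m) :
    primInt (conjPoissonDeriv m j) N 0 x =
      -(hilbertRieszCoeff m N * (‖x‖ ^ ((N : ℝ) - m - 1) * x j)) := by
  have hnm : (N : ℝ) ≤ m := by exact_mod_cast hN
  have hn0 : (0 : ℝ) ≤ N := by positivity
  have h := integral_rpow_mul_nrm (a := (N : ℝ) + 1) (c := m + 3) (by linarith)
    (by push_cast; linarith) hx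
  have e : ∀ w ∈ Ioi (0 : ℝ), w ^ (N : ℝ) • conjPoissonDeriv m j (0 + w) x =
      (2 / sig (m + 1) * (m + 1) * x j) * (w ^ ((N : ℝ) + 1) * (nrm w x ^ (m + 3))⁻¹) := by
    intro w hw
    have hw : 0 < w := hw
    simp only [conjPoissonDeriv, smul_eq_mul, zero_add, rpow_add hw, rpow_one]; ring
  rw [primInt, setIntegral_congr_fun measurableSet_Ioi e, integral_const_mul, h,
    two_div_sig _ (by omega), hilbertRieszCoeff]
  have h1 := Gamma_half_mul N
  have hG1 : 0 < Gamma (((N : ℝ) + 1) / 2) := Gamma_pos_of_pos (by positivity)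
  have hG2 : 0 < Gamma (((m + 1 : ℕ) : ℝ) / 2) := Gamma_pos_of_pos (by positivity)
  have e2 : ((N : ℝ) + 1 + 1) / 2 = ((N + 1 : ℕ) + 1 : ℝ) / 2 := by push_cast; ring
  have e3 : (((m + 3 : ℕ) : ℝ) - ((N : ℝ) + 1) - 1) / 2 = ((m : ℝ) - N + 1) / 2 := by
    push_cast; ring
  have e4 : (N : ℝ) + 1 + 1 - (m + 3 : ℕ) = (N : ℝ) - m - 1 := by push_cast; ring
  have e5 : π ^ (((m + 1 : ℕ) : ℝ) / 2) = π ^ ((m : ℝ) / 2) * √π := by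
    rw [Real.sqrt_eq_rpow, ← rpow_add pi_pos]; congr 1; push_cast; ring
  have e6 : Gamma (((m + 3 : ℕ) : ℝ) / 2) = ((m + 1 : ℕ) : ℝ) / 2 *
      Gamma (((m + 1 : ℕ) : ℝ) / 2) := by
    rw [← Gamma_add_one (by positivity)]; congr 1; push_cast; ring
  rw [e2, e3, e4, e5, e6]
  have hG3 : Gamma (((N + 1 : ℕ) + 1 : ℝ) / 2) =
      (N.factorial : ℝ) * (2 ^ N)⁻¹ * √π / Gamma (((N : ℝ) + 1) / 2) := by
    rw [eq_div_iff hG1.ne']; rw [← h1]; push_cast; ring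
  rw [hG3]
  have hp : 0 < √π := Real.sqrt_pos.2 pi_pos
  have hp2 : 0 < π ^ ((m : ℝ) / 2) := by positivity
  have hfac : (0 : ℝ) < N.factorial := by positivity
  simp only [smul_eq_mul]
  push_cast
  field_simp

theorem integral_conjPoissonDeriv (hm : 1 ≤ m) (j : Fin m) {u : ℝ} (hu : 0 < u) (x : Eu m) :
    IntegrableOn (fun w => conjPoissonDeriv m j (u + w) x) (Ioi 0) ∧
    ∫ w in Ioi (0 : ℝ), conjPoissonDeriv m j (u + w) x = -conjPoisson m u x j ∧
    ∫ w in Ioi (0 : ℝ), ‖conjPoissonDeriv m j (u + w) x‖ = ‖conjPoisson m u x j‖ := by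
  have hd : ∀ w ∈ Ici (0 : ℝ), HasDerivAt (fun w => conjPoisson m (u + w) x j)
      (conjPoissonDeriv m j (u + w) x) w := by
    intro w hw
    exact (hasDerivAt_conjPoisson_time (add_pos_of_pos_of_nonneg hu hw) x j).comp_const_add u w
  have hlim : Tendsto (fun w => conjPoisson m (u + w) x j) atTop (𝓝 0) := by
    have h1 := (tendsto_conjPoisson_atTop hm x).comp (tendsto_atTop_add_const_left atTop u tendsto_id)
    have h2 := ((EuclideanSpace.proj (𝕜 := ℝ) j).continuous.tendsto (0 : Eu m)).comp h1
    simpa [Function.comp_def] using h2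
  obtain ⟨s, hs, hsx⟩ : ∃ s : ℝ, |s| = 1 ∧ 0 ≤ s * x j := by
    rcases le_total 0 (x j) with h | h
    · exact ⟨1, by simp, by simpa⟩
    · exact ⟨-1, by simp, by simpa⟩
  have hsg := two_div_sig_succ_pos m
  have hpos : ∀ w ∈ Ioi (0 : ℝ), 0 ≤ s * conjPoissonDeriv m j (u + w) x := by
    intro w hw
    have hw : 0 < u + w := add_pos hu hw
    have := nrm_pos hw x
    have e : s * conjPoissonDeriv m j (u + w) x =
      2 / sig (m + 1) * ((m + 1) * (u + w) / nrm (u + w) x ^ (m + 3)) * (s * x j) := by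
      rw [conjPoissonDeriv]; ring
    rw [e]; positivity
  have hss : s * s = 1 := by rw [← abs_mul_abs_self, hs, one_mul]
  have hi : IntegrableOn (fun w => s * conjPoissonDeriv m j (u + w) x) (Ioi 0) :=
    integrableOn_Ioi_deriv_of_nonneg' (fun w hw => (hd w hw).const_mul s) hpos
      (by simpa using hlim.const_mul s)
  have hi' : IntegrableOn (fun w => conjPoissonDeriv m j (u + w) x) (Ioi 0) := by
    refine (hi.const_mul s).congr (Eventually.of_forall fun w => ?_)
    simp only [← mul_assoc, hss, one_mul]
  have hv : ∫ w in Ioi (0 : ℝ), conjPoissonDeriv m j (u + w) x = -conjPoisson m u x j := by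
    rw [integral_Ioi_of_hasDerivAt_of_tendsto' hd hi' hlim]; simp
  refine ⟨hi', hv, ?_⟩
  have hn : ∀ w ∈ Ioi (0 : ℝ), ‖conjPoissonDeriv m j (u + w) x‖ =
      s * conjPoissonDeriv m j (u + w) x := by
    intro w hw
    rw [Real.norm_eq_abs, ← one_mul |_|, ← hs, ← abs_mul, abs_of_nonneg (hpos w hw)]
  rw [setIntegral_congr_fun measurableSet_Ioi hn, integral_const_mul, hv]
  have h0 : 0 ≤ s * -conjPoisson m u x j := by
    rw [← hv, ← integral_const_mul]; exact setIntegral_nonneg measurableSet_Ioi hpos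
  rw [← abs_of_nonneg h0, abs_mul, hs, abs_neg, one_mul, Real.norm_eq_abs]

theorem continuous_symA (k : ℕ) : Continuous (symA k : Eu m → ℂ) := by
  unfold symA; fun_prop

theorem symB_one (j : Fin m) (ξ : Eu m) : symB j 1 ξ = 2 * π * Complex.I * ξ j := by
  rw [symB, pow_one]
  push_cast
  linear_combination (2 * π * Complex.I) * norm_mul_coord_div ξ j

theorem continuous_symB_one (j : Fin m) : Continuous (symB j 1 : Eu m → ℂ) := by
  simp_rw [funext (symB_one j)]; fun_prop

variable {g ρ : Eu m → ℂ}

theorem aestronglyMeasurable_fourierInv (hg : Integrable g) :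
    AEStronglyMeasurable (𝓕⁻ g) := by
  have : Continuous (𝓕⁻ g) := by
    have := VectorFourier.fourierIntegral_continuous (μ := (volume : Measure (Eu m)))
      Real.continuous_fourierChar (L := -innerₗ (Eu m)) (by exact continuous_inner.neg) hg
    exact this
  exact this.aestronglyMeasurable

theorem integrable_rpow_mul_of_decay (hm : 1 ≤ m) {F : Type*} [NormedAddCommGroup F] {f : Eu m → F}
    (hf : AEStronglyMeasurable f)
    {a C : ℝ} {k : ℕ} (ha : -(m : ℝ) < a) (hk : a + m < k)
    (hb : ∀ x, ‖f x‖ ≤ C * ((1 + ‖x‖) ^ k)⁻¹) : Integrable fun x : Eu m => ‖x‖ ^ a * ‖f x‖ := by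
  refine ((integrable_rpow_mul_one_add_norm hm ha hk).const_mul C).mono' ?_ ?_
  · exact (Measurable.aestronglyMeasurable (by fun_prop)).mul hf.norm
  · refine Eventually.of_forall fun x => ?_
    rw [norm_of_nonneg (by positivity)]
    calc ‖x‖ ^ a * ‖f x‖ ≤ ‖x‖ ^ a * (C * ((1 + ‖x‖) ^ k)⁻¹) := by gcongr; exact hb x
      _ = _ := by ring

/-- The Riesz kernel of order `N < m` divides the Fourier transform by `|2πξ|^N`. -/
theorem integral_riesz_mul_fourierInv {N : ℕ} (hN : 1 ≤ N) (hNm : N < m)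
    (hg : Integrable g) (hρ : Integrable ρ) {C : ℝ}
    (hb : ∀ x, ‖𝓕⁻ g x‖ ≤ C * ((1 + ‖x‖) ^ (m + N))⁻¹)
    (h : ∀ ξ, g ξ = ((2 * π * ‖ξ‖ : ℝ) : ℂ) ^ N * ρ ξ) :
    ∫ x, ((rieszCoeff m N * ‖x‖ ^ ((N : ℝ) - m) : ℝ) : ℂ) * 𝓕⁻ g x = ∫ ξ, ρ ξ := by
  obtain ⟨n, rfl⟩ : ∃ n, N = n + 1 := ⟨N - 1, by omega⟩
  have hm : 1 ≤ m := by omega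
  have hae := ae_ne_zero hm
  have hKmeas : ∀ x, StronglyMeasurable fun v => poisson m v x := fun x =>
    (measurable_poisson_uncurry.comp measurable_prodMk_right).stronglyMeasurable
  have hKb : ∀ v, 0 < v → ∀ x : Eu m,
      ‖poisson m v x‖ ≤ (2 / sig (m + 1)) * (nrm v x ^ m)⁻¹ := fun v hv x => by
    rw [norm_of_nonneg (poisson_nonneg hv x)]; exact poisson_le (nrm_pos hv x)
  have key := integral_primInt_mul_fourierInv hm (p := symA 0) (isSymbol_symA 0)
    (continuous_symA 0) (K := poisson m) measurable_poisson_uncurry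
    (fun v hv x => by
      rw [← poisson_eq_symbolKernel hv]; congr 1)
    (fun v hv => integrable_poisson hv) (n := n) (u := 0) le_rfl
    (fun x hx => integrableOn_primInt (h := fun _ => 2 / sig (m + 1)) hKmeas hNm hKb le_rfl
      (by rw [nrm_zero]; exact norm_pos_iff.2 hx))
    (fun x hx => integral_norm_primInt_le (h := fun _ => 2 / sig (m + 1)) hKmeas hNm hKb le_rfl hx)
    hg hρ ?_ (fun ξ => by rw [h ξ]; simp [symA])
  · simp only [mul_zero, zero_mul, neg_zero, Real.exp_zero, Complex.ofReal_one, one_mul] at key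
    rw [← key]
    refine integral_congr_ae ?_
    filter_upwards [hae] with x hx
    congr 2
    rw [← integral_rpow_mul_poisson hNm hx]
    simp [primInt]
  · have hi := (integrable_rpow_mul_of_decay hm (aestronglyMeasurable_fourierInv hg)
      (a := (n : ℝ) + 1 - m) (k := m + (n + 1)) (by have : (0 : ℝ) ≤ n := by positivity
                                                    linarith)
      (by push_cast; have : (1 : ℝ) ≤ m := by exact_mod_cast hm
          linarith) hb).const_mul
      (1 / 2 * Gamma (((n : ℝ) + 1) / 2) * Gamma ((m - n - 1) / 2) / Gamma ((m : ℝ) / 2) *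
        (2 / sig (m + 1)))
    refine hi.congr (Eventually.of_forall fun x => ?_)
    simp only; ring

/-- The vector Riesz kernel of order `1 ≤ N ≤ m` on the Fourier side. -/
theorem integral_hilbertRiesz_mul_fourierInv (hm : 1 ≤ m) {N : ℕ} (hN : 1 ≤ N) (hNm : N ≤ m)
    (j : Fin m) (hg : Integrable g) (hρ : Integrable ρ) {C : ℝ}
    (hb : ∀ x, ‖𝓕⁻ g x‖ ≤ C * ((1 + ‖x‖) ^ (m + N))⁻¹)
    (h : ∀ ξ, -(symB j 1 ξ * g ξ) = ((2 * π * ‖ξ‖ : ℝ) : ℂ) ^ (N + 1) * ρ ξ) :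
    ∫ x, ((hilbertRieszCoeff m N * (‖x‖ ^ ((N : ℝ) - m - 1) * x j) : ℝ) : ℂ) * 𝓕⁻ g x =
      ∫ ξ, ρ ξ := by
  have hae := ae_ne_zero hm
  have hKmeas : ∀ x, StronglyMeasurable fun v => conjPoissonDeriv m j v x := fun x =>
    ((measurable_conjPoissonDeriv j).comp measurable_prodMk_right).stronglyMeasurable
  set c := 2 / sig (m + 1) * (m + 1)
  have hKb : ∀ v, 0 < v → ∀ x : Eu m,
      ‖conjPoissonDeriv m j v x‖ ≤ (c * ‖x‖) * (nrm v x ^ (m + 2))⁻¹ :=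
    fun v hv x => norm_conjPoissonDeriv_le j hv x
  have hN2 : N + 1 < m + 2 := by omega
  have key := integral_primInt_mul_fourierInv hm (p := symB j 1) (isSymbol_symB j 1)
    (continuous_symB_one j) (K := conjPoissonDeriv m j) (measurable_conjPoissonDeriv j)
    (fun v hv x => symbolKernel_symB_one hm j hv x)
    (fun v hv => integrable_conjPoissonDeriv hm j hv) (n := N) (u := 0) le_rfl
    (fun x hx => integrableOn_primInt (h := fun x => c * ‖x‖) hKmeas hN2 hKb le_rfl
      (by rw [nrm_zero]; exact norm_pos_iff.2 hx))
    (fun x hx => integral_norm_primInt_le (h := fun x => c * ‖x‖) hKmeas hN2 hKb le_rfl hx)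
    hg hρ.neg ?_ (fun ξ => by have := h ξ; simp only [Pi.neg_apply]; linear_combination -this)
  · simp only [mul_zero, zero_mul, neg_zero, Real.exp_zero, Complex.ofReal_one, one_mul,
      Pi.neg_apply, integral_neg] at key
    rw [← neg_inj, ← key, ← integral_neg]
    refine integral_congr_ae ?_
    filter_upwards [hae] with x hx
    rw [primInt_conjPoissonDeriv hNm hx]
    push_cast; ring
  · have hi := (integrable_rpow_mul_of_decay hm (aestronglyMeasurable_fourierInv hg)
      (a := (N : ℝ) - m) (k := m + N) (by have : (1 : ℝ) ≤ N := by exact_mod_cast hN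
                                          linarith)
      (by push_cast; have : (1 : ℝ) ≤ m := by exact_mod_cast hm
          linarith) hb).const_mul
      (1 / 2 * Gamma (((N : ℝ) + 1) / 2) * Gamma (((m + 2 : ℕ) - N - 1) / 2) /
        Gamma (((m + 2 : ℕ) : ℝ) / 2) * c)
    refine hi.congr ?_
    filter_upwards [hae] with x hx
    have hx' : 0 < ‖x‖ := norm_pos_iff.2 hx
    have e : ‖x‖ ^ ((N : ℝ) + 1 - (m + 2 : ℕ)) * ‖x‖ = ‖x‖ ^ ((N : ℝ) - m) := by
      rw [← rpow_add_one hx'.ne']; congr 1; push_cast; ring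
    rw [← e]; ring

/-- The conjugate Poisson kernel paired with a function of known Fourier transform that decays
like `(1 + |x|)^{-m}`. -/
theorem integral_conjPoisson_mul_fourierInv (hm : 1 ≤ m) (j : Fin m) (hg : Integrable g)
    (hρ : Integrable ρ) {C : ℝ} (hb : ∀ x, ‖𝓕⁻ g x‖ ≤ C * ((1 + ‖x‖) ^ m)⁻¹)
    (h : ∀ ξ, -(symB j 1 ξ * g ξ) = ((2 * π * ‖ξ‖ : ℝ) : ℂ) * ρ ξ) {u : ℝ} (hu : 0 < u) :
    ∫ x, (conjPoisson m u x j : ℂ) * 𝓕⁻ g x =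
      ∫ ξ, (Real.exp (-(2 * π * u * ‖ξ‖)) : ℂ) * ρ ξ := by
  have key := integral_primInt_mul_fourierInv hm (p := symB j 1) (isSymbol_symB j 1)
    (continuous_symB_one j) (K := conjPoissonDeriv m j) (measurable_conjPoissonDeriv j)
    (fun v hv x => symbolKernel_symB_one hm j hv x)
    (fun v hv => integrable_conjPoissonDeriv hm j hv) (n := 0) (u := u) hu.le
    (G := fun x => ‖conjPoisson m u x j‖)
    (fun x _ => by simpa using (integral_conjPoissonDeriv hm j hu x).1)
    (fun x _ => by simpa using (integral_conjPoissonDeriv hm j hu x).2.2.le)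
    hg hρ.neg ?_ (fun ξ => by have := h ξ; simp only [Pi.neg_apply]; linear_combination -this)
  · simp only [Pi.neg_apply, mul_neg, integral_neg] at key
    rw [← neg_inj, ← key, ← integral_neg]
    refine integral_congr_of_eq fun x => ?_
    simp [primInt, (integral_conjPoissonDeriv hm j hu x).2.1]
  · have hm1 : (1 : ℝ) ≤ m := by exact_mod_cast hm
    refine ((integrable_rpow_mul_one_add_norm hm (a := 0) (k := m + m) (by linarith)
      (by push_cast; linarith)).const_mul
      ((2 / sig (m + 1)) * (u⁻¹ + 1) ^ m * C)).mono' ?_ (Eventually.of_forall fun x => ?_)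
    · refine AEStronglyMeasurable.mul ?_ (aestronglyMeasurable_fourierInv hg).norm
      have : Continuous fun x => ‖conjPoisson m u x j‖ := by
        exact ((EuclideanSpace.proj (𝕜 := ℝ) j).continuous.comp
          (continuous_conjPoisson (m := m) hu)).norm
      exact this.aestronglyMeasurable
    · have hs := two_div_sig_succ_pos m
      have hn := nrm_pos hu x
      have h1 : ‖conjPoisson m u x j‖ ≤ 2 / sig (m + 1) * (nrm u x ^ m)⁻¹ := by
        refine (PiLp.norm_apply_le _ j).trans ?_
        rw [norm_conjPoisson hu]
        gcongr
        rw [div_le_iff₀ (by positivity), pow_succ]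
        calc ‖x‖ ≤ nrm u x := norm_le_nrm u x
          _ = _ := by field_simp
      have h2 := inv_nrm_pow_le hu m x
      rw [norm_of_nonneg (by positivity), rpow_zero, one_mul]
      calc ‖conjPoisson m u x j‖ * ‖𝓕⁻ g x‖
          ≤ (2 / sig (m + 1) * ((u⁻¹ + 1) ^ m * ((1 + ‖x‖) ^ m)⁻¹)) *
            (C * ((1 + ‖x‖) ^ m)⁻¹) := by
            refine mul_le_mul (h1.trans ?_) (hb x) (norm_nonneg _) (by positivity)
            gcongr
        _ = _ := by rw [pow_add]; field_simp

end

theorem IsApproxUnit.norm_le {χ : ℕ → Eu m → ℂ} (h : IsApproxUnit χ) :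
    ∃ C, 0 ≤ C ∧ ∀ i x, ‖χ i x‖ ≤ C := by
  obtain ⟨C, hC⟩ := h.bounded 0
  refine ⟨C, (norm_nonneg _).trans (hC 0 0), fun i x => ?_⟩
  simpa using hC i x

theorem isScalarConv_of {s t r : 𝓢'(Eu m, ℂ)}
    (hsm : ∀ φ : 𝓢(Eu m, ℂ), ContDiff ℝ ∞ fun x => t (shift x φ))
    (hlim : ∀ (φ : 𝓢(Eu m, ℂ)) (χ : ℕ → Eu m → ℂ), IsApproxUnit χ → ∀ ψ : ℕ → 𝓢(Eu m, ℂ),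
      (∀ i x, ψ i x = χ i x * t (shift x φ)) → Tendsto (fun i => s (ψ i)) atTop (𝓝 (r φ))) :
    IsScalarConv s t r := by
  intro φ χ hχ
  have hc : ∀ i, HasCompactSupport fun x => χ i x * t (shift x φ) :=
    fun i => (hχ.compactSupport i).mul_right
  refine ⟨fun i => (hc i).toSchwartzMap ((hχ.smooth i).mul (hsm φ)), fun i x => rfl, ?_⟩
  exact hlim φ χ hχ _ fun i x => rfl

theorem tendsto_integral_mul_approxUnit {f : Eu m → ℂ} (hf : Integrable f)
    {χ : ℕ → Eu m → ℂ} (hχ : IsApproxUnit χ) :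
    Tendsto (fun i => ∫ x, χ i x * f x) atTop (𝓝 (∫ x, f x)) := by
  obtain ⟨C, hC, hb⟩ := hχ.norm_le
  refine tendsto_integral_of_dominated_convergence (fun x => C * ‖f x‖) ?_ (hf.norm.const_mul C)
    ?_ ?_
  · exact fun i => (hχ.smooth i).continuous.aestronglyMeasurable.mul hf.aestronglyMeasurable
  · exact fun i => Eventually.of_forall fun x => by
      rw [norm_mul]; exact mul_le_mul_of_nonneg_right (hb i x) (norm_nonneg _)
  · refine Eventually.of_forall fun x => ?_
    refine tendsto_const_nhds.congr' ?_
    filter_upwards [hχ.eventuallyOne {x} isCompact_singleton] with i hi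
    rw [hi x rfl, one_mul]

/-- Convolution of a regular distribution with one given by a symbol. -/
theorem isScalarConv_tempered_symbol {k q ρ : Eu m → ℂ} (hk : IsTempered k) (hq : IsSymbol q)
    (hρ : IsSymbol ρ)
    (hint : ∀ φ : 𝓢(Eu m, ℂ), Integrable fun x => k x * hq.toDist (shift x φ))
    (hval : ∀ φ : 𝓢(Eu m, ℂ), ∫ x, k x * hq.toDist (shift x φ) = ∫ ξ, ρ ξ * 𝓕 φ ξ) :
    IsScalarConv hk.toDist hq.toDist hρ.toDist := by
  refine isScalarConv_of hq.contDiff_toDist_shift fun φ χ hχ ψ hψ => ?_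
  have h := tendsto_integral_mul_approxUnit (hint φ) hχ
  rw [hval φ] at h
  rw [IsSymbol.toDist_apply]
  refine h.congr fun i => ?_
  rw [IsTempered.toDist_apply]
  refine integral_congr_of_eq fun x => ?_
  simp only [hψ]; ring

theorem tendsto_of_kernel_limit {A : ℝ → Eu m → ℂ} {s : 𝓢'(Eu m, ℂ)} {τ : Eu m → ℂ}
    {g : Eu m → ℝ} {L : ℂ}
    (hs : ∀ ψ : 𝓢(Eu m, ℂ), Tendsto (fun u => ∫ x, A u x * ψ x) (𝓝[>] 0) (𝓝 (s ψ)))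
    (hAψ : ∀ u, 0 < u → ∀ ψ : 𝓢(Eu m, ℂ), Integrable fun x => A u x * ψ x)
    (hA : ∀ u, 0 < u → ∀ x, 1 ≤ ‖x‖ → ‖A u x‖ ≤ g x)
    (hAτ : ∀ u, 0 < u → Integrable fun x => A u x * τ x)
    (hg : IntegrableOn (fun x => g x * ‖τ x‖) {x | 1 ≤ ‖x‖})
    (hL : Tendsto (fun u => ∫ x, A u x * τ x) (𝓝[>] 0) (𝓝 L))
    {χ : ℕ → Eu m → ℂ} (hχ : IsApproxUnit χ) {ψ : ℕ → 𝓢(Eu m, ℂ)}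
    (hψ : ∀ i x, ψ i x = χ i x * τ x) :
    Tendsto (fun i => s (ψ i)) atTop (𝓝 L) := by
  obtain ⟨C, hC, hb⟩ := hχ.norm_le
  set S : Set (Eu m) := {x | 1 ≤ ‖x‖} with hS
  have hSm : MeasurableSet S := measurableSet_le measurable_const measurable_norm
  have hbi : ∀ i x, ‖1 - χ i x‖ ≤ 1 + C := fun i x =>
    (norm_sub_le _ _).trans (by simpa using hb i x)
  have hdom : ∀ i, IntegrableOn (fun x => ‖1 - χ i x‖ * (g x * ‖τ x‖)) S := fun i => by
    refine hg.bdd_mul (c := 1 + C) ?_ (Eventually.of_forall fun x => ?_)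
    · exact (continuous_const.sub (hχ.smooth i).continuous).norm.aestronglyMeasurable
    · rw [norm_norm]; exact hbi i x
  have he : Tendsto (fun i => ∫ x in S, ‖1 - χ i x‖ * (g x * ‖τ x‖)) atTop (𝓝 0) := by
    have : Tendsto (fun i => ∫ x in S, ‖1 - χ i x‖ * (g x * ‖τ x‖)) atTop
        (𝓝 (∫ x in S, (0 : ℝ))) := by
      refine tendsto_integral_of_dominated_convergence (fun x => (1 + C) * ‖g x * ‖τ x‖‖)
        (fun i => (hdom i).aestronglyMeasurable) (hg.norm.const_mul _) ?_ ?_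
      · exact fun i => Eventually.of_forall fun x => by
          rw [norm_mul, norm_norm]; exact mul_le_mul_of_nonneg_right (hbi i x) (norm_nonneg _)
      · refine Eventually.of_forall fun x => ?_
        refine tendsto_const_nhds.congr' ?_
        filter_upwards [hχ.eventuallyOne {x} isCompact_singleton] with i hi
        rw [hi x rfl]; simp
    simpa using this
  rw [tendsto_iff_norm_sub_tendsto_zero]
  refine squeeze_zero' (Eventually.of_forall fun i => norm_nonneg _) ?_ he
  filter_upwards [hχ.eventuallyOne (Metric.closedBall 0 1) (isCompact_closedBall 0 1)] with i hi
  refine le_of_tendsto ((hs (ψ i)).sub hL).norm ?_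
  filter_upwards [self_mem_nhdsWithin] with u hu
  rw [← integral_sub (hAψ u hu _) (hAτ u hu)]
  have e : ∀ x, A u x * ψ i x - A u x * τ x = S.indicator (fun x => -(A u x * (1 - χ i x) * τ x)) x := by
    intro x
    by_cases hx : x ∈ S
    · rw [indicator_of_mem hx, hψ]; ring
    · rw [indicator_of_notMem hx, hψ, hi x (by
        simp only [hS, mem_ofPred_eq, not_le] at hx
        simpa using hx.le)]; ring
  simp_rw [e]
  rw [integral_indicator hSm]
  refine norm_integral_le_of_norm_le (hdom i) ?_
  filter_upwards [ae_restrict_mem hSm] with x hx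
  rw [norm_neg, norm_mul, norm_mul]
  calc _ ≤ g x * ‖1 - χ i x‖ * ‖τ x‖ := by gcongr; exact hA u hu x hx
    _ = _ := by ring

/-- Convolution of a distribution given by a symbol with decaying kernel. -/
theorem isScalarConv_symbol (hm : 1 ≤ m) {q ρ : Eu m → ℂ} (hq : IsSymbol q) {d k : ℕ}
    (hd : HasKernelDecay q d) (hρ : IsSymbol ρ) {t : 𝓢'(Eu m, ℂ)} (hdk : m < d + k)
    (hsm : ∀ φ : 𝓢(Eu m, ℂ), ContDiff ℝ ∞ fun x => t (shift x φ))
    (hτ : ∀ φ : 𝓢(Eu m, ℂ), ∃ C, 0 ≤ C ∧ ∀ x, ‖t (shift x φ)‖ ≤ C * ((1 + ‖x‖) ^ k)⁻¹)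
    (hval : ∀ (φ : 𝓢(Eu m, ℂ)) u, 0 < u →
      ∫ x, symbolKernel q u x * t (shift x φ) =
        ∫ ξ, (Real.exp (-(2 * π * u * ‖ξ‖)) : ℂ) * (ρ ξ * 𝓕 φ ξ)) :
    IsScalarConv hq.toDist t hρ.toDist := by
  refine isScalarConv_of hsm fun φ χ hχ ψ hψ => ?_
  obtain ⟨C, hC, hb⟩ := hτ φ
  obtain ⟨D, hD, hbD⟩ := hd
  have hm1 : (1 : ℝ) ≤ m := by exact_mod_cast hm
  have hmdk : (m : ℝ) < d + k := by exact_mod_cast hdk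
  have hτc := (hsm φ).continuous
  refine tendsto_of_kernel_limit (A := fun u => symbolKernel q u) (g := fun x => D * (‖x‖ ^ d)⁻¹)
    hq.tendsto_integral_symbolKernel (fun u hu ψ => hq.integrable_symbolKernel_mul hu ψ) ?_ ?_ ?_ ?_
    hχ hψ
  · intro u hu x hx
    refine (hbD u hu x).trans ?_
    have : 0 < ‖x‖ := by linarith
    gcongr
    exact norm_le_nrm u x
  · intro u hu
    refine ((integrable_rpow_mul_one_add_norm hm (a := 0) (k := d + k) (by linarith)
      (by push_cast; linarith)).const_mul (D * (u⁻¹ + 1) ^ d * C)).mono' ?_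
      (Eventually.of_forall fun x => ?_)
    · exact ((hq.continuous_symbolKernel hu).mul hτc).aestronglyMeasurable
    · rw [norm_mul, rpow_zero, one_mul]
      calc _ ≤ (D * ((u⁻¹ + 1) ^ d * ((1 + ‖x‖) ^ d)⁻¹)) * (C * ((1 + ‖x‖) ^ k)⁻¹) := by
            refine mul_le_mul ((hbD u hu x).trans ?_) (hb x) (norm_nonneg _) (by positivity)
            gcongr; exact inv_nrm_pow_le hu d x
        _ = _ := by rw [pow_add]; field_simp
  · refine ((integrable_rpow_mul_one_add_norm hm (a := 0) (k := d + k) (by linarith)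
      (by push_cast; linarith)).const_mul (D * 2 ^ d * C)).integrableOn.mono' ?_ ?_
    · refine AEStronglyMeasurable.mul ?_ hτc.norm.aestronglyMeasurable
      exact Measurable.aestronglyMeasurable (by fun_prop)
    · filter_upwards [ae_restrict_mem (measurableSet_le measurable_const measurable_norm)] with x hx
      have hx1 : 1 ≤ ‖x‖ := hx
      have hx0 : 0 < ‖x‖ := by linarith
      rw [norm_of_nonneg (by positivity), rpow_zero, one_mul]
      have h2 : (‖x‖ ^ d)⁻¹ ≤ 2 ^ d * ((1 + ‖x‖) ^ d)⁻¹ := by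
        rw [← div_eq_mul_inv, inv_le_comm₀ (by positivity) (by positivity), inv_div, ← div_pow]
        gcongr; linarith
      calc _ ≤ (D * (2 ^ d * ((1 + ‖x‖) ^ d)⁻¹)) * (C * ((1 + ‖x‖) ^ k)⁻¹) := by
            gcongr; exact hb x
        _ = _ := by rw [pow_add]; field_simp
  · have h1 := hρ.tendsto_integral_symbolKernel φ
    rw [IsSymbol.toDist_apply]
    refine h1.congr' ?_
    filter_upwards [self_mem_nhdsWithin] with u hu
    have hu0 : 0 < u := hu
    rw [hρ.integral_symbolKernel_mul hu0 φ.integrable, hval φ u hu0]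
    refine integral_congr_of_eq fun ξ => ?_
    simp only [damp, SchwartzMap.fourier_coe]; ring

theorem isSymbol_damp {q : Eu m → ℂ} (hq : IsSymbol q) {u : ℝ} (hu : 0 < u) :
    IsSymbol (damp q u) := by
  refine ⟨?_, ?_⟩
  · have := hq.measurable
    unfold damp; fun_prop
  · obtain ⟨C, N, h⟩ := hq.growth
    refine ⟨C, N, fun ξ => ?_⟩
    rw [damp, norm_mul, Complex.norm_real, norm_of_nonneg (Real.exp_nonneg _)]
    refine (mul_le_of_le_one_right (norm_nonneg _) (Real.exp_le_one_iff.2 ?_)).trans (h ξ)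
    have : 0 ≤ 2 * π * u * ‖ξ‖ := by have := pi_pos; positivity
    linarith

theorem damp_damp (q : Eu m → ℂ) (u t : ℝ) : damp (damp q u) t = damp q (t + u) := by
  funext ξ
  have : Real.exp (-(2 * π * (t + u) * ‖ξ‖)) =
      Real.exp (-(2 * π * u * ‖ξ‖)) * Real.exp (-(2 * π * t * ‖ξ‖)) := by
    rw [← Real.exp_add]; congr 1; ring
  simp only [damp, this]; push_cast; ring

theorem HasKernelDecay.damp {q : Eu m → ℂ} {d : ℕ} (h : HasKernelDecay q d) {u : ℝ} (hu : 0 < u) :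
    HasKernelDecay (damp q u) d := by
  obtain ⟨C, hC, hb⟩ := h
  refine ⟨C, hC, fun t ht x => ?_⟩
  have := nrm_pos ht x
  rw [symbolKernel, damp_damp]
  refine (hb (t + u) (by positivity) x).trans ?_
  gcongr
  exact nrm_mono ht.le (by linarith) x

/-- A function bounded by a locally integrable power `‖x‖^a`, `-m < a ≤ 0`. -/
structure IsRieszBounded (k : Eu m → ℂ) (a : ℝ) : Prop where
  measurable : AEStronglyMeasurable k
  lower : -(m : ℝ) < a
  upper : a ≤ 0
  bound : ∃ C, 0 ≤ C ∧ ∀ x, ‖k x‖ ≤ C * ‖x‖ ^ a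

theorem IsRieszBounded.isTempered (hm : 1 ≤ m) {k : Eu m → ℂ} {a : ℝ} (h : IsRieszBounded k a) :
    IsTempered k := by
  refine ⟨h.measurable, m + 1, ?_⟩
  obtain ⟨C, hC, hb⟩ := h.bound
  refine ((integrable_rpow_mul_one_add_norm hm (k := m + 1) h.lower
    (by push_cast; linarith [h.upper])).const_mul C).mono' ?_ (Eventually.of_forall fun x => ?_)
  · refine h.measurable.mul ?_
    exact Measurable.aestronglyMeasurable (by fun_prop)
  · rw [norm_mul, Complex.norm_real, norm_of_nonneg (by positivity)]
    calc _ ≤ C * ‖x‖ ^ a * ((1 + ‖x‖) ^ (m + 1))⁻¹ := by gcongr; exact hb x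
      _ = _ := by ring

theorem IsRieszBounded.integrable_smul (hm : 1 ≤ m) {k : Eu m → ℂ} {a : ℝ} (h : IsRieszBounded k a)
    (φ : 𝓢(Eu m, ℂ)) (x : Eu m) : Integrable fun y => k y * φ (x + y) :=
  (h.isTempered hm).integrable_smul φ x

theorem IsRieszBounded.integral_norm_le (hm : 1 ≤ m) {k : Eu m → ℂ} {a : ℝ}
    (h : IsRieszBounded k a) (φ : 𝓢(Eu m, ℂ)) :
    ∃ C, 0 ≤ C ∧ ∀ x, ∫ y, ‖k y * φ (x + y)‖ ≤ C := by
  obtain ⟨C, hC, hb⟩ := h.bound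
  obtain ⟨D, hD, hφ⟩ := schwartz_norm_le φ 0
  simp only [pow_zero, inv_one, mul_one] at hφ
  have hi : Integrable (fun y : Eu m => (Metric.ball (0 : Eu m) 1).indicator
      (fun y => ‖y‖ ^ a) y) := by
    rw [integrable_indicator_iff measurableSet_ball]
    refine integrableOn_ball_of_norm_le_rpow (C := 1) (α := -a) (by simpa using hm)
      (by simpa using by linarith [h.lower]) ?_
      (Measurable.aestronglyMeasurable (by fun_prop))
    exact Eventually.of_forall fun x => by
      rw [norm_of_nonneg (by positivity), neg_neg, one_mul]
  refine ⟨(∫ y, C * D * (Metric.ball (0 : Eu m) 1).indicator (fun y => ‖y‖ ^ a) y) +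
    ∫ y, C * ‖φ y‖, ?_, fun x => ?_⟩
  · refine add_nonneg (integral_nonneg fun y => ?_) (integral_nonneg fun y => by positivity)
    have : 0 ≤ (Metric.ball (0 : Eu m) 1).indicator (fun y : Eu m => ‖y‖ ^ a) y :=
      indicator_nonneg (fun y _ => by positivity) y
    positivity
  · have hφi : Integrable fun y => C * ‖φ (x + y)‖ :=
      ((φ.integrable (μ := volume)).comp_add_left x).norm.const_mul C
    rw [← integral_add_left_eq_self (fun y => C * ‖φ y‖) x,
      ← integral_add (hi.const_mul _) hφi]
    refine integral_mono (h.integrable_smul hm φ x).norm ((hi.const_mul _).add hφi) fun y => ?_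
    simp only
    rw [norm_mul]
    by_cases hy : y ∈ Metric.ball (0 : Eu m) 1
    · rw [indicator_of_mem hy]
      calc _ ≤ C * ‖y‖ ^ a * D := by gcongr; exacts [hb y, hφ _]
        _ ≤ _ := by
          have : 0 ≤ C * ‖φ (x + y)‖ := by positivity
          linarith
    · rw [indicator_of_notMem hy, mul_zero, zero_add]
      have hy1 : 1 ≤ ‖y‖ := by simpa using hy
      gcongr
      refine (hb y).trans (mul_le_of_le_one_right hC ?_)
      exact rpow_le_one_of_one_le_of_nonpos hy1 h.upper

theorem IsRieszBounded.integral_symbolKernel_mul (hm : 1 ≤ m) {k q : Eu m → ℂ} {a : ℝ}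
    (h : IsRieszBounded k a) (hq : IsSymbol q) {d : ℕ} (hd : HasKernelDecay q d) (hmd : m < d)
    (φ : 𝓢(Eu m, ℂ)) {u : ℝ} (hu : 0 < u) :
    ∫ x, symbolKernel q u x * (h.isTempered hm).toDist (shift x φ) =
      ∫ y, k y * (isSymbol_damp hq hu).toDist (shift y φ) := by
  have hm1 : (1 : ℝ) ≤ m := by exact_mod_cast hm
  have hmd' : (m : ℝ) < d := by exact_mod_cast hmd
  have hKi : Integrable (symbolKernel q u) := by
    obtain ⟨D, hD, hbD⟩ := hd
    refine ((integrable_rpow_mul_one_add_norm hm (a := 0) (k := d) (by linarith)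
      (by linarith)).const_mul (D * (u⁻¹ + 1) ^ d)).mono'
      (hq.continuous_symbolKernel hu).aestronglyMeasurable (Eventually.of_forall fun x => ?_)
    refine (hbD u hu x).trans ?_
    rw [rpow_zero, one_mul, mul_assoc]
    gcongr; exact inv_nrm_pow_le hu d x
  obtain ⟨C, hC, hb⟩ := h.integral_norm_le hm φ
  set f : Eu m → Eu m → ℂ := fun x y => symbolKernel q u x * (k y * φ (x + y)) with hf
  have hfm : AEStronglyMeasurable (Function.uncurry f) (volume.prod volume) := by
    refine ((hq.continuous_symbolKernel hu).aestronglyMeasurable.comp_fst).mul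
      (h.measurable.comp_snd.mul ?_)
    exact (φ.continuous.comp (continuous_fst.add continuous_snd)).aestronglyMeasurable
  have hfi : Integrable (Function.uncurry f) (volume.prod volume) := by
    rw [integrable_prod_iff hfm]
    refine ⟨Eventually.of_forall fun x => ?_, ?_⟩
    · exact (h.integrable_smul hm φ x).const_mul (symbolKernel q u x)
    refine (hKi.norm.const_mul C).mono' hfm.norm.integral_prod_right' (Eventually.of_forall fun x => ?_)
    rw [norm_of_nonneg (integral_nonneg fun y => norm_nonneg _)]
    have e : ∀ y, ‖Function.uncurry f (x, y)‖ = ‖symbolKernel q u x‖ * ‖k y * φ (x + y)‖ :=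
      fun y => norm_mul _ _
    simp_rw [e]
    rw [integral_const_mul, mul_comm]
    exact mul_le_mul_of_nonneg_right (hb x) (norm_nonneg _)
  calc _ = ∫ x, ∫ y, f x y := by
        refine integral_congr_of_eq fun x => ?_
        simp only [hf, IsTempered.toDist_apply, shift_apply, integral_const_mul]
    _ = ∫ y, ∫ x, f x y := integral_integral_swap hfi
    _ = _ := by
        refine integral_congr_of_eq fun y => ?_
        rw [IsSymbol.toDist_apply]
        have h1 := hq.integral_symbolKernel_mul hu (shift y φ).integrable
        simp only [SchwartzMap.fourier_coe]
        rw [← h1, ← integral_const_mul]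
        refine integral_congr_of_eq fun x => ?_
        simp only [hf, shift_apply, add_comm x y]; ring

/-- The symbol `|2πξ|^N`. -/
def powSym (N : ℕ) (ξ : Eu m) : ℂ := ((2 * π * ‖ξ‖ : ℝ) : ℂ) ^ N

/-- The symbol `-i (ξ_j/|ξ|) |2πξ|^N`. -/
def hilSym (j : Fin m) (N : ℕ) (ξ : Eu m) : ℂ :=
  powSym N ξ * (-Complex.I * ((ξ j : ℂ) / (‖ξ‖ : ℂ)))

/-- The product `-(ξ_i/|ξ|)(ξ_j/|ξ|)` of two Riesz transform symbols. -/
def rieszSq (i j : Fin m) (ξ : Eu m) : ℂ :=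
  -(((ξ i : ℂ) / (‖ξ‖ : ℂ)) * ((ξ j : ℂ) / (‖ξ‖ : ℂ)))

theorem isSymbol_powSym (N : ℕ) : IsSymbol (powSym N : Eu m → ℂ) := by
  have := ((IsSymbol.const (m := m) (2 * π : ℝ)).mul IsSymbol.norm).pow N
  convert this using 2
  simp [powSym]

theorem isSymbol_hilSym (j : Fin m) (N : ℕ) : IsSymbol (hilSym j N) :=
  (isSymbol_powSym N).mul ((IsSymbol.const _).mul (IsSymbol.direction j))

theorem isSymbol_rieszSq (i j : Fin m) : IsSymbol (rieszSq i j) := by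
  have := (IsSymbol.const (m := m) (-1)).mul ((IsSymbol.direction i).mul (IsSymbol.direction j))
  convert this using 2
  simp [rieszSq]

theorem symA_eq_powSym (N : ℕ) (ξ : Eu m) : symA N ξ = (-1) ^ N * powSym N ξ := by
  rw [symA, powSym, ← mul_pow]; push_cast; ring

theorem symB_eq_hilSym (j : Fin m) (N : ℕ) (ξ : Eu m) : symB j N ξ = (-1) ^ N * hilSym j N ξ := by
  rw [symB, hilSym, powSym, ← mul_assoc ((-1) ^ N), ← mul_pow]; push_cast; ring

theorem symbolKernel_const_mul (c : ℂ) (p : Eu m → ℂ) (t : ℝ) (x : Eu m) :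
    symbolKernel (fun ξ => c * p ξ) t x = c * symbolKernel p t x := by
  rw [symbolKernel_eq, symbolKernel_eq, ← integral_const_mul]
  refine integral_congr_of_eq fun ξ => ?_
  simp only [damp]; ring

theorem HasKernelDecay.const_mul {p : Eu m → ℂ} {d : ℕ} (h : HasKernelDecay p d) (c : ℂ) :
    HasKernelDecay (fun ξ => c * p ξ) d := by
  obtain ⟨C, hC, hb⟩ := h
  refine ⟨‖c‖ * C, by positivity, fun t ht x => ?_⟩
  rw [symbolKernel_const_mul, norm_mul, mul_assoc]
  gcongr
  exact hb t ht x

theorem hasKernelDecay_powSym (N : ℕ) : HasKernelDecay (powSym N : Eu m → ℂ) (m + N) := by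
  convert (hasKernelDecay_symA (m := m) N).const_mul ((-1) ^ N) using 2 with ξ
  rw [symA_eq_powSym, ← mul_assoc, ← mul_pow]; norm_num

theorem hasKernelDecay_hilSym (hm : 1 ≤ m) (j : Fin m) (N : ℕ) :
    HasKernelDecay (hilSym j N) (m + N) := by
  convert (hasKernelDecay_symB hm j N).const_mul ((-1) ^ N) using 2 with ξ
  rw [symB_eq_hilSym, ← mul_assoc, ← mul_pow]; norm_num

/-- The kernel with symbol `|2πξ|^{-N}`, `N < m`. -/
def rieszKernel (m N : ℕ) (x : Eu m) : ℂ := ((rieszCoeff m N * ‖x‖ ^ ((N : ℝ) - m) : ℝ) : ℂ)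

/-- The kernel with symbol `-i (ξ_j/|ξ|) |2πξ|^{-N}`, `1 ≤ N ≤ m`. -/
def hilbertRieszKernel (m : ℕ) (j : Fin m) (N : ℕ) (x : Eu m) : ℂ :=
  ((hilbertRieszCoeff m N * (‖x‖ ^ ((N : ℝ) - m - 1) * x j) : ℝ) : ℂ)

theorem isRieszBounded_rieszKernel {N : ℕ} (hN : 1 ≤ N) (hNm : N < m) :
    IsRieszBounded (rieszKernel m N) ((N : ℝ) - m) where
  measurable := Measurable.aestronglyMeasurable (by unfold rieszKernel; fun_prop)
  lower := by have : (1 : ℝ) ≤ N := by exact_mod_cast hN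
              linarith
  upper := by have : (N : ℝ) < m := by exact_mod_cast hNm
              linarith
  bound := by
    refine ⟨|rieszCoeff m N|, abs_nonneg _, fun x => ?_⟩
    rw [rieszKernel, Complex.norm_real, norm_mul, Real.norm_eq_abs, norm_of_nonneg (by positivity)]

theorem norm_rpow_mul_coord_le (a : ℝ) (x : Eu m) (j : Fin m) :
    ‖‖x‖ ^ (a - 1) * x j‖ ≤ ‖x‖ ^ a := by
  rcases eq_or_ne x 0 with rfl | hx
  · simp; positivity
  · have hx0 := norm_pos_iff.2 hx
    rw [norm_mul, norm_of_nonneg (by positivity)]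
    calc _ ≤ ‖x‖ ^ (a - 1) * ‖x‖ := by gcongr; exact PiLp.norm_apply_le x j
      _ = _ := by rw [← rpow_add_one hx0.ne']; congr 1; ring

theorem isRieszBounded_hilbertRieszKernel {N : ℕ} (hN : 1 ≤ N) (hNm : N ≤ m) (j : Fin m) :
    IsRieszBounded (hilbertRieszKernel m j N) ((N : ℝ) - m) where
  measurable := Measurable.aestronglyMeasurable (by unfold hilbertRieszKernel; fun_prop)
  lower := by have : (1 : ℝ) ≤ N := by exact_mod_cast hN
              linarith
  upper := by have : (N : ℝ) ≤ m := by exact_mod_cast hNm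
              linarith
  bound := by
    refine ⟨|hilbertRieszCoeff m N|, abs_nonneg _, fun x => ?_⟩
    rw [hilbertRieszKernel, Complex.norm_real, norm_mul, Real.norm_eq_abs]
    gcongr
    exact norm_rpow_mul_coord_le _ x j

theorem IsSymbol.toDist_shift_fun {q : Eu m → ℂ} (hq : IsSymbol q) (φ : 𝓢(Eu m, ℂ)) :
    (fun x => hq.toDist (shift x φ)) = 𝓕⁻ (fun ξ => q ξ * 𝓕 φ ξ) :=
  funext fun x => hq.toDist_shift φ x

/-- Convolution of a Riesz bounded kernel, known to divide by a symbol, with a symbol. -/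
theorem IsRieszBounded.isScalarConv (hm : 1 ≤ m) {k : Eu m → ℂ} {a : ℝ} (h : IsRieszBounded k a)
    {q ρ : Eu m → ℂ} (hq : IsSymbol q) {N : ℕ} (hN : 1 ≤ N) (hd : HasKernelDecay q (m + N))
    (ha : a = (N : ℝ) - m) (hρ : IsSymbol ρ)
    (hval : ∀ q' ρ' : Eu m → ℂ, Integrable q' → Integrable ρ' →
      (∃ C, ∀ x, ‖𝓕⁻ q' x‖ ≤ C * ((1 + ‖x‖) ^ (m + N))⁻¹) →
      (∃ φ : Eu m → ℂ, (∀ ξ, q' ξ = q ξ * φ ξ) ∧ ∀ ξ, ρ' ξ = ρ ξ * φ ξ) →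
      ∫ x, k x * 𝓕⁻ q' x = ∫ ξ, ρ' ξ) :
    IsScalarConv (h.isTempered hm).toDist hq.toDist hρ.toDist ∧
    IsScalarConv hq.toDist (h.isTempered hm).toDist hρ.toDist := by
  have hm1 : (1 : ℝ) ≤ m := by exact_mod_cast hm
  have hN1 : (1 : ℝ) ≤ N := by exact_mod_cast hN
  constructor
  · refine isScalarConv_tempered_symbol _ hq hρ (fun φ => ?_) (fun φ => ?_)
    · obtain ⟨C, hC, hb⟩ := hq.norm_toDist_shift_le hd φ
      obtain ⟨D, hD, hk⟩ := h.bound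
      have hc := (hq.contDiff_toDist_shift φ).continuous
      refine ((integrable_rpow_mul_of_decay hm (a := a) hc.aestronglyMeasurable h.lower
        (by rw [ha]; push_cast; linarith) hb).const_mul D).mono'
        (h.measurable.mul hc.aestronglyMeasurable) (Eventually.of_forall fun x => ?_)
      rw [norm_mul, ← mul_assoc]
      gcongr
      exact hk x
    · simp_rw [hq.toDist_shift φ]
      refine hval _ _ (hq.integrable_mul _) (hρ.integrable_mul (𝓕 φ)) ?_
        ⟨fun ξ => 𝓕 φ ξ, fun ξ => rfl, fun ξ => rfl⟩
      obtain ⟨C, hC, hb⟩ := hq.norm_toDist_shift_le hd φ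
      exact ⟨C, fun x => by rw [← hq.toDist_shift φ]; exact hb x⟩
  · refine isScalarConv_symbol hm hq hd hρ (k := 0) (by omega) (fun φ => ?_) (fun φ => ?_)
      (fun φ u hu => ?_)
    · rw [contDiff_infty]
      intro n
      have := (h.isTempered hm).contDiff_correlation φ n
      simp only [smul_eq_mul] at this
      simpa only [IsTempered.toDist_apply, shift_apply] using this
    · obtain ⟨C, hC, hb⟩ := h.integral_norm_le hm φ
      refine ⟨C, hC, fun x => ?_⟩
      rw [IsTempered.toDist_apply, pow_zero, inv_one, mul_one]
      simp_rw [shift_apply]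
      exact (norm_integral_le_integral_norm _).trans (hb x)
    · rw [h.integral_symbolKernel_mul hm hq hd (by omega) φ hu]
      simp_rw [(isSymbol_damp hq hu).toDist_shift φ]
      have hi := (isSymbol_damp hρ hu).integrable_mul (𝓕 φ)
      refine (hval _ _ ((isSymbol_damp hq hu).integrable_mul (𝓕 φ)) hi ?_
        ⟨fun ξ => (Real.exp (-(2 * π * u * ‖ξ‖)) : ℂ) * 𝓕 φ ξ, fun ξ => ?_, fun ξ => ?_⟩).trans ?_
      · obtain ⟨C, hC, hb⟩ := (isSymbol_damp hq hu).norm_toDist_shift_le (hd.damp hu) φ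
        exact ⟨C, fun x => by rw [← (isSymbol_damp hq hu).toDist_shift φ]; exact hb x⟩
      · simp only [damp]; ring
      · simp only [damp]; ring
      · refine integral_congr_of_eq fun ξ => ?_
        simp only [damp]; ring

theorem isScalarConv_rieszKernel {N : ℕ} (hN : 1 ≤ N) (hNm : N < m) (hm : 1 ≤ m) :
    IsScalarConv ((isRieszBounded_rieszKernel hN hNm).isTempered hm).toDist
      (isSymbol_powSym N).toDist (IsSymbol.const 1).toDist ∧
    IsScalarConv (isSymbol_powSym N).toDist
      ((isRieszBounded_rieszKernel hN hNm).isTempered hm).toDist (IsSymbol.const 1).toDist := by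
  refine (isRieszBounded_rieszKernel hN hNm).isScalarConv hm _ hN (hasKernelDecay_powSym N) rfl _ ?_
  rintro q' ρ' hq hρ ⟨C, hb⟩ ⟨φ, h1, h2⟩
  exact integral_riesz_mul_fourierInv hN hNm hq hρ hb fun ξ => by rw [h1, h2, powSym, one_mul]

theorem isScalarConv_hilbertRieszKernel {N : ℕ} (hN : 1 ≤ N) (hNm : N ≤ m) (hm : 1 ≤ m)
    (i j : Fin m) :
    IsScalarConv ((isRieszBounded_hilbertRieszKernel hN hNm i).isTempered hm).toDist
      (isSymbol_hilSym j N).toDist (isSymbol_rieszSq i j).toDist ∧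
    IsScalarConv (isSymbol_hilSym i N).toDist
      ((isRieszBounded_hilbertRieszKernel hN hNm j).isTempered hm).toDist
      (isSymbol_rieszSq i j).toDist := by
  have key : ∀ i j : Fin m, ∀ q' ρ' : Eu m → ℂ, Integrable q' → Integrable ρ' →
      (∃ C, ∀ x, ‖𝓕⁻ q' x‖ ≤ C * ((1 + ‖x‖) ^ (m + N))⁻¹) →
      (∃ φ : Eu m → ℂ, (∀ ξ, q' ξ = hilSym j N ξ * φ ξ) ∧ ∀ ξ, ρ' ξ = rieszSq i j ξ * φ ξ) →
      ∫ x, hilbertRieszKernel m i N x * 𝓕⁻ q' x = ∫ ξ, ρ' ξ := by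
    rintro i j q' ρ' hq hρ ⟨C, hb⟩ ⟨φ, h1, h2⟩
    refine integral_hilbertRiesz_mul_fourierInv hm hN hNm i hq hρ hb fun ξ => ?_
    rw [h1, h2, symB_one, hilSym, powSym, rieszSq, pow_succ]
    have := norm_mul_coord_div ξ i
    push_cast
    linear_combination (-(2 * π * (2 * π * ‖ξ‖) ^ N * ((ξ j : ℂ) / ‖ξ‖) * φ ξ) : ℂ) * (-this) +
      (2 * π * (2 * π * ‖ξ‖) ^ N * ξ i * ((ξ j : ℂ) / ‖ξ‖) * φ ξ) * Complex.I_sq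
  refine ⟨((isRieszBounded_hilbertRieszKernel hN hNm i).isScalarConv hm _ hN
    (hasKernelDecay_hilSym hm j N) rfl _ (key i j)).1, ?_⟩
  refine ((isRieszBounded_hilbertRieszKernel hN hNm j).isScalarConv hm _ hN
    (hasKernelDecay_hilSym hm i N) rfl (isSymbol_rieszSq i j) ?_).2
  rintro q' ρ' hq hρ hb ⟨φ, h1, h2⟩
  exact key j i q' ρ' hq hρ hb ⟨φ, h1, fun ξ => by rw [h2, rieszSq, rieszSq, mul_comm (_ / _)]⟩

theorem isScalarConv_hilSym_zero (hm : 1 ≤ m) (i j : Fin m) :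
    IsScalarConv (isSymbol_hilSym i 0).toDist (isSymbol_hilSym j 0).toDist
      (isSymbol_rieszSq i j).toDist := by
  have hj := isSymbol_hilSym j 0
  have hρ := isSymbol_rieszSq i j
  refine isScalarConv_symbol hm _ (hasKernelDecay_hilSym hm i 0) hρ (k := m) (by omega)
    hj.contDiff_toDist_shift (fun φ => hj.norm_toDist_shift_le (hasKernelDecay_hilSym hm j 0) φ)
    fun φ u hu => ?_
  simp_rw [hj.toDist_shift φ]
  obtain ⟨C, hC, hb⟩ := hj.norm_toDist_shift_le (hasKernelDecay_hilSym hm j 0) φ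
  rw [← integral_conjPoisson_mul_fourierInv hm i (hj.integrable_mul (𝓕 φ))
    (hρ.integrable_mul (𝓕 φ)) (fun x => by rw [← hj.toDist_shift φ]; exact hb x) ?_ hu]
  · refine integral_congr_of_eq fun x => ?_
    congr 1
    rw [← conjPoisson_eq_symbolKernel hm hu]
    congr 1
  · intro ξ
    rw [symB_one, hilSym, powSym, rieszSq, pow_zero]
    have := norm_mul_coord_div ξ i
    push_cast
    linear_combination (-(2 * π * ((ξ j : ℂ) / ‖ξ‖) * 𝓕 φ ξ) : ℂ) * (-this) +
      (2 * π * ξ i * ((ξ j : ℂ) / ‖ξ‖) * 𝓕 φ ξ) * Complex.I_sq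

theorem toDist_const_one (φ : 𝓢(Eu m, ℂ)) : (IsSymbol.const (m := m) 1).toDist φ = φ 0 := by
  rw [IsSymbol.toDist_apply]
  have h : 𝓕⁻ (𝓕 (φ : Eu m → ℂ)) 0 = φ 0 := by
    have hi : Integrable (𝓕 (φ : Eu m → ℂ)) := by
      rw [← SchwartzMap.fourier_coe]; exact (𝓕 φ).integrable
    rw [φ.continuous.fourierInv_fourier_eq φ.integrable hi]
  rw [← h, Real.fourierInv_eq']
  simp [SchwartzMap.fourier_coe]

theorem isScalarConv_const_one : IsScalarConv (IsSymbol.const (m := m) 1).toDist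
    (IsSymbol.const 1).toDist (IsSymbol.const 1).toDist := by
  refine isScalarConv_of (IsSymbol.const 1).contDiff_toDist_shift fun φ χ hχ ψ hψ => ?_
  refine tendsto_const_nhds.congr' ?_
  filter_upwards [hχ.eventuallyOne {0} isCompact_singleton] with i hi
  simp [toDist_const_one, hψ, hi 0 rfl, shift_apply]

/-! ### Integration by parts without compact support -/

theorem hasLineDerivAt_gaussian (ε : ℝ) (x v : Eu m) :
    HasLineDerivAt ℝ (fun x : Eu m => ((Real.exp (-(ε * ‖x‖ ^ 2)) : ℝ) : ℂ))
      ((-(2 * ε * inner ℝ x v) * Real.exp (-(ε * ‖x‖ ^ 2)) : ℝ) : ℂ) x v := by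
  have h1 : HasDerivAt (fun t : ℝ => ‖x + t • v‖ ^ 2) (2 * inner ℝ x v) 0 := by
    have h2 : HasDerivAt (fun t : ℝ => x + t • v) v 0 := by
      simpa using ((hasDerivAt_id (0 : ℝ)).smul_const v).const_add x
    simpa using h2.norm_sq
  have h3 := (h1.const_mul ε).neg.exp
  have h4 := h3.ofReal_comp
  refine h4.congr_deriv ?_
  simp only [Pi.neg_apply, zero_smul, add_zero]
  congr 1; ring

theorem gaussian_mul_one_add_le {ε : ℝ} (h0 : 0 < ε) (h1 : ε ≤ 1) (r : ℝ) :
    Real.exp (-(ε * r ^ 2)) * (1 + r) ≤ 2 / ε := by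
  have h2 : Real.exp (-(ε * r ^ 2)) * (1 + ε * r ^ 2) ≤ 1 := by
    rw [Real.exp_neg, inv_mul_le_iff₀ (Real.exp_pos _), mul_one, add_comm]
    exact Real.add_one_le_exp _
  rw [le_div_iff₀ h0]
  have hE := Real.exp_nonneg (-(ε * r ^ 2))
  have h3 : (1 + r) * ε ≤ 2 * (1 + ε * r ^ 2) := by nlinarith [sq_nonneg (r - 1)]
  calc Real.exp (-(ε * r ^ 2)) * (1 + r) * ε = Real.exp (-(ε * r ^ 2)) * ((1 + r) * ε) := by ring
    _ ≤ Real.exp (-(ε * r ^ 2)) * (2 * (1 + ε * r ^ 2)) := by gcongr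
    _ ≤ 2 := by linarith

theorem gaussian_deriv_mul_one_add_le {ε : ℝ} (h0 : 0 < ε) (h1 : ε ≤ 1) (r : ℝ) :
    ε * r * Real.exp (-(ε * r ^ 2)) * (1 + r) ≤ 2 := by
  have h2 : Real.exp (-(ε * r ^ 2)) * (1 + ε * r ^ 2) ≤ 1 := by
    rw [Real.exp_neg, inv_mul_le_iff₀ (Real.exp_pos _), mul_one, add_comm]
    exact Real.add_one_le_exp _
  have hE := Real.exp_nonneg (-(ε * r ^ 2))
  have h3 : ε * r * (1 + r) ≤ 2 * (1 + ε * r ^ 2) := by nlinarith [sq_nonneg (r - 1)]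
  calc ε * r * Real.exp (-(ε * r ^ 2)) * (1 + r) =
        Real.exp (-(ε * r ^ 2)) * (ε * r * (1 + r)) := by ring
    _ ≤ Real.exp (-(ε * r ^ 2)) * (2 * (1 + ε * r ^ 2)) := by gcongr
    _ ≤ 2 := by linarith

/-- Integration by parts for functions whose product decays faster than `|x|^{1-m}`. -/
theorem integral_mul_lineDeriv_eq_neg (hm : 1 ≤ m) {f f' g g' : Eu m → ℂ} {v : Eu m} {C : ℝ}
    (hf : ∀ x, HasLineDerivAt ℝ f (f' x) x v) (hg : ∀ x, HasLineDerivAt ℝ g (g' x) x v)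
    (hf'g : Integrable fun x => f' x * g x) (hfg' : Integrable fun x => f x * g' x)
    (hfgm : AEStronglyMeasurable fun x => f x * g x)
    (hfg : ∀ x, ‖f x * g x‖ ≤ C * (1 + ‖x‖) ^ (1 / 2 - m : ℝ)) :
    ∫ x, f x * g' x = -∫ x, f' x * g x := by
  have hm1 : (1 : ℝ) ≤ m := by exact_mod_cast hm
  have hC : 0 ≤ C := by
    have := (norm_nonneg _).trans (hfg 0)
    simpa using this
  set χ : ℝ → Eu m → ℂ := fun ε x => ((Real.exp (-(ε * ‖x‖ ^ 2)) : ℝ) : ℂ) with hχ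
  set χ' : ℝ → Eu m → ℂ := fun ε x =>
    ((-(2 * ε * inner ℝ x v) * Real.exp (-(ε * ‖x‖ ^ 2)) : ℝ) : ℂ) with hχ'
  have hcχ : ∀ ε, Continuous (χ ε) := fun ε => by simp only [hχ]; fun_prop
  have hcχ' : ∀ ε, Continuous (χ' ε) := fun ε => by simp only [hχ']; fun_prop
  have hχ1 : ∀ ε, 0 < ε → ∀ x, ‖χ ε x‖ ≤ 1 := fun ε hε x => by
    rw [Complex.norm_real, norm_of_nonneg (Real.exp_nonneg _), Real.exp_le_one_iff]
    have : 0 ≤ ε * ‖x‖ ^ 2 := by positivity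
    linarith
  have hχ'b : ∀ ε, 0 < ε → ε ≤ 1 → ∀ x, ‖χ' ε x‖ ≤ 4 * ‖v‖ * (1 + ‖x‖)⁻¹ := fun ε hε hε1 x => by
    have h := gaussian_deriv_mul_one_add_le hε hε1 ‖x‖
    have hx : 0 < 1 + ‖x‖ := by positivity
    rw [Complex.norm_real, norm_mul, norm_neg, norm_mul, norm_mul, norm_of_nonneg hε.le,
      norm_of_nonneg (Real.exp_nonneg _), Real.norm_ofNat, ← div_eq_mul_inv, le_div_iff₀ hx]
    calc _ ≤ 2 * ε * (‖x‖ * ‖v‖) * Real.exp (-(ε * ‖x‖ ^ 2)) * (1 + ‖x‖) := by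
          gcongr; exact norm_inner_le_norm x v
      _ = 2 * ‖v‖ * (ε * ‖x‖ * Real.exp (-(ε * ‖x‖ ^ 2)) * (1 + ‖x‖)) := by ring
      _ ≤ 2 * ‖v‖ * 2 := by gcongr
      _ = _ := by ring
  have hJ : Integrable fun x : Eu m => (1 + ‖x‖) ^ (-((m : ℝ) + 1 / 2)) :=
    integrable_one_add_norm (by simp)
  have hJe : ∀ x : Eu m, (1 + ‖x‖) ^ (-((m : ℝ) + 1 / 2)) =
      (1 + ‖x‖) ^ (1 / 2 - m : ℝ) * (1 + ‖x‖)⁻¹ := fun x => by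
    have hx : 0 < 1 + ‖x‖ := by positivity
    rw [← rpow_neg_one (1 + ‖x‖), ← rpow_add hx]; congr 1; ring
  have key : ∀ ε, 0 < ε → ε ≤ 1 →
      ∫ x, f x * (χ' ε x * g x + χ ε x * g' x) = -∫ x, f' x * (χ ε x * g x) := by
    intro ε hε hε1
    have i1 : Integrable fun x => f' x * (χ ε x * g x) := by
      have := hf'g.bdd_mul (c := 1) (hcχ ε).aestronglyMeasurable (Eventually.of_forall (hχ1 ε hε))
      exact this.congr (Eventually.of_forall fun x => by simp only; ring)
    have i2 : Integrable fun x => f x * (χ ε x * g' x) := by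
      have := hfg'.bdd_mul (c := 1) (hcχ ε).aestronglyMeasurable (Eventually.of_forall (hχ1 ε hε))
      exact this.congr (Eventually.of_forall fun x => by simp only; ring)
    have i3 : Integrable fun x => f x * (χ' ε x * g x) := by
      refine (hJ.const_mul (C * (4 * ‖v‖))).mono' ?_ (Eventually.of_forall fun x => ?_)
      · exact ((hcχ' ε).aestronglyMeasurable.mul hfgm).congr
          (Eventually.of_forall fun x => by simp only [Pi.mul_apply]; ring)
      · calc ‖f x * (χ' ε x * g x)‖ = ‖f x * g x‖ * ‖χ' ε x‖ := by rw [← norm_mul]; congr 1; ring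
          _ ≤ C * (1 + ‖x‖) ^ (1 / 2 - m : ℝ) * (4 * ‖v‖ * (1 + ‖x‖)⁻¹) :=
            mul_le_mul (hfg x) (hχ'b ε hε hε1 x) (norm_nonneg _) (by positivity)
          _ = _ := by rw [hJe]; ring
    have i4 : Integrable fun x => f x * (χ ε x * g x) := by
      refine (hJ.const_mul (C * (2 / ε))).mono' ?_ (Eventually.of_forall fun x => ?_)
      · exact ((hcχ ε).aestronglyMeasurable.mul hfgm).congr
          (Eventually.of_forall fun x => by simp only [Pi.mul_apply]; ring)
      · have hx : 0 < 1 + ‖x‖ := by positivity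
        have h5 : ‖χ ε x‖ ≤ 2 / ε * (1 + ‖x‖)⁻¹ := by
          rw [← div_eq_mul_inv, le_div_iff₀ hx, Complex.norm_real,
            norm_of_nonneg (Real.exp_nonneg _)]
          exact gaussian_mul_one_add_le hε hε1 _
        calc ‖f x * (χ ε x * g x)‖ = ‖f x * g x‖ * ‖χ ε x‖ := by rw [← norm_mul]; congr 1; ring
          _ ≤ C * (1 + ‖x‖) ^ (1 / 2 - m : ℝ) * (2 / ε * (1 + ‖x‖)⁻¹) :=
            mul_le_mul (hfg x) h5 (norm_nonneg _) (by positivity)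
          _ = _ := by rw [hJe]; ring
    have := integral_bilinear_hasLineDerivAt_right_eq_neg_left_of_integrable
      (μ := (volume : Measure (Eu m))) (B := ContinuousLinearMap.mul ℝ ℂ) (f := f) (f' := f')
      (g := fun x => χ ε x * g x) (g' := fun x => χ' ε x * g x + χ ε x * g' x) (v := v)
      i1 ((i3.add i2).congr (Eventually.of_forall fun x => by
        simp only [Pi.add_apply, ContinuousLinearMap.mul_apply']; ring)) i4
      (fun x _ => hf x) (fun x _ => by
        have h6 := HasDerivAt.mul (hasLineDerivAt_gaussian ε x v) (hg x)
        refine HasDerivAt.congr_deriv h6 ?_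
        simp [hχ, hχ'])
    exact this
  have l1 : Tendsto (fun n : ℕ => ∫ x, f x * (χ' (1 / ((n : ℝ) + 1)) x * g x +
      χ (1 / ((n : ℝ) + 1)) x * g' x)) atTop (𝓝 (∫ x, f x * g' x)) := by
    refine tendsto_integral_of_dominated_convergence
      (fun x => C * (4 * ‖v‖) * (1 + ‖x‖) ^ (-((m : ℝ) + 1 / 2)) + ‖f x * g' x‖) (fun n => ?_)
      ((hJ.const_mul _).add hfg'.norm) (fun n => Eventually.of_forall fun x => ?_)
      (Eventually.of_forall fun x => ?_)
    · refine (((hcχ' (1 / ((n : ℝ) + 1))).aestronglyMeasurable.mul hfgm).add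
        ((hcχ (1 / ((n : ℝ) + 1))).aestronglyMeasurable.mul hfg'.aestronglyMeasurable)).congr
        (Eventually.of_forall fun x => ?_)
      simp only [Pi.add_apply, Pi.mul_apply]; ring
    · have hε : 0 < 1 / ((n : ℝ) + 1) := by positivity
      have hε1 : 1 / ((n : ℝ) + 1) ≤ 1 := by
        rw [div_le_one (by positivity)]; linarith [(Nat.cast_nonneg n : (0 : ℝ) ≤ n)]
      rw [mul_add]
      refine (norm_add_le _ _).trans (add_le_add ?_ ?_)
      · calc _ = ‖f x * g x‖ * ‖χ' (1 / ((n : ℝ) + 1)) x‖ := by rw [← norm_mul]; congr 1; ring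
          _ ≤ C * (1 + ‖x‖) ^ (1 / 2 - m : ℝ) * (4 * ‖v‖ * (1 + ‖x‖)⁻¹) :=
            mul_le_mul (hfg x) (hχ'b _ hε hε1 x) (norm_nonneg _) (by positivity)
          _ = _ := by rw [hJe]; ring
      · calc _ = ‖f x * g' x‖ * ‖χ (1 / ((n : ℝ) + 1)) x‖ := by rw [← norm_mul]; congr 1; ring
          _ ≤ _ := mul_le_of_le_one_right (norm_nonneg _) (hχ1 _ hε x)
    · have h7 : Tendsto (fun n : ℕ => 1 / ((n : ℝ) + 1)) atTop (𝓝 0) :=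
        tendsto_one_div_add_atTop_nhds_zero_nat
      have h8 : Continuous fun ε : ℝ => f x * (χ' ε x * g x + χ ε x * g' x) := by
        simp only [hχ, hχ']; fun_prop
      have h9 := (h8.tendsto 0).comp h7
      simpa [hχ, hχ', Function.comp_def] using h9
  have l2 : Tendsto (fun n : ℕ => -∫ x, f' x * (χ (1 / ((n : ℝ) + 1)) x * g x)) atTop
      (𝓝 (-∫ x, f' x * g x)) := by
    refine Tendsto.neg (tendsto_integral_of_dominated_convergence (fun x => ‖f' x * g x‖)
      (fun n => ?_) hf'g.norm (fun n => Eventually.of_forall fun x => ?_)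
      (Eventually.of_forall fun x => ?_))
    · exact ((hcχ (1 / ((n : ℝ) + 1))).aestronglyMeasurable.mul hf'g.aestronglyMeasurable).congr
        (Eventually.of_forall fun x => by simp only [Pi.mul_apply]; ring)
    · calc _ = ‖f' x * g x‖ * ‖χ (1 / ((n : ℝ) + 1)) x‖ := by rw [← norm_mul]; congr 1; ring
        _ ≤ _ := mul_le_of_le_one_right (norm_nonneg _) (hχ1 _ (by positivity) x)
    · have h7 : Tendsto (fun n : ℕ => 1 / ((n : ℝ) + 1)) atTop (𝓝 0) :=
        tendsto_one_div_add_atTop_nhds_zero_nat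
      have h8 : Continuous fun ε : ℝ => f' x * (χ ε x * g x) := by
        simp only [hχ]; fun_prop
      have h9 := (h8.tendsto 0).comp h7
      simpa [hχ, Function.comp_def] using h9
  refine tendsto_nhds_unique l1 (l2.congr fun n => ?_)
  have hε1 : 1 / ((n : ℝ) + 1) ≤ 1 := by
    rw [div_le_one (by positivity)]; linarith [(Nat.cast_nonneg n : (0 : ℝ) ≤ n)]
  exact (key _ (by positivity) hε1).symm

/-- Derivatives of an inverse Fourier transform. -/
theorem hasLineDerivAt_fourierInv {g : Eu m → ℂ} (hg : Integrable g)
    (hg1 : Integrable fun ξ => ‖ξ‖ * ‖g ξ‖) (x : Eu m) (j : Fin m) :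
    HasLineDerivAt ℝ (𝓕⁻ g) (𝓕⁻ (fun ξ => ((2 * π * ξ j : ℝ) : ℂ) * Complex.I * g ξ) x) x
      (unitVec j) := by
  have hn' : Integrable (fun ξ => VectorFourier.fourierSMulRight (innerSL ℝ) g ξ) := by
    refine Integrable.mono' (hg1.const_mul (2 * π * ‖innerSL ℝ (E := Eu m)‖)) ?_
      (Eventually.of_forall fun ξ => ?_)
    · exact hg.1.fourierSMulRight
    · refine (VectorFourier.norm_fourierSMulRight_le _ _ _).trans (le_of_eq (by ring))
  have h1 := Real.hasFDerivAt_fourier hg hg1 (-x)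
  have h2 : HasDerivAt (fun s : ℝ => -(x + s • unitVec j))
      (-unitVec j) 0 := by
    have := (((hasDerivAt_id (0 : ℝ)).smul_const
      (unitVec j)).const_add x).neg
    rw [one_smul] at this
    exact this
  have h3 : HasFDerivAt (𝓕 g) (𝓕 (VectorFourier.fourierSMulRight (innerSL ℝ) g) (-x))
      (-(x + (0 : ℝ) • unitVec j)) := by simpa using h1
  have h4 := h3.comp_hasDerivAt (0 : ℝ) h2
  have h5 : (fun s : ℝ => 𝓕⁻ g (x + s • unitVec j)) =
      𝓕 g ∘ fun s : ℝ => -(x + s • unitVec j) := by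
    funext s; simp [Real.fourierInv_eq_fourier_neg]
  rw [HasLineDerivAt, h5]
  refine h4.congr_deriv ?_
  rw [Real.fourier_continuousLinearMap_apply hn', Real.fourierInv_eq_fourier_neg]
  refine congrArg (fun f : Eu m → ℂ => 𝓕 f (-x)) (funext fun ξ => ?_)
  simp only [VectorFourier.fourierSMulRight_apply]
  have : innerSL ℝ ξ (unitVec j) = ξ j := by
    rw [innerSL_apply_apply]
    simp [EuclideanSpace.inner_single_right]
  rw [map_neg, this]
  simp only [Complex.real_smul, smul_eq_mul]
  push_cast; ring

theorem IsSymbol.deriv_coord {q : Eu m → ℂ} (hq : IsSymbol q) (j : Fin m) :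
    IsSymbol fun ξ => ((2 * π * ξ j : ℝ) : ℂ) * Complex.I * q ξ := by
  have := (((IsSymbol.const (m := m) (2 * π : ℝ)).mul (IsSymbol.coord j)).mul
    (IsSymbol.const Complex.I)).mul hq
  convert this using 2
  push_cast; ring

theorem IsSymbol.hasLineDerivAt_toDist_shift {q : Eu m → ℂ} (hq : IsSymbol q) (φ : 𝓢(Eu m, ℂ))
    (x : Eu m) (j : Fin m) :
    HasLineDerivAt ℝ (fun x => hq.toDist (shift x φ)) ((hq.deriv_coord j).toDist (shift x φ)) x
      (unitVec j) := by
  rw [hq.toDist_shift_fun, (hq.deriv_coord j).toDist_shift]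
  have h := hasLineDerivAt_fourierInv (hq.integrable_mul (𝓕 φ))
    (by simpa using hq.integrable_pow_mul (𝓕 φ) 1) x j
  simpa only [mul_assoc] using h

section

/-! ### Regularised logarithmic kernels -/

/-- The function `s^c (α ln √s + β)`. -/
def logPow (α β c s : ℝ) : ℝ := s ^ c * (α * (Real.log s / 2) + β)

theorem hasDerivAt_logPow (α β c : ℝ) {s : ℝ} (hs : 0 < s) :
    HasDerivAt (logPow α β c) (logPow (2 * c * α) (2 * c * β + α) (c - 1) s / 2) s := by
  have h1 := Real.hasDerivAt_rpow_const (x := s) (p := c) (Or.inl hs.ne')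
  have h2 := (((Real.hasDerivAt_log hs.ne').div_const 2).const_mul α).add_const β
  refine (h1.mul h2).congr_deriv ?_
  have : s ^ c = s ^ (c - 1) * s := by rw [← rpow_add_one hs.ne']; congr 1; ring
  rw [logPow, this]
  field_simp
  ring

theorem hasLineDerivAt_logPow (α β c : ℝ) {ε : ℝ} (hε : 0 < ε) (x : Eu m) (l : Fin m) :
    HasLineDerivAt ℝ (fun x : Eu m => logPow α β c (‖x‖ ^ 2 + ε ^ 2))
      (x l * logPow (2 * c * α) (2 * c * β + α) (c - 1) (‖x‖ ^ 2 + ε ^ 2)) x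
      (unitVec l) := by
  have h1 := (hasDerivAt_norm_sq_line x l).add_const (ε ^ 2)
  have h2 : HasDerivAt (logPow α β c)
      (logPow (2 * c * α) (2 * c * β + α) (c - 1) (‖x‖ ^ 2 + ε ^ 2) / 2)
      (‖x + (0 : ℝ) • unitVec l‖ ^ 2 + ε ^ 2) := by
    simpa using hasDerivAt_logPow α β c (s := ‖x‖ ^ 2 + ε ^ 2) (by positivity)
  refine (h2.comp (0 : ℝ) h1).congr_deriv ?_
  ring

theorem abs_logPow_le (α β c : ℝ) : ∃ C, 0 ≤ C ∧ ∀ s, 0 < s →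
    |logPow α β c s| ≤ C * (s ^ (c - 1 / 8) + s ^ (c + 1 / 8)) := by
  refine ⟨4 * |α| + |β|, by positivity, fun s hs => ?_⟩
  set p := s ^ (1 / 8 : ℝ) with hp
  have hp0 : 0 < p := by positivity
  have hpi : s ^ (-(1 / 8) : ℝ) = p⁻¹ := by rw [rpow_neg hs.le]
  have h1 : Real.log s ≤ 8 * p := by
    have := Real.log_le_rpow_div hs.le (ε := 1 / 8) (by norm_num)
    linarith
  have h2 : -Real.log s ≤ 8 * p⁻¹ := by
    have := Real.log_le_rpow_div (inv_nonneg.2 hs.le) (ε := 1 / 8) (by norm_num)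
    rw [Real.log_inv, Real.inv_rpow hs.le] at this
    linarith
  have hpi0 : 0 < p⁻¹ := by positivity
  have h3 : |Real.log s| ≤ 8 * (p⁻¹ + p) := abs_le.2 ⟨by linarith, by linarith⟩
  have h4 : 1 ≤ p⁻¹ + p := by
    rcases le_total 1 p with h | h
    · linarith
    · linarith [(one_le_inv₀ hp0).2 h]
  have h5 : |α * (Real.log s / 2) + β| ≤ (4 * |α| + |β|) * (p⁻¹ + p) := by
    calc _ ≤ |α| * (|Real.log s| / 2) + |β| := by
          refine (abs_add_le _ _).trans (le_of_eq ?_)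
          rw [abs_mul, abs_div]; norm_num
      _ ≤ |α| * (8 * (p⁻¹ + p) / 2) + |β| * (p⁻¹ + p) := by
          gcongr; exact le_mul_of_one_le_right (abs_nonneg _) h4
      _ = _ := by ring
  have e1 : s ^ (c - 1 / 8) = s ^ c * p⁻¹ := by
    rw [sub_eq_add_neg, rpow_add hs, hpi]
  have e2 : s ^ (c + 1 / 8) = s ^ c * p := by rw [rpow_add hs]
  rw [logPow, abs_mul, abs_of_pos (by positivity), e1, e2, ← mul_add]
  calc _ ≤ s ^ c * ((4 * |α| + |β|) * (p⁻¹ + p)) := by gcongr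
    _ = _ := by ring

theorem continuous_logPow_nrm (α β c : ℝ) {ε : ℝ} (hε : 0 < ε) :
    Continuous fun x : Eu m => logPow α β c (‖x‖ ^ 2 + ε ^ 2) := by
  have h : ∀ x : Eu m, ‖x‖ ^ 2 + ε ^ 2 ≠ 0 := fun x => by positivity
  unfold logPow
  refine Continuous.mul ?_ ?_
  · exact Continuous.rpow_const (by fun_prop) fun x => Or.inl (h x)
  · exact ((Continuous.log (by fun_prop) h).div_const 2).const_mul α |>.add continuous_const

theorem tendsto_logPow (α β c : ℝ) {x : Eu m} (hx : x ≠ 0) :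
    Tendsto (fun ε : ℝ => logPow α β c (‖x‖ ^ 2 + ε ^ 2)) (𝓝[>] 0)
      (𝓝 (logPow α β c (‖x‖ ^ 2))) := by
  have h0 : 0 < ‖x‖ ^ 2 := by have := norm_pos_iff.2 hx; positivity
  have h1 : Tendsto (fun ε : ℝ => ‖x‖ ^ 2 + ε ^ 2) (𝓝[>] 0) (𝓝 (‖x‖ ^ 2)) := by
    have : Continuous fun ε : ℝ => ‖x‖ ^ 2 + ε ^ 2 := by fun_prop
    simpa using (this.tendsto 0).mono_left nhdsWithin_le_nhds
  exact (hasDerivAt_logPow α β c h0).continuousAt.tendsto.comp h1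

/-- A family `f ε` of functions of `x` of size `(|x|² + ε²)^{a/2}` up to logarithms. -/
structure HasOrder (f : ℝ → Eu m → ℝ) (a : ℝ) : Prop where
  continuous : ∀ ε, 0 < ε → Continuous (f ε)
  bound : ∃ C, 0 ≤ C ∧ ∀ ε, 0 < ε → ∀ x : Eu m, |f ε x| ≤
    C * ((‖x‖ ^ 2 + ε ^ 2) ^ (a / 2 - 1 / 8) + (‖x‖ ^ 2 + ε ^ 2) ^ (a / 2 + 1 / 8))

theorem hasOrder_logPow (α β c : ℝ) :
    HasOrder (fun ε (x : Eu m) => logPow α β c (‖x‖ ^ 2 + ε ^ 2)) (2 * c) where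
  continuous ε hε := continuous_logPow_nrm α β c hε
  bound := by
    obtain ⟨C, hC, h⟩ := abs_logPow_le α β c
    refine ⟨C, hC, fun ε hε x => ?_⟩
    rw [mul_div_cancel_left₀ _ two_ne_zero]
    exact h _ (by positivity)

theorem HasOrder.coord {f : ℝ → Eu m → ℝ} {a : ℝ} (h : HasOrder f a) (l : Fin m) :
    HasOrder (fun ε x => x l * f ε x) (a + 1) where
  continuous ε hε := by
    have := h.continuous ε hε
    fun_prop
  bound := by
    obtain ⟨C, hC, hb⟩ := h.bound
    refine ⟨C, hC, fun ε hε x => ?_⟩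
    set s := ‖x‖ ^ 2 + ε ^ 2 with hs
    have hs0 : 0 < s := by positivity
    have hx : |x l| ≤ s ^ (1 / 2 : ℝ) := by
      rw [← Real.sqrt_eq_rpow]
      refine (PiLp.norm_apply_le x l).trans (Real.le_sqrt_of_sq_le ?_)
      rw [hs]; nlinarith
    have e1 : s ^ ((a + 1) / 2 - 1 / 8) = s ^ (1 / 2 : ℝ) * s ^ (a / 2 - 1 / 8) := by
      rw [← rpow_add hs0]; congr 1; ring
    have e2 : s ^ ((a + 1) / 2 + 1 / 8) = s ^ (1 / 2 : ℝ) * s ^ (a / 2 + 1 / 8) := by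
      rw [← rpow_add hs0]; congr 1; ring
    rw [abs_mul, e1, e2, ← mul_add, mul_left_comm]
    gcongr
    exact hb ε hε x

theorem HasOrder.add {f g : ℝ → Eu m → ℝ} {a : ℝ} (hf : HasOrder f a) (hg : HasOrder g a) :
    HasOrder (fun ε x => f ε x + g ε x) a where
  continuous ε hε := (hf.continuous ε hε).add (hg.continuous ε hε)
  bound := by
    obtain ⟨C, hC, hb⟩ := hf.bound
    obtain ⟨D, hD, hd⟩ := hg.bound
    refine ⟨C + D, by positivity, fun ε hε x => (abs_add_le _ _).trans ?_⟩
    rw [add_mul]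
    exact add_le_add (hb ε hε x) (hd ε hε x)

theorem HasOrder.const_mul {f : ℝ → Eu m → ℝ} {a : ℝ} (hf : HasOrder f a) (c : ℝ) :
    HasOrder (fun ε x => c * f ε x) a where
  continuous ε hε := (hf.continuous ε hε).const_mul c
  bound := by
    obtain ⟨C, hC, hb⟩ := hf.bound
    refine ⟨|c| * C, by positivity, fun ε hε x => ?_⟩
    rw [abs_mul, mul_assoc]
    gcongr
    exact hb ε hε x

/-- Growth of a regularised family for a fixed parameter. -/
theorem HasOrder.bound_fixed {f : ℝ → Eu m → ℝ} {a : ℝ} (h : HasOrder f a) {ε : ℝ} (hε : 0 < ε) :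
    ∃ C, 0 ≤ C ∧ ∀ x, |f ε x| ≤ C * (1 + ‖x‖) ^ (a + 1 / 4) := by
  obtain ⟨C, hC, hb⟩ := h.bound
  have key : ∀ e : ℝ, ∃ D, 0 ≤ D ∧ ∀ x : Eu m, (‖x‖ ^ 2 + ε ^ 2) ^ e ≤ D * (1 + ‖x‖) ^ (2 * e) := by
    intro e
    have hsq : ∀ x : Eu m, (1 + ‖x‖) ^ (2 * e) = ((1 + ‖x‖) ^ 2) ^ e := fun x => by
      rw [rpow_mul (by positivity)]; norm_num
    rcases le_total 0 e with he | he
    · refine ⟨((1 + ε) ^ 2) ^ e, by positivity, fun x => ?_⟩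
      rw [hsq, ← Real.mul_rpow (by positivity) (by positivity)]
      refine rpow_le_rpow (by positivity) ?_ he
      have := norm_nonneg x
      rw [← mul_pow]
      nlinarith [mul_nonneg this hε.le, mul_nonneg (mul_nonneg this hε.le) (add_nonneg this hε.le),
        mul_nonneg (mul_nonneg this hε.le) (mul_nonneg this hε.le)]
    · refine ⟨(((ε⁻¹ + 1) ^ 2)⁻¹) ^ e, by positivity, fun x => ?_⟩
      rw [hsq, ← Real.mul_rpow (by positivity) (by positivity)]
      refine rpow_le_rpow_of_nonpos (by positivity) ?_ he
      rw [inv_mul_le_iff₀ (by positivity), add_comm (‖x‖ ^ 2), ← nrm_sq, ← mul_pow]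
      gcongr
      exact one_add_norm_le_mul_nrm hε x
  obtain ⟨D₁, hD₁, h₁⟩ := key (a / 2 - 1 / 8)
  obtain ⟨D₂, hD₂, h₂⟩ := key (a / 2 + 1 / 8)
  refine ⟨C * (D₁ + D₂), by positivity, fun x => (hb ε hε x).trans ?_⟩
  have e1 : (1 + ‖x‖) ^ (2 * (a / 2 - 1 / 8)) ≤ (1 + ‖x‖) ^ (a + 1 / 4) :=
    rpow_le_rpow_of_exponent_le (by linarith [norm_nonneg x]) (by linarith)
  have e2 : (1 + ‖x‖) ^ (2 * (a / 2 + 1 / 8)) = (1 + ‖x‖) ^ (a + 1 / 4) := by congr 1; ring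
  rw [mul_assoc, add_mul]
  gcongr
  · exact (h₁ x).trans (by gcongr)
  · rw [← e2]; exact h₂ x

/-- The bound of a regularised family, uniform in the parameter. -/
theorem HasOrder.bound_uniform {f : ℝ → Eu m → ℝ} {a : ℝ} (h : HasOrder f a) :
    ∃ C, 0 ≤ C ∧ ∀ ε, 0 < ε → ε ≤ 1 → ∀ x, x ≠ 0 → |f ε x| ≤
      C * (‖x‖ ^ min (a - 1 / 4) 0 * (1 + ‖x‖) ^ (max (a - 1 / 4) 0 + 1 / 2)) := by
  obtain ⟨C, hC, hb⟩ := h.bound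
  refine ⟨C * 2, by positivity, fun ε hε hε1 x hx => (hb ε hε x).trans ?_⟩
  have hx0 := norm_pos_iff.2 hx
  set s := ‖x‖ ^ 2 + ε ^ 2 with hs
  have hs0 : 0 < s := by positivity
  have hs1 : s ≤ (1 + ‖x‖) ^ 2 := by rw [hs]; nlinarith
  have hs2 : ‖x‖ ^ 2 ≤ s := by rw [hs]; nlinarith
  have h1 : 1 ≤ 1 + ‖x‖ := by linarith
  have e1 : s ^ (a / 2 - 1 / 8) ≤
      ‖x‖ ^ min (a - 1 / 4) 0 * (1 + ‖x‖) ^ max (a - 1 / 4) 0 := by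
    have e : a / 2 - 1 / 8 = (a - 1 / 4) / 2 := by ring
    rw [e]
    rcases le_total (a - 1 / 4) 0 with h | h
    · rw [min_eq_left h, max_eq_right h, rpow_zero, mul_one]
      calc s ^ ((a - 1 / 4) / 2) ≤ (‖x‖ ^ 2) ^ ((a - 1 / 4) / 2) :=
            rpow_le_rpow_of_nonpos (by positivity) hs2 (by linarith)
        _ = _ := by rw [← rpow_natCast, ← rpow_mul hx0.le]; congr 1; push_cast; ring
    · rw [min_eq_right h, max_eq_left h, rpow_zero, one_mul]
      calc s ^ ((a - 1 / 4) / 2) ≤ ((1 + ‖x‖) ^ 2) ^ ((a - 1 / 4) / 2) :=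
            rpow_le_rpow (by positivity) hs1 (by linarith)
        _ = _ := by
            rw [← rpow_natCast, ← rpow_mul (by positivity)]; congr 1; push_cast; ring
  have e2 : s ^ (a / 2 + 1 / 8) = s ^ (a / 2 - 1 / 8) * s ^ (1 / 4 : ℝ) := by
    rw [← rpow_add hs0]; congr 1; ring
  have e3 : s ^ (1 / 4 : ℝ) ≤ (1 + ‖x‖) ^ (1 / 2 : ℝ) := by
    calc s ^ (1 / 4 : ℝ) ≤ ((1 + ‖x‖) ^ 2) ^ (1 / 4 : ℝ) :=
          rpow_le_rpow (by positivity) hs1 (by norm_num)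
      _ = _ := by
          rw [← rpow_natCast, ← rpow_mul (by positivity)]; congr 1; norm_num
  have e4 : (1 : ℝ) ≤ (1 + ‖x‖) ^ (1 / 2 : ℝ) := Real.one_le_rpow h1 (by norm_num)
  rw [e2, mul_assoc, rpow_add (by positivity)]
  gcongr
  calc s ^ (a / 2 - 1 / 8) + s ^ (a / 2 - 1 / 8) * s ^ (1 / 4 : ℝ)
      = s ^ (a / 2 - 1 / 8) * (1 + s ^ (1 / 4 : ℝ)) := by ring
    _ ≤ (‖x‖ ^ min (a - 1 / 4) 0 * (1 + ‖x‖) ^ max (a - 1 / 4) 0) *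
        ((1 + ‖x‖) ^ (1 / 2 : ℝ) + (1 + ‖x‖) ^ (1 / 2 : ℝ)) := by gcongr
    _ = _ := by ring

variable {f f' : ℝ → Eu m → ℝ} {f₀ f₀' : Eu m → ℝ} {τ τ' : Eu m → ℂ} {a C C' : ℝ} {k : ℕ}

theorem HasOrder.integrable_fixed (h : HasOrder f a) (hτ : Continuous τ)
    (hb : ∀ x, ‖τ x‖ ≤ C * ((1 + ‖x‖) ^ k)⁻¹) (hk : a + m + 1 / 4 < k) {ε : ℝ} (hε : 0 < ε) :
    Integrable fun x => (f ε x : ℂ) * τ x := by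
  obtain ⟨D, hD, hf⟩ := h.bound_fixed hε
  have hi := integrable_one_add_norm (E := Eu m) (μ := volume) (r := k - (a + 1 / 4))
    (by simpa using by linarith)
  refine (hi.const_mul (D * C)).mono' ?_ (Eventually.of_forall fun x => ?_)
  · exact ((Complex.continuous_ofReal.comp (h.continuous ε hε)).mul hτ).aestronglyMeasurable
  · have hx : 0 < 1 + ‖x‖ := by positivity
    rw [norm_mul, Complex.norm_real, Real.norm_eq_abs, neg_sub, rpow_sub hx, rpow_natCast]
    calc _ ≤ (D * (1 + ‖x‖) ^ (a + 1 / 4)) * (C * ((1 + ‖x‖) ^ k)⁻¹) :=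
          mul_le_mul (hf x) (hb x) (norm_nonneg _) (by positivity)
      _ = _ := by ring

theorem HasOrder.tendsto_integral (hm : 1 ≤ m) (h : HasOrder f a) (hτ : Continuous τ)
    (hb : ∀ x, ‖τ x‖ ≤ C * ((1 + ‖x‖) ^ k)⁻¹) (ha : -(m : ℝ) + 1 / 4 < a)
    (hk : a + m + 1 / 4 < k)
    (hf₀ : ∀ x, x ≠ 0 → Tendsto (fun ε => f ε x) (𝓝[>] 0) (𝓝 (f₀ x))) :
    Tendsto (fun ε => ∫ x, (f ε x : ℂ) * τ x) (𝓝[>] 0) (𝓝 (∫ x, (f₀ x : ℂ) * τ x)) := by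
  have hae := ae_ne_zero hm
  have hm1 : (1 : ℝ) ≤ m := by exact_mod_cast hm
  obtain ⟨D, hD, hf⟩ := h.bound_uniform
  have hmm : min (a - 1 / 4) 0 + max (a - 1 / 4) 0 = a - 1 / 4 := by rw [min_add_max]; ring
  have hi := integrable_rpow_mul_rpow_one_add_norm hm (a := min (a - 1 / 4) 0)
    (r := k - (max (a - 1 / 4) 0 + 1 / 2)) (lt_min (by linarith) (by linarith)) (by linarith)
  refine tendsto_integral_filter_of_dominated_convergence _ ?_ ?_ (hi.const_mul (D * C)) ?_
  · filter_upwards [self_mem_nhdsWithin] with ε hε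
    exact ((Complex.continuous_ofReal.comp (h.continuous ε hε)).mul hτ).aestronglyMeasurable
  · filter_upwards [Ioc_mem_nhdsGT one_pos] with ε hε
    filter_upwards [hae] with x hx
    have hx0 : 0 < 1 + ‖x‖ := by positivity
    rw [norm_mul, Complex.norm_real, Real.norm_eq_abs, neg_sub, rpow_sub hx0 _ (k : ℝ),
      rpow_natCast]
    calc _ ≤ (D * (‖x‖ ^ min (a - 1 / 4) 0 * (1 + ‖x‖) ^ (max (a - 1 / 4) 0 + 1 / 2))) *
          (C * ((1 + ‖x‖) ^ k)⁻¹) :=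
          mul_le_mul (hf ε hε.1 hε.2 x hx) (hb x) (norm_nonneg _) (by positivity)
      _ = _ := by ring
  · filter_upwards [hae] with x hx
    exact ((Complex.continuous_ofReal.tendsto _).comp (hf₀ x hx)).mul_const _

/-- Integration by parts against a singular kernel that is a limit of a regularised family. -/
theorem HasOrder.integral_eq_neg (hm : 1 ≤ m) (hf : HasOrder f a) (hf' : HasOrder f' (a - 1))
    {l : Fin m} (hd : ∀ ε, 0 < ε → ∀ x, HasLineDerivAt ℝ (f ε) (f' ε x) x (unitVec l))
    (hτ : Continuous τ) (hτ' : Continuous τ')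
    (hdτ : ∀ x, HasLineDerivAt ℝ τ (τ' x) x (unitVec l))
    (hb : ∀ x, ‖τ x‖ ≤ C * ((1 + ‖x‖) ^ k)⁻¹)
    (hb' : ∀ x, ‖τ' x‖ ≤ C' * ((1 + ‖x‖) ^ (k + 1))⁻¹) (hk : a + m ≤ k + 1 / 4) {ε : ℝ}
    (hε : 0 < ε) :
    ∫ x, (f ε x : ℂ) * τ' x = -∫ x, (f' ε x : ℂ) * τ x := by
  obtain ⟨D, hD, hfb⟩ := hf.bound_fixed hε
  have hC : 0 ≤ C := by
    have := (norm_nonneg _).trans (hb 0)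
    simpa using this
  refine integral_mul_lineDeriv_eq_neg (C := D * C) hm (fun x => (hd ε hε x).ofReal_comp) hdτ
    (hf'.integrable_fixed hτ hb (by linarith) hε)
    (hf.integrable_fixed hτ' hb' (by push_cast; linarith) hε)
    ((Complex.continuous_ofReal.comp (hf.continuous ε hε)).mul hτ).aestronglyMeasurable fun x => ?_
  have hx : 1 ≤ 1 + ‖x‖ := by linarith [norm_nonneg x]
  rw [norm_mul, Complex.norm_real, Real.norm_eq_abs]
  calc _ ≤ (D * (1 + ‖x‖) ^ (a + 1 / 4)) * (C * ((1 + ‖x‖) ^ k)⁻¹) :=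
        mul_le_mul (hfb x) (hb x) (norm_nonneg _) (by positivity)
    _ = D * C * (1 + ‖x‖) ^ (a + 1 / 4 - k) := by
        rw [rpow_sub (by positivity), rpow_natCast]; ring
    _ ≤ _ := by
        gcongr 1
        exact rpow_le_rpow_of_exponent_le hx (by linarith)

theorem HasOrder.integral_limit_eq_neg (hm : 1 ≤ m) (hf : HasOrder f a) (hf' : HasOrder f' (a - 1))
    {l : Fin m} (hd : ∀ ε, 0 < ε → ∀ x, HasLineDerivAt ℝ (f ε) (f' ε x) x (unitVec l))
    (hτ : Continuous τ) (hτ' : Continuous τ')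
    (hdτ : ∀ x, HasLineDerivAt ℝ τ (τ' x) x (unitVec l))
    (hb : ∀ x, ‖τ x‖ ≤ C * ((1 + ‖x‖) ^ k)⁻¹)
    (hb' : ∀ x, ‖τ' x‖ ≤ C' * ((1 + ‖x‖) ^ (k + 1))⁻¹) (hk : a + m ≤ k + 1 / 4)
    (ha : -(m : ℝ) + 1 / 4 < a - 1)
    (hf₀ : ∀ x, x ≠ 0 → Tendsto (fun ε => f ε x) (𝓝[>] 0) (𝓝 (f₀ x)))
    (hf₀' : ∀ x, x ≠ 0 → Tendsto (fun ε => f' ε x) (𝓝[>] 0) (𝓝 (f₀' x))) :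
    ∫ x, (f₀ x : ℂ) * τ' x = -∫ x, (f₀' x : ℂ) * τ x := by
  have h1 := hf.tendsto_integral hm hτ' hb' (by linarith) (by push_cast; linarith) hf₀
  have h2 := (hf'.tendsto_integral hm hτ hb ha (by linarith) hf₀').neg
  refine tendsto_nhds_unique h1 (h2.congr' ?_)
  filter_upwards [self_mem_nhdsWithin] with ε hε
  exact (hf.integral_eq_neg hm hf' hd hτ hτ' hdτ hb hb' hk hε).symm

end

section

variable {f : ℝ → Eu m → ℝ} {f₀ : Eu m → ℝ} {τ : Eu m → ℂ} {a C : ℝ} {k : ℕ}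

theorem HasOrder.integrable_limit (hm : 1 ≤ m) (h : HasOrder f a) (hτ : AEStronglyMeasurable τ)
    (hb : ∀ x, ‖τ x‖ ≤ C * ((1 + ‖x‖) ^ k)⁻¹) (ha : -(m : ℝ) + 1 / 4 < a)
    (hk : a + m + 1 / 4 < k) (hm₀ : Measurable f₀)
    (hf₀ : ∀ x, x ≠ 0 → Tendsto (fun ε => f ε x) (𝓝[>] 0) (𝓝 (f₀ x))) :
    Integrable fun x => (f₀ x : ℂ) * τ x := by
  have hae := ae_ne_zero hm
  obtain ⟨D, hD, hf⟩ := h.bound_uniform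
  have hmm : min (a - 1 / 4) 0 + max (a - 1 / 4) 0 = a - 1 / 4 := by rw [min_add_max]; ring
  have hm1 : (1 : ℝ) ≤ m := by exact_mod_cast hm
  have hi := integrable_rpow_mul_rpow_one_add_norm hm (a := min (a - 1 / 4) 0)
    (r := k - (max (a - 1 / 4) 0 + 1 / 2)) (lt_min (by linarith) (by linarith)) (by linarith)
  refine (hi.const_mul (D * C)).mono' ?_ ?_
  · exact (Complex.measurable_ofReal.comp hm₀).aestronglyMeasurable.mul hτ
  · filter_upwards [hae] with x hx
    have hx0 : 0 < 1 + ‖x‖ := by positivity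
    have hl : |f₀ x| ≤
        D * (‖x‖ ^ min (a - 1 / 4) 0 * (1 + ‖x‖) ^ (max (a - 1 / 4) 0 + 1 / 2)) := by
      refine le_of_tendsto (hf₀ x hx).abs ?_
      filter_upwards [Ioc_mem_nhdsGT one_pos] with ε hε
      exact hf ε hε.1 hε.2 x hx
    rw [norm_mul, Complex.norm_real, Real.norm_eq_abs, neg_sub, rpow_sub hx0 _ (k : ℝ),
      rpow_natCast]
    calc _ ≤ (D * (‖x‖ ^ min (a - 1 / 4) 0 * (1 + ‖x‖) ^ (max (a - 1 / 4) 0 + 1 / 2))) *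
          (C * ((1 + ‖x‖) ^ k)⁻¹) :=
          mul_le_mul hl (hb x) (norm_nonneg _) (by positivity)
      _ = _ := by ring

theorem HasOrder.isTempered_limit (hm : 1 ≤ m) (h : HasOrder f a) (ha : -(m : ℝ) + 1 / 4 < a)
    (hm₀ : Measurable f₀)
    (hf₀ : ∀ x, x ≠ 0 → Tendsto (fun ε => f ε x) (𝓝[>] 0) (𝓝 (f₀ x))) :
    IsTempered fun x => (f₀ x : ℂ) := by
  obtain ⟨k, hk⟩ := exists_nat_gt (a + m + 1 / 4)
  refine ⟨(Complex.measurable_ofReal.comp hm₀).aestronglyMeasurable, k, ?_⟩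
  refine h.integrable_limit hm (C := 1) (k := k) ?_ (fun x => ?_) ha hk hm₀ hf₀
  · exact Measurable.aestronglyMeasurable (by fun_prop)
  · rw [Complex.norm_real, norm_of_nonneg (by positivity), one_mul]

/-! ### The upstream kernels of all orders -/

/-- The coefficients of `|x|^{N-m} ln|x|` and `|x|^{N-m}` in the kernel with symbol `|2πξ|^{-N}`. -/
def tCoef (m N : ℕ) : ℝ × ℝ :=
  if m ≤ N ∧ Even (N - m) then
    ((pq m (N - m)).1 * (π ^ ((N : ℝ) / 2) / Gamma ((N : ℝ) / 2)),
      (pq m (N - m)).2 * (π ^ ((N : ℝ) / 2) / Gamma ((N : ℝ) / 2)))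
  else (0, rieszCoeff m N)

/-- The coefficients in the kernel with symbol `-i (ξ_j/|ξ|) |2πξ|^{-N}`. -/
def vCoef (m N : ℕ) : ℝ × ℝ :=
  if m < N ∧ Odd (N - m) then
    ((pq m (N - m)).1 * (π ^ (((N : ℝ) + 1) / 2) / Gamma (((N : ℝ) + 1) / 2)),
      (pq m (N - m)).2 * (π ^ (((N : ℝ) + 1) / 2) / Gamma (((N : ℝ) + 1) / 2)))
  else (0, hilbertRieszCoeff m N)

/-- The kernel with symbol `|2πξ|^{-N}`. -/
def upT (m N : ℕ) (x : Eu m) : ℝ :=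
  logPow (tCoef m N).1 (tCoef m N).2 (((N : ℝ) - m) / 2) (‖x‖ ^ 2)

/-- The kernel with symbol `-i (ξ_j/|ξ|) |2πξ|^{-N}`. -/
def upV (m : ℕ) (j : Fin m) (N : ℕ) (x : Eu m) : ℝ :=
  x j * logPow (vCoef m N).1 (vCoef m N).2 (((N : ℝ) - m - 1) / 2) (‖x‖ ^ 2)

theorem logPow_zero_left (β c : ℝ) (x : Eu m) : logPow 0 β (c / 2) (‖x‖ ^ 2) = β * ‖x‖ ^ c := by
  rw [logPow, zero_mul, zero_add, mul_comm, ← rpow_natCast, ← rpow_mul (norm_nonneg _)]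
  congr 2; push_cast; ring

theorem upT_eq_rieszKernel {N : ℕ} (h : N < m) (x : Eu m) : (upT m N x : ℂ) = rieszKernel m N x := by
  rw [upT, tCoef, if_neg (by omega), logPow_zero_left, rieszKernel]

theorem upV_eq_hilbertRieszKernel {N : ℕ} (h : N ≤ m) (j : Fin m) (x : Eu m) :
    (upV m j N x : ℂ) = hilbertRieszKernel m j N x := by
  rw [upV, vCoef, if_neg (by omega), logPow_zero_left, hilbertRieszKernel]
  congr 1; ring

theorem vCoef_of_tCoef (hm : 1 ≤ m) {N : ℕ} (hN : m ≤ N + 1) :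
    vCoef m N = (((N + 1 : ℕ) - m : ℝ) * (tCoef m (N + 1)).1,
      ((N + 1 : ℕ) - m : ℝ) * (tCoef m (N + 1)).2 + (tCoef m (N + 1)).1) := by
  have hN0 : (0 : ℝ) ≤ N := by positivity
  have hG : Gamma (((N : ℝ) + 1) / 2) ≠ 0 := (Gamma_pos_of_pos (by positivity)).ne'
  by_cases he : Even (N + 1 - m)
  · rw [tCoef, if_pos ⟨hN, he⟩]
    rcases Nat.lt_or_ge N m with h | h
    · obtain rfl : m = N + 1 := by omega
      rw [vCoef, if_neg (by omega), hilbertRieszCoeff]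
      simp only [Nat.sub_self, pq, sub_self, zero_mul, zero_add, Prod.mk.injEq, true_and]
      have e : ((((N + 1 : ℕ) : ℝ)) - N + 1) / 2 = 1 := by push_cast; ring
      have e2 : π ^ (N + 1) = π ^ (((N : ℝ) + 1) / 2) * π ^ (((N : ℝ) + 1) / 2) := by
        rw [← rpow_add pi_pos, ← rpow_natCast]; congr 1; push_cast; ring
      rw [e, Gamma_one, e2]
      push_cast
      have : π ^ (((N : ℝ) + 1) / 2) ≠ 0 := by positivity
      field_simp
    · obtain ⟨n, rfl⟩ := Nat.exists_eq_add_of_le h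
      have e1 : m + n + 1 - m = n + 1 := by omega
      have e2 : m + n - m = n := by omega
      rw [e1] at he
      have ho : ¬ Even n := by rwa [Nat.even_add_one] at he
      have hn0 : n ≠ 0 := by rintro rfl; simp at ho
      rw [vCoef, e2, if_pos ⟨by omega, Nat.not_even_iff_odd.1 ho⟩, e1]
      simp only [pq, if_neg ho]
      push_cast
      have : (n : ℝ) + 1 ≠ 0 := by positivity
      refine Prod.ext ?_ ?_
      · simp only; field_simp; ring
      · simp only; field_simp; ring
  · have hlt : m < N + 1 := by
      rcases hN.lt_or_eq with h | h
      · exact h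
      · rw [← h] at he; simp at he
    obtain ⟨n, rfl⟩ := Nat.exists_eq_add_of_le (show m ≤ N by omega)
    have e1 : m + n + 1 - m = n + 1 := by omega
    have e2 : m + n - m = n := by omega
    rw [e1] at he
    have ho : ¬ Odd n := by
      rw [Nat.not_odd_iff_even]; by_contra h; exact he (Nat.even_add_one.2 h)
    rw [tCoef, e1, if_neg (by tauto), vCoef, e2, if_neg (by tauto), rieszCoeff, hilbertRieszCoeff]
    simp only [mul_zero, add_zero, Prod.mk.injEq, true_and]
    have e3 : ((m : ℝ) - (m + n : ℕ) + 1) / 2 = ((m : ℝ) - (m + n + 1 : ℕ)) / 2 + 1 := by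
      push_cast; ring
    have hne : ((m : ℝ) - (m + n + 1 : ℕ)) / 2 ≠ 0 := by
      push_cast; have : (0 : ℝ) ≤ n := by positivity
      intro h; linarith
    rw [e3, Gamma_add_one hne]
    have e4 : (((m + n : ℕ) : ℝ) + 1) / 2 = (((m + n + 1 : ℕ) : ℝ)) / 2 := by push_cast; ring
    rw [e4] at hG ⊢
    push_cast at hG ⊢
    have : π ^ ((m : ℝ) / 2) ≠ 0 := by positivity
    field_simp
    ring

theorem tCoef_of_vCoef (hm : 1 ≤ m) {N : ℕ} (hN : m ≤ N) :
    tCoef m N = (-(N * (vCoef m (N + 1)).1), -(N * (vCoef m (N + 1)).2 + (vCoef m (N + 1)).1)) := by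
  have hN0 : (0 : ℝ) < N := by exact_mod_cast (by omega : 0 < N)
  have hG : Gamma ((N : ℝ) / 2) ≠ 0 := (Gamma_pos_of_pos (by positivity)).ne'
  have hG1 : Gamma ((((N + 1 : ℕ) : ℝ) + 1) / 2) = N / 2 * Gamma ((N : ℝ) / 2) := by
    rw [← Gamma_add_one (by positivity)]; congr 1; push_cast; ring
  obtain ⟨n, rfl⟩ := Nat.exists_eq_add_of_le hN
  have e1 : m + n + 1 - m = n + 1 := by omega
  have e2 : m + n - m = n := by omega
  by_cases he : Even n
  · rw [tCoef, e2, if_pos ⟨hN, he⟩, vCoef, e1, if_pos ⟨by omega, Even.add_one he⟩, hG1]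
    simp only [pq, if_pos he]
    have e3 : π ^ ((((m + n + 1 : ℕ) : ℝ) + 1) / 2) = π ^ (((m + n : ℕ) : ℝ) / 2) * π := by
      rw [← rpow_add_one pi_pos.ne']; congr 1; push_cast; ring
    rw [e3]
    push_cast at hN0 hG ⊢
    have : π ^ (((m : ℝ) + n) / 2) ≠ 0 := by positivity
    have : (m : ℝ) + n ≠ 0 := hN0.ne'
    refine Prod.ext ?_ ?_
    · simp only; field_simp
    · simp only; field_simp; ring
  · have ho : ¬ Odd (n + 1) := by rw [Nat.not_odd_iff_even, Nat.even_add_one]; exact he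
    rw [tCoef, e2, if_neg (by tauto), vCoef, e1, if_neg (by tauto), rieszCoeff, hilbertRieszCoeff,
      hG1]
    simp only [mul_zero, neg_zero, add_zero, Prod.mk.injEq, true_and]
    have e3 : ((m : ℝ) - (m + n + 1 : ℕ) + 1) / 2 = ((m : ℝ) - (m + n : ℕ)) / 2 := by
      push_cast; ring
    rw [e3]
    have : π ^ ((m : ℝ) / 2) ≠ 0 := by positivity
    field_simp
    ring

theorem measurable_logPow_norm (α β c : ℝ) :
    Measurable fun x : Eu m => logPow α β c (‖x‖ ^ 2) := by
  unfold logPow; fun_prop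

theorem measurable_upT (N : ℕ) : Measurable (upT m N) := measurable_logPow_norm _ _ _

theorem measurable_upV (j : Fin m) (N : ℕ) : Measurable (upV m j N) := by
  have := measurable_logPow_norm (m := m) (vCoef m N).1 (vCoef m N).2 (((N : ℝ) - m - 1) / 2)
  unfold upV; fun_prop

theorem hasOrder_upT (N : ℕ) : HasOrder (fun ε (x : Eu m) =>
    logPow (tCoef m N).1 (tCoef m N).2 (((N : ℝ) - m) / 2) (‖x‖ ^ 2 + ε ^ 2)) ((N : ℝ) - m) := by
  have := hasOrder_logPow (m := m) (tCoef m N).1 (tCoef m N).2 (((N : ℝ) - m) / 2)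
  rwa [mul_div_cancel₀ _ two_ne_zero] at this

theorem hasOrder_upV (j : Fin m) (N : ℕ) : HasOrder (fun ε (x : Eu m) =>
    x j * logPow (vCoef m N).1 (vCoef m N).2 (((N : ℝ) - m - 1) / 2) (‖x‖ ^ 2 + ε ^ 2))
      ((N : ℝ) - m) := by
  have := (hasOrder_logPow (m := m) (vCoef m N).1 (vCoef m N).2 (((N : ℝ) - m - 1) / 2)).coord j
  rwa [mul_div_cancel₀ _ two_ne_zero, sub_add_cancel] at this

theorem isTempered_upT (hm : 1 ≤ m) {N : ℕ} (hN : 1 ≤ N) : IsTempered fun x => (upT m N x : ℂ) :=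
  (hasOrder_upT N).isTempered_limit hm (by have : (1 : ℝ) ≤ N := by exact_mod_cast hN
                                           linarith)
    (measurable_upT N) fun x hx => tendsto_logPow _ _ _ hx

theorem isTempered_upV (hm : 1 ≤ m) (j : Fin m) {N : ℕ} (hN : 1 ≤ N) :
    IsTempered fun x => (upV m j N x : ℂ) :=
  (hasOrder_upV j N).isTempered_limit hm (by have : (1 : ℝ) ≤ N := by exact_mod_cast hN
                                             linarith)
    (measurable_upV j N) fun x hx => (tendsto_logPow _ _ _ hx).const_mul _

end

/-! ### Decay of derivatives of convolutions -/

theorem IsHomKernel.hasKernelDecay {p : Eu m → ℂ} {d : ℕ} {g : ℝ → Eu m → ℂ}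
    (hg : IsHomKernel d g) (h : ∀ t, 0 < t → ∀ x, symbolKernel p t x = g t x) :
    HasKernelDecay p d := by
  obtain ⟨C, hC, hb⟩ := hg.bound
  exact ⟨C, hC, fun t ht x => by rw [h t ht]; exact hb t ht x⟩

theorem hasKernelDecay_hilSym_deriv (hm : 1 ≤ m) (l j : Fin m) (N : ℕ) :
    HasKernelDecay (fun ξ => ((2 * π * ξ l : ℝ) : ℂ) * Complex.I * hilSym j N ξ) (m + N + 1) := by
  convert (hasKernelDecay_symB_space hm l j N).const_mul (-(-1) ^ N) using 2 with ξ
  have h : ((-1 : ℂ) ^ N) * (-1) ^ N = 1 := by rw [← mul_pow]; norm_num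
  rw [symB_eq_hilSym]
  linear_combination (-((2 * π * ξ l : ℝ) : ℂ) * Complex.I * hilSym j N ξ) * h

theorem hasKernelDecay_hilSym_deriv_deriv (hm : 1 ≤ m) (l j : Fin m) (N : ℕ) :
    HasKernelDecay (fun ξ => ((2 * π * ξ l : ℝ) : ℂ) * Complex.I *
      (((2 * π * ξ l : ℝ) : ℂ) * Complex.I * hilSym j N ξ)) (m + N + 1 + 1) := by
  obtain ⟨g, hg, he⟩ := exists_isHomKernel_symB hm j N
  obtain ⟨g', hg', he'⟩ := exists_isHomKernel_space (isSymbol_symB j N) hg he l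
  have hs : IsSymbol (fun ξ => -((2 * π * ξ l : ℝ) : ℂ) * Complex.I * symB j N ξ) := by
    have := (IsSymbol.const (m := m) (-1)).mul ((isSymbol_symB j N).deriv_coord l)
    convert this using 2
    ring
  obtain ⟨g'', hg'', he''⟩ := exists_isHomKernel_space hs hg' he' l
  convert (hg''.hasKernelDecay he'').const_mul ((-1) ^ N) using 2 with ξ
  have h : ((-1 : ℂ) ^ N) * (-1) ^ N = 1 := by rw [← mul_pow]; norm_num
  rw [symB_eq_hilSym]
  linear_combination (-((2 * π * ξ l : ℝ) : ℂ) * Complex.I *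
    (((2 * π * ξ l : ℝ) : ℂ) * Complex.I * hilSym j N ξ)) * h

theorem powSym_deriv (j : Fin m) (N : ℕ) (ξ : Eu m) :
    ((2 * π * ξ j : ℝ) : ℂ) * Complex.I * powSym N ξ = -hilSym j (N + 1) ξ := by
  rw [hilSym, powSym, powSym, pow_succ]
  have := norm_mul_coord_div ξ j
  push_cast
  linear_combination (-(2 * π * (2 * π * ‖ξ‖) ^ N * Complex.I) : ℂ) * this

theorem sum_hilSym_deriv (N : ℕ) (ξ : Eu m) :
    ∑ l, ((2 * π * ξ l : ℝ) : ℂ) * Complex.I * hilSym l N ξ = powSym (N + 1) ξ := by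
  have h : ∀ l : Fin m, ((2 * π * ξ l : ℝ) : ℂ) * Complex.I * hilSym l N ξ =
      2 * π * powSym N ξ * ((ξ l : ℂ) * ((ξ l : ℂ) / ‖ξ‖)) := fun l => by
    rw [hilSym]; push_cast
    linear_combination (-(2 * π * powSym N ξ * ((ξ l : ℂ) * ((ξ l : ℂ) / ‖ξ‖)))) * Complex.I_sq
  have h2 : ∑ l : Fin m, (ξ l : ℂ) * ((ξ l : ℂ) / ‖ξ‖) = ‖ξ‖ := by
    simp_rw [← mul_div_assoc]
    rw [← Finset.sum_div, sum_coord_sq, mul_self_div_self]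
  simp_rw [h]
  rw [← Finset.mul_sum, h2, powSym, powSym, pow_succ]
  push_cast; ring

theorem sum_hilSym_deriv_deriv (j : Fin m) (N : ℕ) (ξ : Eu m) :
    ∑ l, ((2 * π * ξ l : ℝ) : ℂ) * Complex.I *
      (((2 * π * ξ l : ℝ) : ℂ) * Complex.I * hilSym j N ξ) = -hilSym j (N + 2) ξ := by
  have h : ∀ l : Fin m, ((2 * π * ξ l : ℝ) : ℂ) * Complex.I *
      (((2 * π * ξ l : ℝ) : ℂ) * Complex.I * hilSym j N ξ) =
      -(2 * π) ^ 2 * hilSym j N ξ * ((ξ l : ℂ) * (ξ l : ℂ)) := fun l => by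
    push_cast
    linear_combination ((2 * π) ^ 2 * hilSym j N ξ * ((ξ l : ℂ) * (ξ l : ℂ))) * Complex.I_sq
  simp_rw [h]
  rw [← Finset.mul_sum, sum_coord_sq, hilSym, hilSym, powSym, powSym, pow_add]
  push_cast; ring

theorem sum_rieszSq (hm : 1 ≤ m) : ∀ᵐ ξ : Eu m, ∑ j, rieszSq j j ξ = -1 := by
  have hae := ae_ne_zero hm
  filter_upwards [hae] with ξ hξ
  have h0 : (‖ξ‖ : ℂ) ≠ 0 := by exact_mod_cast (norm_pos_iff.2 hξ).ne'
  have h : ∀ j : Fin m, rieszSq j j ξ = -((ξ j : ℂ) * (ξ j : ℂ) / ((‖ξ‖ : ℂ) * ‖ξ‖)) :=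
    fun j => by rw [rieszSq]; field_simp
  simp_rw [h, Finset.sum_neg_distrib]
  rw [← Finset.sum_div, sum_coord_sq, div_self (mul_ne_zero h0 h0)]

theorem IsSymbol.toDist_congr {p q : Eu m → ℂ} (hp : IsSymbol p) (hq : IsSymbol q)
    (h : ∀ ξ, p ξ = q ξ) : hp.toDist = hq.toDist := by
  obtain rfl : p = q := funext h
  rfl

theorem IsSymbol.toDist_sum {ι : Type*} (s : Finset ι) {p : ι → Eu m → ℂ} {q : Eu m → ℂ}
    (hp : ∀ i, IsSymbol (p i)) (hq : IsSymbol q) (h : ∀ ξ, q ξ = ∑ i ∈ s, p i ξ)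
    (φ : 𝓢(Eu m, ℂ)) : hq.toDist φ = ∑ i ∈ s, (hp i).toDist φ := by
  simp_rw [IsSymbol.toDist_apply]
  rw [← integral_finsetSum _ fun i _ => (hp i).integrable_mul _]
  refine integral_congr_of_eq fun ξ => ?_
  simp only [h, Finset.sum_mul]

theorem IsSymbol.toDist_neg {p q : Eu m → ℂ} (hp : IsSymbol p) (hq : IsSymbol q)
    (h : ∀ ξ, q ξ = -p ξ) (φ : 𝓢(Eu m, ℂ)) : hq.toDist φ = -hp.toDist φ := by
  simp_rw [IsSymbol.toDist_apply]
  rw [← integral_neg]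
  refine integral_congr_of_eq fun ξ => ?_
  simp only [h, neg_mul]

/-! ### Values of the convolutions with upstream kernels -/

/-- `|2πξ|^{-N}` inverts `|2πξ|^N`. -/
def UpTValue (m N : ℕ) : Prop := ∀ φ : 𝓢(Eu m, ℂ),
  ∫ x, (upT m N x : ℂ) * (isSymbol_powSym N).toDist (shift x φ) = ∫ ξ, 𝓕 φ ξ

/-- The corresponding property of the vector kernels. -/
def UpVValue (m N : ℕ) : Prop := ∀ (i j : Fin m) (φ : 𝓢(Eu m, ℂ)),
  ∫ x, (upV m i N x : ℂ) * (isSymbol_hilSym j N).toDist (shift x φ) = ∫ ξ, rieszSq i j ξ * 𝓕 φ ξ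

theorem upTValue_of_lt {N : ℕ} (hN : 1 ≤ N) (hNm : N < m) : UpTValue m N := by
  intro φ
  obtain ⟨C, hC, hb⟩ := (isSymbol_powSym N).norm_toDist_shift_le (hasKernelDecay_powSym N) φ
  have := integral_riesz_mul_fourierInv hN hNm ((isSymbol_powSym N).integrable_mul (𝓕 φ))
    (𝓕 φ).integrable (C := C) (fun x => by rw [← (isSymbol_powSym N).toDist_shift φ]; exact hb x)
    (fun ξ => by rw [powSym])
  rw [← this]
  refine integral_congr_of_eq fun x => ?_
  simp only [(isSymbol_powSym N).toDist_shift φ, upT_eq_rieszKernel hNm, rieszKernel]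

theorem upVValue_of_le (hm : 1 ≤ m) {N : ℕ} (hN : 1 ≤ N) (hNm : N ≤ m) : UpVValue m N := by
  intro i j φ
  have hq := isSymbol_hilSym j N
  obtain ⟨C, hC, hb⟩ := hq.norm_toDist_shift_le (hasKernelDecay_hilSym hm j N) φ
  have := integral_hilbertRiesz_mul_fourierInv hm hN hNm i (hq.integrable_mul (𝓕 φ))
    ((isSymbol_rieszSq i j).integrable_mul (𝓕 φ)) (C := C)
    (fun x => by rw [← hq.toDist_shift φ]; exact hb x) (fun ξ => by
      rw [symB_one, hilSym, powSym, rieszSq, pow_succ]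
      have := norm_mul_coord_div ξ i
      push_cast
      linear_combination (-(2 * π * (2 * π * ‖ξ‖) ^ N * ((ξ j : ℂ) / ‖ξ‖) * 𝓕 φ ξ) : ℂ) * (-this) +
        (2 * π * (2 * π * ‖ξ‖) ^ N * ξ i * ((ξ j : ℂ) / ‖ξ‖) * 𝓕 φ ξ) * Complex.I_sq)
  rw [← this]
  refine integral_congr_of_eq fun x => ?_
  simp only [hq.toDist_shift φ, upV_eq_hilbertRieszKernel hNm, hilbertRieszKernel]

theorem IsSymbol.continuous_toDist_shift {q : Eu m → ℂ} (hq : IsSymbol q) (φ : 𝓢(Eu m, ℂ)) :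
    Continuous fun x => hq.toDist (shift x φ) := (hq.contDiff_toDist_shift φ).continuous

/-- The one-step relation from vector kernels to scalar kernels. -/
theorem upTValue_succ (hm : 1 ≤ m) {M : ℕ} (hM : 1 ≤ M) (hmM : m ≤ M + 1) (h : UpVValue m M) :
    UpTValue m (M + 1) := by
  intro φ
  have hm1 : (1 : ℝ) ≤ m := by exact_mod_cast hm
  have hM1 : (1 : ℝ) ≤ M := by exact_mod_cast hM
  have hmM' : (m : ℝ) ≤ M + 1 := by exact_mod_cast hmM
  have hd : ∀ l : Fin m, IsSymbol fun ξ => ((2 * π * ξ l : ℝ) : ℂ) * Complex.I * hilSym l M ξ :=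
    fun l => (isSymbol_hilSym l M).deriv_coord l
  have hdec : ∀ l : Fin m, ∃ C, 0 ≤ C ∧ ∀ x, ‖(hd l).toDist (shift x φ)‖ ≤
      C * ((1 + ‖x‖) ^ (m + M + 1))⁻¹ := fun l =>
    (hd l).norm_toDist_shift_le (hasKernelDecay_hilSym_deriv hm l l M) φ
  have hsum : ∀ x, (isSymbol_powSym (M + 1)).toDist (shift x φ) =
      ∑ l, (hd l).toDist (shift x φ) := fun x =>
    IsSymbol.toDist_sum _ hd _ (fun ξ => (sum_hilSym_deriv M ξ).symm) _
  have hcast : (((M + 1 : ℕ) : ℝ) - m) = M + 1 - m := by push_cast; ring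
  have step : ∀ l : Fin m, ∫ x, (upT m (M + 1) x : ℂ) * (hd l).toDist (shift x φ) =
      -∫ ξ, rieszSq l l ξ * 𝓕 φ ξ := by
    intro l
    obtain ⟨C, hC, hb⟩ := (isSymbol_hilSym l M).norm_toDist_shift_le
      (hasKernelDecay_hilSym hm l M) φ
    obtain ⟨C', hC', hb'⟩ := hdec l
    have hV := vCoef_of_tCoef hm hmM
    have ho := (hasOrder_logPow (m := m) (vCoef m M).1 (vCoef m M).2
      ((((M + 1 : ℕ) : ℝ) - m) / 2 - 1)).coord l
    have := (hasOrder_upT (m := m) (M + 1)).integral_limit_eq_neg hm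
      (f' := fun ε x => x l * logPow (vCoef m M).1 (vCoef m M).2
        ((((M + 1 : ℕ) : ℝ) - m) / 2 - 1) (‖x‖ ^ 2 + ε ^ 2)) (by convert ho using 1; ring)
      (fun ε hε x => by
        have := hasLineDerivAt_logPow (tCoef m (M + 1)).1 (tCoef m (M + 1)).2
          ((((M + 1 : ℕ) : ℝ) - m) / 2) hε x l
        rw [mul_div_cancel₀ _ two_ne_zero] at this
        rw [hV]; exact this)
      ((isSymbol_hilSym l M).continuous_toDist_shift φ) ((hd l).continuous_toDist_shift φ)
      (fun x => (isSymbol_hilSym l M).hasLineDerivAt_toDist_shift φ x l) hb hb'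
      (by push_cast; linarith) (by push_cast; linarith)
      (fun x hx => tendsto_logPow _ _ _ hx)
      (fun x hx => (tendsto_logPow _ _ _ hx).const_mul _)
    rw [← h l l φ]
    refine this.trans (congrArg Neg.neg ?_)
    refine integral_congr_of_eq fun x => ?_
    have e : ((M : ℝ) - m - 1) / 2 = (((M + 1 : ℕ) : ℝ) - m) / 2 - 1 := by push_cast; ring
    simp only [upV, e]
  calc _ = ∑ l, ∫ x, (upT m (M + 1) x : ℂ) * (hd l).toDist (shift x φ) := by
        rw [← integral_finsetSum]
        · refine integral_congr_of_eq fun x => ?_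
          simp only [hsum, Finset.mul_sum]
        · intro l _
          obtain ⟨C', hC', hb'⟩ := hdec l
          exact (hasOrder_upT (m := m) (M + 1)).integrable_limit hm
            ((hd l).continuous_toDist_shift φ).aestronglyMeasurable hb'
            (by push_cast; linarith) (by push_cast; linarith) (measurable_upT _)
            (fun x hx => tendsto_logPow _ _ _ hx)
    _ = -∫ ξ, ∑ l, rieszSq l l ξ * 𝓕 φ ξ := by
        simp_rw [step]
        rw [Finset.sum_neg_distrib, integral_finsetSum _ fun l _ =>
          (isSymbol_rieszSq l l).integrable_mul (𝓕 φ)]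
    _ = _ := by
        rw [← integral_neg]
        refine integral_congr_ae ?_
        filter_upwards [sum_rieszSq hm] with ξ hξ
        rw [← Finset.sum_mul, hξ]; ring

/-- In dimension one the logarithm inverts `|2πξ|`. -/
theorem upTValue_one_one : UpTValue 1 1 := by
  intro φ
  have hq := isSymbol_hilSym (m := 1) 0 0
  have hd := hq.deriv_coord 0
  have h0 : ∀ x, (isSymbol_powSym 1).toDist (shift x φ) = hd.toDist (shift x φ) := fun x => by
    refine congrArg (fun t : 𝓢'(Eu 1, ℂ) => t (shift x φ)) (IsSymbol.toDist_congr _ _ fun ξ => ?_)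
    rw [← sum_hilSym_deriv 0 ξ]; simp
  obtain ⟨C, hC, hb⟩ := hq.norm_toDist_shift_le (hasKernelDecay_hilSym le_rfl 0 0) φ
  obtain ⟨C', hC', hb'⟩ := hd.norm_toDist_shift_le (hasKernelDecay_hilSym_deriv le_rfl 0 0 0) φ
  have ho := (hasOrder_logPow (m := 1) (-(2 / sig 2)) 0 (0 / 2))
  have hα : tCoef 1 1 = (-(2 / sig 2), 0) := by
    rw [tCoef, if_pos (by simp), two_div_sig 2 (by norm_num)]
    have : π ^ (2⁻¹ : ℝ) ≠ 0 := by positivity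
    have hG : Gamma (2⁻¹ : ℝ) = π ^ (2⁻¹ : ℝ) := by
      rw [← one_div, Gamma_one_half_eq, Real.sqrt_eq_rpow]
    simp [pq, hG, this, neg_div]
  have ho' : HasOrder (fun ε (x : Eu 1) => conjPoisson 1 ε x 0) (0 - 1) := by
    have := (hasOrder_logPow (m := 1) 0 (-(2 / sig 2)) (-1)).coord 0
    convert this using 1
    · funext ε x
      have : ‖x‖ ^ 2 + ε ^ 2 = nrm ε x ^ 2 := by rw [nrm_sq]; ring
      rw [this]
      simp only [conjPoisson, PiLp.smul_apply, smul_eq_mul, logPow, rpow_neg_one]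
      norm_num; ring
    · norm_num
  have hdl : ∀ ε, 0 < ε → ∀ x : Eu 1, HasLineDerivAt ℝ
      (fun x : Eu 1 => logPow (-(2 / sig 2)) 0 (0 / 2) (‖x‖ ^ 2 + ε ^ 2))
      (conjPoisson 1 ε x 0) x (EuclideanSpace.single 0 1) := fun ε hε x => by
    have h := hasLineDerivAt_logPow (-(2 / sig 2)) 0 (0 / 2) hε x 0
    convert h using 1
    have : ‖x‖ ^ 2 + ε ^ 2 = nrm ε x ^ 2 := by rw [nrm_sq]; ring
    rw [this]
    simp only [conjPoisson, PiLp.smul_apply, smul_eq_mul, logPow]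
    norm_num [rpow_neg_one]; ring
  have e1 : ∀ ε, 0 < ε → ∫ x, (logPow (-(2 / sig 2)) 0 (0 / 2) (‖x‖ ^ 2 + ε ^ 2) : ℂ) *
      hd.toDist (shift x φ) = ∫ ξ, (Real.exp (-(2 * π * ε * ‖ξ‖)) : ℂ) * 𝓕 φ ξ := by
    intro ε hε
    rw [(by simpa using ho : HasOrder (fun ε (x : Eu 1) =>
      logPow (-(2 / sig 2)) 0 (0 / 2) (‖x‖ ^ 2 + ε ^ 2)) 0).integral_eq_neg le_rfl ho' hdl
      (hq.continuous_toDist_shift φ) (hd.continuous_toDist_shift φ)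
      (fun x => hq.hasLineDerivAt_toDist_shift φ x 0) hb hb' (by norm_num) hε]
    simp_rw [hq.toDist_shift φ]
    rw [integral_conjPoisson_mul_fourierInv le_rfl 0 (hq.integrable_mul (𝓕 φ))
      ((isSymbol_rieszSq 0 0).integrable_mul (𝓕 φ)) (C := C)
      (fun x => by rw [← hq.toDist_shift φ]; simpa using hb x) (fun ξ => by
        rw [symB_one, hilSym, powSym, rieszSq, pow_zero]
        have := norm_mul_coord_div ξ 0
        push_cast
        linear_combination (-(2 * π * ((ξ 0 : ℂ) / ‖ξ‖) * 𝓕 φ ξ) : ℂ) * (-this) +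
          (2 * π * ξ 0 * ((ξ 0 : ℂ) / ‖ξ‖) * 𝓕 φ ξ) * Complex.I_sq) hε, ← integral_neg]
    refine integral_congr_ae ?_
    filter_upwards [sum_rieszSq (m := 1) le_rfl] with ξ hξ
    simp only [Finset.univ_unique, Fin.default_eq_zero, Finset.sum_singleton] at hξ
    rw [hξ]; ring
  have l1 := (by simpa using ho : HasOrder (fun ε (x : Eu 1) =>
      logPow (-(2 / sig 2)) 0 (0 / 2) (‖x‖ ^ 2 + ε ^ 2)) 0).tendsto_integral le_rfl
    (hd.continuous_toDist_shift φ) hb' (by norm_num) (by norm_num)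
    (fun x hx => tendsto_logPow _ _ _ hx)
  have l2 := (IsSymbol.const (m := 1) 1).tendsto_integral_symbolKernel φ
  simp only [one_mul] at l2
  have l3 : ∫ x, (upT 1 1 x : ℂ) * (isSymbol_powSym 1).toDist (shift x φ) =
      ∫ x, (logPow (-(2 / sig 2)) 0 (0 / 2) (‖x‖ ^ 2) : ℂ) * hd.toDist (shift x φ) := by
    refine integral_congr_of_eq fun x => ?_
    simp only [h0, upT, hα]; norm_num
  rw [l3]
  refine tendsto_nhds_unique l1 (l2.congr' ?_)
  filter_upwards [self_mem_nhdsWithin] with ε hε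
  rw [e1 ε hε, (IsSymbol.const 1).integral_symbolKernel_mul hε φ.integrable]
  refine integral_congr_of_eq fun ξ => ?_
  simp only [damp, one_mul, SchwartzMap.fourier_coe]

theorem hasLineDerivAt_coord (i l : Fin m) (x : Eu m) :
    HasLineDerivAt ℝ (fun x : Eu m => x i) (if i = l then 1 else 0) x
      (unitVec l) := by
  have h : HasDerivAt (fun t : ℝ => x i + t * (if i = l then 1 else 0)) (if i = l then 1 else 0) 0 := by
    simpa using ((hasDerivAt_id (0 : ℝ)).mul_const (if i = l then (1 : ℝ) else 0)).const_add (x i)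
  refine h.congr_of_eventuallyEq (Eventually.of_forall fun t => ?_)
  simp

theorem _root_.HasLineDerivAt.mul_real {f g : Eu m → ℝ} {f' g' : ℝ} {x v : Eu m}
    (hf : HasLineDerivAt ℝ f f' x v) (hg : HasLineDerivAt ℝ g g' x v) :
    HasLineDerivAt ℝ (fun y => f y * g y) (f' * g x + f x * g') x v := by
  have := HasDerivAt.fun_mul hf hg
  simp only [zero_smul, add_zero] at this
  exact this

theorem _root_.HasLineDerivAt.add_real {f g : Eu m → ℝ} {f' g' : ℝ} {x v : Eu m}
    (hf : HasLineDerivAt ℝ f f' x v) (hg : HasLineDerivAt ℝ g g' x v) :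
    HasLineDerivAt ℝ (fun y => f y + g y) (f' + g') x v := HasDerivAt.add hf hg

/-- The derivative of `x_i F` in the direction `l`, if `∂_l F = x_l G`. -/
def coordDeriv (α β c : ℝ) (i l : Fin m) (x : Eu m) (s : ℝ) : ℝ :=
  (if i = l then 1 else 0) * logPow α β c s +
    x i * (x l * logPow (2 * c * α) (2 * c * β + α) (c - 1) s)

theorem hasLineDerivAt_coord_logPow (α β c : ℝ) {ε : ℝ} (hε : 0 < ε) (x : Eu m) (i l : Fin m) :
    HasLineDerivAt ℝ (fun x : Eu m => x i * logPow α β c (‖x‖ ^ 2 + ε ^ 2))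
      (coordDeriv α β c i l x (‖x‖ ^ 2 + ε ^ 2)) x (unitVec l) :=
  (hasLineDerivAt_coord i l x).mul_real (hasLineDerivAt_logPow α β c hε x l)

theorem hasOrder_coordDeriv (α β c : ℝ) (i l : Fin m) :
    HasOrder (fun ε (x : Eu m) => coordDeriv α β c i l x (‖x‖ ^ 2 + ε ^ 2)) (2 * c) := by
  refine ((hasOrder_logPow α β c).const_mul _).add ?_
  convert ((hasOrder_logPow (2 * c * α) (2 * c * β + α) (c - 1)).coord l).coord i using 1
  ring

theorem tendsto_coordDeriv (α β c : ℝ) (i l : Fin m) {x : Eu m} (hx : x ≠ 0) :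
    Tendsto (fun ε : ℝ => coordDeriv α β c i l x (‖x‖ ^ 2 + ε ^ 2)) (𝓝[>] 0)
      (𝓝 (coordDeriv α β c i l x (‖x‖ ^ 2))) :=
  ((tendsto_logPow _ _ _ hx).const_mul _).add
    (((tendsto_logPow _ _ _ hx).const_mul _).const_mul _)

theorem mul_logPow_sub_one (α β c : ℝ) {s : ℝ} (hs : 0 < s) :
    s * logPow α β (c - 1) s = logPow α β c s := by
  have : s ^ c = s ^ (c - 1) * s := by rw [← rpow_add_one hs.ne']; congr 1; ring
  rw [logPow, logPow, this]; ring

theorem logPow_add (α β α' β' c s : ℝ) :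
    logPow α β c s + logPow α' β' c s = logPow (α + α') (β + β') c s := by
  rw [logPow, logPow, logPow]; ring

theorem logPow_const_mul (a α β c s : ℝ) : a * logPow α β c s = logPow (a * α) (a * β) c s := by
  rw [logPow, logPow]; ring

/-- The one-step relation from scalar to vector kernels in dimension one. -/
theorem upVValue_succ_of_dim_one {M : ℕ} (hM : 1 ≤ M) (h : UpTValue 1 M) : UpVValue 1 (M + 1) := by
  intro i j φ
  obtain rfl : i = 0 := Subsingleton.elim _ _
  obtain rfl : j = 0 := Subsingleton.elim _ _
  have hM1 : (1 : ℝ) ≤ M := by exact_mod_cast hM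
  have hq := isSymbol_powSym (m := 1) M
  have hd := hq.deriv_coord 0
  obtain ⟨C, hC, hb⟩ := hq.norm_toDist_shift_le (hasKernelDecay_powSym M) φ
  obtain ⟨C', hC', hb'⟩ := (isSymbol_hilSym (m := 1) 0 (M + 1)).norm_toDist_shift_le
    (hasKernelDecay_hilSym le_rfl 0 (M + 1)) φ
  have hneg : ∀ x, hd.toDist (shift x φ) = -(isSymbol_hilSym 0 (M + 1)).toDist (shift x φ) :=
    fun x => IsSymbol.toDist_neg _ _ (fun ξ => powSym_deriv 0 M ξ) _
  set α := (vCoef 1 (M + 1)).1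
  set β := (vCoef 1 (M + 1)).2
  set c : ℝ := (((M + 1 : ℕ) : ℝ) - (1 : ℕ) - 1) / 2 with hc
  have hc' : 2 * c = M - 1 := by rw [hc]; push_cast; ring
  have hT := tCoef_of_vCoef le_rfl hM
  have := (hasOrder_upV (m := 1) 0 (M + 1)).integral_limit_eq_neg le_rfl
    (f' := fun ε x => coordDeriv α β c 0 0 x (‖x‖ ^ 2 + ε ^ 2))
    (f₀' := fun x => coordDeriv α β c 0 0 x (‖x‖ ^ 2))
    (by convert hasOrder_coordDeriv α β c (0 : Fin 1) 0 using 1; rw [hc']; push_cast; ring)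
    (fun ε hε x => hasLineDerivAt_coord_logPow α β c hε x 0 0)
    (hq.continuous_toDist_shift φ) (hd.continuous_toDist_shift φ)
    (fun x => hq.hasLineDerivAt_toDist_shift φ x 0) hb
    (fun x => by rw [hneg, norm_neg]; exact hb' x)
    (by push_cast; linarith) (by push_cast; linarith)
    (fun x hx => (tendsto_logPow _ _ _ hx).const_mul _)
    (fun x hx => tendsto_coordDeriv α β c 0 0 hx)
  simp_rw [hneg, mul_neg, integral_neg, neg_inj] at this
  have hae : ∀ᵐ x : Eu 1, x ≠ 0 := by simp [ae_iff]
  calc _ = ∫ x, (coordDeriv α β c 0 0 x (‖x‖ ^ 2) : ℂ) * hq.toDist (shift x φ) := this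
    _ = -∫ x, (upT 1 M x : ℂ) * hq.toDist (shift x φ) := by
        rw [← integral_neg]
        refine integral_congr_ae ?_
        filter_upwards [hae] with x hx
        have hs : (0 : ℝ) < ‖x‖ ^ 2 := by have := norm_pos_iff.2 hx; positivity
        have hxx : x 0 * x 0 = ‖x‖ ^ 2 := by
          rw [EuclideanSpace.norm_sq_eq]; simp [sq]
        rw [← neg_mul, ← Complex.ofReal_neg, coordDeriv, if_pos rfl, one_mul, ← mul_assoc, hxx,
          mul_logPow_sub_one _ _ _ hs, logPow_add, upT, hT, ← neg_one_mul, logPow_const_mul, hc']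
        have e1 : α + (M - 1) * α = -1 * -(M * α) := by ring
        have e2 : β + ((M - 1) * β + α) = -1 * -(M * β + α) := by ring
        have e3 : c = ((M : ℝ) - (1 : ℕ)) / 2 := by rw [hc]; push_cast; ring
        rw [e1, e2, e3]
    _ = _ := by
        rw [h φ, ← integral_neg]
        refine integral_congr_ae ?_
        filter_upwards [sum_rieszSq (m := 1) le_rfl] with ξ hξ
        simp only [Finset.univ_unique, Fin.default_eq_zero, Finset.sum_singleton] at hξ
        rw [hξ]; ring

/-- The two-step relation between vector kernels. -/
theorem upVValue_add_two (hm : 1 ≤ m) {M : ℕ} (hM : 1 ≤ M) (hmM : m ≤ M + 1) (h : UpVValue m M) :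
    UpVValue m (M + 2) := by
  intro i j φ
  have hm1 : (1 : ℝ) ≤ m := by exact_mod_cast hm
  have hM1 : (1 : ℝ) ≤ M := by exact_mod_cast hM
  have hae := ae_ne_zero hm
  have hq := isSymbol_hilSym j M
  have hd1 : ∀ l : Fin m, IsSymbol fun ξ => ((2 * π * ξ l : ℝ) : ℂ) * Complex.I * hilSym j M ξ :=
    fun l => hq.deriv_coord l
  have hd2 : ∀ l : Fin m, IsSymbol fun ξ => ((2 * π * ξ l : ℝ) : ℂ) * Complex.I *
      (((2 * π * ξ l : ℝ) : ℂ) * Complex.I * hilSym j M ξ) := fun l => (hd1 l).deriv_coord l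
  obtain ⟨C, hC, hb⟩ := hq.norm_toDist_shift_le (hasKernelDecay_hilSym hm j M) φ
  have hb1 : ∀ l : Fin m, ∃ C, 0 ≤ C ∧ ∀ x, ‖(hd1 l).toDist (shift x φ)‖ ≤
      C * ((1 + ‖x‖) ^ (m + M + 1))⁻¹ := fun l =>
    (hd1 l).norm_toDist_shift_le (hasKernelDecay_hilSym_deriv hm l j M) φ
  have hb2 : ∀ l : Fin m, ∃ C, 0 ≤ C ∧ ∀ x, ‖(hd2 l).toDist (shift x φ)‖ ≤
      C * ((1 + ‖x‖) ^ (m + M + 1 + 1))⁻¹ := fun l =>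
    (hd2 l).norm_toDist_shift_le (hasKernelDecay_hilSym_deriv_deriv hm l j M) φ
  have hsum : ∀ x, (isSymbol_hilSym j (M + 2)).toDist (shift x φ) =
      -∑ l, (hd2 l).toDist (shift x φ) := fun x => by
    have hn : IsSymbol fun ξ => -hilSym j (M + 2) ξ := by
      convert (IsSymbol.const (m := m) (-1)).mul (isSymbol_hilSym j (M + 2)) using 2
      simp
    rw [← IsSymbol.toDist_sum _ hd2 hn (fun ξ => (sum_hilSym_deriv_deriv j M ξ).symm),
      IsSymbol.toDist_neg (isSymbol_hilSym j (M + 2)) hn (fun ξ => rfl), neg_neg]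
  set α := (vCoef m (M + 2)).1
  set β := (vCoef m (M + 2)).2
  set c : ℝ := (((M + 2 : ℕ) : ℝ) - m - 1) / 2 with hc
  set α₁ := 2 * c * α with hα₁
  set β₁ := 2 * c * β + α with hβ₁
  have hc' : 2 * c = M + 1 - m := by rw [hc]; push_cast; ring
  -- the second derivatives and their sum
  let D : Fin m → Eu m → ℝ → ℝ := fun l x s =>
    (if i = l then 1 else 0) * (x l * logPow α₁ β₁ (c - 1) s) +
      ((if i = l then 1 else 0) * (x l * logPow α₁ β₁ (c - 1) s) +
        x i * coordDeriv α₁ β₁ (c - 1) l l x s)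
  have hDd : ∀ l ε, 0 < ε → ∀ x : Eu m, HasLineDerivAt ℝ
      (fun x : Eu m => coordDeriv α β c i l x (‖x‖ ^ 2 + ε ^ 2))
      (D l x (‖x‖ ^ 2 + ε ^ 2)) x (unitVec l) := fun l ε hε x => by
    have h1 : HasLineDerivAt ℝ (fun _ : Eu m => if i = l then (1 : ℝ) else 0) 0 x
        (unitVec l) := hasDerivAt_const _ _
    have := (h1.mul_real (hasLineDerivAt_logPow α β c hε x l)).add_real
      ((hasLineDerivAt_coord i l x).mul_real (hasLineDerivAt_coord_logPow α₁ β₁ (c - 1) hε x l l))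
    rw [zero_mul, zero_add] at this
    exact this
  have hDo : ∀ l, HasOrder (fun ε (x : Eu m) => D l x (‖x‖ ^ 2 + ε ^ 2)) ((M : ℝ) - m) := fun l => by
    have e : (M : ℝ) - m = 2 * (c - 1) + 1 := by linarith
    have h1 := ((hasOrder_logPow (m := m) α₁ β₁ (c - 1)).coord l).const_mul
      (if i = l then 1 else 0)
    rw [e]
    exact h1.add (h1.add ((hasOrder_coordDeriv α₁ β₁ (c - 1) l l).coord i))
  have hDt : ∀ l x, x ≠ 0 → Tendsto (fun ε : ℝ => D l x (‖x‖ ^ 2 + ε ^ 2)) (𝓝[>] 0)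
      (𝓝 (D l x (‖x‖ ^ 2))) := fun l x hx => by
    have h1 := ((tendsto_logPow α₁ β₁ (c - 1) hx).const_mul (x l)).const_mul
      (if i = l then (1 : ℝ) else 0)
    exact h1.add (h1.add ((tendsto_coordDeriv α₁ β₁ (c - 1) l l hx).const_mul (x i)))
  have hDs : ∀ x : Eu m, x ≠ 0 → ∑ l, D l x (‖x‖ ^ 2) = -upV m i M x := fun x hx => by
    have hs : (0 : ℝ) < ‖x‖ ^ 2 := by have := norm_pos_iff.2 hx; positivity
    have hV : vCoef m M = ((((M + 1 : ℕ) : ℝ) - m) * -((M + 1 : ℕ) * α),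
        (((M + 1 : ℕ) : ℝ) - m) * -((M + 1 : ℕ) * β + α) + -((M + 1 : ℕ) * α)) := by
      rw [vCoef_of_tCoef hm hmM, tCoef_of_vCoef hm hmM]
    have hxx : ∑ l : Fin m, x l * (x l * logPow (2 * (c - 1) * α₁) (2 * (c - 1) * β₁ + α₁) (c - 1 - 1)
        (‖x‖ ^ 2)) = logPow (2 * (c - 1) * α₁) (2 * (c - 1) * β₁ + α₁) (c - 1) (‖x‖ ^ 2) := by
      rw [← mul_logPow_sub_one _ _ (c - 1) hs]
      simp_rw [← mul_assoc, ← Finset.sum_mul, EuclideanSpace.norm_sq_eq, Real.norm_eq_abs, sq_abs, sq]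
    simp only [D, Finset.sum_add_distrib, ite_mul, one_mul, zero_mul, Finset.sum_ite_eq,
      Finset.mem_univ, if_true, coordDeriv, mul_add, ← Finset.mul_sum, hxx, Finset.sum_const,
      Finset.card_univ, Fintype.card_fin, nsmul_eq_mul]
    have e0 : ((M : ℝ) - m - 1) / 2 = c - 1 := by linarith
    have e1 : (m : ℝ) = M + 1 - 2 * c := by linarith
    rw [upV, hV, e0]
    simp only [logPow, hα₁, hβ₁, e1]
    push_cast; ring
  have step : ∀ l, ∫ x, (upV m i (M + 2) x : ℂ) * (hd2 l).toDist (shift x φ) =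
      ∫ x, (D l x (‖x‖ ^ 2) : ℂ) * hq.toDist (shift x φ) := fun l => by
    obtain ⟨C1, hC1, hb1⟩ := hb1 l
    obtain ⟨C2, hC2, hb2⟩ := hb2 l
    have e1 := hasOrder_coordDeriv α β c i l
    have e2 : 2 * c = ((M + 2 : ℕ) : ℝ) - m - 1 := by rw [hc]; ring
    rw [e2] at e1
    have s1 := (hasOrder_upV (m := m) i (M + 2)).integral_limit_eq_neg hm e1
      (fun ε hε x => hasLineDerivAt_coord_logPow α β c hε x i l)
      ((hd1 l).continuous_toDist_shift φ) ((hd2 l).continuous_toDist_shift φ)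
      (fun x => (hd1 l).hasLineDerivAt_toDist_shift φ x l) hb1 hb2
      (by push_cast; linarith) (by push_cast; linarith)
      (fun x hx => (tendsto_logPow _ _ _ hx).const_mul _)
      (fun x hx => tendsto_coordDeriv α β c i l hx)
    have s2 := e1.integral_limit_eq_neg hm (by convert hDo l using 1; push_cast; ring)
      (hDd l) (hq.continuous_toDist_shift φ) ((hd1 l).continuous_toDist_shift φ)
      (fun x => hq.hasLineDerivAt_toDist_shift φ x l) hb hb1
      (by push_cast; linarith) (by push_cast; linarith)
      (fun x hx => tendsto_coordDeriv α β c i l hx) (hDt l)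
    rw [s2, neg_neg] at s1
    exact s1
  have hmeas : ∀ l, Measurable fun x : Eu m => D l x (‖x‖ ^ 2) := fun l => by
    have a1 := measurable_logPow_norm (m := m) α₁ β₁ (c - 1)
    have a2 := measurable_logPow_norm (m := m) (2 * (c - 1) * α₁) (2 * (c - 1) * β₁ + α₁) (c - 1 - 1)
    simp only [D, coordDeriv]; fun_prop
  calc _ = -∑ l, ∫ x, (upV m i (M + 2) x : ℂ) * (hd2 l).toDist (shift x φ) := by
        rw [← integral_finsetSum, ← integral_neg]
        · refine integral_congr_of_eq fun x => ?_
          simp only [hsum, Finset.mul_sum, mul_neg]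
        · intro l _
          obtain ⟨C2, hC2, hb2⟩ := hb2 l
          exact (hasOrder_upV (m := m) i (M + 2)).integrable_limit hm
            ((hd2 l).continuous_toDist_shift φ).aestronglyMeasurable hb2
            (by push_cast; linarith) (by push_cast; linarith) (measurable_upV _ _)
            (fun x hx => (tendsto_logPow _ _ _ hx).const_mul _)
    _ = -∫ x, ∑ l, (D l x (‖x‖ ^ 2) : ℂ) * hq.toDist (shift x φ) := by
        simp_rw [step]
        rw [integral_finsetSum]
        intro l _
        exact (hDo l).integrable_limit hm (hq.continuous_toDist_shift φ).aestronglyMeasurable hb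
          (by linarith) (by push_cast; linarith) (hmeas l) (hDt l)
    _ = ∫ x, (upV m i M x : ℂ) * hq.toDist (shift x φ) := by
        rw [← integral_neg]
        refine integral_congr_ae ?_
        filter_upwards [hae] with x hx
        rw [← Finset.sum_mul, ← Complex.ofReal_sum, hDs x hx]
        push_cast; ring
    _ = _ := h i j φ

theorem upVValue (hm : 1 ≤ m) (N : ℕ) (hN : 1 ≤ N) : UpVValue m N := by
  induction N using Nat.strong_induction_on with
  | _ N ih =>
    rcases Nat.lt_or_ge m N with h | h
    · rcases Nat.lt_or_ge m 2 with h2 | h2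
      · obtain rfl : m = 1 := by omega
        obtain ⟨M, rfl⟩ := Nat.exists_eq_add_of_le' (by omega : 2 ≤ N)
        refine upVValue_succ_of_dim_one (by omega) ?_
        rcases Nat.eq_zero_or_pos M with rfl | hM
        · exact upTValue_one_one
        · exact upTValue_succ le_rfl hM (by omega) (ih M (by omega) hM)
      · obtain ⟨M, rfl⟩ := Nat.exists_eq_add_of_le' (by omega : 2 ≤ N)
        exact upVValue_add_two hm (by omega) (by omega) (ih M (by omega) (by omega))
    · exact upVValue_of_le hm hN h

theorem upTValue (hm : 1 ≤ m) (N : ℕ) (hN : 1 ≤ N) : UpTValue m N := by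
  rcases Nat.lt_or_ge N m with h | h
  · exact upTValue_of_lt hN h
  · obtain ⟨M, rfl⟩ := Nat.exists_eq_add_of_le' hN
    rcases Nat.eq_zero_or_pos M with rfl | hM
    · obtain rfl : m = 1 := by omega
      exact upTValue_one_one
    · exact upTValue_succ hm hM h (upVValue hm M hM)

/-! ### Convolvability of all orders -/

theorem isScalarConv_upT_powSym (hm : 1 ≤ m) {N : ℕ} (hN : 1 ≤ N) :
    IsScalarConv (isTempered_upT hm hN).toDist (isSymbol_powSym N).toDist
      (IsSymbol.const 1).toDist := by
  have hm1 : (1 : ℝ) ≤ m := by exact_mod_cast hm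
  have hN1 : (1 : ℝ) ≤ N := by exact_mod_cast hN
  refine isScalarConv_tempered_symbol _ _ _ (fun φ => ?_) fun φ => by
    simpa using upTValue hm N hN φ
  obtain ⟨C, hC, hb⟩ := (isSymbol_powSym N).norm_toDist_shift_le (hasKernelDecay_powSym N) φ
  exact (hasOrder_upT N).integrable_limit hm
    ((isSymbol_powSym N).continuous_toDist_shift φ).aestronglyMeasurable hb (by linarith)
    (by push_cast; linarith) (measurable_upT N) fun x hx => tendsto_logPow _ _ _ hx

theorem isScalarConv_upV_hilSym (hm : 1 ≤ m) {N : ℕ} (hN : 1 ≤ N) (i j : Fin m) :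
    IsScalarConv (isTempered_upV hm i hN).toDist (isSymbol_hilSym j N).toDist
      (isSymbol_rieszSq i j).toDist := by
  have hm1 : (1 : ℝ) ≤ m := by exact_mod_cast hm
  have hN1 : (1 : ℝ) ≤ N := by exact_mod_cast hN
  refine isScalarConv_tempered_symbol _ _ _ (fun φ => ?_) (upVValue hm N hN i j)
  obtain ⟨C, hC, hb⟩ := (isSymbol_hilSym j N).norm_toDist_shift_le (hasKernelDecay_hilSym hm j N) φ
  exact (hasOrder_upV i N).integrable_limit hm
    ((isSymbol_hilSym j N).continuous_toDist_shift φ).aestronglyMeasurable hb (by linarith)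
    (by push_cast; linarith) (measurable_upV i N)
    fun x hx => (tendsto_logPow _ _ _ hx).const_mul _

theorem isScalarConv_powSym_upT (hm : 1 ≤ m) {N : ℕ} (hN : 1 ≤ N) (hNm : N < m) :
    IsScalarConv (isSymbol_powSym N).toDist (isTempered_upT hm hN).toDist
      (IsSymbol.const 1).toDist := by
  convert (isScalarConv_rieszKernel hN hNm hm).2 using 3
  exact upT_eq_rieszKernel hNm _

theorem isScalarConv_hilSym_upV (hm : 1 ≤ m) {N : ℕ} (hN : 1 ≤ N) (hNm : N ≤ m) (i j : Fin m) :
    IsScalarConv (isSymbol_hilSym i N).toDist (isTempered_upV hm j hN).toDist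
      (isSymbol_rieszSq i j).toDist := by
  convert (isScalarConv_hilbertRieszKernel hN hNm hm i j).2 using 3
  exact upV_eq_hilbertRieszKernel hNm j _

/-- The scalar distribution with symbol `|2πξ|^n`. -/
def distT (hm : 1 ≤ m) : ℤ → 𝓢'(Eu m, ℂ)
  | Int.ofNat N => (isSymbol_powSym N).toDist
  | Int.negSucc n => (isTempered_upT hm (Nat.succ_pos n)).toDist

/-- The distribution with symbol `-i (ξ_j/|ξ|) |2πξ|^n`. -/
def distV (hm : 1 ≤ m) (j : Fin m) : ℤ → 𝓢'(Eu m, ℂ)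
  | Int.ofNat N => (isSymbol_hilSym j N).toDist
  | Int.negSucc n => (isTempered_upV hm j (Nat.succ_pos n)).toDist

theorem isScalarConv_distT (hm : 1 ≤ m) {n : ℤ} (hn : n < m) :
    IsScalarConv (distT hm n) (distT hm (-n)) (IsSymbol.const 1).toDist := by
  match n, hn with
  | Int.ofNat 0, _ =>
    have h : (isSymbol_powSym (m := m) 0).toDist = (IsSymbol.const 1).toDist :=
      IsSymbol.toDist_congr _ _ fun ξ => by simp [powSym]
    simp only [Int.ofNat_eq_natCast, Nat.cast_zero, neg_zero]
    change IsScalarConv (isSymbol_powSym 0).toDist (isSymbol_powSym 0).toDist _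
    rw [h]
    exact isScalarConv_const_one
  | Int.ofNat (N + 1), hn =>
    have hN : N + 1 < m := by simp only [Int.ofNat_eq_natCast] at hn; omega
    exact isScalarConv_powSym_upT hm (Nat.succ_pos N) hN
  | Int.negSucc N, _ => exact isScalarConv_upT_powSym hm (Nat.succ_pos N)

theorem isScalarConv_distV (hm : 1 ≤ m) {n : ℤ} (hn : n ≤ m) (i j : Fin m) :
    IsScalarConv (distV hm i n) (distV hm j (-n)) (isSymbol_rieszSq i j).toDist := by
  match n, hn with
  | Int.ofNat 0, _ => exact isScalarConv_hilSym_zero hm i j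
  | Int.ofNat (N + 1), hn =>
    have hN : N + 1 ≤ m := by simp only [Int.ofNat_eq_natCast] at hn; omega
    exact isScalarConv_hilSym_upV hm (Nat.succ_pos N) hN i j
  | Int.negSucc N, _ => exact isScalarConv_upV_hilSym hm (Nat.succ_pos N) i j

/-! ### Boundary values of the potentials -/

theorem tendsto_integral_of_norm_rpow_le (hm : 1 ≤ m) {A : ℝ → Eu m → ℝ} {k : Eu m → ℝ} {a C : ℝ}
    (ha : -(m : ℝ) < a) (ha0 : a ≤ 0) (hA : ∀ u, 0 < u → AEStronglyMeasurable (A u))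
    (hb : ∀ u, 0 < u → ∀ x, x ≠ 0 → ‖A u x‖ ≤ C * ‖x‖ ^ a)
    (hlim : ∀ x, x ≠ 0 → Tendsto (fun u => A u x) (𝓝[>] 0) (𝓝 (k x))) (φ : 𝓢(Eu m, ℂ)) :
    (∀ u, 0 < u → Integrable fun x => (A u x : ℂ) * φ x) ∧
    Tendsto (fun u => ∫ x, (A u x : ℂ) * φ x) (𝓝[>] 0) (𝓝 (∫ x, (k x : ℂ) * φ x)) := by
  have hae := ae_ne_zero hm
  have hr : IsRieszBounded (fun x : Eu m => ((‖x‖ ^ a : ℝ) : ℂ)) a :=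
    ⟨Measurable.aestronglyMeasurable (by fun_prop), ha, ha0, 1, zero_le_one, fun x => by
      rw [Complex.norm_real, norm_of_nonneg (by positivity), one_mul]⟩
  have hi := (((hr.isTempered hm).integrable_mul φ).norm).const_mul C
  have hmeas : ∀ u, 0 < u → AEStronglyMeasurable fun x => (A u x : ℂ) * φ x := fun u hu =>
    (Complex.continuous_ofReal.comp_aestronglyMeasurable (hA u hu)).mul
      φ.continuous.aestronglyMeasurable
  have hbd : ∀ u, 0 < u → ∀ᵐ x, ‖(A u x : ℂ) * φ x‖ ≤ C * ‖((‖x‖ ^ a : ℝ) : ℂ) * φ x‖ := by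
    intro u hu
    filter_upwards [hae] with x hx
    rw [norm_mul, norm_mul, Complex.norm_real, Complex.norm_real,
      norm_of_nonneg (by positivity : 0 ≤ ‖x‖ ^ a), ← mul_assoc]
    gcongr
    exact hb u hu x hx
  refine ⟨fun u hu => hi.mono' (hmeas u hu) (hbd u hu), ?_⟩
  refine tendsto_integral_filter_of_dominated_convergence _ ?_ ?_ hi ?_
  · filter_upwards [self_mem_nhdsWithin] with u hu using hmeas u hu
  · filter_upwards [self_mem_nhdsWithin] with u hu using hbd u hu
  · filter_upwards [hae] with x hx
    exact ((Complex.continuous_ofReal.tendsto _).comp (hlim x hx)).mul_const _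

theorem aestronglyMeasurable_primInt {K : ℝ → Eu m → ℝ} (hK : Measurable (Function.uncurry K))
    (n : ℕ) (u : ℝ) : AEStronglyMeasurable (primInt K n u) := by
  have h : StronglyMeasurable (Function.uncurry fun (x : Eu m) (w : ℝ) =>
      w ^ (n : ℝ) • K (u + w) x) := by
    have h1 : Measurable fun q : Eu m × ℝ => K (u + q.2) q.1 :=
      hK.comp ((measurable_const.add measurable_snd).prodMk measurable_fst)
    refine Measurable.stronglyMeasurable ?_
    unfold Function.uncurry
    simp only [smul_eq_mul]
    fun_prop
  exact (h.integral_prod_right (ν := volume.restrict (Ioi 0))).aestronglyMeasurable.const_smul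
    ((n.factorial : ℝ)⁻¹)

theorem continuousAt_poisson_time {t : ℝ} (ht : 0 < t) (x : Eu m) :
    ContinuousAt (fun t => poisson m t x) t := by
  have h : Continuous fun t => nrm t x ^ (m + 1) :=
    (continuous_nrm.comp (by fun_prop : Continuous fun t : ℝ => (t, x))).pow _
  exact (continuousAt_id.div h.continuousAt (pow_pos (nrm_pos ht x) _).ne').const_mul _

theorem upstream_scalar_limit {k : ℕ} (hk : k + 1 < m) (φ : 𝓢(Eu m, ℂ)) :
    (∀ u, 0 < u → Integrable fun x => (potA m k u x : ℂ) * φ x) ∧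
    Tendsto (fun u => ∫ x, (potA m k u x : ℂ) * φ x) (𝓝[>] 0)
      (𝓝 ((-1) ^ (k + 1) * ∫ x, (upT m (k + 1) x : ℂ) * φ x)) := by
  have hkm : (k : ℝ) + 1 < m := by exact_mod_cast hk
  have hKmeas : ∀ x : Eu m, StronglyMeasurable fun v => poisson m v x := fun x =>
    (measurable_poisson_uncurry.comp (measurable_id.prodMk measurable_const)).stronglyMeasurable
  have hKb : ∀ v, 0 < v → ∀ x : Eu m, ‖poisson m v x‖ ≤ 2 / sig (m + 1) * (nrm v x ^ m)⁻¹ := by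
    intro v hv x
    rw [norm_of_nonneg (poisson_nonneg hv x)]; exact poisson_le (nrm_pos hv x)
  have hpot : ∀ u, 0 < u → ∀ x : Eu m,
      (potA m k u x : ℂ) * φ x = (-1) ^ (k + 1) * (((primInt (poisson m) k u x : ℝ) : ℂ) * φ x) := by
    intro u hu x
    change (upA m k u x : ℂ) * φ x = _
    rw [upA_eq hk hu, upInt_eq_primInt]
    push_cast [smul_eq_mul]; ring
  have key := tendsto_integral_of_norm_rpow_le (by omega : 1 ≤ m) (A := primInt (poisson m) k)
    (k := upT m (k + 1)) (a := (k : ℝ) + 1 - m) (by linarith) (by linarith)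
    (fun u _ => aestronglyMeasurable_primInt measurable_poisson_uncurry k u)
    (fun u hu x hx => by
      have := norm_primInt_le (h := fun _ => 2 / sig (m + 1)) hKmeas hk hKb hu.le hx
      rw [← mul_assoc, ← mul_assoc] at this
      exact this) (fun x hx => by
      have := tendsto_primInt (h := fun _ => 2 / sig (m + 1)) hKmeas
        (fun x v hv => continuousAt_poisson_time hv x) hk hKb hx
      convert this using 2
      rw [primInt]
      simp only [zero_add, smul_eq_mul]
      rw [integral_rpow_mul_poisson hk hx]
      have := upT_eq_rieszKernel hk x
      rw [rieszKernel] at this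
      exact_mod_cast this) φ
  refine ⟨fun u hu => ((key.1 u hu).const_mul ((-1) ^ (k + 1))).congr
    (Eventually.of_forall fun x => (hpot u hu x).symm), (key.2.const_mul ((-1) ^ (k + 1))).congr' ?_⟩
  filter_upwards [self_mem_nhdsWithin] with u hu
  rw [← integral_const_mul]
  exact integral_congr_of_eq (fun x => (hpot u hu x).symm)

theorem upstream_vector_limit {k : ℕ} (hk : k < m) (j : Fin m) (φ : 𝓢(Eu m, ℂ)) :
    (∀ u, 0 < u → Integrable fun x => (potB m k u x j : ℂ) * φ x) ∧
    Tendsto (fun u => ∫ x, (potB m k u x j : ℂ) * φ x) (𝓝[>] 0)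
      (𝓝 ((-1) ^ (k + 1) * ∫ x, (upV m j (k + 1) x : ℂ) * φ x)) := by
  have hkm : (k : ℝ) + 1 ≤ m := by exact_mod_cast hk
  have hm : 1 ≤ m := by omega
  have hsg := two_div_sig_succ_pos m
  have hmu : Measurable (Function.uncurry fun v (x : Eu m) => conjPoisson m v x) :=
    measurable_conjPoisson_uncurry
  have hKmeas : ∀ x : Eu m, StronglyMeasurable fun v => conjPoisson m v x := fun x =>
    (hmu.comp (measurable_id.prodMk measurable_const)).stronglyMeasurable
  have hKb : ∀ v, 0 < v → ∀ x : Eu m,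
      ‖conjPoisson m v x‖ ≤ 2 / sig (m + 1) * ‖x‖ * (nrm v x ^ (m + 1))⁻¹ := by
    intro v hv x
    have := nrm_pos hv x
    rw [conjPoisson, norm_smul, norm_div, norm_neg, norm_of_nonneg hsg.le,
      norm_of_nonneg (by positivity)]
    exact le_of_eq (by ring)
  let p : Eu m →L[ℝ] ℝ := EuclideanSpace.proj j
  let q : ℝ → Eu m → ℝ := fun v x => conjPoisson m v x j
  have hpj : ∀ x : Eu m, ‖x j‖ ≤ ‖x‖ := fun x => PiLp.norm_apply_le x j
  have hKmeas' : ∀ x : Eu m, StronglyMeasurable fun v => conjPoisson m v x j := fun x =>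
    p.continuous.comp_stronglyMeasurable (hKmeas x)
  have hKb' : ∀ v, 0 < v → ∀ x : Eu m,
      ‖conjPoisson m v x j‖ ≤ 2 / sig (m + 1) * ‖x‖ * (nrm v x ^ (m + 1))⁻¹ :=
    fun v hv x => (hpj _).trans (hKb v hv x)
  have hcoord : ∀ u, 0 < u → ∀ x, primInt (conjPoisson m) k u x j =
      primInt q k u x := by
    intro u hu x
    have hi := integrableOn_primInt (n := k) (h := fun x => 2 / sig (m + 1) * ‖x‖) hKmeas
      (by omega) hKb hu.le (nrm_pos hu x)
    have := p.integral_comp_comm hi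
    rw [primInt, primInt, PiLp.smul_apply]
    exact congrArg (fun z => (k.factorial : ℝ)⁻¹ • z) this.symm
  have hpot : ∀ u, 0 < u → ∀ x : Eu m, (potB m k u x j : ℂ) * φ x =
      (-1) ^ (k + 1) * (((primInt q k u x : ℝ) : ℂ) * φ x) := by
    intro u hu x
    change (upB m k u x j : ℂ) * φ x = _
    rw [upB_eq hk hu, upInt_eq_primInt, PiLp.smul_apply, hcoord u hu]
    push_cast [smul_eq_mul]; ring
  have key := tendsto_integral_of_norm_rpow_le hm (A := primInt q k)
    (k := upV m j (k + 1)) (a := (k : ℝ) + 1 - m)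
    (C := (k.factorial : ℝ)⁻¹ * (1 / 2 * Gamma (((k : ℝ) + 1) / 2) *
      Gamma (((m + 1 : ℕ) - k - 1) / 2) / Gamma (((m + 1 : ℕ) : ℝ) / 2)) * (2 / sig (m + 1)))
    (by linarith) (by linarith)
    (fun u _ => aestronglyMeasurable_primInt (K := q) (p.measurable.comp hmu) k u)
    (fun u hu x hx => by
      have hx0 := norm_pos_iff.2 hx
      refine (norm_primInt_le (K := q) (n := k) (h := fun x => 2 / sig (m + 1) * ‖x‖) hKmeas' (by omega) hKb'
        hu.le hx).trans_eq ?_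
      have : ‖x‖ ^ ((k : ℝ) + 1 - m) = ‖x‖ * ‖x‖ ^ ((k : ℝ) + 1 - (m + 1 : ℕ)) := by
        rw [mul_comm, ← rpow_add_one hx0.ne']; congr 1; push_cast; ring
      rw [this]; ring) (fun x hx => by
      have := tendsto_primInt (K := q) (n := k) (h := fun x => 2 / sig (m + 1) * ‖x‖) hKmeas'
        (fun x v hv => (hasDerivAt_conjPoisson_time hv x j).continuousAt) (by omega) hKb' hx
      convert this using 2
      rw [primInt]
      simp only [q, zero_add, smul_eq_mul]
      rw [integral_rpow_mul_conjPoisson hk hx]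
      have := upV_eq_hilbertRieszKernel hk j x
      rw [hilbertRieszKernel] at this
      exact_mod_cast this) φ
  refine ⟨fun u hu => ((key.1 u hu).const_mul ((-1) ^ (k + 1))).congr
    (Eventually.of_forall fun x => (hpot u hu x).symm), (key.2.const_mul ((-1) ^ (k + 1))).congr' ?_⟩
  filter_upwards [self_mem_nhdsWithin] with u hu
  rw [← integral_const_mul]
  exact integral_congr_of_eq (fun x => (hpot u hu x).symm)

/-- The boundary values of the scalar potentials. -/
theorem tendsto_potA (hm : 1 ≤ m) {k : ℤ} (hk : k + 1 < m) (φ : 𝓢(Eu m, ℂ)) :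
    (∀ u, 0 < u → Integrable fun x => (potA m k u x : ℂ) * φ x) ∧
    Tendsto (fun u => ∫ x, (potA m k u x : ℂ) * φ x) (𝓝[>] 0)
      (𝓝 ((-1) ^ (k + 1) * distT hm (-k - 1) φ)) := by
  match k, hk with
  | Int.ofNat k, hk =>
    have h : -Int.ofNat k - 1 = Int.negSucc k := by rw [Int.negSucc_eq]; simp; ring
    rw [h]
    exact upstream_scalar_limit (by simp only [Int.ofNat_eq_natCast] at hk; omega) φ
  | Int.negSucc k, _ =>
    have h : -Int.negSucc k - 1 = Int.ofNat k := by rw [Int.negSucc_eq]; simp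
    have h' : Int.negSucc k + 1 = -(k : ℤ) := by rw [Int.negSucc_eq]; ring
    have hs := isSymbol_symA (m := m) k
    rw [h, h']
    refine ⟨fun u hu => (hs.integrable_symbolKernel_mul hu φ).congr
      (Eventually.of_forall fun x => by simp only [potA_negSucc_eq k hu]), ?_⟩
    have := hs.tendsto_integral_symbolKernel φ
    have e : ∫ ξ, symA k ξ * 𝓕 φ ξ = (-1) ^ (-(k : ℤ)) * distT hm (Int.ofNat k) φ := by
      change _ = _ * (isSymbol_powSym k).toDist φ
      rw [IsSymbol.toDist_apply, ← integral_const_mul]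
      refine integral_congr_of_eq fun ξ => ?_
      simp only [symA_eq_powSym, zpow_neg, zpow_natCast, ← inv_pow]
      norm_num [mul_assoc]
    rw [e] at this
    refine this.congr' ?_
    filter_upwards [self_mem_nhdsWithin] with u hu
    refine integral_congr_of_eq fun x => ?_
    simp only [potA_negSucc_eq k (show 0 < u from hu)]

/-- The boundary values of the vector potentials. -/
theorem tendsto_potB (hm : 1 ≤ m) {k : ℤ} (hk : k < m) (j : Fin m) (φ : 𝓢(Eu m, ℂ)) :
    (∀ u, 0 < u → Integrable fun x => (potB m k u x j : ℂ) * φ x) ∧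
    Tendsto (fun u => ∫ x, (potB m k u x j : ℂ) * φ x) (𝓝[>] 0)
      (𝓝 ((-1) ^ (k + 1) * distV hm j (-k - 1) φ)) := by
  match k, hk with
  | Int.ofNat k, hk =>
    have h : -Int.ofNat k - 1 = Int.negSucc k := by rw [Int.negSucc_eq]; simp; ring
    rw [h]
    exact upstream_vector_limit (by simp only [Int.ofNat_eq_natCast] at hk; omega) j φ
  | Int.negSucc k, _ =>
    have h : -Int.negSucc k - 1 = Int.ofNat k := by rw [Int.negSucc_eq]; simp
    have h' : Int.negSucc k + 1 = -(k : ℤ) := by rw [Int.negSucc_eq]; ring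
    have hs := isSymbol_symB (m := m) j k
    rw [h, h']
    refine ⟨fun u hu => (hs.integrable_symbolKernel_mul hu φ).congr
      (Eventually.of_forall fun x => by simp only [potB_negSucc_eq hm k hu]), ?_⟩
    have := hs.tendsto_integral_symbolKernel φ
    have e : ∫ ξ, symB j k ξ * 𝓕 φ ξ = (-1) ^ (-(k : ℤ)) * distV hm j (Int.ofNat k) φ := by
      change _ = _ * (isSymbol_hilSym j k).toDist φ
      rw [IsSymbol.toDist_apply, ← integral_const_mul]
      refine integral_congr_of_eq fun ξ => ?_
      simp only [symB_eq_hilSym, zpow_neg, zpow_natCast, ← inv_pow]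
      norm_num [mul_assoc]
    rw [e] at this
    refine this.congr' ?_
    filter_upwards [self_mem_nhdsWithin] with u hu
    refine integral_congr_of_eq fun x => ?_
    simp only [potB_negSucc_eq hm k (show 0 < u from hu)]

/-! ### Polar coordinates and spherical means -/

theorem integral_polar (hm : 1 ≤ m) {F : Eu m → ℂ} (hF : Integrable F) :
    IntegrableOn (fun r : ℝ => ((r ^ (m - 1) : ℝ) : ℂ) *
      ∫ w : Metric.sphere (0 : Eu m) 1, F (r • (w : Eu m)) ∂(volume : Measure (Eu m)).toSphere)
      (Ioi 0) ∧
    ∫ x, F x = ∫ r in Ioi (0 : ℝ), ((r ^ (m - 1) : ℝ) : ℂ) *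
      ∫ w : Metric.sphere (0 : Eu m) 1, F (r • (w : Eu m)) ∂(volume : Measure (Eu m)).toSphere := by
  have : Nonempty (Fin m) := ⟨⟨0, hm⟩⟩
  have hdim : Module.finrank ℝ (Eu m) = m := by simp
  have hmp := (volume : Measure (Eu m)).measurePreserving_homeomorphUnitSphereProd
  rw [hdim] at hmp
  have hemb := (homeomorphUnitSphereProd (Eu m)).measurableEmbedding
  set G : Metric.sphere (0 : Eu m) 1 × Ioi (0 : ℝ) → ℂ := fun z => F ((z.2 : ℝ) • (z.1 : Eu m)) with hG
  have hcomp : ∀ x : ({0}ᶜ : Set (Eu m)), G (homeomorphUnitSphereProd (Eu m) x) = F x := fun x => by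
    have := (homeomorphUnitSphereProd (Eu m)).symm_apply_apply x
    rw [hG]
    exact congrArg F (congrArg Subtype.val this)
  have hms : MeasurableSet ({0}ᶜ : Set (Eu m)) := (measurableSet_singleton _).compl
  have hi1 : Integrable (fun x : ({0}ᶜ : Set (Eu m)) => F x) (volume.comap Subtype.val) := by
    have := (integrableOn_iff_comap_subtypeVal (μ := volume) (f := F) hms).1 hF.integrableOn
    exact this
  have hi2 : Integrable G
      ((volume : Measure (Eu m)).toSphere.prod (Measure.volumeIoiPow (m - 1))) := by
    rw [← hmp.integrable_comp_emb hemb]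
    exact hi1.congr (Eventually.of_forall fun x => (hcomp x).symm)
  have hi3 := hi2.integral_prod_right
  have hmeas : Measurable fun r : Ioi (0 : ℝ) => Real.toNNReal ((r : ℝ) ^ (m - 1)) :=
    (measurable_subtype_coe.pow_const _).real_toNNReal
  have hval : ∀ r : ℝ, 0 < r → ∀ z : ℂ, Real.toNNReal (r ^ (m - 1)) • z =
      ((r ^ (m - 1) : ℝ) : ℂ) * z := fun r hr z => by
    rw [NNReal.smul_def, Real.coe_toNNReal _ (by positivity), Complex.real_smul]
  constructor
  · have h : Integrable (fun r : Ioi (0 : ℝ) => Real.toNNReal ((r : ℝ) ^ (m - 1)) •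
        ∫ w, G (w, r) ∂(volume : Measure (Eu m)).toSphere) (volume.comap Subtype.val) :=
      (integrable_withDensity_iff_integrable_smul hmeas).1 hi3
    have h2 := (integrableOn_iff_comap_subtypeVal (μ := volume) (f := fun r : ℝ =>
      Real.toNNReal (r ^ (m - 1)) • ∫ w : Metric.sphere (0 : Eu m) 1, F (r • (w : Eu m))
        ∂(volume : Measure (Eu m)).toSphere) measurableSet_Ioi).2 h
    exact h2.congr_fun (fun r hr => hval r hr _) measurableSet_Ioi
  · calc ∫ x, F x = ∫ x : ({0}ᶜ : Set (Eu m)), F x ∂(volume.comap Subtype.val) := by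
          rw [integral_subtype_comap hms F, restrict_compl_singleton]
      _ = ∫ z, G z ∂((volume : Measure (Eu m)).toSphere.prod (Measure.volumeIoiPow (m - 1))) := by
          rw [← hmp.integral_comp hemb]
          simp_rw [hcomp]
      _ = ∫ r, ∫ w, G (w, r) ∂(volume : Measure (Eu m)).toSphere ∂(Measure.volumeIoiPow (m - 1)) :=
          integral_prod_symm _ hi2
      _ = _ := by
          simp only [Measure.volumeIoiPow, ENNReal.ofReal]
          rw [integral_withDensity_eq_integral_smul hmeas,
            integral_subtype_comap measurableSet_Ioi fun r : ℝ => Real.toNNReal (r ^ (m - 1)) •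
              ∫ w : Metric.sphere (0 : Eu m) 1, F (r • (w : Eu m))
                ∂(volume : Measure (Eu m)).toSphere]
          exact setIntegral_congr_fun measurableSet_Ioi fun r hr => hval r hr _

/-- The integral of `f φ(r ·)` over the unit sphere. -/
def sphInt (f : Eu m → ℂ) (φ : 𝓢(Eu m, ℂ)) (r : ℝ) : ℂ :=
  ∫ w : Metric.sphere (0 : Eu m) 1, f w * φ (r • (w : Eu m)) ∂(volume : Measure (Eu m)).toSphere

theorem sphereMean_eq (φ : 𝓢(Eu m, ℂ)) (r : ℝ) :
    sphereMean m φ r = 1 / (sig m : ℂ) * sphInt (fun _ => 1) φ r := by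
  simp [sphereMean, sphInt]

theorem norm_sphere_eq (w : Metric.sphere (0 : Eu m) 1) : ‖(w : Eu m)‖ = 1 := by
  simp

theorem integrable_sphere {g : Metric.sphere (0 : Eu m) 1 → ℂ} (hg : Continuous g) :
    Integrable g (volume : Measure (Eu m)).toSphere :=
  hg.integrable_of_hasCompactSupport (HasCompactSupport.of_compactSpace g)

theorem hasDerivAt_sphInt {f : Eu m → ℂ} (hf : Continuous f) (φ : 𝓢(Eu m, ℂ)) (r : ℝ) :
    HasDerivAt (sphInt f φ)
      (∑ j, sphInt (fun x => f x * x j) (∂_{unitVec j} φ) r) r := by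
  obtain ⟨C, hC⟩ := (SchwartzMap.fderivCLM ℝ (Eu m) ℂ φ).decay 0 0
  have hC' : ∀ x, ‖fderiv ℝ φ x‖ ≤ C := fun x => by simpa using hC.2 x
  have hcont : ∀ r : ℝ, Continuous fun w : Metric.sphere (0 : Eu m) 1 => f w * φ (r • (w : Eu m)) :=
    fun r => by have := φ.continuous; fun_prop
  have hfd : Continuous (fderiv ℝ φ) := (SchwartzMap.fderivCLM ℝ (Eu m) ℂ φ).continuous
  have key := (hasDerivAt_integral_of_dominated_loc_of_deriv_le (𝕜 := ℝ)
    (μ := (volume : Measure (Eu m)).toSphere)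
    (F := fun r w => f w * φ (r • (w : Eu m)))
    (F' := fun r w => f w * fderiv ℝ φ (r • (w : Eu m)) w) (x₀ := r) (s := univ)
    (bound := fun w => ‖f w‖ * C) Filter.univ_mem
    (Eventually.of_forall fun r => (hcont r).aestronglyMeasurable) (integrable_sphere (hcont r))
    (Continuous.aestronglyMeasurable (by fun_prop))
    (Eventually.of_forall fun w r _ => by
      rw [norm_mul]
      gcongr
      refine ((fderiv ℝ φ _).le_opNorm _).trans ?_
      rw [norm_sphere_eq, mul_one]
      exact hC' _)
    (by
      have : Continuous fun w : Metric.sphere (0 : Eu m) 1 => ‖f w‖ * C := by fun_prop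
      exact this.integrable_of_hasCompactSupport (HasCompactSupport.of_compactSpace _))
    (Eventually.of_forall fun w r _ => by
      have h1 : HasDerivAt (fun r : ℝ => r • (w : Eu m)) (w : Eu m) r := by
        simpa using (hasDerivAt_id r).smul_const (w : Eu m)
      exact ((φ.differentiableAt.hasFDerivAt).comp_hasDerivAt r h1).const_mul _)).2
  refine key.congr_deriv ?_
  simp only [sphInt]
  rw [← integral_finsetSum]
  · refine integral_congr_of_eq fun w => ?_
    simp only [SchwartzMap.lineDerivOp_apply_eq_fderiv]
    have hw : (w : Eu m) = ∑ j, (w : Eu m) j • unitVec j := by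
      ext i; simp [Pi.single_apply]
    conv_lhs => rw [hw]
    rw [map_sum, Finset.mul_sum, ← hw]
    refine Finset.sum_congr rfl fun j _ => ?_
    rw [map_smul, Complex.real_smul]; ring
  · intro j _
    have := (∂_{unitVec j} φ).continuous
    exact integrable_sphere (by fun_prop)

theorem contDiff_sphInt (n : ℕ) : ∀ {f : Eu m → ℂ}, Continuous f → ∀ φ : 𝓢(Eu m, ℂ),
    ContDiff ℝ n (sphInt f φ) := by
  induction n with
  | zero =>
    intro f hf φ
    exact contDiff_zero.2 (continuous_iff_continuousAt.2 fun r => (hasDerivAt_sphInt hf φ r).continuousAt)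
  | succ n ih =>
    intro f hf φ
    push_cast
    rw [contDiff_succ_iff_deriv]
    refine ⟨fun r => (hasDerivAt_sphInt hf φ r).differentiableAt, by simp, ?_⟩
    rw [funext fun r => (hasDerivAt_sphInt hf φ r).deriv]
    exact ContDiff.sum fun j _ => ih (by fun_prop) _

theorem map_neg_toSphere : MeasurePreserving (fun w : Metric.sphere (0 : Eu m) 1 => -w)
    (volume : Measure (Eu m)).toSphere (volume : Measure (Eu m)).toSphere := by
  refine ⟨continuous_neg.measurable, Measure.ext fun s hs => ?_⟩
  rw [Measure.map_apply continuous_neg.measurable hs, Measure.toSphere_apply' _ hs,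
    Measure.toSphere_apply' _ (continuous_neg.measurable hs), ← Measure.measure_neg]
  congr 2
  ext x
  simp only [Set.mem_neg, Set.mem_smul, Set.mem_image, Set.mem_preimage]
  constructor
  · rintro ⟨c, hc, _, ⟨w, hw, rfl⟩, h⟩
    exact ⟨c, hc, _, ⟨-w, hw, rfl⟩, by simp [h]⟩
  · rintro ⟨c, hc, _, ⟨w, hw, rfl⟩, h⟩
    exact ⟨c, hc, _, ⟨-w, by simpa using hw, rfl⟩, by simp [← h]⟩

theorem sphInt_neg {f : Eu m → ℂ} {c : ℂ} (hf : ∀ x, f (-x) = c * f x) (φ : 𝓢(Eu m, ℂ)) (r : ℝ) :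
    sphInt f φ (-r) = c * sphInt f φ r := by
  rw [sphInt, sphInt, ← map_neg_toSphere.integral_comp (Homeomorph.neg _).measurableEmbedding,
    ← integral_const_mul]
  refine integral_congr_of_eq fun w => ?_
  simp [hf, mul_assoc]

theorem exists_norm_sphInt_le {f : Eu m → ℂ} (hf : Continuous f) (φ : 𝓢(Eu m, ℂ)) :
    ∃ C, 0 ≤ C ∧ ∀ r : ℝ, 0 < r → ‖sphInt f φ r‖ ≤ C * r⁻¹ := by
  obtain ⟨C, hC⟩ := φ.decay 1 0
  refine ⟨∫ w : Metric.sphere (0 : Eu m) 1, ‖f w‖ * C ∂(volume : Measure (Eu m)).toSphere,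
    integral_nonneg fun w => mul_nonneg (norm_nonneg _) hC.1.le, fun r hr => ?_⟩
  rw [← integral_mul_const]
  refine norm_integral_le_of_norm_le ?_ (Eventually.of_forall fun w => ?_)
  · have : Continuous fun w : Metric.sphere (0 : Eu m) 1 => ‖f w‖ * C * r⁻¹ := by fun_prop
    exact this.integrable_of_hasCompactSupport (HasCompactSupport.of_compactSpace _)
  · have h := hC.2 (r • (w : Eu m))
    rw [norm_iteratedFDeriv_zero, norm_smul, norm_sphere_eq, pow_one, mul_one,
      norm_of_nonneg hr.le] at h
    rw [norm_mul, mul_assoc]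
    gcongr
    rw [← div_eq_mul_inv, le_div_iff₀ hr, mul_comm]; exact h

/-- Functions with the properties of spherical means that matter for finite parts. -/
structure IsMeanLike (N : ℕ) (ψ : ℝ → ℂ) : Prop where
  contDiff : ContDiff ℝ (N + 1) ψ
  decay : ∃ C, 0 ≤ C ∧ ∀ r : ℝ, 0 < r → ‖ψ r‖ ≤ C * r⁻¹
  parity : iteratedDeriv N ψ 0 = 0

theorem isMeanLike_sphInt {f : Eu m → ℂ} (hf : Continuous f) (φ : 𝓢(Eu m, ℂ)) {N : ℕ}
    (hfN : ∀ x, f (-x) = -(-1) ^ N * f x) (a : ℂ) : IsMeanLike N fun r => a * sphInt f φ r where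
  contDiff := contDiff_const.mul (by exact_mod_cast contDiff_sphInt (N + 1) hf φ)
  decay := by
    obtain ⟨C, hC, h⟩ := exists_norm_sphInt_le hf φ
    refine ⟨‖a‖ * C, by positivity, fun r hr => ?_⟩
    rw [norm_mul, mul_assoc]
    gcongr
    exact h r hr
  parity := by
    have h : (fun r => a * sphInt f φ (-r)) = (-(-1) ^ N : ℂ) • fun r => a * sphInt f φ r := by
      funext r
      rw [sphInt_neg hfN, Pi.smul_apply, smul_eq_mul]; ring
    have h1 := iteratedDeriv_comp_neg N (fun r => a * sphInt f φ r) 0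
    rw [h, iteratedDeriv_const_smul_field, neg_zero, smul_eq_mul] at h1
    set z := iteratedDeriv N (fun r => a * sphInt f φ r) 0
    have h2 : ((-1 : ℝ) ^ N) • z = (-1) ^ N * z := by rw [Complex.real_smul]; push_cast; rfl
    rw [h2] at h1
    have h3 : ((-1 : ℂ) ^ N) * (-1) ^ N = 1 := by rw [← mul_pow]; norm_num
    linear_combination (-(-1) ^ N / 2) * h1 - z * h3

theorem isMeanLike_sphereMean (φ : 𝓢(Eu m, ℂ)) {N : ℕ} (hN : Odd N) :
    IsMeanLike N (sphereMean m φ) := by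
  rw [funext (sphereMean_eq φ)]
  exact isMeanLike_sphInt continuous_const φ (by simp [hN.neg_one_pow]) _

theorem isMeanLike_sphereMeanVec (j : Fin m) (φ : 𝓢(Eu m, ℂ)) {N : ℕ} (hN : Even N) :
    IsMeanLike N (sphereMeanVec m j φ) :=
  isMeanLike_sphInt (f := fun x => (x j : ℂ)) (by fun_prop) φ (by simp [hN.neg_one_pow]) _

section

/-! ### Constant terms of asymptotic expansions -/

/-- As `u → 0+`, `f(u)` is a polynomial in `u⁻¹` without constant term, plus `L`, plus `o(1)`. -/
def HasConstTerm (f : ℝ → ℂ) (L : ℂ) : Prop :=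
  ∃ p : Polynomial ℂ, p.eval 0 = 0 ∧
    Tendsto (fun u : ℝ => f u - p.eval ((u : ℂ)⁻¹)) (𝓝[>] 0) (𝓝 L)

theorem HasConstTerm.add {f g : ℝ → ℂ} {L M : ℂ} (hf : HasConstTerm f L) (hg : HasConstTerm g M) :
    HasConstTerm (fun u => f u + g u) (L + M) := by
  obtain ⟨p, hp, h⟩ := hf
  obtain ⟨q, hq, h'⟩ := hg
  refine ⟨p + q, by simp [hp, hq], (h.add h').congr fun u => ?_⟩
  simp only [Polynomial.eval_add]; ring

theorem HasConstTerm.const_mul {f : ℝ → ℂ} {L : ℂ} (hf : HasConstTerm f L) (c : ℂ) :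
    HasConstTerm (fun u => c * f u) (c * L) := by
  obtain ⟨p, hp, h⟩ := hf
  refine ⟨Polynomial.C c * p, by simp [hp], (h.const_mul c).congr fun u => ?_⟩
  simp only [Polynomial.eval_mul, Polynomial.eval_C]; ring

theorem HasConstTerm.congr {f g : ℝ → ℂ} {L : ℂ} (hf : HasConstTerm f L)
    (h : ∀ u, 0 < u → f u = g u) : HasConstTerm g L := by
  obtain ⟨p, hp, h'⟩ := hf
  refine ⟨p, hp, h'.congr' ?_⟩
  filter_upwards [self_mem_nhdsWithin] with u hu
  rw [h u hu]

theorem HasConstTerm.sum {ι : Type*} (s : Finset ι) {f : ι → ℝ → ℂ} {L : ι → ℂ}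
    (h : ∀ i, HasConstTerm (f i) (L i)) : HasConstTerm (fun u => ∑ i ∈ s, f i u) (∑ i ∈ s, L i) := by
  classical
  induction s using Finset.induction_on with
  | empty => exact ⟨0, by simp, by simp⟩
  | insert a s ha ih => simp only [Finset.sum_insert ha]; exact (h a).add ih

theorem HasConstTerm.of_tendsto {f : ℝ → ℂ} {L : ℂ} (h : Tendsto f (𝓝[>] 0) (𝓝 L)) :
    HasConstTerm f L := ⟨0, by simp, by simpa using h⟩

theorem HasConstTerm.unique {f : ℝ → ℂ} {L M : ℂ} (hL : HasConstTerm f L) (hM : HasConstTerm f M) :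
    L = M := by
  obtain ⟨p, hp, h⟩ := hL
  obtain ⟨q, hq, h'⟩ := hM
  have h1 : Tendsto (fun u : ℝ => (q - p).eval ((u : ℂ)⁻¹)) (𝓝[>] 0) (𝓝 (L - M)) :=
    (h.sub h').congr fun u => by simp only [Polynomial.eval_sub]; ring
  have h0 : (q - p).eval 0 = 0 := by simp [hp, hq]
  rcases lt_or_ge 0 (q - p).degree with hd | hd
  · have hz : Tendsto (fun u : ℝ => ‖(u : ℂ)⁻¹‖) (𝓝[>] 0) atTop := by
      refine tendsto_inv_nhdsGT_zero.congr' ?_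
      filter_upwards [self_mem_nhdsWithin] with u hu
      rw [norm_inv, Complex.norm_real, norm_of_nonneg (le_of_lt hu)]
    exact absurd h1.norm (not_tendsto_nhds_of_tendsto_atTop
      (Polynomial.tendsto_norm_atTop _ hd hz) _)
  · rw [Polynomial.eq_C_of_degree_le_zero hd] at h0 h1
    simp only [Polynomial.eval_C] at h0 h1
    rw [h0] at h1
    exact sub_eq_zero.1 (tendsto_nhds_unique h1 tendsto_const_nhds)

/-! ### Finite parts as constant terms -/

/-- The Taylor polynomial of degree less than `N`. -/
def taylorPoly (N : ℕ) (ψ : ℝ → ℂ) (r : ℝ) : ℂ :=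
  ∑ i ∈ Finset.range N, iteratedDeriv i ψ 0 / (i.factorial : ℂ) * (r : ℂ) ^ i

variable {N : ℕ} {ψ : ℝ → ℂ}

theorem IsMeanLike.taylorPoly_succ (h : IsMeanLike N ψ) : taylorPoly (N + 1) ψ = taylorPoly N ψ := by
  funext r
  rw [taylorPoly, Finset.sum_range_succ, h.parity, taylorPoly]; simp

theorem IsMeanLike.taylor_bound (h : IsMeanLike N ψ) : ∃ M, 0 ≤ M ∧ ∀ r ∈ Ioc (0 : ℝ) 1,
    ‖ψ r - taylorPoly N ψ r‖ ≤ M * r ^ (N + 1) := by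
  obtain ⟨M, hM⟩ := exists_taylor_mean_remainder_bound (n := N) (zero_le_one' ℝ) h.contDiff.contDiffOn
  refine ⟨|M|, abs_nonneg M, fun r hr => ?_⟩
  have h1 := hM r ⟨hr.1.le, hr.2⟩
  have e : taylorWithinEval ψ N (Icc 0 1) 0 r = taylorPoly N ψ r := by
    rw [← h.taylorPoly_succ, taylor_within_apply, taylorPoly]
    refine Finset.sum_congr rfl fun i hi => ?_
    rw [iteratedDerivWithin_eq_iteratedDeriv (uniqueDiffOn_Icc one_pos)
      (h.contDiff.contDiffAt.of_le (by
        have := Finset.mem_range.1 hi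
        exact_mod_cast this.le)) (by simp), Complex.real_smul]
    push_cast
    rw [sub_zero]; field_simp
  rw [e, sub_zero] at h1
  refine h1.trans ?_
  have := hr.1
  gcongr
  exact le_abs_self M

theorem continuous_taylorPoly (N : ℕ) (ψ : ℝ → ℂ) : Continuous (taylorPoly N ψ) := by
  unfold taylorPoly; fun_prop

theorem integrableOn_inv_pow (n : ℕ) : IntegrableOn (fun r : ℝ => (r ^ (n + 2))⁻¹) (Ioi 1) := by
  have := integrableOn_Ioi_rpow_of_lt (a := -((n + 2 : ℕ) : ℝ)) (by
    push_cast; have : (0 : ℝ) ≤ n := by positivity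
    linarith) one_pos
  refine this.congr_fun (fun r hr => ?_) measurableSet_Ioi
  simp only [rpow_neg (zero_le_one.trans (le_of_lt hr)), rpow_natCast]

theorem IsMeanLike.integrableOn_decay (h : IsMeanLike N ψ) :
    IntegrableOn (fun r : ℝ => (((r ^ (N + 1))⁻¹ : ℝ) : ℂ) * ψ r) (Ioi 1) := by
  obtain ⟨C, hC, hb⟩ := h.decay
  have hcont := h.contDiff.continuous
  refine ((integrableOn_inv_pow N).const_mul C).mono' ?_ ?_
  · exact Measurable.aestronglyMeasurable (by have := hcont.measurable; fun_prop)
  · filter_upwards [ae_restrict_mem measurableSet_Ioi] with r hr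
    have hr0 : 0 < r := one_pos.trans hr
    rw [norm_mul, Complex.norm_real, norm_of_nonneg (by positivity)]
    calc _ ≤ (r ^ (N + 1))⁻¹ * (C * r⁻¹) := by gcongr; exact hb r hr0
      _ = _ := by rw [pow_succ r (N + 1)]; field_simp

theorem inv_pow_mul_pow {i : ℕ} (hi : i < N) {r : ℝ} (hr : 0 < r) :
    (r ^ (N + 1))⁻¹ * r ^ i = (r ^ (N - i - 1 + 2))⁻¹ := by
  have : N + 1 = i + (N - i - 1 + 2) := by omega
  rw [this, pow_add]; field_simp

theorem integrableOn_inv_pow_mul {i : ℕ} (hi : i < N) :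
    IntegrableOn (fun r : ℝ => (((r ^ (N + 1))⁻¹ * r ^ i : ℝ) : ℂ)) (Ioi 1) := by
  have : IntegrableOn (fun r : ℝ => (((r ^ (N - i - 1 + 2))⁻¹ : ℝ) : ℂ)) (Ioi 1) :=
    (integrableOn_inv_pow (N - i - 1)).ofReal
  refine this.congr_fun (fun r hr => ?_) measurableSet_Ioi
  simp only [inv_pow_mul_pow hi (one_pos.trans hr)]

theorem integral_inv_pow_mul {i : ℕ} (hi : i < N) :
    ∫ r in Ioi (1 : ℝ), (((r ^ (N + 1))⁻¹ * r ^ i : ℝ) : ℂ) = 1 / ((N : ℂ) - i) := by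
  have e : ∀ r ∈ Ioi (1 : ℝ), (r ^ (N + 1))⁻¹ * r ^ i = r ^ ((i : ℝ) - N - 1) := fun r hr => by
    have hr0 : 0 < r := one_pos.trans hr
    rw [← rpow_natCast, ← rpow_natCast, ← rpow_neg hr0.le, ← rpow_add hr0]
    congr 1; push_cast; ring
  have hiN : (i : ℝ) < N := by exact_mod_cast hi
  rw [integral_complex_ofReal, setIntegral_congr_fun measurableSet_Ioi e,
    integral_Ioi_rpow_of_lt (by linarith) one_pos, Real.one_rpow]
  have h0 : (N : ℝ) - i ≠ 0 := by linarith
  have h1 : (i : ℝ) - N - 1 + 1 = -((N : ℝ) - i) := by ring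
  rw [h1, neg_div_neg_eq]; push_cast; rfl

theorem inv_pow_mul_taylorPoly (r : ℝ) : (((r ^ (N + 1))⁻¹ : ℝ) : ℂ) * taylorPoly N ψ r =
    ∑ i ∈ Finset.range N, iteratedDeriv i ψ 0 / (i.factorial : ℂ) *
      (((r ^ (N + 1))⁻¹ * r ^ i : ℝ) : ℂ) := by
  rw [taylorPoly, Finset.mul_sum]
  refine Finset.sum_congr rfl fun i _ => ?_
  push_cast; ring

theorem integrableOn_taylorPoly : IntegrableOn (fun r : ℝ => (((r ^ (N + 1))⁻¹ : ℝ) : ℂ) *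
    taylorPoly N ψ r) (Ioi 1) := by
  simp_rw [inv_pow_mul_taylorPoly]
  exact integrable_finsetSum _ fun i hi =>
    (integrableOn_inv_pow_mul (Finset.mem_range.1 hi)).const_mul _

theorem IsMeanLike.integrableOn_sub (h : IsMeanLike N ψ) :
    IntegrableOn (fun r : ℝ => (((r ^ (N + 1))⁻¹ : ℝ) : ℂ) * (ψ r - taylorPoly N ψ r)) (Ioi 0) := by
  have hcont := h.contDiff.continuous
  obtain ⟨M, hM, hb⟩ := h.taylor_bound
  rw [← Ioc_union_Ioi_eq_Ioi zero_le_one]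
  refine IntegrableOn.union ?_ ?_
  · refine Measure.integrableOn_of_bounded (M := M) (by simp) ?_ ?_
    · have := hcont.measurable
      have := (continuous_taylorPoly N ψ).measurable
      exact Measurable.aestronglyMeasurable (by fun_prop)
    · filter_upwards [ae_restrict_mem measurableSet_Ioc] with r hr
      have hr0 := hr.1
      rw [norm_mul, Complex.norm_real, norm_of_nonneg (by positivity), inv_mul_le_iff₀ (by positivity),
        mul_comm]
      exact hb r hr
  · simp_rw [mul_sub]
    exact h.integrableOn_decay.sub integrableOn_taylorPoly

theorem IsMeanLike.finitePart_eq (h : IsMeanLike N ψ) : finitePart (-(N : ℂ) - 1) ψ =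
    ∫ r in Ioi (0 : ℝ), (((r ^ (N + 1))⁻¹ : ℝ) : ℂ) * (ψ r - taylorPoly N ψ r) := by
  have hc : ⌈-(-(N : ℂ) - 1).re⌉₊ = N + 1 := by
    have : -(-(N : ℂ) - 1).re = ((N + 1 : ℕ) : ℝ) := by simp [add_comm]
    rw [this, Nat.ceil_natCast]
  have hp : ∀ r : ℝ, 0 < r → (r : ℂ) ^ (-(N : ℂ) - 1) = (((r ^ (N + 1))⁻¹ : ℝ) : ℂ) := fun r hr => by
    rw [show -(N : ℂ) - 1 = -((N + 1 : ℕ) : ℂ) by push_cast; ring, Complex.cpow_neg,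
      Complex.cpow_natCast]
    push_cast; rfl
  have hi := h.integrableOn_sub
  rw [finitePart, hc]
  simp only
  rw [← Ioc_union_Ioi_eq_Ioi zero_le_one, setIntegral_union (Set.Ioc_disjoint_Ioi le_rfl)
    measurableSet_Ioi (hi.mono_set Ioc_subset_Ioi_self) (hi.mono_set (Ioi_subset_Ioi zero_le_one)),
    add_assoc]
  congr 1
  · refine setIntegral_congr_fun measurableSet_Ioc fun r hr => ?_
    rw [hp r hr.1, ← h.taylorPoly_succ, taylorPoly]
  · rw [setIntegral_congr_fun measurableSet_Ioi fun r hr => by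
      simp only [hp r (one_pos.trans hr)]; rfl]
    simp_rw [mul_sub]
    rw [integral_sub h.integrableOn_decay integrableOn_taylorPoly]
    simp_rw [inv_pow_mul_taylorPoly]
    rw [integral_finsetSum _ fun i hi => (integrableOn_inv_pow_mul (Finset.mem_range.1 hi)).const_mul _,
      Finset.sum_range_succ, h.parity, zero_div, zero_div, add_zero, sub_eq_add_neg (∫ r in Ioi (1 : ℝ), _),
      ← Finset.sum_neg_distrib]
    congr 1
    refine Finset.sum_congr rfl fun i hi => ?_
    rw [integral_const_mul, integral_inv_pow_mul (Finset.mem_range.1 hi), ← mul_neg, ← div_neg,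
      mul_one_div]
    congr 1; ring

theorem IsMeanLike.hasConstTerm_of_profile (h : IsMeanLike N ψ) {w : ℝ → ℝ} {b : ℝ} (hw : Measurable w)
    (hw0 : ∀ s, 0 < s → s ≤ 1 → |w s| ≤ 1) (hw1 : ∀ s, 0 < s → |w s| ≤ (s ^ (N + 1))⁻¹)
    (hlim : Tendsto (fun s => s ^ (N + 1) * w s) atTop (𝓝 b)) :
    HasConstTerm (fun u => ∫ r in Ioi (0 : ℝ), (((u ^ (N + 1))⁻¹ * w (r / u) : ℝ) : ℂ) * ψ r)
      (b * finitePart (-(N : ℂ) - 1) ψ) := by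
  have hcont := h.contDiff.continuous
  have hwm : ∀ (i : ℕ) {μ : Measure ℝ}, AEStronglyMeasurable (fun s : ℝ => ((w s * s ^ i : ℝ) : ℂ)) μ :=
    fun i μ => Measurable.aestronglyMeasurable (by fun_prop)
  have hint : ∀ i < N, IntegrableOn (fun s => ((w s * s ^ i : ℝ) : ℂ)) (Ioi 0) := fun i hi => by
    rw [← Ioc_union_Ioi_eq_Ioi zero_le_one]
    refine IntegrableOn.union ?_ ?_
    · refine Measure.integrableOn_of_bounded (M := 1) (by simp) (hwm i) ?_
      filter_upwards [ae_restrict_mem measurableSet_Ioc] with s hs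
      have hs0 := hs.1
      rw [Complex.norm_real, norm_mul, Real.norm_eq_abs, norm_of_nonneg (by positivity)]
      exact mul_le_one₀ (hw0 s hs.1 hs.2) (by positivity) (pow_le_one₀ hs.1.le hs.2)
    · refine Integrable.mono (integrableOn_inv_pow_mul hi) (hwm i) ?_
      filter_upwards [ae_restrict_mem measurableSet_Ioi] with s hs
      have hs0 : 0 < s := one_pos.trans hs
      rw [Complex.norm_real, Complex.norm_real, norm_mul, norm_mul, Real.norm_eq_abs,
        norm_of_nonneg (by positivity : 0 ≤ (s ^ (N + 1))⁻¹)]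
      gcongr
      exact hw1 s hs0
  have hbd : ∀ u, 0 < u → ∀ r, 0 < r → |(u ^ (N + 1))⁻¹ * w (r / u)| ≤ (r ^ (N + 1))⁻¹ := by
    intro u hu r hr
    rw [abs_mul, abs_of_nonneg (by positivity)]
    calc _ ≤ (u ^ (N + 1))⁻¹ * ((r / u) ^ (N + 1))⁻¹ := by gcongr; exact hw1 _ (by positivity)
      _ = _ := by rw [div_pow]; field_simp
  have hmeas : ∀ u : ℝ, AEStronglyMeasurable (fun r : ℝ => (((u ^ (N + 1))⁻¹ * w (r / u) : ℝ) : ℂ) *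
      (ψ r - taylorPoly N ψ r)) (volume.restrict (Ioi 0)) := fun u => by
    have := hcont.measurable
    have := (continuous_taylorPoly N ψ).measurable
    exact Measurable.aestronglyMeasurable (by fun_prop)
  have hdom : ∀ u : ℝ, 0 < u → ∀ᵐ r ∂(volume.restrict (Ioi (0 : ℝ))),
      ‖(((u ^ (N + 1))⁻¹ * w (r / u) : ℝ) : ℂ) * (ψ r - taylorPoly N ψ r)‖ ≤
        ‖(((r ^ (N + 1))⁻¹ : ℝ) : ℂ) * (ψ r - taylorPoly N ψ r)‖ := fun u hu => by
    filter_upwards [ae_restrict_mem measurableSet_Ioi] with r hr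
    have hr0 : 0 < r := hr
    rw [norm_mul, norm_mul, Complex.norm_real, Complex.norm_real, Real.norm_eq_abs,
      norm_of_nonneg (by positivity : 0 ≤ (r ^ (N + 1))⁻¹)]
    gcongr
    exact hbd u hu r hr
  have hscale : ∀ u : ℝ, 0 < u → ∀ i < N,
      IntegrableOn (fun r => (((u ^ (N + 1))⁻¹ * w (r / u) * r ^ i : ℝ) : ℂ)) (Ioi 0) ∧
      ∫ r in Ioi (0 : ℝ), (((u ^ (N + 1))⁻¹ * w (r / u) * r ^ i : ℝ) : ℂ) =
        ((u : ℂ)⁻¹) ^ (N - i) * ∫ s in Ioi (0 : ℝ), ((w s * s ^ i : ℝ) : ℂ) := fun u hu i hi => by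
    have hu0 : (u : ℂ) ≠ 0 := by exact_mod_cast hu.ne'
    have e : ∀ r : ℝ, (((u ^ (N + 1))⁻¹ * w (r / u) * r ^ i : ℝ) : ℂ) =
        ((u : ℂ)⁻¹) ^ (N - i + 1) * ((w (u⁻¹ * r) * (u⁻¹ * r) ^ i : ℝ) : ℂ) := fun r => by
      have hN : N + 1 = (N - i + 1) + i := by omega
      rw [hN, pow_add, mul_pow, div_eq_inv_mul]
      push_cast
      rw [inv_pow, inv_pow]; field_simp
    simp_rw [e]
    refine ⟨Integrable.const_mul ((integrableOn_Ioi_comp_mul_left_iff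
      (fun s => ((w s * s ^ i : ℝ) : ℂ)) 0 (inv_pos.2 hu)).2 (by simpa using hint i hi)) _, ?_⟩
    rw [integral_const_mul, integral_comp_mul_left_Ioi (fun s => ((w s * s ^ i : ℝ) : ℂ)) 0
      (inv_pos.2 hu), mul_zero, inv_inv, Complex.real_smul, pow_succ]
    field_simp
  refine ⟨∑ i ∈ Finset.range N, Polynomial.C (iteratedDeriv i ψ 0 / (i.factorial : ℂ) *
    ∫ s in Ioi (0 : ℝ), ((w s * s ^ i : ℝ) : ℂ)) * Polynomial.X ^ (N - i), ?_, ?_⟩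
  · rw [Polynomial.eval_finsetSum]
    refine Finset.sum_eq_zero fun i hi => ?_
    have := Finset.mem_range.1 hi
    simp [show N - i ≠ 0 by omega]
  · have key : Tendsto (fun u : ℝ => ∫ r in Ioi (0 : ℝ),
        (((u ^ (N + 1))⁻¹ * w (r / u) : ℝ) : ℂ) * (ψ r - taylorPoly N ψ r)) (𝓝[>] 0)
        (𝓝 (∫ r in Ioi (0 : ℝ), (b : ℂ) * ((((r ^ (N + 1))⁻¹ : ℝ) : ℂ) *
          (ψ r - taylorPoly N ψ r)))) := by
      refine tendsto_integral_filter_of_dominated_convergence _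
        (Eventually.of_forall hmeas) ?_ h.integrableOn_sub.norm ?_
      · filter_upwards [self_mem_nhdsWithin] with u hu using hdom u hu
      · filter_upwards [ae_restrict_mem measurableSet_Ioi] with r hr
        have hr0 : 0 < r := hr
        rw [← mul_assoc]
        refine Tendsto.mul_const _ ?_
        rw [← Complex.ofReal_mul]
        refine (Complex.continuous_ofReal.tendsto _).comp ?_
        have h1 : Tendsto (fun u : ℝ => r / u) (𝓝[>] 0) atTop := by
          simpa [div_eq_mul_inv] using tendsto_inv_nhdsGT_zero.const_mul_atTop hr0
        refine ((hlim.comp h1).mul_const _).congr' ?_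
        filter_upwards [self_mem_nhdsWithin] with u hu
        have hu0 : 0 < u := hu
        simp only [Function.comp, div_pow]; field_simp
    rw [integral_const_mul, ← h.finitePart_eq] at key
    refine key.congr' ?_
    filter_upwards [self_mem_nhdsWithin] with u hu
    have e1 : ∀ r, (((u ^ (N + 1))⁻¹ * w (r / u) : ℝ) : ℂ) * taylorPoly N ψ r =
        ∑ i ∈ Finset.range N, iteratedDeriv i ψ 0 / (i.factorial : ℂ) *
          (((u ^ (N + 1))⁻¹ * w (r / u) * r ^ i : ℝ) : ℂ) := fun r => by
      rw [taylorPoly, Finset.mul_sum]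
      refine Finset.sum_congr rfl fun i _ => ?_
      push_cast; ring
    have hi1 : ∀ i ∈ Finset.range N, IntegrableOn (fun r => iteratedDeriv i ψ 0 / (i.factorial : ℂ) *
        (((u ^ (N + 1))⁻¹ * w (r / u) * r ^ i : ℝ) : ℂ)) (Ioi 0) := fun i hi =>
      (hscale u hu i (Finset.mem_range.1 hi)).1.const_mul _
    have hi2 : IntegrableOn (fun r : ℝ => (((u ^ (N + 1))⁻¹ * w (r / u) : ℝ) : ℂ) *
        (ψ r - taylorPoly N ψ r)) (Ioi 0) :=
      h.integrableOn_sub.norm.mono' (hmeas u) (hdom u hu)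
    have e2 : ∀ r, (((u ^ (N + 1))⁻¹ * w (r / u) : ℝ) : ℂ) * ψ r =
        (((u ^ (N + 1))⁻¹ * w (r / u) : ℝ) : ℂ) * (ψ r - taylorPoly N ψ r) +
        ∑ i ∈ Finset.range N, iteratedDeriv i ψ 0 / (i.factorial : ℂ) *
          (((u ^ (N + 1))⁻¹ * w (r / u) * r ^ i : ℝ) : ℂ) := fun r => by rw [← e1]; ring
    simp_rw [e2]
    rw [integral_add hi2 (integrable_finsetSum _ hi1), integral_finsetSum _ hi1,
      Polynomial.eval_finsetSum, eq_sub_iff_add_eq]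
    congr 1
    refine Finset.sum_congr rfl fun i hi => ?_
    rw [integral_const_mul, (hscale u hu i (Finset.mem_range.1 hi)).2]
    simp only [Polynomial.eval_mul, Polynomial.eval_C, Polynomial.eval_pow, Polynomial.eval_X]
    ring

/-- The kernel `r^a (r² + u²)^{-c/2-k} u^{2k}` with `c = a + N + 1`. -/
theorem IsMeanLike.hasConstTerm (h : IsMeanLike N ψ) (a k : ℕ) :
    HasConstTerm (fun u => ∫ r in Ioi (0 : ℝ), ((u ^ (2 * k) *
      (r ^ a * (r ^ 2 + u ^ 2) ^ (-((a + N + 1 : ℕ) : ℝ) / 2 - k)) : ℝ) : ℂ) * ψ r)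
      ((if k = 0 then 1 else 0) * finitePart (-(N : ℂ) - 1) ψ) := by
  set c : ℝ := ((a + N + 1 : ℕ) : ℝ) with hc
  have hc0 : 0 ≤ c := by positivity
  have hk0 : (0 : ℝ) ≤ k := by positivity
  let w : ℝ → ℝ := fun s => s ^ a * (s ^ 2 + 1) ^ (-c / 2 - k)
  have hsq : ∀ s : ℝ, 0 < s → (s ^ 2) ^ (-c / 2) = (s ^ (a + N + 1))⁻¹ := fun s hs => by
    rw [← rpow_natCast s 2, ← rpow_mul hs.le, hc, ← rpow_natCast s (a + N + 1),
      ← rpow_neg hs.le]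
    congr 1; push_cast; ring
  have hpa : ∀ s : ℝ, 0 < s → s ^ a * (s ^ (a + N + 1))⁻¹ = (s ^ (N + 1))⁻¹ := fun s hs => by
    rw [add_assoc, pow_add]; field_simp
  have key := h.hasConstTerm_of_profile (w := w) (b := if k = 0 then 1 else 0)
    (by simp only [w]; fun_prop)
    (fun s hs hs1 => by
      rw [abs_of_nonneg (by positivity)]
      exact mul_le_one₀ (pow_le_one₀ hs.le hs1) (by positivity)
        (rpow_le_one_of_one_le_of_nonpos (by nlinarith) (by linarith)))
    (fun s hs => by
      rw [abs_of_nonneg (by positivity), ← hpa s hs, ← hsq s hs]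
      simp only [w]
      gcongr
      calc (s ^ 2 + 1) ^ (-c / 2 - k) ≤ (s ^ 2 + 1) ^ (-c / 2) :=
            rpow_le_rpow_of_exponent_le (by nlinarith) (by linarith)
        _ ≤ _ := rpow_le_rpow_of_nonpos (by positivity) (by linarith) (by linarith))
    (by
      have e : ∀ s : ℝ, 0 < s → s ^ (N + 1) * w s =
          (1 + (s ^ 2)⁻¹) ^ (-c / 2) * (s ^ 2 + 1) ^ (-(k : ℝ)) := fun s hs => by
        have h1 : (s ^ 2 + 1) = s ^ 2 * (1 + (s ^ 2)⁻¹) := by field_simp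
        have h2 := hpa s hs
        have h3 : (s ^ (N + 1)) * (s ^ (N + 1))⁻¹ = 1 := mul_inv_cancel₀ (by positivity)
        simp only [w]
        rw [sub_eq_add_neg, rpow_add (by positivity)]
        conv_lhs => rw [h1, Real.mul_rpow (by positivity) (by positivity), hsq s hs, ← h1]
        linear_combination ((1 + (s ^ 2)⁻¹) ^ (-c / 2) * (s ^ 2 + 1) ^ (-(k : ℝ))) *
          (s ^ (N + 1) * h2 + h3)
      have hs2 : Tendsto (fun s : ℝ => s ^ 2) atTop atTop := tendsto_pow_atTop two_ne_zero
      have t1 : Tendsto (fun s : ℝ => (1 + (s ^ 2)⁻¹) ^ (-c / 2)) atTop (𝓝 1) := by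
        have := (hs2.inv_tendsto_atTop.const_add 1).rpow_const (p := -c / 2) (by simp)
        simpa using this
      have t2 : Tendsto (fun s : ℝ => (s ^ 2 + 1) ^ (-(k : ℝ))) atTop
          (𝓝 (if k = 0 then 1 else 0)) := by
        split_ifs with h0
        · simp [h0]
        · exact (tendsto_rpow_neg_atTop (by positivity)).comp
            (tendsto_atTop_add_const_right _ 1 hs2)
      have := t1.mul t2
      rw [one_mul] at this
      refine this.congr' ?_
      filter_upwards [eventually_gt_atTop 0] with s hs
      rw [e s hs])
  have e : (((if k = 0 then 1 else 0 : ℝ)) : ℂ) = if k = 0 then 1 else 0 := by split_ifs <;> simp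
  rw [e] at key
  refine key.congr fun u hu => ?_
  refine setIntegral_congr_fun measurableSet_Ioi fun r hr => ?_
  have hr0 : 0 < r := hr
  congr 2
  have h1 : r ^ 2 + u ^ 2 = u ^ 2 * ((r / u) ^ 2 + 1) := by field_simp
  have h2 : (u ^ 2) ^ (-c / 2 - k) = (u ^ (a + N + 1))⁻¹ * (u ^ (2 * k))⁻¹ := by
    rw [sub_eq_add_neg, rpow_add (by positivity), hsq u hu, rpow_neg (by positivity),
      rpow_natCast, ← pow_mul]
  rw [h1, Real.mul_rpow (by positivity) (by positivity), h2, ← hpa u hu]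
  simp only [w, div_pow]
  field_simp

end

/-! ### Derivatives of the distributions with a symbol -/

theorem fourier_lineDeriv_apply (φ : 𝓢(Eu m, ℂ)) (l : Fin m) (ξ : Eu m) :
    𝓕 (∂_{unitVec l} φ) ξ = ((2 * π * ξ l : ℝ) : ℂ) * Complex.I * 𝓕 φ ξ := by
  have hg : (inner ℝ · (unitVec l) : Eu m → ℝ).HasTemperateGrowth := by fun_prop
  rw [SchwartzMap.fourier_lineDerivOp_eq, smul_apply,
    SchwartzMap.smulLeftCLM_apply_apply hg, EuclideanSpace.inner_single_right, Complex.real_smul,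
    smul_eq_mul]
  simp only [one_mul, conj_trivial]
  push_cast; ring

theorem IsSymbol.toDist_lineDeriv {q : Eu m → ℂ} (hq : IsSymbol q) (φ : 𝓢(Eu m, ℂ)) (l : Fin m) :
    hq.toDist (∂_{unitVec l} φ) = (hq.deriv_coord l).toDist φ := by
  rw [IsSymbol.toDist_apply, IsSymbol.toDist_apply]
  refine integral_congr_of_eq fun ξ => ?_
  simp only [fourier_lineDeriv_apply]; ring

theorem hilSym_succ_toDist (N : ℕ) (j : Fin m) (φ : 𝓢(Eu m, ℂ)) :
    (isSymbol_hilSym j (N + 1)).toDist φ =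
      -(isSymbol_powSym N).toDist (∂_{unitVec j} φ) := by
  rw [IsSymbol.toDist_lineDeriv, IsSymbol.toDist_neg (isSymbol_hilSym j (N + 1)) _
    (fun ξ => powSym_deriv j N ξ), neg_neg]

theorem powSym_succ_toDist (N : ℕ) (φ : 𝓢(Eu m, ℂ)) :
    (isSymbol_powSym (N + 1)).toDist φ =
      ∑ l : Fin m, (isSymbol_hilSym l N).toDist (∂_{unitVec l} φ) := by
  simp_rw [IsSymbol.toDist_lineDeriv]
  exact IsSymbol.toDist_sum _ (fun l => (isSymbol_hilSym l N).deriv_coord l) _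
    (fun ξ => (sum_hilSym_deriv N ξ).symm) φ

theorem laplacian_eq (φ : 𝓢(Eu m, ℂ)) : Δ φ = ∑ l : Fin m,
    ∂_{unitVec l} (∂_{unitVec l} φ) := by
  simpa using SchwartzMap.laplacian_eq_sum (EuclideanSpace.basisFun (Fin m) ℝ) φ

theorem powSym_add_two_toDist (N : ℕ) (φ : 𝓢(Eu m, ℂ)) :
    (isSymbol_powSym (N + 2)).toDist φ = (isSymbol_powSym N).toDist (-Δ φ) := by
  rw [powSym_succ_toDist, laplacian_eq, map_neg, map_sum, ← Finset.sum_neg_distrib]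
  exact Finset.sum_congr rfl fun l _ => hilSym_succ_toDist N l _

theorem hilSym_add_two_toDist (N : ℕ) (j : Fin m) (φ : 𝓢(Eu m, ℂ)) :
    (isSymbol_hilSym j (N + 2)).toDist φ = (isSymbol_hilSym j N).toDist (-Δ φ) := by
  have hn : IsSymbol fun ξ : Eu m => -hilSym j (N + 2) ξ := by
    convert (IsSymbol.const (m := m) (-1)).mul (isSymbol_hilSym j (N + 2)) using 2
    simp
  rw [laplacian_eq, map_neg, map_sum]
  simp_rw [IsSymbol.toDist_lineDeriv]
  rw [← IsSymbol.toDist_sum Finset.univ (fun l => ((isSymbol_hilSym j N).deriv_coord l).deriv_coord l)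
    hn (fun ξ => (sum_hilSym_deriv_deriv j N ξ).symm),
    IsSymbol.toDist_neg (isSymbol_hilSym j (N + 2)) hn (fun ξ => rfl), neg_neg]

theorem powSym_two_mul_toDist (l : ℕ) : ∀ φ : 𝓢(Eu m, ℂ),
    (isSymbol_powSym (2 * l)).toDist φ = negLaplaceIter l φ 0 := by
  induction l with
  | zero =>
    intro φ
    rw [IsSymbol.toDist_congr _ (IsSymbol.const 1) fun ξ => by simp [powSym], toDist_const_one]
    rfl
  | succ l ih =>
    intro φ
    rw [mul_add, mul_one, powSym_add_two_toDist, ih]; rfl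

theorem hilSym_two_mul_add_one_toDist (l : ℕ) (j : Fin m) : ∀ φ : 𝓢(Eu m, ℂ),
    (isSymbol_hilSym j (2 * l + 1)).toDist φ =
      -lineDeriv ℝ (negLaplaceIter l φ) 0 (unitVec j) := by
  induction l with
  | zero =>
    intro φ
    rw [mul_zero, hilSym_succ_toDist, ← SchwartzMap.lineDerivOp_apply]
    exact congrArg Neg.neg (powSym_two_mul_toDist 0 _)
  | succ l ih =>
    intro φ
    rw [show 2 * (l + 1) + 1 = 2 * l + 1 + 2 by ring, hilSym_add_two_toDist, ih]; rfl

/-! ### Regularised kernels of positive order -/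

/-- The pairing with `(|x|² + u²)^c`. -/
def powInt (c : ℝ) (φ : 𝓢(Eu m, ℂ)) (u : ℝ) : ℂ := ∫ x, (((‖x‖ ^ 2 + u ^ 2) ^ c : ℝ) : ℂ) * φ x

/-- The pairing with `x_j (|x|² + u²)^c`. -/
def coordPowInt (j : Fin m) (c : ℝ) (φ : 𝓢(Eu m, ℂ)) (u : ℝ) : ℂ :=
  ∫ x, ((x j * (‖x‖ ^ 2 + u ^ 2) ^ c : ℝ) : ℂ) * φ x

theorem logPow_zero (β c s : ℝ) : logPow 0 β c s = β * s ^ c := by rw [logPow]; ring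

theorem hasOrder_pow (c : ℝ) : HasOrder (fun u (x : Eu m) => (‖x‖ ^ 2 + u ^ 2) ^ c) (2 * c) := by
  simpa only [logPow_zero, one_mul] using hasOrder_logPow (m := m) 0 1 c

theorem HasOrder.integrable_mul {f : ℝ → Eu m → ℝ} {a : ℝ} (h : HasOrder f a) (φ : 𝓢(Eu m, ℂ))
    {u : ℝ} (hu : 0 < u) : Integrable fun x => (f u x : ℂ) * φ x := by
  obtain ⟨k, hk⟩ := exists_nat_gt (a + m + 1 / 4)
  obtain ⟨C, hC, hb⟩ := schwartz_norm_le φ k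
  exact h.integrable_fixed φ.continuous hb hk hu

theorem HasOrder.integral_mul_lineDeriv (hm : 1 ≤ m) {f f' : ℝ → Eu m → ℝ} {a : ℝ} {l : Fin m}
    (hf : HasOrder f a) (hf' : HasOrder f' (a - 1))
    (hd : ∀ ε, 0 < ε → ∀ x, HasLineDerivAt ℝ (f ε) (f' ε x) x (unitVec l))
    (φ : 𝓢(Eu m, ℂ)) {u : ℝ} (hu : 0 < u) :
    ∫ x, (f u x : ℂ) * (∂_{unitVec l} φ) x = -∫ x, (f' u x : ℂ) * φ x := by
  obtain ⟨k, hk⟩ := exists_nat_gt (a + m)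
  obtain ⟨C, hC, hb⟩ := schwartz_norm_le φ k
  obtain ⟨C', hC', hb'⟩ := schwartz_norm_le (∂_{unitVec l} φ) (k + 1)
  refine hf.integral_eq_neg hm hf' hd φ.continuous (SchwartzMap.continuous _) (fun x => ?_) hb hb'
    (by linarith) hu
  rw [SchwartzMap.lineDerivOp_apply]
  exact φ.differentiableAt.lineDifferentiableAt.hasLineDerivAt

theorem powInt_lineDeriv (hm : 1 ≤ m) (c : ℝ) (φ : 𝓢(Eu m, ℂ)) (j : Fin m) {u : ℝ} (hu : 0 < u) :
    powInt c (∂_{unitVec j} φ) u = -(2 * c) * coordPowInt j (c - 1) φ u := by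
  have h := (hasOrder_pow (m := m) c).integral_mul_lineDeriv hm (l := j)
    (f' := fun u x => 2 * c * (x j * (‖x‖ ^ 2 + u ^ 2) ^ (c - 1)))
    (by convert ((hasOrder_pow (m := m) (c - 1)).coord j).const_mul (2 * c) using 1; ring)
    (fun ε hε x => by
      have := hasLineDerivAt_logPow 0 1 c hε x j
      simp only [logPow_zero, mul_zero, one_mul, mul_one, add_zero] at this
      convert this using 1; ring) φ hu
  rw [powInt, h, coordPowInt, ← integral_const_mul, ← integral_neg]
  refine integral_congr_of_eq fun x => ?_
  push_cast; ring

theorem sum_coordPowInt_lineDeriv (hm : 1 ≤ m) (c : ℝ) (φ : 𝓢(Eu m, ℂ)) {u : ℝ} (hu : 0 < u) :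
    ∑ l : Fin m, coordPowInt l c (∂_{unitVec l} φ) u =
      -(m + 2 * c) * powInt c φ u + 2 * c * (u ^ 2 * powInt (c - 1) φ u) := by
  have h : ∀ l : Fin m, coordPowInt l c (∂_{unitVec l} φ) u =
      ∫ x, -((coordDeriv 0 1 c l l x (‖x‖ ^ 2 + u ^ 2) : ℝ) : ℂ) * φ x := fun l => by
    rw [coordPowInt, ((hasOrder_pow (m := m) c).coord l).integral_mul_lineDeriv hm
      (f' := fun u x => coordDeriv 0 1 c l l x (‖x‖ ^ 2 + u ^ 2))
      (by convert hasOrder_coordDeriv (m := m) 0 1 c l l using 1; ring)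
      (fun ε hε x => by
        simpa only [logPow_zero, one_mul] using hasLineDerivAt_coord_logPow 0 1 c hε x l l) φ hu,
      ← integral_neg]
    refine integral_congr_of_eq fun x => ?_
    ring
  simp_rw [h]
  rw [← integral_finsetSum, powInt, powInt, ← integral_const_mul, ← integral_const_mul,
    ← integral_const_mul, ← integral_add]
  · refine integral_congr_of_eq fun x => ?_
    have hs : 0 < ‖x‖ ^ 2 + u ^ 2 := by positivity
    have e1 : (‖x‖ ^ 2 + u ^ 2) ^ c = (‖x‖ ^ 2 + u ^ 2) ^ (c - 1) * (‖x‖ ^ 2 + u ^ 2) := by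
      rw [← rpow_add_one hs.ne']; congr 1; ring
    have e2 : ∑ l, coordDeriv 0 1 c l l x (‖x‖ ^ 2 + u ^ 2) =
        (m + 2 * c) * (‖x‖ ^ 2 + u ^ 2) ^ c - 2 * c * u ^ 2 * (‖x‖ ^ 2 + u ^ 2) ^ (c - 1) := by
      have e3 : ∑ l, x l * (x l * ((2 * c) * (‖x‖ ^ 2 + u ^ 2) ^ (c - 1))) =
          ‖x‖ ^ 2 * ((2 * c) * (‖x‖ ^ 2 + u ^ 2) ^ (c - 1)) := by
        simp_rw [← mul_assoc, ← Finset.sum_mul]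
        congr 2
        rw [EuclideanSpace.norm_sq_eq]
        simp_rw [Real.norm_eq_abs, sq_abs, sq]
      simp only [coordDeriv, if_true, logPow_zero, mul_zero, mul_one, one_mul, add_zero,
        Finset.sum_add_distrib, e3, Finset.sum_const, Finset.card_univ, Fintype.card_fin,
        nsmul_eq_mul]
      rw [e1]; ring
    rw [← Finset.sum_mul, Finset.sum_neg_distrib, ← Complex.ofReal_sum, e2]
    push_cast; ring
  · exact ((hasOrder_pow c).integrable_mul φ hu).const_mul _
  · exact (((hasOrder_pow (c - 1)).integrable_mul φ hu).const_mul _).const_mul _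
  · intro l _
    exact ((hasOrder_coordDeriv 0 1 c l l).integrable_mul φ hu).neg.congr
      (Eventually.of_forall fun x => by simp)

theorem sig_ne_zero (hm : 1 ≤ m) : (sig m : ℂ) ≠ 0 := by
  have : 0 < Gamma ((m : ℝ) / 2) := Gamma_pos_of_pos (by
    have : (1 : ℝ) ≤ m := by exact_mod_cast hm
    linarith)
  have := pi_pos
  have : sig m ≠ 0 := by rw [sig]; positivity
  exact_mod_cast this

theorem sig_mul_T (hm : 1 ≤ m) {k : ℝ → ℝ} {φ : 𝓢(Eu m, ℂ)}
    (hi : Integrable fun x : Eu m => (k ‖x‖ : ℂ) * φ x) :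
    IntegrableOn (fun r : ℝ => ((r ^ (m - 1) * k r : ℝ) : ℂ) * sphereMean m φ r) (Ioi 0) ∧
    ∫ x : Eu m, (k ‖x‖ : ℂ) * φ x =
      sig m * ∫ r in Ioi (0 : ℝ), ((r ^ (m - 1) * k r : ℝ) : ℂ) * sphereMean m φ r := by
  have hs := sig_ne_zero hm
  have e : ∀ r ∈ Ioi (0 : ℝ), ((r ^ (m - 1) : ℝ) : ℂ) * ∫ w : Metric.sphere (0 : Eu m) 1,
      (k ‖r • (w : Eu m)‖ : ℂ) * φ (r • (w : Eu m)) ∂(volume : Measure (Eu m)).toSphere =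
      sig m * (((r ^ (m - 1) * k r : ℝ) : ℂ) * sphereMean m φ r) := fun r hr => by
    have hr0 : 0 < r := hr
    simp_rw [norm_smul, norm_sphere_eq, mul_one, norm_of_nonneg hr0.le]
    rw [integral_const_mul, sphereMean]
    push_cast; field_simp
  obtain ⟨h1, h2⟩ := integral_polar hm hi
  rw [setIntegral_congr_fun measurableSet_Ioi e, integral_const_mul] at h2
  refine ⟨?_, h2⟩
  have h3 := (h1.congr_fun e measurableSet_Ioi).const_mul ((sig m : ℂ)⁻¹)
  refine IntegrableOn.congr_fun h3 (fun r _ => ?_) measurableSet_Ioi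
  field_simp

theorem sig_mul_U (hm : 1 ≤ m) {k : ℝ → ℝ} {φ : 𝓢(Eu m, ℂ)} (j : Fin m)
    (hi : Integrable fun x : Eu m => ((x j * k ‖x‖ : ℝ) : ℂ) * φ x) :
    IntegrableOn (fun r : ℝ => ((r ^ m * k r : ℝ) : ℂ) * sphereMeanVec m j φ r) (Ioi 0) ∧
    ∫ x : Eu m, ((x j * k ‖x‖ : ℝ) : ℂ) * φ x =
      sig m * ∫ r in Ioi (0 : ℝ), ((r ^ m * k r : ℝ) : ℂ) * sphereMeanVec m j φ r := by
  have hs := sig_ne_zero hm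
  have e : ∀ r ∈ Ioi (0 : ℝ), ((r ^ (m - 1) : ℝ) : ℂ) * ∫ w : Metric.sphere (0 : Eu m) 1,
      (((r • (w : Eu m)) j * k ‖r • (w : Eu m)‖ : ℝ) : ℂ) * φ (r • (w : Eu m))
        ∂(volume : Measure (Eu m)).toSphere =
      sig m * (((r ^ m * k r : ℝ) : ℂ) * sphereMeanVec m j φ r) := fun r hr => by
    have hr0 : 0 < r := hr
    have h1 : ∀ w : Metric.sphere (0 : Eu m) 1, (((r • (w : Eu m)) j * k ‖r • (w : Eu m)‖ : ℝ) : ℂ) *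
        φ (r • (w : Eu m)) = ((r * k r : ℝ) : ℂ) * (((w : Eu m) j : ℂ) * φ (r • (w : Eu m))) := by
      intro w
      rw [norm_smul, norm_sphere_eq, mul_one, norm_of_nonneg hr0.le, PiLp.smul_apply, smul_eq_mul]
      push_cast; ring
    have h2 : r ^ m = r ^ (m - 1) * r := by rw [← pow_succ, Nat.sub_add_cancel hm]
    simp_rw [h1]
    rw [integral_const_mul, sphereMeanVec, h2]
    push_cast; field_simp
  obtain ⟨h1, h2⟩ := integral_polar hm hi
  rw [setIntegral_congr_fun measurableSet_Ioi e, integral_const_mul] at h2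
  refine ⟨?_, h2⟩
  have h3 := (h1.congr_fun e measurableSet_Ioi).const_mul ((sig m : ℂ)⁻¹)
  refine IntegrableOn.congr_fun h3 (fun r _ => ?_) measurableSet_Ioi
  field_simp

theorem hasConstTerm_powInt (hm : 1 ≤ m) {N : ℕ} (hN : Odd N) (φ : 𝓢(Eu m, ℂ)) (k : ℕ) :
    HasConstTerm (fun u => (u : ℂ) ^ (2 * k) * powInt (-((m : ℝ) + N) / 2 - k) φ u)
      ((if k = 0 then 1 else 0) * T m (-m - N) φ) := by
  have h := ((isMeanLike_sphereMean φ hN).hasConstTerm (m - 1) k).const_mul (sig m)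
  have e0 : (-(m : ℂ) - N) + m - 1 = -(N : ℂ) - 1 := by ring
  have e : ((m - 1 + N + 1 : ℕ) : ℝ) = m + N := by
    rw [show m - 1 + N + 1 = m + N by omega]; push_cast; ring
  rw [T, e0, mul_left_comm]
  refine h.congr fun u hu => ?_
  rw [e, powInt, (sig_mul_T hm (k := fun r => (r ^ 2 + u ^ 2) ^ (-((m : ℝ) + N) / 2 - k))
    ((hasOrder_pow _).integrable_mul φ hu)).2, mul_left_comm]
  congr 1
  rw [← integral_const_mul]
  congr 1
  funext r
  push_cast; ring

theorem hasConstTerm_coordPowInt (hm : 1 ≤ m) {N : ℕ} (hN : Even N) (j : Fin m) (φ : 𝓢(Eu m, ℂ)) :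
    HasConstTerm (fun u => coordPowInt j (-((m : ℝ) + N + 1) / 2) φ u) (U m (-m - N) j φ) := by
  have h := ((isMeanLike_sphereMeanVec j φ hN).hasConstTerm m 0).const_mul (sig m)
  have e0 : (-(m : ℂ) - N) + m - 1 = -(N : ℂ) - 1 := by ring
  rw [U, e0]
  simp only [if_true, one_mul, mul_zero, pow_zero, Nat.cast_zero, sub_zero] at h
  refine h.congr fun u hu => ?_
  rw [coordPowInt, (sig_mul_U hm (k := fun r => (r ^ 2 + u ^ 2) ^ (-((m : ℝ) + N + 1) / 2)) j
    (((hasOrder_pow _).coord j).integrable_mul φ hu)).2]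
  congr 3
  funext r
  push_cast; rfl

/-- The coefficient of `r^{-m-N}` in the kernel with symbol `|2πξ|^N`. -/
def cT (m N : ℕ) : ℝ := 2 ^ N * Gamma (((m : ℝ) + N) / 2) / (π ^ ((m : ℝ) / 2) * Gamma (-(N : ℝ) / 2))

/-- The coefficient of `x_j r^{-m-N-1}` in the kernel with symbol `-i (ξ_j/|ξ|) |2πξ|^N`. -/
def cU (m N : ℕ) : ℝ :=
  -(2 ^ N * Gamma (((m : ℝ) + N + 1) / 2) / (π ^ ((m : ℝ) / 2) * Gamma ((1 - N : ℝ) / 2)))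

theorem cT_succ (m N : ℕ) : cT m (N + 1) = (N + 1) * cU m N := by
  have h := Gamma_add_one (s := -((N + 1 : ℕ) : ℝ) / 2) (by
    have : (0 : ℝ) < (N + 1 : ℕ) := by positivity
    linarith)
  have e : -((N + 1 : ℕ) : ℝ) / 2 + 1 = (1 - N : ℝ) / 2 := by push_cast; ring
  have e2 : ((m : ℝ) + (N + 1 : ℕ)) / 2 = ((m : ℝ) + N + 1) / 2 := by push_cast; ring
  rw [e] at h
  rw [cT, cU, e2, h]
  have hN : ((N : ℝ) + 1) ≠ 0 := by positivity
  push_cast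
  rw [pow_succ]
  by_cases hG : Gamma (-((N : ℝ) + 1) / 2) = 0
  · simp only [hG, mul_zero, div_zero, neg_zero]
  · field_simp

theorem cU_succ (hm : 1 ≤ m) (N : ℕ) : cU m (N + 1) = -((m + N) * cT m N) := by
  have hm0 : (0 : ℝ) < m := by exact_mod_cast hm
  have h := Gamma_add_one (s := ((m : ℝ) + N) / 2) (by positivity)
  have e : ((m : ℝ) + (N + 1 : ℕ) + 1) / 2 = ((m : ℝ) + N) / 2 + 1 := by push_cast; ring
  have e2 : (1 - ((N + 1 : ℕ) : ℝ)) / 2 = -(N : ℝ) / 2 := by push_cast; ring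
  rw [cT, cU, e, e2, h, pow_succ]
  ring

theorem hasConstTerm_hilSym_zero (hm : 1 ≤ m) (j : Fin m) (φ : 𝓢(Eu m, ℂ)) :
    HasConstTerm (fun u => cU m 0 * coordPowInt j (-((m : ℝ) + (0 : ℕ) + 1) / 2) φ u)
      ((isSymbol_hilSym j 0).toDist φ) := by
  refine (HasConstTerm.of_tendsto
    ((isSymbol_hilSym j 0).tendsto_integral_symbolKernel φ)).congr fun u hu => ?_
  rw [coordPowInt, ← integral_const_mul]
  refine integral_congr_of_eq fun x => ?_
  have h : symbolKernel (hilSym j 0) u x = (conjPoisson m u x j : ℂ) := by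
    have h0 : hilSym (m := m) j 0 = symB j 0 := by
      funext ξ; rw [symB_eq_hilSym, pow_zero, one_mul]
    rw [h0, conjPoisson_eq_symbolKernel hm hu]
  have hn := nrm_pos hu x
  have e : (‖x‖ ^ 2 + u ^ 2) ^ (-((m : ℝ) + (0 : ℕ) + 1) / 2) = (nrm u x ^ (m + 1))⁻¹ := by
    have : ‖x‖ ^ 2 + u ^ 2 = nrm u x ^ 2 := by rw [nrm_sq]; ring
    rw [this, ← rpow_natCast _ 2, ← rpow_mul hn.le, ← rpow_natCast _ (m + 1),
      ← rpow_neg hn.le]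
    congr 1; push_cast; ring
  have e2 : cU m 0 = -(2 / sig (m + 1)) := by
    have e3 : π ^ (((m + 1 : ℕ) : ℝ) / 2) = π ^ ((m : ℝ) / 2) * √π := by
      rw [Real.sqrt_eq_rpow, ← rpow_add pi_pos]; congr 1; push_cast; ring
    rw [cU, two_div_sig _ (Nat.succ_pos m), e3, ← Gamma_one_half_eq]
    norm_num
  simp only [h, e, e2, conjPoisson, PiLp.smul_apply, smul_eq_mul]
  push_cast; ring

theorem hasConstTerm_powSym_succ (hm : 1 ≤ m) {N : ℕ} (hN : Even N)
    (h : ∀ (j : Fin m) (φ : 𝓢(Eu m, ℂ)), HasConstTerm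
      (fun u => cU m N * coordPowInt j (-((m : ℝ) + N + 1) / 2) φ u) ((isSymbol_hilSym j N).toDist φ))
    (φ : 𝓢(Eu m, ℂ)) : HasConstTerm
      (fun u => cT m (N + 1) * powInt (-((m : ℝ) + (N + 1 : ℕ)) / 2) φ u)
      ((isSymbol_powSym (N + 1)).toDist φ) := by
  have h1 := HasConstTerm.sum Finset.univ fun l => h l (∂_{unitVec l} φ)
  rw [← powSym_succ_toDist] at h1
  have h2 := (hasConstTerm_powInt hm hN.add_one φ 1).const_mul (cU m N * ((m : ℂ) + N + 1))
  simp only [one_ne_zero, if_false, zero_mul, mul_zero] at h2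
  have h3 := h1.add h2
  rw [add_zero] at h3
  refine h3.congr fun u hu => ?_
  have e1 : -((m : ℝ) + N + 1) / 2 = -((m : ℝ) + (N + 1 : ℕ)) / 2 := by push_cast; ring
  rw [← Finset.mul_sum, sum_coordPowInt_lineDeriv hm _ φ hu, e1, cT_succ]
  push_cast; ring

theorem hasConstTerm_hilSym_succ (hm : 1 ≤ m) {N : ℕ}
    (h : ∀ φ : 𝓢(Eu m, ℂ), HasConstTerm
      (fun u => cT m N * powInt (-((m : ℝ) + N) / 2) φ u) ((isSymbol_powSym N).toDist φ))
    (j : Fin m) (φ : 𝓢(Eu m, ℂ)) : HasConstTerm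
      (fun u => cU m (N + 1) * coordPowInt j (-((m : ℝ) + (N + 1 : ℕ) + 1) / 2) φ u)
      ((isSymbol_hilSym j (N + 1)).toDist φ) := by
  have h1 := (h (∂_{unitVec j} φ)).const_mul (-1)
  rw [neg_one_mul, ← hilSym_succ_toDist] at h1
  refine h1.congr fun u hu => ?_
  have e1 : -((m : ℝ) + N) / 2 - 1 = -((m : ℝ) + (N + 1 : ℕ) + 1) / 2 := by push_cast; ring
  rw [powInt_lineDeriv hm _ φ j hu, e1, cU_succ hm]
  push_cast; ring

theorem hasConstTerm_hilSym_even (hm : 1 ≤ m) (l : ℕ) : ∀ (j : Fin m) (φ : 𝓢(Eu m, ℂ)), HasConstTerm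
    (fun u => cU m (2 * l) * coordPowInt j (-((m : ℝ) + (2 * l : ℕ) + 1) / 2) φ u)
    ((isSymbol_hilSym j (2 * l)).toDist φ) := by
  induction l with
  | zero => exact hasConstTerm_hilSym_zero hm
  | succ l ih => exact hasConstTerm_hilSym_succ hm (hasConstTerm_powSym_succ hm (even_two_mul l) ih)

theorem hilSym_toDist_of_even (hm : 1 ≤ m) {N : ℕ} (hN : Even N) (j : Fin m) (φ : 𝓢(Eu m, ℂ)) :
    (isSymbol_hilSym j N).toDist φ = cU m N * U m (-m - N) j φ := by
  obtain ⟨l, rfl⟩ := hN.exists_two_nsmul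
  rw [smul_eq_mul] at hN ⊢
  exact (hasConstTerm_hilSym_even hm l j φ).unique ((hasConstTerm_coordPowInt hm hN j φ).const_mul _)

theorem powSym_toDist_of_odd (hm : 1 ≤ m) {N : ℕ} (hN : Odd N) (φ : 𝓢(Eu m, ℂ)) :
    (isSymbol_powSym N).toDist φ = cT m N * T m (-m - N) φ := by
  obtain ⟨l, rfl⟩ := hN
  have h := (hasConstTerm_powInt hm ⟨l, rfl⟩ φ 0).const_mul (cT m (2 * l + 1))
  simp only [if_true, one_mul, mul_zero, pow_zero, Nat.cast_zero, sub_zero] at h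
  exact (hasConstTerm_powSym_succ hm (even_two_mul l) (hasConstTerm_hilSym_even hm l) φ).unique h

/-! ### Finite parts at the locally integrable exponents -/

theorem finitePart_natCast (N : ℕ) {ψ : ℝ → ℂ}
    (h : IntegrableOn (fun r : ℝ => ((r ^ N : ℝ) : ℂ) * ψ r) (Ioi 0)) :
    finitePart N ψ = ∫ r in Ioi (0 : ℝ), ((r ^ N : ℝ) : ℂ) * ψ r := by
  have hn : ⌈-((N : ℂ)).re⌉₊ = 0 := by
    rw [Nat.ceil_eq_zero]; simp
  rw [finitePart]
  simp only [hn, Finset.range_zero, Finset.sum_empty, sub_zero, add_zero, Complex.cpow_natCast]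
  rw [← Ioc_union_Ioi_eq_Ioi zero_le_one, setIntegral_union (Ioc_disjoint_Ioi le_rfl)
    measurableSet_Ioi (h.mono_set Ioc_subset_Ioi_self) (h.mono_set (Ioi_subset_Ioi zero_le_one))]
  push_cast; rfl

theorem isTempered_norm_rpow (hm : 1 ≤ m) {N : ℕ} (hN : 1 ≤ N) :
    IsTempered fun x : Eu m => ((‖x‖ ^ ((N : ℝ) - m) : ℝ) : ℂ) := by
  have hN1 : (1 : ℝ) ≤ N := by exact_mod_cast hN
  have h := (hasOrder_logPow (m := m) 0 1 (((N : ℝ) - m) / 2)).isTempered_limit hm (by linarith)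
    (measurable_logPow_norm 0 1 _) fun x hx => tendsto_logPow _ _ _ hx
  simpa only [logPow_zero_left, one_mul] using h

theorem isTempered_coord_mul_norm_rpow (hm : 1 ≤ m) {N : ℕ} (hN : 1 ≤ N) (j : Fin m) :
    IsTempered fun x : Eu m => ((x j * ‖x‖ ^ ((N : ℝ) - m - 1) : ℝ) : ℂ) := by
  have hN1 : (1 : ℝ) ≤ N := by exact_mod_cast hN
  have hmeas : Measurable fun x : Eu m => x j * logPow 0 1 (((N : ℝ) - m - 1) / 2) (‖x‖ ^ 2) := by
    have := measurable_logPow_norm (m := m) 0 1 (((N : ℝ) - m - 1) / 2)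
    fun_prop
  have h := ((hasOrder_logPow (m := m) 0 1 (((N : ℝ) - m - 1) / 2)).coord j).isTempered_limit hm
    (by linarith) hmeas fun x hx => (tendsto_logPow _ _ _ hx).const_mul _
  simpa only [logPow_zero_left, one_mul] using h

theorem T_natCast_sub (hm : 1 ≤ m) {N : ℕ} (hN : 1 ≤ N) (φ : 𝓢(Eu m, ℂ)) :
    T m (N - m) φ = ∫ x : Eu m, ((‖x‖ ^ ((N : ℝ) - m) : ℝ) : ℂ) * φ x := by
  obtain ⟨N, rfl⟩ : ∃ K, N = K + 1 := ⟨N - 1, by omega⟩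
  obtain ⟨h1, h2⟩ := sig_mul_T hm (k := fun r => r ^ (((N + 1 : ℕ) : ℝ) - m))
    ((isTempered_norm_rpow hm hN).integrable_mul φ)
  have e : ∀ r ∈ Ioi (0 : ℝ), ((r ^ (m - 1) * r ^ (((N + 1 : ℕ) : ℝ) - m) : ℝ) : ℂ) *
      sphereMean m φ r = ((r ^ N : ℝ) : ℂ) * sphereMean m φ r := fun r hr => by
    rw [← rpow_natCast r (m - 1), ← rpow_add hr, ← rpow_natCast r N]
    congr 3; push_cast [Nat.cast_sub hm]; ring
  have e2 : (((N + 1 : ℕ) : ℂ) - m) + m - 1 = (N : ℂ) := by push_cast; ring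
  rw [h2, T, e2, finitePart_natCast N (h1.congr_fun e measurableSet_Ioi),
    setIntegral_congr_fun measurableSet_Ioi e]

theorem U_natCast_sub (hm : 1 ≤ m) {N : ℕ} (hN : 1 ≤ N) (j : Fin m) (φ : 𝓢(Eu m, ℂ)) :
    U m (N - m) j φ = ∫ x : Eu m, ((x j * ‖x‖ ^ ((N : ℝ) - m - 1) : ℝ) : ℂ) * φ x := by
  obtain ⟨N, rfl⟩ : ∃ K, N = K + 1 := ⟨N - 1, by omega⟩
  obtain ⟨h1, h2⟩ := sig_mul_U hm (k := fun r => r ^ (((N + 1 : ℕ) : ℝ) - m - 1)) j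
    ((isTempered_coord_mul_norm_rpow hm hN j).integrable_mul φ)
  have e : ∀ r ∈ Ioi (0 : ℝ), ((r ^ m * r ^ (((N + 1 : ℕ) : ℝ) - m - 1) : ℝ) : ℂ) *
      sphereMeanVec m j φ r = ((r ^ N : ℝ) : ℂ) * sphereMeanVec m j φ r := fun r hr => by
    rw [← rpow_natCast r m, ← rpow_add hr, ← rpow_natCast r N]
    congr 3; push_cast; ring
  have e2 : (((N + 1 : ℕ) : ℂ) - m) + m - 1 = (N : ℂ) := by push_cast; ring
  rw [h2, U, e2, finitePart_natCast N (h1.congr_fun e measurableSet_Ioi),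
    setIntegral_congr_fun measurableSet_Ioi e]

/-! ### The normalised kernels -/

theorem distT_neg_natCast (hm : 1 ≤ m) {N : ℕ} (hN : 1 ≤ N) (φ : 𝓢(Eu m, ℂ)) :
    distT hm (-N) φ = ∫ x : Eu m, (upT m N x : ℂ) * φ x := by
  obtain ⟨N, rfl⟩ : ∃ K, N = K + 1 := ⟨N - 1, by omega⟩
  rfl

theorem distV_neg_natCast (hm : 1 ≤ m) {N : ℕ} (hN : 1 ≤ N) (j : Fin m) (φ : 𝓢(Eu m, ℂ)) :
    distV hm j (-N) φ = ∫ x : Eu m, (upV m j N x : ℂ) * φ x := by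
  obtain ⟨N, rfl⟩ : ∃ K, N = K + 1 := ⟨N - 1, by omega⟩
  rfl

theorem coef_mul_ofReal (x a b c d : ℝ) (t : ℂ) :
    (2 : ℂ) ^ (x : ℂ) * Complex.Gamma a / (π : ℂ) ^ (b : ℂ) *
      ((π : ℂ) ^ (c : ℂ) * t / Complex.Gamma d) =
    ((2 ^ x * Gamma a / (π ^ (b - c) * Gamma d) : ℝ) : ℂ) * t := by
  rw [Complex.Gamma_ofReal, Complex.Gamma_ofReal, ← Complex.ofReal_cpow pi_pos.le,
    ← Complex.ofReal_cpow pi_pos.le, ← Complex.ofReal_ofNat, ← Complex.ofReal_cpow zero_le_two,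
    rpow_sub pi_pos]
  have h1 : π ^ b ≠ 0 := (rpow_pos_of_pos pi_pos b).ne'
  have h2 : π ^ c ≠ 0 := (rpow_pos_of_pos pi_pos c).ne'
  have h3 : (π ^ b : ℝ) / π ^ c * Gamma d = π ^ b * Gamma d / π ^ c := by ring
  rw [h3]
  push_cast
  have h1 : ((π ^ b : ℝ) : ℂ) ≠ 0 := by exact_mod_cast h1
  have h2 : ((π ^ c : ℝ) : ℂ) ≠ 0 := by exact_mod_cast h2
  rw [div_div_eq_mul_div]
  ring

theorem coef_mul_Tstar_of_forall_ne {x : ℝ} (h : ∀ l : ℕ, x ≠ 2 * l) (φ : 𝓢(Eu m, ℂ)) :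
    (2 : ℂ) ^ (x : ℂ) * Complex.Gamma ((m + x) / 2) / (π : ℂ) ^ (((m : ℂ) - x) / 2) *
      Tstar m (-m - x) φ =
    ((2 ^ x * Gamma ((m + x) / 2) / (π ^ ((m : ℝ) / 2) * Gamma (-x / 2)) : ℝ) : ℂ) *
      T m (-m - x) φ := by
  have hd : ¬ ∃ l : ℕ, -(m : ℂ) - x = -m - 2 * l := by
    rintro ⟨l, hl⟩
    refine h l ?_
    have : (x : ℂ) = ((2 * l : ℝ) : ℂ) := by push_cast; linear_combination -hl
    exact_mod_cast this
  have k := coef_mul_ofReal x ((m + x) / 2) ((m - x) / 2) (-x / 2) (-x / 2) (T m (-m - x) φ)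
  rw [show ((m : ℝ) - x) / 2 - -x / 2 = m / 2 by ring] at k
  rw [← k, Tstar, dif_neg hd, show (-(m : ℂ) - x + m) / 2 = -x / 2 by ring]
  push_cast; rfl

theorem coef_mul_Ustar_of_forall_ne {x : ℝ} (h : ∀ l : ℕ, x ≠ 2 * l + 1) (j : Fin m)
    (φ : 𝓢(Eu m, ℂ)) :
    (2 : ℂ) ^ (x : ℂ) * Complex.Gamma ((m + x + 1) / 2) / (π : ℂ) ^ (((m : ℂ) - x + 1) / 2) *
      Ustar m (-m - x) j φ =
    ((2 ^ x * Gamma ((m + x + 1) / 2) / (π ^ ((m : ℝ) / 2) * Gamma ((1 - x) / 2)) : ℝ) : ℂ) *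
      U m (-m - x) j φ := by
  have hd : ¬ ∃ l : ℕ, -(m : ℂ) - x = -m - 2 * l - 1 := by
    rintro ⟨l, hl⟩
    refine h l ?_
    have : (x : ℂ) = ((2 * l + 1 : ℝ) : ℂ) := by push_cast; linear_combination -hl
    exact_mod_cast this
  have k := coef_mul_ofReal x ((m + x + 1) / 2) ((m - x + 1) / 2) ((1 - x) / 2) ((1 - x) / 2)
    (U m (-m - x) j φ)
  rw [show ((m : ℝ) - x + 1) / 2 - (1 - x) / 2 = m / 2 by ring] at k
  rw [← k, Ustar, dif_neg hd, show (-(m : ℂ) - x + m + 1) / 2 = (1 - x) / 2 by ring]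
  push_cast; rfl

theorem Gamma_half_ne_zero (hm : 1 ≤ m) (l : ℕ) : Complex.Gamma ((m : ℂ) / 2 + l) ≠ 0 := by
  refine Complex.Gamma_ne_zero_of_re_pos ?_
  have : (0 : ℝ) < m := by exact_mod_cast hm
  have h : ((m : ℂ) / 2 + l).re = (m : ℝ) / 2 + l := by simp
  rw [h]; positivity

theorem coef_mul_Tstar_two_mul (hm : 1 ≤ m) (l : ℕ) (φ : 𝓢(Eu m, ℂ)) :
    (2 : ℂ) ^ (2 * l : ℂ) * Complex.Gamma ((m + 2 * l) / 2) / (π : ℂ) ^ (((m : ℂ) - 2 * l) / 2) *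
      Tstar m (-m - 2 * l) φ = negLaplaceIter l φ 0 := by
  have h : ∃ l' : ℕ, -(m : ℂ) - 2 * l = -m - 2 * l' := ⟨l, rfl⟩
  have hc : h.choose = l := by
    have : (l : ℂ) = h.choose := by linear_combination (-1 / 2 : ℂ) * h.choose_spec
    exact_mod_cast this.symm
  have hp : (π : ℂ) ^ ((m : ℂ) / 2 - l) ≠ 0 := by
    rw [Complex.cpow_ne_zero_iff]; left; exact_mod_cast pi_pos.ne'
  have hG := Gamma_half_ne_zero hm l
  have h2 : (2 : ℂ) ^ (2 * l : ℂ) = 2 ^ (2 * l) := by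
    rw [← Complex.cpow_natCast]; push_cast; rfl
  rw [Tstar, dif_pos h, hc, h2, show ((m : ℂ) + 2 * l) / 2 = m / 2 + l by ring,
    show ((m : ℂ) - 2 * l) / 2 = m / 2 - l by ring]
  generalize Complex.Gamma ((m : ℂ) / 2 + l) = g at hG ⊢
  field_simp

theorem coef_mul_Ustar_two_mul_add_one (hm : 1 ≤ m) (l : ℕ) (j : Fin m) (φ : 𝓢(Eu m, ℂ)) :
    (2 : ℂ) ^ (2 * l + 1 : ℂ) * Complex.Gamma ((m + (2 * l + 1) + 1) / 2) /
      (π : ℂ) ^ (((m : ℂ) - (2 * l + 1) + 1) / 2) * Ustar m (-m - (2 * l + 1)) j φ =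
      lineDeriv ℝ (negLaplaceIter l φ) 0 (unitVec j) := by
  have h : ∃ l' : ℕ, -(m : ℂ) - (2 * l + 1) = -m - 2 * l' - 1 := ⟨l, by ring⟩
  have hc : h.choose = l := by
    have : (l : ℂ) = h.choose := by linear_combination (-1 / 2 : ℂ) * h.choose_spec
    exact_mod_cast this.symm
  have hp : (π : ℂ) ^ ((m : ℂ) / 2 - l) ≠ 0 := by
    rw [Complex.cpow_ne_zero_iff]; left; exact_mod_cast pi_pos.ne'
  have hG : Complex.Gamma ((m : ℂ) / 2 + l + 1) ≠ 0 := by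
    have := Gamma_half_ne_zero hm (l + 1)
    rwa [Nat.cast_add_one, ← add_assoc] at this
  have h2 : (2 : ℂ) ^ (2 * l + 1 : ℂ) = 2 ^ (2 * l + 1) := by
    rw [← Complex.cpow_natCast]; push_cast; rfl
  rw [Ustar, dif_pos h, hc, h2, show ((m : ℂ) + (2 * l + 1) + 1) / 2 = m / 2 + l + 1 by ring,
    show ((m : ℂ) - (2 * l + 1) + 1) / 2 = m / 2 - l by ring]
  generalize Complex.Gamma ((m : ℂ) / 2 + l + 1) = g at hG ⊢
  field_simp

theorem exists_eq_natCast_or_neg (n : ℤ) : (∃ N : ℕ, n = N) ∨ ∃ N : ℕ, 1 ≤ N ∧ n = -N := by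
  rcases le_or_gt 0 n with h | h
  · exact Or.inl ⟨n.toNat, by omega⟩
  · exact Or.inr ⟨(-n).toNat, by omega, by omega⟩

theorem coef_mul_Tstar (hm : 1 ≤ m) {n : ℤ} (hn : ∀ l : ℕ, n ≠ -m - 2 * l) (φ : 𝓢(Eu m, ℂ)) :
    (2 : ℂ) ^ (n : ℂ) * Complex.Gamma ((m + n) / 2) / (π : ℂ) ^ (((m : ℂ) - n) / 2) *
      Tstar m (-m - n) φ = distT hm n φ := by
  obtain ⟨N, rfl⟩ | ⟨N, hN, rfl⟩ := exists_eq_natCast_or_neg n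
  · change _ = (isSymbol_powSym N).toDist φ
    rcases N.even_or_odd' with ⟨l, rfl | rfl⟩
    · rw [powSym_two_mul_toDist, ← coef_mul_Tstar_two_mul hm]
      push_cast; rfl
    · have k := coef_mul_Tstar_of_forall_ne (m := m) (x := ((2 * l + 1 : ℕ) : ℝ))
        (fun l' h => by have : 2 * l + 1 = 2 * l' := by exact_mod_cast h
                        omega) φ
      rw [powSym_toDist_of_odd hm (odd_two_mul_add_one l), cT, ← rpow_natCast 2]
      rw [Complex.ofReal_natCast] at k
      rw [Int.cast_natCast, k]
  · have hN' : (1 : ℝ) ≤ N := by exact_mod_cast hN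
    have k := coef_mul_Tstar_of_forall_ne (m := m) (x := -(N : ℝ))
      (fun l' h => by have : (0 : ℝ) ≤ l' := by positivity
                      linarith) φ
    have hc : tCoef m N = (0, rieszCoeff m N) := by
      rw [tCoef, if_neg]
      rintro ⟨h1, l, hl⟩
      exact hn l (by omega)
    have e : ((-(N : ℤ) : ℤ) : ℂ) = ((-(N : ℝ) : ℝ) : ℂ) := by push_cast; rfl
    have e2 : -(m : ℂ) - ((-(N : ℝ) : ℝ) : ℂ) = N - m := by push_cast; ring
    rw [e, k, e2, T_natCast_sub hm hN, distT_neg_natCast hm hN, ← integral_const_mul]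
    refine integral_congr_of_eq fun x => ?_
    simp only [upT, hc, logPow_zero_left, rieszCoeff, rpow_neg zero_le_two,
      rpow_natCast, ← sub_eq_add_neg, neg_neg]
    push_cast; ring

theorem neg_coef_mul_Ustar (hm : 1 ≤ m) {n : ℤ} (hn : ∀ l : ℕ, n ≠ -m - 1 - 2 * l) (j : Fin m)
    (φ : 𝓢(Eu m, ℂ)) :
    -((2 : ℂ) ^ (n : ℂ) * Complex.Gamma ((m + n + 1) / 2) / (π : ℂ) ^ (((m : ℂ) - n + 1) / 2)) *
      Ustar m (-m - n) j φ = distV hm j n φ := by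
  rw [neg_mul]
  obtain ⟨N, rfl⟩ | ⟨N, hN, rfl⟩ := exists_eq_natCast_or_neg n
  · change _ = (isSymbol_hilSym j N).toDist φ
    rcases N.even_or_odd' with ⟨l, rfl | rfl⟩
    · have k := coef_mul_Ustar_of_forall_ne (m := m) (x := ((2 * l : ℕ) : ℝ))
        (fun l' h => by have : 2 * l = 2 * l' + 1 := by exact_mod_cast h
                        omega) j φ
      rw [hilSym_toDist_of_even hm (even_two_mul l), cU, ← rpow_natCast 2]
      rw [Complex.ofReal_natCast] at k
      rw [Int.cast_natCast, k, Complex.ofReal_neg, neg_mul]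
    · rw [hilSym_two_mul_add_one_toDist, ← coef_mul_Ustar_two_mul_add_one hm]
      push_cast; rfl
  · have hN' : (1 : ℝ) ≤ N := by exact_mod_cast hN
    have k := coef_mul_Ustar_of_forall_ne (m := m) (x := -(N : ℝ))
      (fun l' h => by have : (0 : ℝ) ≤ l' := by positivity
                      linarith) j φ
    have hc : vCoef m N = (0, hilbertRieszCoeff m N) := by
      rw [vCoef, if_neg]
      rintro ⟨h1, l, hl⟩
      exact hn l (by omega)
    have e : ((-(N : ℤ) : ℤ) : ℂ) = ((-(N : ℝ) : ℝ) : ℂ) := by push_cast; rfl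
    have e2 : -(m : ℂ) - ((-(N : ℝ) : ℝ) : ℂ) = N - m := by push_cast; ring
    rw [e, k, e2, U_natCast_sub hm hN, distV_neg_natCast hm hN, ← integral_const_mul,
      ← integral_neg]
    refine integral_congr_of_eq fun x => ?_
    simp only [upV, hc, logPow_zero_left, hilbertRieszCoeff, rpow_neg zero_le_two,
      rpow_natCast, ← sub_eq_add_neg, sub_neg_eq_add, add_comm (1 : ℝ)]
    push_cast; ring

/-! ### The kernels of the four operators -/

theorem logDist_two_mul (hm : 1 ≤ m) (l : ℕ) :
    logDist m (2 * l) = scalarVector (fun φ => distT hm (-m - 2 * l) φ) 0 := by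
  rw [logDist, if_pos (even_two_mul l)]
  congr 1
  funext φ
  have hN : 1 ≤ m + 2 * l := by omega
  have e : (-m - 2 * l : ℤ) = -((m + 2 * l : ℕ) : ℤ) := by push_cast; ring
  have hc : tCoef m (m + 2 * l) = _ := if_pos
    ⟨by omega, by rw [Nat.add_sub_cancel_left]; exact even_two_mul l⟩
  rw [e, distT_neg_natCast hm hN]
  refine integral_congr_of_eq fun x => ?_
  have e1 : (((m + 2 * l : ℕ) : ℝ) - m) / 2 = l := by push_cast; ring
  have e2 : ((2 * l : ℕ) : ℝ) + m = (m + 2 * l : ℕ) := by push_cast; ring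
  simp only [upT, hc, logPow, e1, e2, Nat.add_sub_cancel_left, rpow_natCast,
    ← pow_mul, Real.log_pow]
  congr 2
  push_cast; ring

theorem logDist_two_mul_add_one (hm : 1 ≤ m) (l : ℕ) :
    logDist m (2 * l + 1) = scalarVector 0 fun j φ => distV hm j (-m - 1 - 2 * l) φ := by
  rw [logDist, if_neg (by simp)]
  congr 1
  funext j φ
  have hN : 1 ≤ m + (2 * l + 1) := by omega
  have e : (-m - 1 - 2 * l : ℤ) = -((m + (2 * l + 1) : ℕ) : ℤ) := by push_cast; ring
  have hc : vCoef m (m + (2 * l + 1)) = _ := if_pos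
    ⟨by omega, by rw [Nat.add_sub_cancel_left]; exact odd_two_mul_add_one l⟩
  rw [e, distV_neg_natCast hm hN]
  refine integral_congr_of_eq fun x => ?_
  have e1 : (((m + (2 * l + 1) : ℕ) : ℝ) - m - 1) / 2 = l := by push_cast; ring
  have e2 : ((2 * l + 1 : ℕ) : ℝ) + m = (m + (2 * l + 1) : ℕ) := by push_cast; ring
  simp only [upV, hc, logPow, e1, e2, Nat.add_sub_cancel_left, rpow_natCast,
    ← pow_mul, Real.log_pow, Nat.add_sub_cancel]
  congr 2
  push_cast; ring

theorem logDist_of_even (hm : 1 ≤ m) {n : ℤ} {k : ℕ} (he : Even (n + m)) (h : (n : ℂ) = -m - k) :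
    logDist m k = scalarVector (fun φ => distT hm n φ) 0 := by
  have h' : n = -m - k := by exact_mod_cast h
  obtain ⟨a, ha⟩ := he
  obtain ⟨l, rfl⟩ : ∃ l, k = 2 * l := ⟨k / 2, by omega⟩
  rw [h', logDist_two_mul hm]
  push_cast; rfl

theorem logDist_of_odd (hm : 1 ≤ m) {n : ℤ} {k : ℕ} (ho : Odd (n + m)) (h : (n : ℂ) = -m - k) :
    logDist m k = scalarVector 0 fun j φ => distV hm j n φ := by
  have h' : n = -m - k := by exact_mod_cast h
  obtain ⟨a, ha⟩ := ho
  obtain ⟨l, rfl⟩ : ∃ l, k = 2 * l + 1 := ⟨k / 2, by omega⟩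
  have e : n = -m - 1 - 2 * l := by rw [h']; push_cast; ring
  rw [e, logDist_two_mul_add_one hm]

theorem laplacePow_eq (hm : 1 ≤ m) {β : ℂ} {n : ℤ} (hβ : 2 * β = n) :
    laplacePow m β = scalarVector (fun φ => distT hm n φ) 0 := by
  by_cases h : ∃ n : ℕ, β = -(m / 2) - n
  · rw [laplacePow, dif_pos h, logDist_two_mul hm]
    have : n = -m - 2 * h.choose := by
      have : (n : ℂ) = ((-m - 2 * h.choose : ℤ) : ℂ) := by
        push_cast; rw [← hβ]; linear_combination 2 * h.choose_spec
      exact_mod_cast this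
    rw [← this]
  · rw [laplacePow, dif_neg h, hβ]
    congr 1
    funext φ
    refine coef_mul_Tstar hm (fun l hl => h ⟨l, ?_⟩) φ
    rw [hl] at hβ
    push_cast at hβ
    linear_combination hβ / 2

theorem laplaceHilbertPow_eq (hm : 1 ≤ m) {β : ℂ} {n : ℤ} (hβ : 2 * β = n) :
    laplaceHilbertPow m β = scalarVector 0 fun j φ => distV hm j n φ := by
  by_cases h : ∃ n : ℕ, β = -((m + 1) / 2) - n
  · rw [laplaceHilbertPow, dif_pos h, logDist_two_mul_add_one hm]
    have : n = -m - 1 - 2 * h.choose := by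
      have : (n : ℂ) = ((-m - 1 - 2 * h.choose : ℤ) : ℂ) := by
        push_cast; rw [← hβ]; linear_combination 2 * h.choose_spec
      exact_mod_cast this
    rw [← this]
  · rw [laplaceHilbertPow, dif_neg h, hβ]
    congr 1
    funext j φ
    refine neg_coef_mul_Ustar hm (fun l hl => h ⟨l, ?_⟩) j φ
    rw [hl] at hβ
    push_cast at hβ
    linear_combination hβ / 2

theorem eip_of_even {n : ℤ} (hn : Even n) : eip n = 1 := by
  obtain ⟨k, rfl⟩ := hn
  rw [eip, ← Complex.exp_int_mul_two_pi_mul_I k]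
  congr 1; push_cast; ring

theorem eip_of_odd {n : ℤ} (hn : Odd n) : eip n = -1 := by
  obtain ⟨k, rfl⟩ := hn
  have h : Complex.I * π * ((2 * k + 1 : ℤ) : ℂ) = k * (2 * π * Complex.I) + π * Complex.I := by
    push_cast; ring
  rw [eip, h, Complex.exp_add, Complex.exp_int_mul_two_pi_mul_I, Complex.exp_pi_mul_I, one_mul]

theorem cast_eq_neg_sub_natCast {n : ℤ} {k : ℕ} (h : n = -m - k) : (n : ℂ) = -m - k := by
  rw [h]; push_cast; rfl

theorem diracPow_of_even (hm : 1 ≤ m) {n : ℤ} (hn : Even n) :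
    diracPow m n = scalarVector (fun φ => distT hm n φ) 0 := by
  by_cases h : Even m ∧ ∃ k : ℕ, (n : ℂ) = -m - k
  · rw [diracPow, dif_pos h]
    exact logDist_of_even hm (hn.add (by exact_mod_cast h.1)) h.2.choose_spec
  · rw [diracPow, dif_neg h, eip_of_even hn]
    have h0 : ∀ l : ℕ, n ≠ -m - 2 * l := fun l hl => by
      refine h ⟨?_, 2 * l, cast_eq_neg_sub_natCast (by rw [hl]; push_cast; rfl)⟩
      obtain ⟨a, ha⟩ := hn
      exact Nat.even_iff.2 (by omega)
    congr 1
    · funext φ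
      rw [← coef_mul_Tstar hm h0]; ring
    · funext j φ
      simp

theorem diracPow_of_odd (hm : 1 ≤ m) {n : ℤ} (hn : Odd n) :
    diracPow m n = scalarVector 0 fun j φ => distV hm j n φ := by
  by_cases h : Even m ∧ ∃ k : ℕ, (n : ℂ) = -m - k
  · rw [diracPow, dif_pos h]
    exact logDist_of_odd hm (hn.add_even (by exact_mod_cast h.1)) h.2.choose_spec
  · rw [diracPow, dif_neg h, eip_of_odd hn]
    have h0 : ∀ l : ℕ, n ≠ -m - 1 - 2 * l := fun l hl => by
      refine h ⟨?_, 2 * l + 1, cast_eq_neg_sub_natCast (by rw [hl]; push_cast; ring)⟩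
      obtain ⟨a, ha⟩ := hn
      exact Nat.even_iff.2 (by omega)
    congr 1
    · funext φ
      simp
    · funext j φ
      rw [← neg_coef_mul_Ustar hm h0]; ring

theorem hilbertPow_of_odd (hm : 1 ≤ m) {n : ℤ} (hn : Odd n) :
    hilbertPow m n = scalarVector (fun φ => distT hm n φ) 0 := by
  by_cases h : Odd m ∧ ∃ k : ℕ, (n : ℂ) = -m - k
  · rw [hilbertPow, dif_pos h]
    exact logDist_of_even hm (hn.add_odd (by exact_mod_cast h.1)) h.2.choose_spec
  · rw [hilbertPow, dif_neg h, eip_of_odd hn]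
    have h0 : ∀ l : ℕ, n ≠ -m - 2 * l := fun l hl => by
      refine h ⟨?_, 2 * l, cast_eq_neg_sub_natCast (by rw [hl]; push_cast; rfl)⟩
      obtain ⟨a, ha⟩ := hn
      exact Nat.odd_iff.2 (by omega)
    congr 1
    · funext φ
      rw [← coef_mul_Tstar hm h0]; ring
    · funext j φ
      simp

theorem hilbertPow_of_even (hm : 1 ≤ m) {n : ℤ} (hn : Even n) :
    hilbertPow m n = scalarVector 0 fun j φ => distV hm j n φ := by
  by_cases h : Odd m ∧ ∃ k : ℕ, (n : ℂ) = -m - k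
  · rw [hilbertPow, dif_pos h]
    exact logDist_of_odd hm (hn.add_odd (by exact_mod_cast h.1)) h.2.choose_spec
  · rw [hilbertPow, dif_neg h, eip_of_even hn]
    have h0 : ∀ l : ℕ, n ≠ -m - 1 - 2 * l := fun l hl => by
      refine h ⟨?_, 2 * l + 1, cast_eq_neg_sub_natCast (by rw [hl]; push_cast; ring)⟩
      obtain ⟨a, ha⟩ := hn
      exact Nat.odd_iff.2 (by omega)
    congr 1
    · funext φ
      simp
    · funext j φ
      rw [← neg_coef_mul_Ustar hm h0]; ring

/-! ### Fundamental solutions and boundary values -/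

theorem scalarVector_left (s : SFun m) (φ : 𝓢(Eu m, ℂ)) : scalarVector s 0 φ = s φ • 1 := by
  simp [scalarVector, sc, Algebra.algebraMap_eq_smul_one]

theorem scalarVector_right (u : Fin m → SFun m) (φ : 𝓢(Eu m, ℂ)) :
    scalarVector 0 u φ = ∑ j, u j φ • e j := by
  simp [scalarVector, sc]

theorem isFundamentalSolution_distT (hm : 1 ≤ m) {n : ℤ} (hn : n < m) :
    IsFundamentalSolution (scalarVector (fun φ => distT hm n φ) 0)
      (scalarVector (fun φ => distT hm (-n) φ) 0) := by
  refine ⟨1, 1, fun _ => 1, fun _ => 1, fun _ => distT hm n, fun _ => distT hm (-n),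
    fun _ _ => (IsSymbol.const 1).toDist, fun φ => ?_, fun φ => ?_,
    fun _ _ => isScalarConv_distT hm hn, fun φ => ?_⟩
  · simp [scalarVector_left]
  · simp [scalarVector_left]
  · simp [delta, toDist_const_one, sc, Algebra.algebraMap_eq_smul_one]

theorem sum_rieszSq_toDist (hm : 1 ≤ m) (φ : 𝓢(Eu m, ℂ)) :
    ∑ j, (isSymbol_rieszSq (m := m) j j).toDist φ = -φ 0 := by
  rw [← toDist_const_one]
  simp_rw [IsSymbol.toDist_apply]
  rw [← integral_finsetSum _ fun i _ => (isSymbol_rieszSq i i).integrable_mul _, ← integral_neg]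
  refine integral_congr_ae ?_
  filter_upwards [sum_rieszSq hm] with ξ hξ
  rw [← Finset.sum_mul, hξ]; ring

theorem isFundamentalSolution_distV (hm : 1 ≤ m) {n : ℤ} (hn : n ≤ m) :
    IsFundamentalSolution (scalarVector 0 fun j φ => distV hm j n φ)
      (scalarVector 0 fun j φ => distV hm j (-n) φ) := by
  refine ⟨m, m, e, e, fun i => distV hm i n, fun j => distV hm j (-n),
    fun i j => (isSymbol_rieszSq i j).toDist, scalarVector_right _, scalarVector_right _,
    fun i j => isScalarConv_distV hm hn i j, fun φ => ?_⟩
  have hs : ∀ i j, (isSymbol_rieszSq i j).toDist φ = (isSymbol_rieszSq j i).toDist φ := fun i j => by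
    rw [IsSymbol.toDist_congr _ (isSymbol_rieszSq j i) fun ξ => by rw [rieszSq, rieszSq, mul_comm]]
  rw [sum_sum_e_mul_e _ hs, sum_rieszSq_toDist hm, delta, sc, sc, map_neg, neg_neg]

theorem isBoundaryValue_clA (hm : 1 ≤ m) {k : ℤ} (hk : k + 1 < m) :
    IsBoundaryValue (clA m k)
      (((-1) ^ (k + 1) : ℂ) • scalarVector (fun φ => distT hm (-k - 1) φ) 0) := by
  intro ℓ φ
  obtain ⟨h1, h2⟩ := tendsto_potA hm hk φ
  have e1 : ∀ u x, ℓ (clA m k u x) * φ x = ℓ 1 * ((potA m k u x : ℂ) * φ x) := fun u x => by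
    rw [clA, sc, Algebra.algebraMap_eq_smul_one, map_smul, smul_eq_mul]; ring
  simp_rw [e1, integral_const_mul]
  refine ⟨fun u hu => (h1 u hu).const_mul _, ?_⟩
  convert h2.const_mul (ℓ 1) using 2
  rw [Pi.smul_apply, scalarVector_left, map_smul, map_smul, smul_eq_mul, smul_eq_mul]; ring

theorem isBoundaryValue_clB (hm : 1 ≤ m) {k : ℤ} (hk : k < m) :
    IsBoundaryValue (clB m k)
      (((-1) ^ (k + 1) : ℂ) • scalarVector 0 fun j φ => distV hm j (-k - 1) φ) := by
  intro ℓ φ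
  have h := fun j => tendsto_potB hm hk j φ
  have e1 : ∀ u x, ℓ (clB m k u x) * φ x =
      ∑ j, ℓ (e j) * ((potB m k u x j : ℂ) * φ x) := fun u x => by
    rw [clB, vec, map_sum, Finset.sum_mul]
    exact Finset.sum_congr rfl fun j _ => by rw [map_smul, smul_eq_mul]; ring
  have hi : ∀ u, 0 < u → ∀ j ∈ (Finset.univ : Finset (Fin m)),
      Integrable fun x => ℓ (e j) * ((potB m k u x j : ℂ) * φ x) :=
    fun u hu j _ => ((h j).1 u hu).const_mul _
  simp_rw [e1]
  refine ⟨fun u hu => integrable_finsetSum _ (hi u hu), ?_⟩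
  have h2 := tendsto_finsetSum Finset.univ fun j _ => (h j).2.const_mul (ℓ (e j))
  refine (h2.congr' ?_).trans_eq ?_
  · filter_upwards [self_mem_nhdsWithin] with u hu
    rw [integral_finsetSum _ (hi u hu)]
    simp_rw [integral_const_mul]
  · rw [Pi.smul_apply, scalarVector_right, map_smul, map_sum, smul_eq_mul, Finset.mul_sum]
    refine congrArg 𝓝 (Finset.sum_congr rfl fun j _ => ?_)
    rw [map_smul, smul_eq_mul]; ring

end HarmonicPotentials

end

open HarmonicPotentials in
theorem mainTheorem6 (m : ℕ) (hm : 1 ≤ m) :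
    -- the potentials form the chain generated by the Cauchy kernel
    (∀ x₀ : ℝ, 0 < x₀ → ∀ x : Eu m, potC m (-1) x₀ x = cauchyKernel m x₀ x) ∧
    (∀ k : ℕ, 1 ≤ k → IsDbar (potC m (-k)) (potC m (-k - 1))) ∧
    (∀ k : ℕ, k + 2 < m → A0Convolvable (potA m k)) ∧
    (∀ k : ℕ, k + 1 < m → A0Convolvable (potB m k)) ∧
    -- `a_{2k-1} = E_{2k} = K_k`
    (∀ k : ℤ, 2 * k < m →
      IsBoundaryValue (clA m (2 * k - 1)) (E m (2 * k)) ∧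
      E m (2 * k) = K m k ∧
      IsFundamentalSolution (diracPow m (2 * k)) (E m (2 * k)) ∧
      IsFundamentalSolution (laplacePow m k) (K m k)) ∧
    -- `b_{2k} = -E_{2k+1} = -L_{k+1/2}`
    (∀ k : ℤ, 2 * k < m →
      IsBoundaryValue (clB m (2 * k)) (-E m (2 * k + 1)) ∧
      E m (2 * k + 1) = L m (k + 1 / 2) ∧
      IsFundamentalSolution (diracPow m (2 * k + 1)) (E m (2 * k + 1)) ∧
      IsFundamentalSolution (laplaceHilbertPow m (k + 1 / 2)) (L m (k + 1 / 2))) ∧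
    -- `a_{2k} = -F_{2k+1} = -K_{k+1/2}`
    (∀ k : ℤ, 2 * k + 1 < m →
      IsBoundaryValue (clA m (2 * k)) (-F m (2 * k + 1)) ∧
      F m (2 * k + 1) = K m (k + 1 / 2) ∧
      IsFundamentalSolution (hilbertPow m (2 * k + 1)) (F m (2 * k + 1)) ∧
      IsFundamentalSolution (laplacePow m (k + 1 / 2)) (K m (k + 1 / 2))) ∧
    -- `b_{2k-1} = F_{2k} = L_k`
    (∀ k : ℤ, 2 * k - 1 < m →
      IsBoundaryValue (clB m (2 * k - 1)) (F m (2 * k)) ∧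
      F m (2 * k) = L m k ∧
      IsFundamentalSolution (hilbertPow m (2 * k)) (F m (2 * k)) ∧
      IsFundamentalSolution (laplaceHilbertPow m k) (L m k)) := by
  have hE : ∀ n : ℤ, Even n → E m n = scalarVector (fun φ => distT hm (-n) φ) 0 := fun n hn => by
    rw [E, ← Int.cast_neg, diracPow_of_even hm hn.neg]
  have hE' : ∀ n : ℤ, Odd n → E m n = scalarVector 0 fun j φ => distV hm j (-n) φ := fun n hn => by
    rw [E, ← Int.cast_neg, diracPow_of_odd hm hn.neg]
  have hF : ∀ n : ℤ, Odd n → F m n = scalarVector (fun φ => distT hm (-n) φ) 0 := fun n hn => by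
    rw [F, ← Int.cast_neg, hilbertPow_of_odd hm hn.neg]
  have hF' : ∀ n : ℤ, Even n → F m n = scalarVector 0 fun j φ => distV hm j (-n) φ := fun n hn => by
    rw [F, ← Int.cast_neg, hilbertPow_of_even hm hn.neg]
  have hK : ∀ (β : ℂ) (n : ℤ), 2 * β = n → K m β = scalarVector (fun φ => distT hm (-n) φ) 0 :=
    fun β n h => by rw [K, laplacePow_eq hm (n := -n) (by push_cast; rw [← h]; ring)]
  have hL : ∀ (β : ℂ) (n : ℤ), 2 * β = n → L m β = scalarVector 0 fun j φ => distV hm j (-n) φ :=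
    fun β n h => by rw [L, laplaceHilbertPow_eq hm (n := -n) (by push_cast; rw [← h]; ring)]
  refine ⟨fun t _ x => potC_neg_one t x, isDbar_potC hm, fun k hk => a0Convolvable_potA hk,
    fun k hk => a0Convolvable_potB hk, fun k hk => ?_, fun k hk => ?_, fun k hk => ?_, fun k hk => ?_⟩
  · have he : Even (2 * k) := even_two_mul k
    have e : (2 : ℂ) * k = ((2 * k : ℤ) : ℂ) := by push_cast; rfl
    have hb := isBoundaryValue_clA hm (k := 2 * k - 1) (by omega)
    rw [show 2 * k - 1 + 1 = 2 * k by ring, show -(2 * k - 1) - 1 = -(2 * k) by ring,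
      he.neg_one_zpow, one_smul] at hb
    have hf := isFundamentalSolution_distT hm hk
    rw [hK k (2 * k) e, laplacePow_eq hm e, e, hE _ he, diracPow_of_even hm he]
    exact ⟨hb, rfl, hf, hf⟩
  · have ho : Odd (2 * k + 1) := odd_two_mul_add_one k
    have e : (2 : ℂ) * k + 1 = ((2 * k + 1 : ℤ) : ℂ) := by push_cast; rfl
    have e2 : (2 : ℂ) * (k + 1 / 2) = ((2 * k + 1 : ℤ) : ℂ) := by push_cast; ring
    have hb := isBoundaryValue_clB hm hk
    rw [show -(2 * k) - 1 = -(2 * k + 1) by ring, ho.neg_one_zpow, neg_one_smul] at hb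
    have hf := isFundamentalSolution_distV hm (n := 2 * k + 1) (by omega)
    rw [hL _ (2 * k + 1) e2, laplaceHilbertPow_eq hm e2, e, hE' _ ho, diracPow_of_odd hm ho]
    exact ⟨hb, rfl, hf, hf⟩
  · have ho : Odd (2 * k + 1) := odd_two_mul_add_one k
    have e : (2 : ℂ) * k + 1 = ((2 * k + 1 : ℤ) : ℂ) := by push_cast; rfl
    have e2 : (2 : ℂ) * (k + 1 / 2) = ((2 * k + 1 : ℤ) : ℂ) := by push_cast; ring
    have hb := isBoundaryValue_clA hm hk
    rw [show -(2 * k) - 1 = -(2 * k + 1) by ring, ho.neg_one_zpow, neg_one_smul] at hb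
    have hf := isFundamentalSolution_distT hm hk
    rw [hK _ (2 * k + 1) e2, laplacePow_eq hm e2, e, hF _ ho, hilbertPow_of_odd hm ho]
    exact ⟨hb, rfl, hf, hf⟩
  · have he : Even (2 * k) := even_two_mul k
    have e : (2 : ℂ) * k = ((2 * k : ℤ) : ℂ) := by push_cast; rfl
    have hb := isBoundaryValue_clB hm (k := 2 * k - 1) hk
    rw [show 2 * k - 1 + 1 = 2 * k by ring, show -(2 * k - 1) - 1 = -(2 * k) by ring,
      he.neg_one_zpow, one_smul] at hb
    have hf := isFundamentalSolution_distV hm (n := 2 * k) (by omega)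
    rw [hL k (2 * k) e, laplaceHilbertPow_eq hm e, e, hF' _ he, hilbertPow_of_even hm he]
    exact ⟨hb, rfl, hf, hf⟩
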